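/- Spaces are simplicial sets. For a pointed cosimplicial space $X$ let $\Pi X$ be its cosimplicial replacement, $\Pi^nX=\prod_{i_0\to\cdots\to i_n}X^{i_n}$ (product over the $n$-simplices of the nerve of $\Delta$). Put $\mathrm{Tot}_sX=\mathrm{Map}_*(\Delta[s]_+,X)$, where $\Delta[s]$ is the levelwise $s$-skeleton of the cosimplicial space $\Delta$ (so $\mathrm{Tot}_sX=*$ for $s<0$), and $\mathrm{Tot}_\infty X=\mathrm{Map}_*(\Delta_+,X)$. For a pointed space $K$ let $K(n)$ be the $n$-th Postnikov stage, i.e. the image of $K$ in its $n$-coskeleton $\mathrm{cosk}_nK$ (a point for $n<0$); let $X(n)$ be obtained by applying this levelwise. A tower of pointed Kan fibrations $\cdots\to T_s\to T_{s-1}\to\cdots$ ($s\in\mathbb Z$, $T_s=*$ for $s<0$) with limit $T$ and fibres $F_s=\mathrm{fib}(T_s\to T_{s-1})$ has a (fringed) homotopy spectral sequence, whose terms, for $r\ge1$ and $t\ge s$, are $$E_r^{s,t}\{T_*\}=\ker\bigl(\pi_{t-s}F_s\to\pi_{t-s}T_s/\mathrm{im}(\pi_{t-s}T_{s+r-1})\bigr)\big/\ker\bigl(\pi_{t-s+1}T_{s-1}\to\pi_{t-s+1}T_{s-r}\bigr),$$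 i.e. the orbit set of the action of the second kernel on the first, with differentials $d_r:E_r^{s,t}\to E_r^{s+r,t+r-1}$ for $t>s$. The term is a group for $t-s\ge1$ and a pointed set for $t=s$, where $d_r$ extends to an action of $E_r^{s-r,s-r+1}$ on $E_r^{s,s}$. Its abutment is $\pi_*T$, filtered by the kernels of $\pi_iT\to\pi_iT_s$. The re-indexed spectral sequence is $\tilde E_r^{s,t}\{T_*\}=E_{r-1}^{t,2t-s}\{T_*\}$ for $r\ge2$; its abutment is $\pi_*T$, with the kernel of $\pi_iT\to\pi_iT_{s+i}$ as filtration step $s$ in degree $i$. A morphism of spectral sequences starting from the $E_2$-page consists of maps on all terms with $r\ge2$ and on the abutments, compatible with base points, group laws, differentials, the actions on the terms with $t=s$, the passage from each page to the next, the filtrations of the abutments, and the relation between the abutment and the pages. **Theorem.** For every level-Kan pointed cosimplicial space $X$, the towers $\mathrm{Tot}_s\Pi\,\mathrm{Ex}^\infty X$ and $\mathrm{Tot}_\infty\Pi X(n)$ are towers of pointed Kan fibrations with limits $\mathrm{Tot}_\infty\Pi\,\mathrm{Ex}^\infty X=\mathrm{holim}_\Delta X$ and $\mathrm{Tot}_\infty\Pi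 X$. Moreover there is an isomorphism of spectral sequences starting from the $E_2$-page, natural in level-Kan pointed cosimplicial spaces $X$, $$\phi:{}^{\mathrm{HL}}E_r^{s,t}X=E_r^{s,t}\{\mathrm{Tot}_*\Pi\,\mathrm{Ex}^\infty X\}\ \xrightarrow{\ \cong\ }\ {}^{\mathrm{Po}}E_r^{s,t}X=\tilde E_r^{s,t}\{\mathrm{Tot}_\infty\Pi X(*)\}\qquad(r\ge2),$$ from the homotopy limit spectral sequence to the Postnikov spectral sequence. On abutments, $\phi$ is compatible with the map $\pi_*\mathrm{Tot}_\infty\Pi X\to\pi_*\mathrm{Tot}_\infty\Pi\,\mathrm{Ex}^\infty X$ induced by $X\to\mathrm{Ex}^\infty X$. -/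

import Mathlib

open CategoryTheory Opposite Simplicial

universe u

namespace CosimplicialSpace

/-! ## Pointed simplicial sets and pointed cosimplicial spaces -/

/-- Pointed simplicial sets ("pointed spaces"): simplicial objects in pointed sets. -/
abbrev PSSet := SimplicialObject Pointed.{u}

/-- Cosimplicial pointed spaces. -/
abbrev CosimplicialPSSet := CosimplicialObject PSSet.{u}

/-- The underlying simplicial set of a pointed simplicial set. -/
def toSSet : PSSet.{u} ⥤ SSet.{u} :=
  (SimplicialObject.whiskering Pointed.{u} (Type u)).obj (forget Pointed.{u})

/-- A cosimplicial pointed space is level Kan if each of its levels is a Kan complex. -/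
def IsLevelKan : ObjectProperty CosimplicialPSSet.{u} :=
  fun X => ∀ n : SimplexCategory, SSet.KanComplex (toSSet.obj (X.obj n))

theorem app_map {K L : PSSet.{u}} (f : K ⟶ L) {q q' : SimplexCategoryᵒᵖ} (θ : q ⟶ q')
    (x : (K.obj q).X) :
    (f.app q').toFun ((K.map θ).toFun x) = (L.map θ).toFun ((f.app q).toFun x) :=
  congrFun (congrArg Pointed.Hom.toFun (f.naturality θ)) x

theorem app_congr {K L : PSSet.{u}} {f g : K ⟶ L} (h : f = g) (q : SimplexCategoryᵒᵖ)
    (x : (K.obj q).X) : (f.app q).toFun x = (g.app q).toFun x := by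
  rw [h]

/-! ## Cosimplicial replacement -/

/-- For `θ : [m] ⟶ [n]` and an `n`-simplex `i₀ → ⋯ → iₙ` of the nerve of the simplex category,
the `m`-simplex `i_{θ 0} → ⋯ → i_{θ m}`. -/
def chainPullback {m n : SimplexCategory} (θ : m ⟶ n)
    (c : Fin (n.len + 1) ⥤ SimplexCategory) : Fin (m.len + 1) ⥤ SimplexCategory :=
  θ.toOrderHom.monotone.functor ⋙ c

/-- For `θ : [m] ⟶ [n]` and a chain `i₀ → ⋯ → iₙ`, the map `i_{θ m} ⟶ iₙ`. -/
def chainLast {m n : SimplexCategory} (θ : m ⟶ n) (c : Fin (n.len + 1) ⥤ SimplexCategory) :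
    (chainPullback θ c).obj (Fin.last m.len) ⟶ c.obj (Fin.last n.len) :=
  c.map (homOfLE (Fin.le_last (θ.toOrderHom (Fin.last m.len))))

/-- The cosimplicial replacement `Π X` of a cosimplicial pointed space, with
`(Π X)ⁿ = ∏_{i₀ → ⋯ → iₙ} X^{iₙ}`. The component at `i₀ → ⋯ → iₙ` of the map induced by
`θ : [m] ⟶ [n]` is the projection to the factor of `i_{θ 0} → ⋯ → i_{θ m}`
followed by `X(i_{θ m} → iₙ)`. -/
def cosimplicialReplacement : CosimplicialPSSet.{u} ⥤ CosimplicialPSSet.{u} where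
  obj X :=
    { obj := fun n =>
        { obj := fun q => Pointed.of (X := ∀ c : Fin (n.len + 1) ⥤ SimplexCategory,
              ((X.obj (c.obj (Fin.last n.len))).obj q).X)
            (fun c => ((X.obj (c.obj (Fin.last n.len))).obj q).point)
          map := fun θ => ⟨fun x c => ((X.obj (c.obj (Fin.last n.len))).map θ).toFun (x c),
              funext fun c => ((X.obj (c.obj (Fin.last n.len))).map θ).map_point⟩
          map_id := fun q => by
            apply Pointed.Hom.ext
            funext x c
            simp
          map_comp := fun f g => by
            apply Pointed.Hom.ext
            funext x c
            simp }
      map := fun {m n} θ =>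
        { app := fun q =>
            ⟨fun x c => ((X.map (chainLast θ c)).app q).toFun (x (chainPullback θ c)),
              funext fun c => ((X.map (chainLast θ c)).app q).map_point⟩
          naturality := fun q q' f => by
            apply Pointed.Hom.ext
            funext x c
            exact app_map (X.map (chainLast θ c)) f (x (chainPullback θ c)) }
      map_id := fun n => by
        apply NatTrans.ext
        funext q
        apply Pointed.Hom.ext
        funext x c
        have h : X.map (chainLast (𝟙 n) c) = 𝟙 (X.obj (c.obj (Fin.last n.len))) :=
          (congrArg X.map (c.map_id _)).trans (X.map_id _)
        exact app_congr h q (x c)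
      map_comp := fun {l m n} f g => by
        apply NatTrans.ext
        funext q
        apply Pointed.Hom.ext
        funext x c
        have h : X.map (chainLast (f ≫ g) c) =
            X.map (chainLast f (chainPullback g c)) ≫ X.map (chainLast g c) := by
          rw [← X.map_comp]
          refine congrArg X.map ?_
          exact c.map_comp (homOfLE (g.toOrderHom.monotone (Fin.le_last _)))
            (homOfLE (Fin.le_last (g.toOrderHom (Fin.last _))))
        exact app_congr h q (x (chainPullback f (chainPullback g c))) }
  map {X Y} φ :=
    { app := fun n =>
        { app := fun q => ⟨fun x c => ((φ.app (c.obj (Fin.last n.len))).app q).toFun (x c),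
            funext fun c => ((φ.app (c.obj (Fin.last n.len))).app q).map_point⟩
          naturality := fun q q' f => by
            apply Pointed.Hom.ext
            funext x c
            exact app_map (φ.app (c.obj (Fin.last n.len))) f (x c) }
      naturality := fun m n θ => by
        apply NatTrans.ext
        funext q
        apply Pointed.Hom.ext
        funext x c
        exact app_congr (φ.naturality (chainLast θ c)) q (x (chainPullback θ c)) }
  map_id _ := rfl
  map_comp _ _ := rfl

/-! ## Total spaces -/

/-- `σ : [q] ⟶ [m]`, seen as a `q`-simplex of `Δᵐ`, lies in the `s`-skeleton `Δᵐ[s]`: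
it is degenerate to a simplex of dimension at most `s`. For `s < 0` the skeleton is empty, and for
`s = ⊤` it is all of `Δᵐ`. -/
def InSkeleton (s : WithTop ℤ) {q m : SimplexCategory} (σ : q ⟶ m) : Prop :=
  ∃ k : SimplexCategory, ((k.len : ℤ) : WithTop ℤ) ≤ s ∧ ∃ (a : q ⟶ k) (b : k ⟶ m), a ≫ b = σ

theorem InSkeleton.precomp {s : WithTop ℤ} {q q' m : SimplexCategory} {σ : q ⟶ m}
    (h : InSkeleton s σ) (θ : q' ⟶ q) : InSkeleton s (θ ≫ σ) := by
  obtain ⟨k, hk, a, b, rfl⟩ := h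
  exact ⟨k, hk, θ ≫ a, b, by simp⟩

theorem InSkeleton.postcomp {s : WithTop ℤ} {q m m' : SimplexCategory} {σ : q ⟶ m}
    (h : InSkeleton s σ) (κ : m ⟶ m') : InSkeleton s (σ ≫ κ) := by
  obtain ⟨k, hk, a, b, rfl⟩ := h
  exact ⟨k, hk, a, b ≫ κ, by simp⟩

theorem InSkeleton.mono {s s' : WithTop ℤ} (hs : s ≤ s') {q m : SimplexCategory} {σ : q ⟶ m}
    (h : InSkeleton s σ) : InSkeleton s' σ := by
  obtain ⟨k, hk, a, b, h⟩ := h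
  exact ⟨k, hk.trans hs, a, b, h⟩

/-- The `n`-simplices of `Tot_s X`: maps of cosimplicial spaces `Δ[s] × Δⁿ ⟶ X`
(equivalently, pointed maps `Δ[s]₊ ∧ Δⁿ₊ ⟶ X`). Such a map consists of functions
`(Δᵐ[s])_q × (Δⁿ)_q → (Xᵐ)_q`, natural in the simplicial degree `q` and in the
cosimplicial degree `m`. -/
@[ext]
structure TotSimplex (X : CosimplicialPSSet.{u}) (s : WithTop ℤ) (n : SimplexCategory) :
    Type u where
  /-- the component in cosimplicial degree `m` and simplicial degree `q` -/
  toFun : ∀ (m q : SimplexCategory) (σ : q ⟶ m), InSkeleton s σ → (q ⟶ n) →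
    ((X.obj m).obj (op q)).X
  map_simplicial : ∀ (m q q' : SimplexCategory) (θ : q' ⟶ q) (σ : q ⟶ m)
    (hσ : InSkeleton s σ) (τ : q ⟶ n),
    ((X.obj m).map θ.op).toFun (toFun m q σ hσ τ) =
      toFun m q' (θ ≫ σ) (hσ.precomp θ) (θ ≫ τ)
  map_cosimplicial : ∀ (m m' q : SimplexCategory) (κ : m ⟶ m') (σ : q ⟶ m)
    (hσ : InSkeleton s σ) (τ : q ⟶ n),
    ((X.map κ).app (op q)).toFun (toFun m q σ hσ τ) =
      toFun m' q (σ ≫ κ) (hσ.postcomp κ) τ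

/-- The pointed simplicial set `Tot_s X = Map_*(Δ[s]₊, X)`; for `s = ⊤` this is
`Tot_∞ X = Map_*(Δ₊, X)`, and for `s < 0` it is a point. -/
def totStage (X : CosimplicialPSSet.{u}) (s : WithTop ℤ) : PSSet.{u} where
  obj n := Pointed.of (X := TotSimplex X s n.unop)
    { toFun := fun m q _ _ _ => ((X.obj m).obj (op q)).point
      map_simplicial := fun m _ _ θ _ _ _ => ((X.obj m).map θ.op).map_point
      map_cosimplicial := fun _ _ q κ _ _ _ => ((X.map κ).app (op q)).map_point }
  map f := ⟨fun x =>
    { toFun := fun m q σ hσ τ => x.toFun m q σ hσ (τ ≫ f.unop)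
      map_simplicial := fun m q q' θ σ hσ τ => by
        rw [x.map_simplicial]
        simp
      map_cosimplicial := fun m m' q κ σ hσ τ => x.map_cosimplicial m m' q κ σ hσ _ }, rfl⟩
  map_id n := by
    apply Pointed.Hom.ext
    funext x
    apply TotSimplex.ext
    funext m q σ hσ τ
    exact congrArg (x.toFun m q σ hσ) (Category.comp_id τ)
  map_comp f g := by
    apply Pointed.Hom.ext
    funext x
    apply TotSimplex.ext
    funext m q σ hσ τ
    exact congrArg (x.toFun m q σ hσ) (Category.assoc _ _ _).symm

/-- A tower of pointed spaces `⋯ → T_s → T_{s-1} → ⋯`, indexed by `s : ℤ`, together with a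
pointed space `T_⊤` mapping compatibly to all the `T_s` (for the towers below, their
inverse limit, see `Tower.IsFibrationTower`). -/
abbrev Tower := (WithTop ℤ)ᵒᵖ ⥤ PSSet.{u}

/-- The tower `s ↦ Tot_s X` (with value `Tot_∞ X` at `⊤`), whose maps are the restrictions. -/
noncomputable def tot : CosimplicialPSSet.{u} ⥤ Tower.{u} where
  obj X :=
    { obj := fun s => totStage X s.unop
      map := fun {s s'} h =>
        { app := fun n => ⟨fun x =>
            { toFun := fun m q σ hσ τ => x.toFun m q σ (hσ.mono (leOfHom h.unop)) τ
              map_simplicial := fun m q q' θ σ hσ τ => x.map_simplicial _ _ _ _ _ _ _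
              map_cosimplicial := fun m m' q κ σ hσ τ => x.map_cosimplicial _ _ _ _ _ _ _ },
            rfl⟩
          naturality := fun _ _ _ => rfl }
      map_id := fun _ => rfl
      map_comp := fun _ _ => rfl }
  map {X Y} φ :=
    { app := fun s =>
        { app := fun n => ⟨fun x =>
            { toFun := fun m q σ hσ τ => ((φ.app m).app (op q)).toFun (x.toFun m q σ hσ τ)
              map_simplicial := fun m q q' θ σ hσ τ => by
                rw [← x.map_simplicial]
                exact (app_map (φ.app m) θ.op _).symm
              map_cosimplicial := fun m m' q κ σ hσ τ => by
                rw [← x.map_cosimplicial]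
                exact (app_congr (φ.naturality κ) (op q) _).symm },
            TotSimplex.ext (by
              funext m q σ hσ τ
              exact ((φ.app m).app (op q)).map_point)⟩
          naturality := fun _ _ _ => rfl }
      naturality := fun _ _ _ => rfl }
  map_id _ := rfl
  map_comp _ _ := rfl

/-- The functor `Tot_∞`. -/
noncomputable def totInfty : CosimplicialPSSet.{u} ⥤ PSSet.{u} :=
  tot ⋙ (evaluation (WithTop ℤ)ᵒᵖ PSSet.{u}).obj (op ⊤)

/-! ## The functor `Ex^∞` -/

/-- The last vertex (maximum) of a nonempty subset of `{0, …, n}`. -/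
noncomputable def maxVertex (n : SimplexCategory) :
    PartialOrder.NonemptyFiniteChains (ULift.{u} (Fin (n.len + 1))) →o Fin (n.len + 1) where
  toFun A := A.finset.sup' A.nonempty ULift.down
  monotone' _ _ h := Finset.sup'_mono _ h _

theorem maxVertex_map {m n : SimplexCategory} (f : m ⟶ n)
    (g : ULift.{u} (Fin (m.len + 1)) →o ULift.{u} (Fin (n.len + 1)))
    (hg : ∀ x, (g x).down = f.toOrderHom x.down)
    (A : PartialOrder.NonemptyFiniteChains (ULift.{u} (Fin (m.len + 1)))) :
    maxVertex n (A.map g) = f.toOrderHom (maxVertex m A) := by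
  apply le_antisymm
  · refine Finset.sup'_le (A.map g).nonempty _ fun b hb => ?_
    obtain ⟨x, hx, rfl⟩ := (PartialOrder.NonemptyFiniteChains.mem_map_iff A g b).1 hb
    rw [hg]
    exact f.toOrderHom.monotone (Finset.le_sup' ULift.down hx)
  · obtain ⟨x, hx, hx'⟩ := Finset.exists_mem_eq_sup' A.nonempty ULift.down
    have h : maxVertex m A = x.down := hx'
    rw [h, ← hg]
    exact Finset.le_sup' ULift.down
      ((PartialOrder.NonemptyFiniteChains.mem_map_iff A g _).2 ⟨x, hx, rfl⟩)

/-- The last vertex maps `sd Δⁿ ⟶ Δⁿ`. -/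
noncomputable def lastVertex : SimplexCategory.sd.{u} ⟶ SSet.stdSimplex.{u} where
  app n :=
    { app := fun q => TypeCat.ofHom fun c => SSet.stdSimplex.objMk
        ((maxVertex n).comp ⟨fun j => c.obj j, fun _ _ h => leOfHom (c.map (homOfLE h))⟩)
      naturality := fun q q' f => by
        ext c
        rfl }
  naturality m n f := by
    ext q c
    apply SSet.stdSimplex.objEquiv.injective
    ext j
    change (((maxVertex n) ((PartialOrder.NonemptyFiniteChains.orderHomMap
      (SimplexCategory.toPartOrd.map f).hom) (c.obj j)) : Fin (n.len + 1)) : ℕ) =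
      (f.toOrderHom (maxVertex m (c.obj j)) : ℕ)
    refine congrArg Fin.val ?_
    exact maxVertex_map f (SimplexCategory.toPartOrd.map f).hom (fun _ => rfl) (c.obj j)

/-- The natural map `K ⟶ Ex K` induced by the last vertex maps. -/
noncomputable def toEx : 𝟭 SSet.{u} ⟶ SSet.ex.{u} where
  app K :=
    { app := fun n => TypeCat.ofHom fun x =>
        ULift.up (lastVertex.app n.unop ≫ SSet.yonedaEquiv.symm x)
      naturality := fun q q' f => by
        ext x
        refine congrArg ULift.up ?_
        have h : SSet.yonedaEquiv.symm (K.map f x) =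
            SSet.stdSimplex.map f.unop ≫ SSet.yonedaEquiv.symm x :=
          (SSet.yonedaEquiv_symm_naturality_left f.unop x).symm
        change lastVertex.app q'.unop ≫ SSet.yonedaEquiv.symm (K.map f x) =
          SimplexCategory.sd.map f.unop ≫ lastVertex.app q.unop ≫ SSet.yonedaEquiv.symm x
        rw [h, lastVertex.naturality_assoc] }
  naturality K L f := by
    ext n x
    refine congrArg ULift.up ?_
    change lastVertex.app n.unop ≫ SSet.yonedaEquiv.symm (f.app n x) =
      (lastVertex.app n.unop ≫ SSet.yonedaEquiv.symm x) ≫ f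
    rw [Category.assoc, SSet.yonedaEquiv_symm_comp]

/-- The iterates `Ex^k`. -/
noncomputable def exIterate : ℕ → (SSet.{u} ⥤ SSet.{u}) :=
  fun k => Nat.rec (𝟭 SSet.{u}) (fun _ F => F ⋙ SSet.ex.{u}) k

/-- The sequence of functors `K → Ex K → Ex² K → ⋯`, whose maps are `Ex^k K ⟶ Ex (Ex^k K)`. -/
noncomputable def exSequence : ℕ ⥤ (SSet.{u} ⥤ SSet.{u}) :=
  Functor.ofSequence (X := exIterate.{u}) fun k => Functor.whiskerLeft (exIterate.{u} k) toEx

/-- The functor `Ex^∞` on simplicial sets, the colimit of `K → Ex K → Ex² K → ⋯`. -/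
noncomputable def exInfty : SSet.{u} ⥤ SSet.{u} := Limits.colimit exSequence.{u}

/-- The natural map `K ⟶ Ex^∞ K`. -/
noncomputable def toExInfty : 𝟭 SSet.{u} ⟶ exInfty := Limits.colimit.ι exSequence.{u} 0

/-- The functor `Ex^∞` on pointed simplicial sets, pointed by the image of the base point
under `K ⟶ Ex^∞ K`. -/
noncomputable def exInftyPt : PSSet.{u} ⥤ PSSet.{u} where
  obj K :=
    { obj := fun q => Pointed.of (X := (exInfty.obj (toSSet.obj K)).obj q)
        ((toExInfty.app (toSSet.obj K)).app q (K.obj q).point)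
      map := fun {q q'} θ => ⟨fun x => (exInfty.obj (toSSet.obj K)).map θ x, by
        have h := congrArg ((toExInfty.app (toSSet.obj K)).app q') (K.map θ).map_point
        exact ((toExInfty.app (toSSet.obj K)).naturality_apply θ (K.obj q).point).symm.trans h⟩
      map_id := fun q => by
        apply Pointed.Hom.ext
        funext x
        simp
      map_comp := fun f g => by
        apply Pointed.Hom.ext
        funext x
        simp }
  map {K L} f :=
    { app := fun q => ⟨fun x => (exInfty.map (toSSet.map f)).app q x, by
        have h := congrArg ((toExInfty.app (toSSet.obj L)).app q) (f.app q).map_point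
        have h' := toExInfty.naturality (toSSet.map f)
        have h'' := congrArg (fun g => g.app q (K.obj q).point) h'
        exact h''.symm.trans h⟩
      naturality := fun q q' θ => by
        apply Pointed.Hom.ext
        funext x
        exact (exInfty.map (toSSet.map f)).naturality_apply θ x }
  map_id K := by
    apply NatTrans.ext
    funext q
    apply Pointed.Hom.ext
    funext x
    change (exInfty.map (toSSet.map (𝟙 K))).app q x = x
    simp
  map_comp f g := by
    apply NatTrans.ext
    funext q
    apply Pointed.Hom.ext
    funext x
    change (exInfty.map (toSSet.map (f ≫ g))).app q x =
      (exInfty.map (toSSet.map g)).app q ((exInfty.map (toSSet.map f)).app q x)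
    simp

/-- The natural pointed map `K ⟶ Ex^∞ K`. -/
noncomputable def toExInftyPt : 𝟭 PSSet.{u} ⟶ exInftyPt where
  app K :=
    { app := fun q => ⟨fun x => (toExInfty.app (toSSet.obj K)).app q x, rfl⟩
      naturality := fun q q' θ => by
        apply Pointed.Hom.ext
        funext x
        exact (toExInfty.app (toSSet.obj K)).naturality_apply θ x }
  naturality K L f := by
    apply NatTrans.ext
    funext q
    apply Pointed.Hom.ext
    funext x
    exact congrArg (fun g => g.app q x) (toExInfty.naturality (toSSet.map f))

/-! ## The Postnikov tower -/

/-- Two `q`-simplices are identified if their restrictions to the `n`-skeleton of `Δ^q` agree. -/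
def postnikovSetoid (K : PSSet.{u}) (n : WithTop ℤ) (q : SimplexCategoryᵒᵖ) :
    Setoid (K.obj q).X where
  r x y := ∀ k : SimplexCategory, ((k.len : ℤ) : WithTop ℤ) ≤ n → ∀ f : k ⟶ q.unop,
    (K.map f.op).toFun x = (K.map f.op).toFun y
  iseqv := ⟨fun _ _ _ _ => rfl, fun h k hk f => (h k hk f).symm,
    fun h h' k hk f => (h k hk f).trans (h' k hk f)⟩

/-- For `n : ℕ`, two simplices of `K` are identified by `postnikovSetoid` if and only if they have
the same image under `K ⟶ cosk_n K`: hence the quotient of `K` below is the image of `K` in its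
`n`-coskeleton. -/
theorem postnikovSetoid_iff_cosk (K : PSSet.{u}) (n : ℕ) (q : SimplexCategoryᵒᵖ)
    (x y : (K.obj q).X) :
    (postnikovSetoid K ((n : ℤ) : WithTop ℤ) q).r x y ↔
      ((SSet.coskAdj n).unit.app (toSSet.obj K)).app q x =
        ((SSet.coskAdj n).unit.app (toSSet.obj K)).app q y := by
  have key : ∀ z : (toSSet.obj K).obj q,
      ((SSet.coskAdj n).unit.app (toSSet.obj K)).app q z =
        SSet.yonedaEquiv (SSet.yonedaEquiv.symm z ≫
          (SSet.coskAdj n).unit.app (toSSet.obj K)) := fun z => by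
    rw [SSet.yonedaEquiv_symm_comp]
    exact (Equiv.apply_symm_apply _ _).symm
  have key' : ∀ z : (toSSet.obj K).obj q,
      SSet.yonedaEquiv.symm z ≫ (SSet.coskAdj n).unit.app (toSSet.obj K) =
        (SSet.coskAdj n).homEquiv _ _
          ((SSet.truncation n).map (SSet.yonedaEquiv.symm z)) := fun z => by
    rw [Adjunction.homEquiv_unit]
    exact (SSet.coskAdj n).unit.naturality (SSet.yonedaEquiv.symm z)
  rw [key x, key y, EmbeddingLike.apply_eq_iff_eq, key' x, key' y,
    EmbeddingLike.apply_eq_iff_eq]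
  constructor
  · intro h
    apply NatTrans.ext
    funext k
    ext f
    exact h k.unop.1 (by exact_mod_cast k.unop.2) f.down
  · intro h k hk f
    exact congrArg (fun g => g.app (op ⟨k, by exact_mod_cast hk⟩)
      (SSet.stdSimplex.objEquiv.symm f)) h

/-- The `n`-th Postnikov stage `K(n)` of a pointed simplicial set `K`: the image of `K` in its
`n`-coskeleton. It is a point for `n < 0`, and it is `K` for `n = ⊤`. -/
def postnikovStage (K : PSSet.{u}) (n : WithTop ℤ) : PSSet.{u} where
  obj q := Pointed.of (X := Quotient (postnikovSetoid K n q)) (Quotient.mk _ (K.obj q).point)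
  map {q q'} θ := ⟨Quotient.map (K.map θ).toFun fun x y h k hk f => by
      have h' := h k hk (f ≫ θ.unop)
      simpa using h', congrArg (Quotient.mk _) (K.map θ).map_point⟩
  map_id q := by
    apply Pointed.Hom.ext
    funext x
    induction x using Quotient.inductionOn with | _ x => ?_
    exact congrArg (Quotient.mk _) (by simp)
  map_comp f g := by
    apply Pointed.Hom.ext
    funext x
    induction x using Quotient.inductionOn with | _ x => ?_
    exact congrArg (Quotient.mk _) (by simp)

/-- The Postnikov tower `n ↦ K(n)` of a pointed simplicial set. -/
def postnikov : PSSet.{u} ⥤ Tower.{u} where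
  obj K :=
    { obj := fun n => postnikovStage K n.unop
      map := fun {n n'} h =>
        { app := fun q => ⟨Quotient.map id fun x y hxy k hk f =>
            hxy k (hk.trans (leOfHom h.unop)) f, rfl⟩
          naturality := fun q q' θ => by
            apply Pointed.Hom.ext
            funext x
            induction x using Quotient.inductionOn with | _ x => ?_
            rfl }
      map_id := fun n => by
        apply NatTrans.ext
        funext q
        apply Pointed.Hom.ext
        funext x
        induction x using Quotient.inductionOn with | _ x => ?_
        rfl
      map_comp := fun f g => by
        apply NatTrans.ext
        funext q
        apply Pointed.Hom.ext
        funext x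
        induction x using Quotient.inductionOn with | _ x => ?_
        rfl }
  map φ :=
    { app := fun n =>
        { app := fun q => ⟨Quotient.map (φ.app q).toFun fun x y h k hk f => by
            rw [← app_map, ← app_map, h k hk f],
            congrArg (Quotient.mk _) (φ.app q).map_point⟩
          naturality := fun q q' θ => by
            apply Pointed.Hom.ext
            funext x
            induction x using Quotient.inductionOn with | _ x => ?_
            exact congrArg (Quotient.mk _) (app_map φ θ x) }
      naturality := fun n n' h => by
        apply NatTrans.ext
        funext q
        apply Pointed.Hom.ext
        funext x
        induction x using Quotient.inductionOn with | _ x => ?_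
        rfl }
  map_id _ := by
    apply NatTrans.ext
    funext _
    apply NatTrans.ext
    funext _
    apply Pointed.Hom.ext
    funext x
    induction x using Quotient.inductionOn with | _ x => ?_
    rfl
  map_comp f g := by
    apply NatTrans.ext
    funext n
    apply NatTrans.ext
    funext q
    apply Pointed.Hom.ext
    funext x
    induction x using Quotient.inductionOn with | _ x => ?_
    rfl

/-- The natural map `K ⟶ K(⊤)` (an isomorphism, as `K(⊤)` is the quotient of `K` by equality). -/
def toPostnikovTop : 𝟭 PSSet.{u} ⟶
    postnikov ⋙ (evaluation (WithTop ℤ)ᵒᵖ PSSet.{u}).obj (op ⊤) where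
  app _ :=
    { app := fun _ => ⟨Quotient.mk _, rfl⟩
      naturality := fun _ _ _ => rfl }
  naturality _ _ _ := rfl

/-! ## Simplicial homotopy groups -/

/-- An `i`-simplex is spherical if its boundary is at the base point. -/
def IsSpherical (K : PSSet.{u}) (i : ℕ) (x : (K _⦋i⦌).X) : Prop :=
  ∀ (m : SimplexCategory) (f : m ⟶ ⦋i⦌), m.len < i →
    (K.map f.op).toFun x = (K.obj (op m)).point

/-- The spherical `i`-simplices, i.e. the pointed maps `Δ^i/∂Δ^i ⟶ K`. -/
def Spherical (K : PSSet.{u}) (i : ℕ) : Type u := { x : (K _⦋i⦌).X // IsSpherical K i x }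

/-- Homotopy of spherical simplices relative to the boundary: `x` and `y` are the faces `d₀ e` and
`d₁ e` of an `(i+1)`-simplex `e` all of whose other faces are at the base point. -/
def Spherical.Homotopic {K : PSSet.{u}} {i : ℕ} (x y : Spherical K i) : Prop :=
  ∃ e : (K _⦋i + 1⦌).X, (K.δ 0).toFun e = x.1 ∧ (K.δ 1).toFun e = y.1 ∧
    ∀ j : Fin (i + 2), 1 < j → (K.δ j).toFun e = (K _⦋i⦌).point

/-- The homotopy set `π_i K` of a pointed Kan complex. -/
def Htpy (K : PSSet.{u}) (i : ℕ) : Type u := Quot (Spherical.Homotopic (K := K) (i := i))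

/-- The spherical simplex at the base point. -/
def Spherical.base (K : PSSet.{u}) (i : ℕ) : Spherical K i :=
  ⟨(K _⦋i⦌).point, fun _ f _ => (K.map f.op).map_point⟩

/-- The map on spherical simplices induced by a pointed map. -/
def Spherical.map {K L : PSSet.{u}} (f : K ⟶ L) {i : ℕ} (x : Spherical K i) : Spherical L i :=
  ⟨(f.app _).toFun x.1, fun m g hm => by
    rw [← app_map, x.2 m g hm, (f.app (op m)).map_point]⟩

namespace Htpy

/-- The homotopy class of a spherical simplex. -/
def mk {K : PSSet.{u}} {i : ℕ} (x : Spherical K i) : Htpy K i := Quot.mk _ x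

/-- The class of the base point (the neutral element if `i ≥ 1`). -/
def zero (K : PSSet.{u}) (i : ℕ) : Htpy K i := mk (Spherical.base K i)

/-- The map `π_i K → π_i L` induced by a pointed map. -/
def map {K L : PSSet.{u}} (f : K ⟶ L) (i : ℕ) : Htpy K i → Htpy L i :=
  Quot.map (Spherical.map f) (by
    rintro x y ⟨e, h₀, h₁, h⟩
    refine ⟨(f.app _).toFun e, ?_, ?_, fun j hj => ?_⟩
    · exact (app_map f _ e).symm.trans (congrArg (f.app _).toFun h₀)
    · exact (app_map f _ e).symm.trans (congrArg (f.app _).toFun h₁)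
    · exact (app_map f _ e).symm.trans
        ((congrArg (f.app _).toFun (h j hj)).trans (f.app _).map_point))

/-- The graph of the group law of `π_{i+1} K`: `c = a * b` if there is an `(i+2)`-simplex whose
last three faces `d_i`, `d_{i+1}`, `d_{i+2}` represent `b`, `c`, `a` and whose other faces are at
the base point. -/
def IsMul {K : PSSet.{u}} {i : ℕ} (a b c : Htpy K (i + 1)) : Prop :=
  ∃ (e : (K _⦋i + 2⦌).X) (x y z : Spherical K (i + 1)),
    mk x = a ∧ mk y = b ∧ mk z = c ∧
    (K.δ (Fin.last i).castSucc.castSucc).toFun e = y.1 ∧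
    (K.δ (Fin.last i).castSucc.succ).toFun e = z.1 ∧
    (K.δ (Fin.last i).succ.succ).toFun e = x.1 ∧
    ∀ j : Fin (i + 3), (j : ℕ) < i → (K.δ j).toFun e = (K _⦋i + 1⦌).point

theorem map_zero {K L : PSSet.{u}} (f : K ⟶ L) (i : ℕ) : map f i (zero K i) = zero L i :=
  congrArg mk (Subtype.ext (f.app _).map_point)

theorem IsMul.map {K L : PSSet.{u}} (f : K ⟶ L) {i : ℕ} {a b c : Htpy K (i + 1)}
    (h : IsMul a b c) :
    IsMul (Htpy.map f (i + 1) a) (Htpy.map f (i + 1) b) (Htpy.map f (i + 1) c) := by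
  obtain ⟨e, x, y, z, rfl, rfl, rfl, h₀, h₁, h₂, h⟩ := h
  refine ⟨(f.app _).toFun e, x.map f, y.map f, z.map f, rfl, rfl, rfl, ?_, ?_, ?_,
    fun j hj => ?_⟩
  · exact (app_map f _ e).symm.trans (congrArg (f.app _).toFun h₀)
  · exact (app_map f _ e).symm.trans (congrArg (f.app _).toFun h₁)
  · exact (app_map f _ e).symm.trans (congrArg (f.app _).toFun h₂)
  · exact (app_map f _ e).symm.trans
      ((congrArg (f.app _).toFun (h j hj)).trans (f.app _).map_point)

end Htpy

/-- The fibre of a pointed map over the base point. -/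
def fiber {A B : PSSet.{u}} (p : A ⟶ B) : PSSet.{u} where
  obj q := Pointed.of (X := { x : (A.obj q).X // (p.app q).toFun x = (B.obj q).point })
    ⟨(A.obj q).point, (p.app q).map_point⟩
  map {q q'} θ := ⟨fun x => ⟨(A.map θ).toFun x.1, by
      rw [app_map, x.2, (B.map θ).map_point]⟩, Subtype.ext (A.map θ).map_point⟩
  map_id q := by
    apply Pointed.Hom.ext
    funext x
    exact Subtype.ext (by simp)
  map_comp f g := by
    apply Pointed.Hom.ext
    funext x
    exact Subtype.ext (by simp)

/-- The inclusion of the fibre. -/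
def fiberι {A B : PSSet.{u}} (p : A ⟶ B) : fiber p ⟶ A where
  app _ := ⟨Subtype.val, rfl⟩
  naturality _ _ _ := rfl

/-- The map of fibres induced by a commutative square. -/
def fiberMap {A B A' B' : PSSet.{u}} {p : A ⟶ B} {p' : A' ⟶ B'} (f : A ⟶ A') (g : B ⟶ B')
    (h : p ≫ g = f ≫ p') : fiber p ⟶ fiber p' where
  app q := ⟨fun x => ⟨(f.app q).toFun x.1, by
      have h' := app_congr h q x.1
      have h'' : (g.app q).toFun ((p.app q).toFun x.1) =
        (p'.app q).toFun ((f.app q).toFun x.1) := h'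
      rw [← h'', x.2, (g.app q).map_point]⟩, Subtype.ext (f.app q).map_point⟩
  naturality q q' θ := by
    apply Pointed.Hom.ext
    funext x
    exact Subtype.ext (app_map f θ x.1)

/-- The graph of the action of `π_{i+1} B` on `π_i F`, for a Kan fibration `p : A ⟶ B` with fibre
`F`: the class `α` takes `a` to `b` if there is an `(i+1)`-simplex `e` of `A` whose faces
`d₀ e` and `d₁ e` represent `a` and `b`, whose other faces are at the base point, and whose image
`p e` represents `α`. For `i = 0` this is the action of `π_1 B` on `π_0 F`. The connecting map
`j : π_{i+1} B → π_i F` is the orbit map of the base point, and for `i ≥ 1` the action is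
translation by `j`. -/
def IsFiberAction {A B : PSSet.{u}} (p : A ⟶ B) {i : ℕ} (α : Htpy B (i + 1))
    (a b : Htpy (fiber p) i) : Prop :=
  ∃ (e : (A _⦋i + 1⦌).X) (z : Spherical B (i + 1)) (x y : Spherical (fiber p) i),
    Htpy.mk z = α ∧ Htpy.mk x = a ∧ Htpy.mk y = b ∧
    (p.app (op ⦋i + 1⦌)).toFun e = z.1 ∧
    (A.δ 0).toFun e = x.1.1 ∧ (A.δ 1).toFun e = y.1.1 ∧
    ∀ j : Fin (i + 2), 1 < j → (A.δ j).toFun e = (A _⦋i⦌).point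

/-! ## The spectral sequence of a tower -/

namespace Tower

/-- The space `T_s`, for `s : ℤ`. -/
abbrev stage (T : Tower.{u}) (s : ℤ) : PSSet.{u} := T.obj (op (s : WithTop ℤ))

/-- The space `T_⊤`. -/
abbrev lim (T : Tower.{u}) : PSSet.{u} := T.obj (op ⊤)

/-- The map `T_s ⟶ T_{s'}` for `s' ≤ s`. -/
noncomputable def down (T : Tower.{u}) {s' s : ℤ} (h : s' ≤ s) : T.stage s ⟶ T.stage s' :=
  T.map (homOfLE (WithTop.coe_le_coe.2 h)).op

/-- The map `T_⊤ ⟶ T_s`. -/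
noncomputable def fromLim (T : Tower.{u}) (s : ℤ) : T.lim ⟶ T.stage s :=
  T.map (homOfLE (le_top : (s : WithTop ℤ) ≤ ⊤)).op

/-- The map `T_s ⟶ T_{s-1}`. -/
noncomputable def step (T : Tower.{u}) (s : ℤ) : T.stage s ⟶ T.stage (s - 1) := T.down (by omega)

/-- The fibre `F_s` of `T_s ⟶ T_{s-1}`. -/
noncomputable def fib (T : Tower.{u}) (s : ℤ) : PSSet.{u} := fiber (T.step s)

/-- The inclusion `F_s ⟶ T_s`. -/
noncomputable def fibι (T : Tower.{u}) (s : ℤ) : T.fib s ⟶ T.stage s := fiberι (T.step s)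

/-- `T` is a tower of Kan fibrations `⋯ → T_1 → T_0 → *`, extended by points in negative degrees,
and `T_⊤` is its inverse limit. -/
structure IsFibrationTower (T : Tower.{u}) : Prop where
  fibration : ∀ s : ℤ, SSet.modelCategoryQuillen.J.rlp (toSSet.map (T.step s))
  subsingleton : ∀ s : ℤ, s < 0 → ∀ q, Subsingleton ((T.stage s).obj q).X
  limit : ∀ (q : SimplexCategoryᵒᵖ) (x : ∀ s : ℤ, ((T.stage s).obj q).X),
    (∀ s : ℤ, ((T.step s).app q).toFun (x s) = x (s - 1)) →
      ∃! y : (T.lim.obj q).X, ∀ s : ℤ, ((T.fromLim s).app q).toFun y = x s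

/-- `a ∈ π_i F_s` satisfies `k a ∈ im (π_i T_{s+j} → π_i T_s)`. -/
def IsCycle (T : Tower.{u}) (j : ℕ) (s : ℤ) (i : ℕ) (a : Htpy (T.fib s) i) : Prop :=
  ∃ b : Htpy (T.stage (s + j)) i,
    Htpy.map (T.down (by omega : s ≤ s + j)) i b = Htpy.map (T.fibι s) i a

/-- Two elements of `π_i F_s` are related if they lie in the same orbit of the action of
`ker (π_{i+1} T_{s-1} → π_{i+1} T_{s-1-j})`. -/
def PageRel (T : Tower.{u}) (j : ℕ) (s : ℤ) (i : ℕ) (a b : { a // T.IsCycle j s i a }) : Prop :=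
  ∃ α : Htpy (T.stage (s - 1)) (i + 1),
    Htpy.map (T.down (by omega : s - 1 - j ≤ s - 1)) (i + 1) α = Htpy.zero _ (i + 1) ∧
      IsFiberAction (T.step s) α a.1 b.1

/-- The `j`-th derived term of `π_i F_s`, that is, the term `E_{j+1}^{s,s+i}` of the homotopy
spectral sequence of the tower: the quotient of
`ker (π_i F_s → π_i T_s / im (π_i T_{s+j} → π_i T_s))` by the action of
`ker (π_{i+1} T_{s-1} → π_{i+1} T_{s-1-j})`. -/
noncomputable def Page (T : Tower.{u}) (j : ℕ) (s : ℤ) (i : ℕ) : Type u := Quot (T.PageRel j s i)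

/-- The class in `E_{j+1}^{s,s+i}` of an element of `π_i F_s`. -/
noncomputable def pageMk (T : Tower.{u}) (j : ℕ) (s : ℤ) (i : ℕ) (a : Htpy (T.fib s) i)
    (h : T.IsCycle j s i a) : T.Page j s i := Quot.mk _ ⟨a, h⟩

theorem isCycle_zero (T : Tower.{u}) (j : ℕ) (s : ℤ) (i : ℕ) :
    T.IsCycle j s i (Htpy.zero _ i) :=
  ⟨Htpy.zero _ i, by rw [Htpy.map_zero, Htpy.map_zero]⟩

/-- The base point of `E_{j+1}^{s,s+i}` (the neutral element if `i ≥ 1`). -/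
noncomputable def pageZero (T : Tower.{u}) (j : ℕ) (s : ℤ) (i : ℕ) : T.Page j s i :=
  T.pageMk j s i (Htpy.zero _ i) (T.isCycle_zero j s i)

/-- The graph of the group law of `E_{j+1}^{s,s+i+1}`, induced by the one of `π_{i+1} F_s`. -/
def PageMul (T : Tower.{u}) (j : ℕ) (s : ℤ) (i : ℕ) (x y z : T.Page j s (i + 1)) : Prop :=
  ∃ a ha b hb c hc, T.pageMk j s (i + 1) a ha = x ∧ T.pageMk j s (i + 1) b hb = y ∧
    T.pageMk j s (i + 1) c hc = z ∧ Htpy.IsMul a b c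

/-- The graph of the action of `E_{j+1}^{s,s+i+1}` on `E_{j+1}^{s',s'+i}`, where `s' = s + j + 1`:
if `x` is the class of `a ∈ π_{i+1} F_s`, lift `k a ∈ π_{i+1} T_s` to `β ∈ π_{i+1} T_{s'-1}` and
let `β` act on `π_i F_{s'}`. -/
def PageAct (T : Tower.{u}) (j : ℕ) {s s' : ℤ} (hs : s' = s + j + 1) (i : ℕ)
    (x : T.Page j s (i + 1)) (y z : T.Page j s' i) : Prop :=
  ∃ a ha b hb c hc, T.pageMk j s (i + 1) a ha = x ∧ T.pageMk j s' i b hb = y ∧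
    T.pageMk j s' i c hc = z ∧ ∃ β : Htpy (T.stage (s' - 1)) (i + 1),
      Htpy.map (T.down (by omega : s ≤ s' - 1)) (i + 1) β = Htpy.map (T.fibι s) (i + 1) a ∧
        IsFiberAction (T.step s') β b c

/-- `x ∈ E_{j+1}` and `y ∈ E_{j+2}` are represented by a common element of `π_i F_s`: then `x` is
a cycle with class `y`. -/
def PageNext (T : Tower.{u}) (j : ℕ) (s : ℤ) (i : ℕ) (x : T.Page j s i)
    (y : T.Page (j + 1) s i) : Prop :=
  ∃ a h h', T.pageMk j s i a h = x ∧ T.pageMk (j + 1) s i a h' = y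

/-- `x ∈ E_{j+1}^{s,s+i}` is represented by an element of `π_i F_s` with the same image in
`π_i T_s` as `z ∈ π_i T_⊤`. -/
def PageDetects (T : Tower.{u}) (j : ℕ) (s : ℤ) (i : ℕ) (z : Htpy T.lim i)
    (x : T.Page j s i) : Prop :=
  ∃ a h, T.pageMk j s i a h = x ∧ Htpy.map (T.fromLim s) i z = Htpy.map (T.fibι s) i a

/-- The filtration of `π_i T_⊤` by `Q_s = ker (π_i T_⊤ → π_i T_s)`. -/
def Filtration (T : Tower.{u}) (s : ℤ) (i : ℕ) (z : Htpy T.lim i) : Prop :=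
  Htpy.map (T.fromLim s) i z = Htpy.zero _ i

/-! ### Functoriality in the tower -/

theorem id_apply {K : PSSet.{u}} (i : ℕ) (x : Htpy K i) : Htpy.map (𝟙 K) i x = x := by
  induction x using Quot.inductionOn with | _ _ => ?_
  rfl

theorem comp_apply {K L M : PSSet.{u}} (f : K ⟶ L) (g : L ⟶ M) (i : ℕ) (x : Htpy K i) :
    Htpy.map (f ≫ g) i x = Htpy.map g i (Htpy.map f i x) := by
  induction x using Quot.inductionOn with | _ x => ?_
  rfl

theorem square_apply {K L K' L' : PSSet.{u}} {f : K ⟶ L} {g : K' ⟶ L'} {a : K ⟶ K'} {b : L ⟶ L'}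
    (h : f ≫ b = a ≫ g) (i : ℕ) (x : Htpy K i) :
    Htpy.map b i (Htpy.map f i x) = Htpy.map g i (Htpy.map a i x) := by
  rw [← comp_apply, ← comp_apply, h]

theorem down_naturality {T T' : Tower.{u}} (φ : T ⟶ T') {s' s : ℤ} (h : s' ≤ s) :
    T.down h ≫ φ.app _ = φ.app _ ≫ T'.down h := φ.naturality _

theorem fromLim_naturality {T T' : Tower.{u}} (φ : T ⟶ T') (s : ℤ) :
    T.fromLim s ≫ φ.app _ = φ.app _ ≫ T'.fromLim s := φ.naturality _

/-- The map of fibres induced by a map of towers. -/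
noncomputable def fibMap {T T' : Tower.{u}} (φ : T ⟶ T') (s : ℤ) : T.fib s ⟶ T'.fib s :=
  fiberMap (φ.app _) (φ.app _) (down_naturality φ _)

theorem fibι_naturality {T T' : Tower.{u}} (φ : T ⟶ T') (s : ℤ) :
    T.fibι s ≫ φ.app _ = fibMap φ s ≫ T'.fibι s := rfl

theorem IsCycle.map {T T' : Tower.{u}} (φ : T ⟶ T') {j : ℕ} {s : ℤ} {i : ℕ}
    {a : Htpy (T.fib s) i} (h : T.IsCycle j s i a) :
    T'.IsCycle j s i (Htpy.map (fibMap φ s) i a) := by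
  obtain ⟨b, hb⟩ := h
  refine ⟨Htpy.map (φ.app _) i b, ?_⟩
  rw [← square_apply (down_naturality φ _), hb, square_apply (fibι_naturality φ s)]

theorem isFiberAction_map {T T' : Tower.{u}} (φ : T ⟶ T') {s : ℤ} {i : ℕ}
    {α : Htpy (T.stage (s - 1)) (i + 1)} {a b : Htpy (T.fib s) i}
    (h : IsFiberAction (T.step s) α a b) :
    IsFiberAction (T'.step s) (Htpy.map (φ.app _) (i + 1) α)
      (Htpy.map (fibMap φ s) i a) (Htpy.map (fibMap φ s) i b) := by
  obtain ⟨e, z, x, y, rfl, rfl, rfl, h, h₀, h₁, hj⟩ := h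
  refine ⟨((φ.app _).app _).toFun e, z.map (φ.app _), x.map (fibMap φ s), y.map (fibMap φ s),
    rfl, rfl, rfl, ?_, ?_, ?_, fun j hj' => ?_⟩
  · exact (app_congr (down_naturality φ (by omega : s - 1 ≤ s)) _ e).symm.trans
      (congrArg ((φ.app _).app _).toFun h)
  · exact (app_map (φ.app _) _ e).symm.trans (congrArg ((φ.app _).app _).toFun h₀)
  · exact (app_map (φ.app _) _ e).symm.trans (congrArg ((φ.app _).app _).toFun h₁)
  · exact (app_map (φ.app _) _ e).symm.trans
      ((congrArg ((φ.app _).app _).toFun (hj j hj')).trans ((φ.app _).app _).map_point)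

/-- The map on pages induced by a map of towers. -/
noncomputable def pageMap {T T' : Tower.{u}} (φ : T ⟶ T') (j : ℕ) (s : ℤ) (i : ℕ) :
    T.Page j s i → T'.Page j s i :=
  Quot.map (fun a => ⟨Htpy.map (fibMap φ s) i a.1, a.2.map φ⟩) (by
    rintro a b ⟨α, hα, h⟩
    refine ⟨Htpy.map (φ.app _) (i + 1) α, ?_, isFiberAction_map φ h⟩
    rw [← square_apply (down_naturality φ _), hα, Htpy.map_zero])

theorem pageMap_id (T : Tower.{u}) (j : ℕ) (s : ℤ) (i : ℕ) (x : T.Page j s i) :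
    pageMap (𝟙 T) j s i x = x := by
  induction x using Quot.inductionOn with | _ x => ?_
  obtain ⟨a, ha⟩ := x
  induction a using Quot.inductionOn with | _ a => ?_
  rfl

theorem pageMap_comp {T T' T'' : Tower.{u}} (φ : T ⟶ T') (ψ : T' ⟶ T'') (j : ℕ) (s : ℤ) (i : ℕ)
    (x : T.Page j s i) : pageMap (φ ≫ ψ) j s i x = pageMap ψ j s i (pageMap φ j s i x) := by
  induction x using Quot.inductionOn with | _ x => ?_
  obtain ⟨a, ha⟩ := x
  induction a using Quot.inductionOn with | _ a => ?_
  rfl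

theorem pageMap_zero {T T' : Tower.{u}} (φ : T ⟶ T') (j : ℕ) (s : ℤ) (i : ℕ) :
    pageMap φ j s i (T.pageZero j s i) = T'.pageZero j s i :=
  congrArg (Quot.mk _) (Subtype.ext (Htpy.map_zero _ i))

theorem PageMul.map {T T' : Tower.{u}} (φ : T ⟶ T') {j : ℕ} {s : ℤ} {i : ℕ}
    {x y z : T.Page j s (i + 1)} (h : T.PageMul j s i x y z) :
    T'.PageMul j s i (pageMap φ j s _ x) (pageMap φ j s _ y) (pageMap φ j s _ z) := by
  obtain ⟨a, ha, b, hb, c, hc, rfl, rfl, rfl, h⟩ := h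
  exact ⟨_, ha.map φ, _, hb.map φ, _, hc.map φ, rfl, rfl, rfl, h.map _⟩

theorem PageAct.map {T T' : Tower.{u}} (φ : T ⟶ T') {j : ℕ} {s s' : ℤ} {hs : s' = s + j + 1}
    {i : ℕ} {x : T.Page j s (i + 1)} {y z : T.Page j s' i} (h : T.PageAct j hs i x y z) :
    T'.PageAct j hs i (pageMap φ j s _ x) (pageMap φ j s' _ y) (pageMap φ j s' _ z) := by
  obtain ⟨a, ha, b, hb, c, hc, rfl, rfl, rfl, β, hβ, h⟩ := h
  refine ⟨_, ha.map φ, _, hb.map φ, _, hc.map φ, rfl, rfl, rfl,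
    Htpy.map (φ.app _) (i + 1) β, ?_, isFiberAction_map φ h⟩
  rw [← square_apply (down_naturality φ _), hβ, square_apply (fibι_naturality φ s)]

theorem PageNext.map {T T' : Tower.{u}} (φ : T ⟶ T') {j : ℕ} {s : ℤ} {i : ℕ}
    {x : T.Page j s i} {y : T.Page (j + 1) s i} (h : T.PageNext j s i x y) :
    T'.PageNext j s i (pageMap φ j s i x) (pageMap φ (j + 1) s i y) := by
  obtain ⟨a, h, h', rfl, rfl⟩ := h
  exact ⟨_, h.map φ, h'.map φ, rfl, rfl⟩

theorem PageDetects.map {T T' : Tower.{u}} (φ : T ⟶ T') {j : ℕ} {s : ℤ} {i : ℕ}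
    {z : Htpy T.lim i} {x : T.Page j s i} (h : T.PageDetects j s i z x) :
    T'.PageDetects j s i (Htpy.map (φ.app _) i z) (pageMap φ j s i x) := by
  obtain ⟨a, h, rfl, h'⟩ := h
  refine ⟨_, h.map φ, rfl, ?_⟩
  rw [← square_apply (fromLim_naturality φ s), h', square_apply (fibι_naturality φ s)]

theorem Filtration.map {T T' : Tower.{u}} (φ : T ⟶ T') {s : ℤ} {i : ℕ}
    {z : Htpy T.lim i} (h : T.Filtration s i z) :
    T'.Filtration s i (Htpy.map (φ.app _) i z) := by
  have h' : Htpy.map (T.fromLim s) i z = Htpy.zero _ i := h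
  change Htpy.map (T'.fromLim s) i _ = Htpy.zero _ i
  rw [← square_apply (fromLim_naturality φ s), h', Htpy.map_zero]

end Tower

/-! ## Fringed spectral sequences starting from the `E₂`-page -/

/-- The data of a (fringed) spectral sequence starting from the `E₂`-page, with its abutment.
The term `E k s i` is `E_{k+2}^{s,t}` for `t = s + i`; it is a group for `i ≥ 1` (abelian for
`i ≥ 2`) and a pointed set for `i = 0`. Group laws, differentials and actions are recorded by their
graphs. -/
structure SpectralSequence where
  /-- the term `E_{k+2}^{s,s+i}` -/
  E : ℕ → ℤ → ℕ → Type u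
  /-- the base point, or neutral element -/
  zero : ∀ k s i, E k s i
  /-- the graph of the group law of `E_{k+2}^{s,s+i+1}` -/
  IsMul : ∀ k s i, E k s (i + 1) → E k s (i + 1) → E k s (i + 1) → Prop
  /-- the graph of the action of `E_r^{s,t}` on `E_r^{s+r,t+r-1}`, where `r = k + 2` and
  `t = s + i + 1`; its orbit map at the base point is the differential `d_r`. For `i ≥ 1` the
  action is translation by `d_r`, for `i = 0` it is the action on the fringe. -/
  IsAct : ∀ k s i, E k s (i + 1) → E k (s + k + 2) i → E k (s + k + 2) i → Prop
  /-- the relation "`x ∈ E_r` is a cycle with class `y ∈ E_{r+1}`", where `r = k + 2` -/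
  IsNext : ∀ k s i, E k s i → E (k + 1) s i → Prop
  /-- the abutment in degree `i` -/
  Ab : ℕ → Type u
  /-- the base point of the abutment -/
  abZero : ∀ i, Ab i
  /-- the graph of the group law of the abutment in degree `i + 1` -/
  AbIsMul : ∀ i, Ab (i + 1) → Ab (i + 1) → Ab (i + 1) → Prop
  /-- the filtration of the abutment -/
  Fil : ℤ → ∀ i, Ab i → Prop
  /-- the relation "`z`, which lies in the filtration step indexed by `s - 1`, is detected by
  `x ∈ E_{k+2}^{s,s+i}`" -/
  Detects : ∀ k s i, Ab i → E k s i → Prop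

namespace SpectralSequence

/-- The graph of the differential `d_r : E_r^{s,t} → E_r^{s+r,t+r-1}`, where `r = k + 2` and
`t = s + i + 1`. -/
def IsDifferential (S : SpectralSequence.{u}) (k : ℕ) (s : ℤ) (i : ℕ) (x : S.E k s (i + 1))
    (y : S.E k (s + k + 2) i) : Prop :=
  S.IsAct k s i x (S.zero k (s + k + 2) i) y

/-- Morphisms of spectral sequences (starting from the `E₂`-page, including the abutment). They are
compatible with group laws, with the actions (that is, with the differentials, see
`Hom.page_differential`, and with the action on the fringe), with the passage from each page to the
next, and with the abutment and its filtration. -/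
@[ext]
structure Hom (S S' : SpectralSequence.{u}) where
  /-- the map `E_{k+2}^{s,s+i} → E'_{k+2}^{s,s+i}` -/
  page : ∀ k s i, S.E k s i → S'.E k s i
  /-- the map of abutments -/
  ab : ∀ i, S.Ab i → S'.Ab i
  page_zero : ∀ k s i, page k s i (S.zero k s i) = S'.zero k s i
  page_mul : ∀ k s i x y z, S.IsMul k s i x y z →
    S'.IsMul k s i (page _ _ _ x) (page _ _ _ y) (page _ _ _ z)
  page_act : ∀ k s i x y z, S.IsAct k s i x y z →
    S'.IsAct k s i (page _ _ _ x) (page _ _ _ y) (page _ _ _ z)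
  page_next : ∀ k s i x y, S.IsNext k s i x y → S'.IsNext k s i (page _ _ _ x) (page _ _ _ y)
  ab_zero : ∀ i, ab i (S.abZero i) = S'.abZero i
  ab_mul : ∀ i x y z, S.AbIsMul i x y z → S'.AbIsMul i (ab _ x) (ab _ y) (ab _ z)
  ab_fil : ∀ s i z, S.Fil s i z → S'.Fil s i (ab i z)
  detects : ∀ k s i z x, S.Detects k s i z x → S'.Detects k s i (ab i z) (page k s i x)

theorem Hom.page_differential {S S' : SpectralSequence.{u}} (f : Hom S S') (k : ℕ) (s : ℤ) (i : ℕ)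
    (x : S.E k s (i + 1)) (y : S.E k (s + k + 2) i) (h : S.IsDifferential k s i x y) :
    S'.IsDifferential k s i (f.page _ _ _ x) (f.page _ _ _ y) := by
  have h' := f.page_act _ _ _ _ _ _ h
  rwa [f.page_zero] at h'

instance : Category SpectralSequence.{u} where
  Hom := Hom
  id S :=
    { page := fun _ _ _ x => x
      ab := fun _ x => x
      page_zero := fun _ _ _ => rfl
      page_mul := fun _ _ _ _ _ _ h => h
      page_act := fun _ _ _ _ _ _ h => h
      page_next := fun _ _ _ _ _ h => h
      ab_zero := fun _ => rfl
      ab_mul := fun _ _ _ _ h => h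
      ab_fil := fun _ _ _ h => h
      detects := fun _ _ _ _ _ h => h }
  comp f g :=
    { page := fun k s i x => g.page k s i (f.page k s i x)
      ab := fun i x => g.ab i (f.ab i x)
      page_zero := fun k s i => by rw [f.page_zero, g.page_zero]
      page_mul := fun k s i x y z h => g.page_mul _ _ _ _ _ _ (f.page_mul _ _ _ _ _ _ h)
      page_act := fun k s i x y z h => g.page_act _ _ _ _ _ _ (f.page_act _ _ _ _ _ _ h)
      page_next := fun k s i x y h => g.page_next _ _ _ _ _ (f.page_next _ _ _ _ _ h)
      ab_zero := fun i => by rw [f.ab_zero, g.ab_zero]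
      ab_mul := fun i x y z h => g.ab_mul _ _ _ _ (f.ab_mul _ _ _ _ h)
      ab_fil := fun s i z h => g.ab_fil _ _ _ (f.ab_fil _ _ _ h)
      detects := fun k s i z x h => g.detects _ _ _ _ _ (f.detects _ _ _ _ _ h) }

@[ext]
theorem hom_ext {S S' : SpectralSequence.{u}} {f g : S ⟶ S'}
    (h : ∀ k s i x, f.page k s i x = g.page k s i x) (h' : ∀ i x, f.ab i x = g.ab i x) : f = g :=
  Hom.ext (by
    funext k s i x
    exact h k s i x) (by
    funext i x
    exact h' i x)

end SpectralSequence

namespace Tower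

theorem act_degree (k : ℕ) (s : ℤ) : s + k + 2 = s + ((k + 1 : ℕ) : ℤ) + 1 := by
  push_cast
  ring

theorem reindexed_act_degree (k : ℕ) (s : ℤ) (i : ℕ) :
    s + k + 2 + i = s + ((i + 1 : ℕ) : ℤ) + k + 1 := by
  push_cast
  ring

/-- The spectral sequence `E_r^{s,t}{T}` of a tower, from the `E₂`-page on. -/
noncomputable def homotopySS (T : Tower.{u}) : SpectralSequence.{u} where
  E k s i := T.Page (k + 1) s i
  zero k s i := T.pageZero (k + 1) s i
  IsMul k s i := T.PageMul (k + 1) s i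
  IsAct k s i := T.PageAct (k + 1) (act_degree k s) i
  IsNext k s i := T.PageNext (k + 1) s i
  Ab i := Htpy T.lim i
  abZero i := Htpy.zero T.lim i
  AbIsMul _ := Htpy.IsMul
  Fil s i := T.Filtration s i
  Detects k s i := T.PageDetects (k + 1) s i

/-- The re-indexed spectral sequence `Ẽ_r^{s,t}{T}` of a tower, which starts from the `E₂`-page:
`Ẽ_2^{s,t}` is `E_1^{t,2t-s} = π_{t-s} F_t`, and more generally `Ẽ_{k+2}^{s,t}` is
`E_{k+1}^{t,2t-s}`. In terms of `s` and `i = t - s`, the tower index is `t = s + i`. -/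
noncomputable def reindexedSS (T : Tower.{u}) : SpectralSequence.{u} where
  E k s i := T.Page k (s + i) i
  zero k s i := T.pageZero k (s + i) i
  IsMul k s i := T.PageMul k (s + ((i + 1 : ℕ) : ℤ)) i
  IsAct k s i := T.PageAct k (reindexed_act_degree k s i) i
  IsNext k s i := T.PageNext k (s + i) i
  Ab i := Htpy T.lim i
  abZero i := Htpy.zero T.lim i
  AbIsMul _ := Htpy.IsMul
  Fil s i := T.Filtration (s + i) i
  Detects k s i := T.PageDetects k (s + i) i

/-- Functoriality of `Tower.homotopySS`. -/
noncomputable def spectralSequence : Tower.{u} ⥤ SpectralSequence.{u} where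
  obj T := T.homotopySS
  map φ :=
    { page := fun k s i => pageMap φ (k + 1) s i
      ab := fun i => Htpy.map (φ.app (op ⊤)) i
      page_zero := fun k s i => pageMap_zero φ (k + 1) s i
      page_mul := fun _ _ _ _ _ _ h => PageMul.map φ h
      page_act := fun k s _ _ _ _ h => PageAct.map φ (hs := act_degree k s) h
      page_next := fun _ _ _ _ _ h => PageNext.map φ h
      ab_zero := fun i => Htpy.map_zero _ i
      ab_mul := fun _ _ _ _ h => Htpy.IsMul.map _ h
      ab_fil := fun _ _ _ h => Filtration.map φ h
      detects := fun _ _ _ _ _ h => PageDetects.map φ h }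
  map_id T := SpectralSequence.hom_ext (fun k s i x => pageMap_id T (k + 1) s i x)
    (fun i x => id_apply i x)
  map_comp φ ψ := SpectralSequence.hom_ext (fun k s i x => pageMap_comp φ ψ (k + 1) s i x)
    (fun i x => comp_apply _ _ i x)

/-- Functoriality of `Tower.reindexedSS`. -/
noncomputable def reindexedSpectralSequence : Tower.{u} ⥤ SpectralSequence.{u} where
  obj T := T.reindexedSS
  map φ :=
    { page := fun k s i => pageMap φ k (s + i) i
      ab := fun i => Htpy.map (φ.app (op ⊤)) i
      page_zero := fun k s i => pageMap_zero φ k (s + i) i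
      page_mul := fun _ _ _ _ _ _ h => PageMul.map φ h
      page_act := fun k s i _ _ _ h => PageAct.map φ (hs := reindexed_act_degree k s i) h
      page_next := fun _ _ _ _ _ h => PageNext.map φ h
      ab_zero := fun i => Htpy.map_zero _ i
      ab_mul := fun _ _ _ _ h => Htpy.IsMul.map _ h
      ab_fil := fun _ _ _ h => Filtration.map φ h
      detects := fun _ _ _ _ _ h => PageDetects.map φ h }
  map_id T := SpectralSequence.hom_ext (fun k s i x => pageMap_id T k (s + i) i x)
    (fun i x => id_apply i x)
  map_comp φ ψ := SpectralSequence.hom_ext (fun k s i x => pageMap_comp φ ψ k (s + i) i x)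
    (fun i x => comp_apply _ _ i x)

end Tower

/-! ## The two spectral sequences of a cosimplicial pointed space -/

/-- The tower `s ↦ Tot_s (Π Ex^∞ X)`, with limit the homotopy limit `Tot_∞ (Π Ex^∞ X)`. -/
noncomputable def holimTower : CosimplicialPSSet.{u} ⥤ Tower.{u} :=
  (CosimplicialObject.whiskering PSSet.{u} PSSet.{u}).obj exInftyPt ⋙
    cosimplicialReplacement ⋙ tot

/-- The levelwise Postnikov tower `n ↦ X(n)` of a cosimplicial pointed space. -/
noncomputable def levelwisePostnikov : CosimplicialPSSet.{u} ⥤ ((WithTop ℤ)ᵒᵖ ⥤ CosimplicialPSSet.{u}) :=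
  (Functor.whiskeringRight SimplexCategory PSSet.{u} Tower.{u}).obj postnikov ⋙
    flipFunctor SimplexCategory (WithTop ℤ)ᵒᵖ PSSet.{u}

/-- The tower `n ↦ Tot_∞ (Π X(n))`, with limit `Tot_∞ (Π X)`. -/
noncomputable def postnikovTower : CosimplicialPSSet.{u} ⥤ Tower.{u} :=
  levelwisePostnikov ⋙ (Functor.whiskeringRight (WithTop ℤ)ᵒᵖ _ _).obj
    (cosimplicialReplacement ⋙ totInfty)

/-- The homotopy limit spectral sequence, from the `E₂`-page on. -/
noncomputable def holimSpectralSequence : CosimplicialPSSet.{u} ⥤ SpectralSequence.{u} :=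
  holimTower ⋙ Tower.spectralSequence

/-- The Postnikov spectral sequence. -/
noncomputable def postnikovSpectralSequence : CosimplicialPSSet.{u} ⥤ SpectralSequence.{u} :=
  postnikovTower ⋙ Tower.reindexedSpectralSequence

/-- The map `Tot_∞ (Π X) ⟶ Tot_∞ (Π Ex^∞ X)` induced by `X ⟶ Ex^∞ X`. -/
noncomputable def toHolim (X : CosimplicialPSSet.{u}) :
    totInfty.obj (cosimplicialReplacement.obj X) ⟶ (holimTower.obj X).lim :=
  totInfty.map (cosimplicialReplacement.map (Functor.whiskerLeft X toExInftyPt))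

/-- The map from `Tot_∞ (Π X)` to the limit of the tower `n ↦ Tot_∞ (Π X(n))`
induced by `X ⟶ X(⊤)`. -/
noncomputable def toPostnikovLim (X : CosimplicialPSSet.{u}) :
    totInfty.obj (cosimplicialReplacement.obj X) ⟶ (postnikovTower.obj X).lim :=
  totInfty.map (cosimplicialReplacement.map (Functor.whiskerLeft X toPostnikovTop))

end CosimplicialSpace

open CosimplicialSpace

/-!
Both spectral sequences come from edges of one grid of spaces, `W (n, s) = Tot_s Π X(n)`, where `n`
and `s` may be `⊤`: the edge `n = ⊤` is the tower `Tot_s Π X`, and the edge `s = ⊤` is the tower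
`Tot_∞ Π X(n)`. The grid has few homotopy groups in the following sense (`IsGrid`, `isGrid`).
The matching maps of `Π X` are projections from products of values of `X`, so a lifting problem for
`Tot_t Π X → Tot_s Π X`, relative to a map `X → X'`, reduces to lifting problems for the maps
`X^i → X'^i` against the products of the simplices of the domain with `∂Δ[r] ⊆ Δ[r]`, for
`s < r ≤ t` (`exists_chainFamily_lift`, `tot_squareFill`). For a Kan complex `K`, the map
`K(n) → K(n')` is a Kan fibration which lifts against boundaries in dimensions up to `n' + 1`, and
`K(n)` fills boundaries in dimensions from `n + 2` on (`postnikovMap_fibration`,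
`postnikovMap_boundary`, `postnikovStage_boundary`). Hence all squares of the grid are fibrations
onto their pullbacks; on homotopy groups, lowering `n` to `n'` at level `s` changes nothing in degrees
`i ≤ n' - s`, and lowering `s = ⊤` to `s` changes nothing in degrees `i ≥ n - s`.

In particular `W (⊤, s)` and `W (s + i, ⊤)` have the same `π_i` as `W (s + i, s)`. This compares the
terms of the two towers: a class in `π_i` of the fibre of `W (⊤, s) → W (⊤, s - 1)`, and a class in
`π_i` of the fibre of `W (s + i, ⊤) → W (s + i - 1, ⊤)`, are linked if they have representatives
with the same image in `W (s + i, s)` (`IsLinked`). Every class of the first kind which lifts to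
`W (⊤, s + 1)` up to homotopy, that is, which survives to the second page, is linked to one of the
second kind, and conversely (`IsGrid.exists_isLinked_left`, `IsGrid.exists_isLinked_right`). The
conditions and the indeterminacies which define `E_{k+2}^{s,s+i}` on one side and its re-indexed
counterpart on the other agree on linked classes, as do products, actions, the passage to the next
page, and the relation to the abutment `π_i W (⊤, ⊤)` (`IsGrid.correspondence`).

It remains to compare `Tot_s Π X` with `Tot_s Π Ex^∞ X`. The mapping path space of `K → Ex^∞ K`
projects to `K` and to `Ex^∞ K`, and both projections are trivial fibrations if `K` is a Kan complex.
For the second one this says that every simplex of `Ex^∞ K` with boundary in `K` can be deformed into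
`K` (`IsDeformable`), which for `Ex K` is an extension problem on the cylinder of the last vertex map
`sd Δⁿ → Δⁿ` (`isDeformable_toEx`), and passes to the colimit. A levelwise trivial fibration induces
a trivial fibration of the towers of total spaces, hence an isomorphism of spectral sequences
(`isTrivialFibration_tot`, `Tower.IsTrivialFibration.isIso`). All constructions are natural, and the
constant paths show that on abutments the isomorphism is compatible with `X → Ex^∞ X`
(`comparison_ab`).
-/

namespace CosimplicialSpace

open MonoidalCategory HomotopicalAlgebra SSet.modelCategoryQuillen

/-! ### Lifting problems in terms of simplices -/

/-- The simplices `y j`, for `j ∈ S`, agree on the intersections of the faces `j` of `Δ[n + 1]`: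
they define a map to `K` from the union of these faces. The values `y j` for `j ∉ S` are
irrelevant. -/
def FaceCompat {K : SSet.{u}} {n : ℕ} (S : Set (Fin (n + 2))) (y : Fin (n + 2) → K _⦋n⦌) : Prop :=
  ∀ i ∈ S, ∀ j ∈ S, ∀ (m : SimplexCategory) (f g : m ⟶ ⦋n⦌),
    f ≫ SimplexCategory.δ i = g ≫ SimplexCategory.δ j → K.map f.op (y i) = K.map g.op (y j)

/-- The right lifting property of `p` against the inclusion of the union of the faces `j ∈ S` in
`Δ[n + 1]`: a horn if `S = {k}ᶜ`, the boundary if `S = Set.univ`. -/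
def HasFill {K L : SSet.{u}} (p : K ⟶ L) (n : ℕ) (S : Set (Fin (n + 2))) : Prop :=
  ∀ y : Fin (n + 2) → K _⦋n⦌, FaceCompat S y → ∀ x : L _⦋n + 1⦌,
    (∀ j ∈ S, L.δ j x = p.app _ (y j)) →
      ∃ z : K _⦋n + 1⦌, (∀ j ∈ S, K.δ j z = y j) ∧ p.app _ z = x

/-- The subcomplex `A` of `Δ[n + 1]` is the union of the faces `j ∈ S`. -/
def IsUnionOfFaces {n : ℕ} (A : (Δ[n + 1] : SSet.{u}).Subcomplex) (S : Set (Fin (n + 2))) : Prop :=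
  ∀ (m : SimplexCategory) (f : m ⟶ ⦋n + 1⦌),
    SSet.stdSimplex.objEquiv.symm f ∈ A.obj (op m) ↔ ∃ j ∈ S, ∃ g, f = g ≫ SimplexCategory.δ j

theorem IsUnionOfFaces.exists_hom {n : ℕ} {A : (Δ[n + 1] : SSet.{u}).Subcomplex}
    {S : Set (Fin (n + 2))} (hA : IsUnionOfFaces A S) {K : SSet.{u}} {y : Fin (n + 2) → K _⦋n⦌}
    (hy : FaceCompat S y) :
    ∃ φ : (A : SSet.{u}) ⟶ K, ∀ (m : SimplexCategory) (f : m ⟶ ⦋n + 1⦌) (h) (j) (_ : j ∈ S)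
      (g : m ⟶ ⦋n⦌), f = g ≫ SimplexCategory.δ j →
        φ.app (op m) ⟨SSet.stdSimplex.objEquiv.symm f, h⟩ = K.map g.op (y j) := by
  have key : ∀ (m : SimplexCategoryᵒᵖ) (x : A.obj m), ∃ v : K.obj m,
      ∀ j ∈ S, ∀ g : m.unop ⟶ ⦋n⦌, SSet.stdSimplex.objEquiv x.1 = g ≫ SimplexCategory.δ j →
        v = K.map g.op (y j) := by
    rintro m ⟨x, hx⟩
    obtain ⟨f, rfl⟩ := SSet.stdSimplex.objEquiv.symm.surjective x
    obtain ⟨j, hj, g, rfl⟩ := (hA _ _).1 hx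
    exact ⟨K.map g.op (y j), fun j' hj' g' h => hy j hj j' hj' _ g g' h⟩
  choose v hv using key
  refine ⟨{ app := fun m => TypeCat.ofHom (v m), naturality := ?_ }, ?_⟩
  · intro m m' θ
    ext ⟨x, hx⟩
    obtain ⟨f, rfl⟩ := SSet.stdSimplex.objEquiv.symm.surjective x
    obtain ⟨j, hj, g, rfl⟩ := (hA _ _).1 hx
    have h1 := hv m ⟨_, hx⟩ j hj g rfl
    have h2 := hv m' ((A : SSet).map θ ⟨_, hx⟩) j hj (θ.unop ≫ g)
      (show θ.unop ≫ (g ≫ SimplexCategory.δ j) = _ from (Category.assoc _ _ _).symm)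
    change v m' _ = K.map θ (v m _)
    rw [h1]
    refine h2.trans ?_
    simp
  · intro m f h j hj g hfg
    exact hv (op m) ⟨_, h⟩ j hj g hfg

theorem IsUnionOfFaces.hasFill {n : ℕ} {A : (Δ[n + 1] : SSet.{u}).Subcomplex}
    {S : Set (Fin (n + 2))} (hA : IsUnionOfFaces A S) {K L : SSet.{u}} (p : K ⟶ L)
    (hp : HasLiftingProperty A.ι p) : HasFill p n S := by
  intro y hy x hx
  obtain ⟨φ, hφ⟩ := hA.exists_hom hy
  have sq : CommSq φ A.ι p (SSet.yonedaEquiv.symm x) := ⟨by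
    ext m ⟨a, ha⟩
    obtain ⟨f, rfl⟩ := SSet.stdSimplex.objEquiv.symm.surjective a
    obtain ⟨j, hj, g, rfl⟩ := (hA _ _).1 ha
    have h1 := hφ _ _ ha j hj g rfl
    change p.app _ (φ.app _ _) = L.map (g ≫ SimplexCategory.δ j).op x
    refine (congrArg (p.app _) h1).trans ?_
    rw [NatTrans.naturality_apply, ← hx j hj]
    simp [SimplicialObject.δ]⟩
  refine ⟨SSet.yonedaEquiv sq.lift, fun j hj => ?_, ?_⟩
  · have hm := (hA _ _).2 ⟨j, hj, 𝟙 _, (Category.id_comp (SimplexCategory.δ j)).symm⟩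
    have h1 := hφ _ (SimplexCategory.δ j) hm j hj (𝟙 _) (by simp)
    have h2 : sq.lift.app (op ⦋n⦌) (SSet.stdSimplex.objEquiv.symm (SimplexCategory.δ j)) =
      φ.app (op ⦋n⦌) ⟨_, hm⟩ := congrArg (fun t => t.app (op ⦋n⦌) ⟨_, hm⟩) sq.fac_left
    rw [← SSet.stdSimplex.yonedaEquiv_δ_comp]
    exact h2.trans (h1.trans (by simp))
  · rw [← SSet.yonedaEquiv_comp, sq.fac_right, Equiv.apply_symm_apply]

theorem IsUnionOfFaces.hasLiftingProperty {n : ℕ} {A : (Δ[n + 1] : SSet.{u}).Subcomplex}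
    {S : Set (Fin (n + 2))} (hA : IsUnionOfFaces A S) (hS : S.Nonempty) {K L : SSet.{u}} (p : K ⟶ L)
    (hp : HasFill p n S) : HasLiftingProperty A.ι p := by
  refine ⟨fun {φ x} sq => ?_⟩
  have mem : ∀ j ∈ S, SSet.stdSimplex.objEquiv.symm (SimplexCategory.δ j) ∈ A.obj (op ⦋n⦌) :=
    fun j hj => (hA _ _).2 ⟨j, hj, 𝟙 _, by simp⟩
  obtain ⟨y, hy⟩ : ∃ y : Fin (n + 2) → K _⦋n⦌, ∀ j (hj : j ∈ S), y j = φ.app _ ⟨_, mem j hj⟩ := by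
    classical
    obtain ⟨j₀, hj₀⟩ := hS
    refine ⟨fun j => if hj : j ∈ S then φ.app _ ⟨_, mem j hj⟩ else φ.app _ ⟨_, mem j₀ hj₀⟩,
      fun j hj => dif_pos hj⟩
  have key : ∀ j (hj : j ∈ S) (m : SimplexCategory) (f : m ⟶ ⦋n⦌) (hf),
      K.map f.op (y j) =
        φ.app (op m) ⟨SSet.stdSimplex.objEquiv.symm (f ≫ SimplexCategory.δ j), hf⟩ := by
    intro j hj m f hf
    rw [hy j hj]
    exact (NatTrans.naturality_apply φ f.op ⟨_, mem j hj⟩).symm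
  have key' : ∀ j (hj : j ∈ S) (m : SimplexCategory) (f : m ⟶ ⦋n⦌),
    SSet.stdSimplex.objEquiv.symm (f ≫ SimplexCategory.δ j) ∈ A.obj (op m) :=
    fun j hj m f => (hA _ _).2 ⟨j, hj, f, rfl⟩
  obtain ⟨z, hz, hz'⟩ := hp y (fun i hi j hj m f g h => by
      rw [key i hi m f (key' i hi m f), key j hj m g (key' j hj m g)]
      exact congrArg (φ.app (op m)) (Subtype.ext (congrArg SSet.stdSimplex.objEquiv.symm h)))
    (SSet.yonedaEquiv x) (fun j hj => by
      rw [hy j hj]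
      have h2 : p.app (op ⦋n⦌) (φ.app (op ⦋n⦌) ⟨_, mem j hj⟩) =
          x.app (op ⦋n⦌) (SSet.stdSimplex.objEquiv.symm (SimplexCategory.δ j)) :=
        congrArg (fun t => t.app (op ⦋n⦌) ⟨_, mem j hj⟩) sq.w
      rw [← SSet.stdSimplex.yonedaEquiv_δ_comp]
      exact h2.symm)
  refine ⟨⟨⟨SSet.yonedaEquiv.symm z, ?_, ?_⟩⟩⟩
  · ext m ⟨a, ha⟩
    obtain ⟨f, rfl⟩ := SSet.stdSimplex.objEquiv.symm.surjective a
    obtain ⟨j, hj, g, rfl⟩ := (hA _ _).1 ha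
    refine Eq.trans ?_ (key j hj m.unop g ha)
    rw [← hz j hj]
    change K.map (g ≫ SimplexCategory.δ j).op z = _
    simp [SimplicialObject.δ]
  · rw [SSet.yonedaEquiv_symm_comp, hz', Equiv.symm_apply_apply]

theorem factors_δ_iff {n : ℕ} {m : SimplexCategory} (f : m ⟶ ⦋n + 1⦌) (j : Fin (n + 2)) :
    (∃ g, f = g ≫ SimplexCategory.δ j) ↔ ∀ k, f.toOrderHom k ≠ j := by
  constructor
  · rintro ⟨g, rfl⟩ k
    exact Fin.succAbove_ne _ _
  · intro h
    exact ⟨SimplexCategory.factor_δ f j, (SimplexCategory.factor_δ_spec f j h).symm⟩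

theorem isUnionOfFaces_boundary (n : ℕ) : IsUnionOfFaces (SSet.boundary.{u} (n + 1)) Set.univ := by
  intro m f
  rw [SSet.mem_boundary_iff_notMem_range]
  simp only [Set.mem_univ, true_and, factors_δ_iff, Set.mem_range, not_exists]
  rfl

theorem isUnionOfFaces_horn (n : ℕ) (k : Fin (n + 2)) :
    IsUnionOfFaces (SSet.horn.{u} (n + 1) k) {k}ᶜ := by
  intro m f
  rw [SSet.mem_horn_iff_notMem_range]
  simp only [Set.mem_compl_iff, Set.mem_singleton_iff, factors_δ_iff, Set.mem_range, not_exists]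
  simp
  rfl

/-- Compatibility of simplices of positive dimension is the simplicial identity for pairs of
faces. -/
theorem FaceCompat.of_le {K : SSet.{u}} {n : ℕ} {S : Set (Fin (n + 3))}
    {y : Fin (n + 3) → K _⦋n + 1⦌} (h : ∀ i j : Fin (n + 2), i ≤ j → i.castSucc ∈ S → j.succ ∈ S →
      K.δ i (y j.succ) = K.δ j (y i.castSucc)) : FaceCompat S y := by
  have key : ∀ i j : Fin (n + 2), i ≤ j → i.castSucc ∈ S → j.succ ∈ S →
      ∀ (m : SimplexCategory) (f g : m ⟶ ⦋n + 1⦌),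
    f ≫ SimplexCategory.δ i.castSucc = g ≫ SimplexCategory.δ j.succ →
        K.map f.op (y i.castSucc) = K.map g.op (y j.succ) := by
    intro i j hij hi hj m f g hfg
    have hf : ∃ f', f = f' ≫ SimplexCategory.δ j := by
      rw [factors_δ_iff]
      intro k hk
      have := congrArg (fun t => t.toOrderHom k) hfg
      have h2 : (SimplexCategory.δ i.castSucc).toOrderHom (f.toOrderHom k) =
        (SimplexCategory.δ j.succ).toOrderHom (g.toOrderHom k) := this
      rw [hk] at h2
      have h3 : (i.castSucc).succAbove j = (j.succ).succAbove (g.toOrderHom k) := h2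
      rw [Fin.succAbove_of_le_castSucc _ _ (by simpa using hij)] at h3
      exact Fin.succAbove_ne _ _ h3.symm
    obtain ⟨f', rfl⟩ := hf
    have hg : g = f' ≫ SimplexCategory.δ i := by
      rw [← cancel_mono (SimplexCategory.δ j.succ), ← hfg]
      simp [SimplexCategory.δ_comp_δ hij]
    subst hg
    simpa [SimplicialObject.δ] using congrArg (K.map f'.op) (h i j hij hi hj).symm
  intro i hi j hj m f g hfg
  rcases lt_trichotomy i j with hij | rfl | hij
  · have := key ⟨i, by omega⟩ ⟨j - 1, by omega⟩ (by simp [Fin.le_def]; omega)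
    have e1 : (⟨i, by omega⟩ : Fin (n+2)).castSucc = i := rfl
    have e2 : (⟨j - 1, by omega⟩ : Fin (n+2)).succ = j := by ext; simp; omega
    rw [e1, e2] at this
    exact this hi hj m f g hfg
  · rw [cancel_mono] at hfg
    rw [hfg]
  · have := key ⟨j, by omega⟩ ⟨i - 1, by omega⟩ (by simp [Fin.le_def]; omega)
    have e1 : (⟨j, by omega⟩ : Fin (n+2)).castSucc = j := rfl
    have e2 : (⟨i - 1, by omega⟩ : Fin (n+2)).succ = i := by ext; simp; omega
    rw [e1, e2] at this
    exact (this hj hi m g f hfg.symm).symm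

theorem faceCompat_zero {K : SSet.{u}} {S : Set (Fin 2)} {y : Fin 2 → K _⦋0⦌} :
    FaceCompat (n := 0) S y := by
  intro i hi j hj m f g hfg
  have : i = j := by
    have := congrArg (fun t => t.toOrderHom 0) hfg
    have h2 : (i : Fin 2).succAbove (f.toOrderHom 0) = j.succAbove (g.toOrderHom 0) := this
    have h3 : f.toOrderHom 0 = (0 : Fin 1) := Subsingleton.elim (α := Fin 1) _ _
    have h4 : g.toOrderHom 0 = (0 : Fin 1) := Subsingleton.elim (α := Fin 1) _ _
    rw [h3, h4] at h2
    revert h2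
    fin_cases i <;> fin_cases j <;> simp
  subst this
  rw [cancel_mono] at hfg
  rw [hfg]

open SSet.relativeCellComplexOfMono in
/-- A monomorphism lifts against `p` if `p` lifts against `∂Δ[d] ⊆ Δ[d]` for the dimensions `d` of
the nondegenerate simplices that have to be attached. -/
theorem hasLiftingProperty_of_cells {A B K L : SSet.{u}} (i : A ⟶ B) [Mono i] (p : K ⟶ L)
    (h : ∀ d, (∃ x ∈ B.nonDegenerate d, x ∉ Set.range (i.app (op ⦋d⦌))) →
      HasLiftingProperty (SSet.boundary.{u} d).ι p) : HasLiftingProperty i p := by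
  have hW : MorphismProperty.llp (MorphismProperty.ofHoms fun _ : Unit => p) i := by
    refine MorphismProperty.transfiniteCompositionsOfShape_le _ ℕ _
      ⟨(SSet.relativeCellComplexOfMono i).toTransfiniteCompositionOfShape, fun d hd => ?_⟩
    by_cases hc : Nonempty (Cell i d)
    · obtain ⟨c⟩ := hc
      have hp := h d ⟨c.simplex, c.nonDegenerate, c.notMem⟩
      refine (?_ : (_ : MorphismProperty _) ≤ _ ) _
        ((SSet.relativeCellComplexOfMono i).attachCells d hd).pushouts_coproducts
      simp only [MorphismProperty.pushouts_le_iff, MorphismProperty.coproducts_le_iff]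
      rintro _ _ _ ⟨c⟩
      rintro _ _ _ ⟨⟩
      exact hp
    · have := not_nonempty_iff.1 hc
      have : IsIso (l i d) := by
        have h1 : Limits.IsInitial (sigmaBoundary i d) :=
          Limits.isColimitEquivIsInitialOfIsEmpty _ _ (Limits.coproductIsCoproduct _)
        have h2 : Limits.IsInitial (sigmaStdSimplex i d) :=
          Limits.isColimitEquivIsInitialOfIsEmpty _ _ (Limits.coproductIsCoproduct _)
        exact Limits.isIso_of_isInitial h1 h2 _
      have : IsIso (r i d) := (isPushout i d).isIso_inl_of_isIso
      rintro _ _ _ ⟨⟩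
      change HasLiftingProperty (r i d) p
      infer_instance
  exact hW _ ⟨()⟩

instance subsingleton_terminal (q : SimplexCategoryᵒᵖ) : Subsingleton ((⊤_ SSet.{u}).obj q) :=
  ⟨fun _ _ => SSet.yonedaEquiv.symm.injective (Limits.terminal.hom_ext _ _)⟩

/-- The lifting property against a subcomplex `A`, with the given map on `A` described by a
natural family of simplices. -/
theorem exists_extension {K L Z : SSet.{u}} (p : K ⟶ L) (A : Z.Subcomplex)
    [HasLiftingProperty A.ι p] (g : ∀ (q : SimplexCategoryᵒᵖ) (z : Z.obj q), z ∈ A.obj q → K.obj q)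
    (hg : ∀ q q' (θ : q ⟶ q') z hz hz', K.map θ (g q z hz) = g q' (Z.map θ z) hz')
    (b : Z ⟶ L) (hb : ∀ q z hz, p.app q (g q z hz) = b.app q z) :
    ∃ f : Z ⟶ K, (∀ q z hz, f.app q z = g q z hz) ∧ f ≫ p = b := by
  let g' : (A : SSet) ⟶ K :=
    { app := fun q => TypeCat.ofHom fun z => g q z.1 z.2
      naturality := fun q q' θ => by
        ext z
        exact (hg q q' θ z.1 z.2 _).symm }
  have sq : CommSq g' A.ι p b := ⟨by
    ext q z
    exact hb q z.1 z.2⟩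
  refine ⟨sq.lift, fun q z hz => ?_, sq.fac_right⟩
  exact congrArg (fun t => t.app q ⟨z, hz⟩) sq.fac_left

theorem exists_extension_of_terminal {K Z : SSet.{u}} (A : Z.Subcomplex)
    [HasLiftingProperty A.ι (Limits.terminal.from K)]
    (g : ∀ (q : SimplexCategoryᵒᵖ) (z : Z.obj q), z ∈ A.obj q → K.obj q)
    (hg : ∀ q q' (θ : q ⟶ q') z hz hz', K.map θ (g q z hz) = g q' (Z.map θ z) hz') :
    ∃ f : Z ⟶ K, ∀ q z hz, f.app q z = g q z hz := by
  obtain ⟨f, hf, -⟩ := exists_extension (Limits.terminal.from K) A g hg (Limits.terminal.from Z)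
    fun _ _ _ => Subsingleton.elim _ _
  exact ⟨f, hf⟩

theorem mem_hornOne {q : SimplexCategory} (α : q ⟶ ⦋1⦌) (ε : Fin 2) :
    SSet.stdSimplex.objEquiv.symm α ∈ (SSet.horn.{u} 1 ε).obj (op q) ↔ ∀ t, α.toOrderHom t = ε := by
  refine (SSet.mem_horn_iff_notMem_range (d := q.len) (SSet.stdSimplex.objEquiv.symm α) ε).trans ?_
  constructor
  · rintro ⟨j, hj, h⟩ t
    have h2 : α.toOrderHom t ≠ j := fun h' => h ⟨t, h'⟩
    change (α.toOrderHom t : Fin 2) = ε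
    generalize (α.toOrderHom t : Fin 2) = x at *
    fin_cases j <;> fin_cases ε <;> fin_cases x <;> simp_all
  · intro h
    refine ⟨1 - ε, by fin_cases ε <;> simp, ?_⟩
    rintro ⟨t, ht⟩
    have h2 := (h t).symm.trans ht
    revert h2
    fin_cases ε <;> simp

/-- The map from a product with a standard simplex given by a natural family. -/
def prodHom {Z K : SSet.{u}} {n : SimplexCategory}
    (g : ∀ q : SimplexCategory, Z.obj (op q) → (q ⟶ n) → K.obj (op q))
    (hg : ∀ q q' (θ : q' ⟶ q) z α, K.map θ.op (g q z α) = g q' (Z.map θ.op z) (θ ≫ α)) :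
    Z ⊗ SSet.stdSimplex.obj n ⟶ K where
  app q := TypeCat.ofHom fun z => g q.unop z.1 (SSet.stdSimplex.objEquiv z.2)
  naturality q q' θ := by
    ext z
    exact (hg q.unop q'.unop θ.unop z.1 (SSet.stdSimplex.objEquiv z.2)).symm

/-- The homotopy lifting extension property of a fibration: a homotopy given on a subcomplex `A`
and on all of `Z` at the end `ε` extends to `Z` over a given homotopy. -/
theorem exists_homotopy_lift {K L Z : SSet.{u}} (p : K ⟶ L) [Fibration p] (A : Z.Subcomplex)
    (ε : Fin 2)
    (g : ∀ (q : SimplexCategory) (z : Z.obj (op q)) (α : q ⟶ ⦋1⦌),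
      (z ∈ A.obj (op q) ∨ ∀ t, α.toOrderHom t = ε) → K.obj (op q))
    (hg : ∀ q q' (θ : q' ⟶ q) z α h h',
      K.map θ.op (g q z α h) = g q' (Z.map θ.op z) (θ ≫ α) h')
    (b : Z ⊗ Δ[1] ⟶ L)
    (hb : ∀ q z α h, p.app _ (g q z α h) = b.app (op q) (z, SSet.stdSimplex.objEquiv.symm α)) :
    ∃ f : Z ⊗ Δ[1] ⟶ K, (∀ q z α h, f.app (op q) (z, SSet.stdSimplex.objEquiv.symm α) = g q z α h) ∧
      f ≫ p = b := by
  have := SSet.anodyneExtensions_unionProd_ι A (SSet.horn.{u} 1 ε)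
    (SSet.anodyneExtensions.horn_ι ε) p (mem_fibrations p)
  have hm : ∀ (q : SimplexCategoryᵒᵖ) (z : (Z ⊗ Δ[1] : SSet.{u}).obj q),
      z ∈ (A.unionProd (SSet.horn.{u} 1 ε)).obj q →
      (z.1 ∈ A.obj (op q.unop) ∨ ∀ t, (SSet.stdSimplex.objEquiv z.2).toOrderHom t = ε) := by
    intro q z hz
    exact ((SSet.Subcomplex.mem_unionProd_iff _ _ _).1 hz).symm.imp id
      (mem_hornOne (SSet.stdSimplex.objEquiv z.2) ε).1
  obtain ⟨f, hf, hf'⟩ := exists_extension p (A.unionProd (SSet.horn.{u} 1 ε))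
    (fun q z hz => g q.unop z.1 (SSet.stdSimplex.objEquiv z.2) (hm q z hz))
    (fun q q' θ z hz hz' => hg q.unop q'.unop θ.unop _ _ _ _) b
    (fun q z hz => (hb q.unop _ _ _).trans rfl)
  refine ⟨f, fun q z α h => hf (op q) (z, SSet.stdSimplex.objEquiv.symm α) ?_, hf'⟩
  exact (SSet.Subcomplex.mem_unionProd_iff _ _ _).2 (h.symm.imp (mem_hornOne α ε).2 id)

/-- If a map `A ⟶ K` extends to `Z`, so does every map homotopic to it. -/
theorem exists_extension_of_homotopic {K Z : SSet.{u}} [SSet.KanComplex K] (A : Z.Subcomplex)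
    (ε ε' : Fin 2)
    (h : ∀ (q : SimplexCategory) (z : Z.obj (op q)), z ∈ A.obj (op q) → (q ⟶ ⦋1⦌) → K.obj (op q))
    (hh : ∀ q q' (θ : q' ⟶ q) z hz hz' α,
      K.map θ.op (h q z hz α) = h q' (Z.map θ.op z) hz' (θ ≫ α))
    (F : Z ⟶ K)
    (hF : ∀ q z hz α, (∀ t, α.toOrderHom t = ε) → h q z hz α = F.app (op q) z) :
    ∃ F' : Z ⟶ K, ∀ q z hz α, (∀ t, α.toOrderHom t = ε') → F'.app (op q) z = h q z hz α := by
  classical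
  obtain ⟨G, hG, -⟩ := exists_homotopy_lift (Limits.terminal.from K) A ε
    (fun q z α _ => if hz : z ∈ A.obj (op q) then h q z hz α else F.app (op q) z)
    (by
      intro q q' θ z α h1 h2
      by_cases hz : z ∈ A.obj (op q)
      · have hz' : Z.map θ.op z ∈ A.obj (op q') := A.map θ.op hz
        rw [dif_pos hz, dif_pos hz', hh]
      · have hα := h1.resolve_left hz
        rw [dif_neg hz, ← NatTrans.naturality_apply]
        split_ifs with hz'
        · exact (hF _ _ hz' _ fun t => hα _).symm
        · rfl)
    (Limits.terminal.from _) (fun _ _ _ _ => Subsingleton.elim _ _)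
  refine ⟨{ app := fun q => TypeCat.ofHom fun z => G.app q
              (z, SSet.stdSimplex.objEquiv.symm (SimplexCategory.const q.unop ⦋1⦌ ε'))
            naturality := fun q q' θ => by
              ext z
              exact NatTrans.naturality_apply (F := Z ⊗ Δ[1]) G θ
                (show (Z ⊗ Δ[1] : SSet.{u}).obj q from (z, SSet.stdSimplex.objEquiv.symm
                  (SimplexCategory.const q.unop ⦋1⦌ ε'))) }, ?_⟩
  intro q z hz α hα
  obtain rfl : α = SimplexCategory.const q ⦋1⦌ ε' := by
    ext t : 3
    exact hα t
  refine (hG q z _ (Or.inl hz)).trans ?_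
  rw [dif_pos hz]

/-- The chain obtained from `c` by applying `g₁` where `α` is `1` and `g₀` where `α` is `0`. -/
def chainMix {P : Type*} [Preorder P] {q : SimplexCategory} (c : Fin (q.len + 1) →o P)
    (g₀ g₁ : P →o P) (hg : ∀ x, g₀ x ≤ g₁ x) (α : q ⟶ ⦋1⦌) : Fin (q.len + 1) →o P where
  toFun t := if α.toOrderHom t = (1 : Fin 2) then g₁ (c t) else g₀ (c t)
  monotone' s t hst := by
    have h1 : (α.toOrderHom s : Fin 2) ≤ α.toOrderHom t := α.toOrderHom.monotone hst
    have h2 := c.monotone hst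
    dsimp only
    split_ifs with hs ht ht
    · exact g₁.monotone h2
    · rw [hs] at h1
      generalize (α.toOrderHom t : Fin 2) = x at *
      fin_cases x <;> simp_all
    · exact (hg _).trans (g₁.monotone h2)
    · exact g₀.monotone h2

/-- Let `f` be a map to a Kan complex from the simplicial set of those chains in `P` which are
`Good`. If the `Good` chains are stable under replacing elements `x` by `φ x` or by `a`, where
`x ≤ φ x ≥ a`, then every composite `A ⟶ Good ⟶ K` extends to `Z`: the `Good` chains are
contractible by `id ≤ φ ≥ const a`, so the composite is homotopic to a constant map. -/
theorem exists_extension_of_contractible {K Z : SSet.{u}} [SSet.KanComplex K] (A : Z.Subcomplex)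
    {P : Type*} [Preorder P] (Good : ∀ q : SimplexCategory, (Fin (q.len + 1) →o P) → Prop)
    (φ : P →o P) (a : P) (hφ : ∀ x, x ≤ φ x) (ha : ∀ x, a ≤ φ x)
    (good : ∀ q c c', Good q c → (∀ t, c' t = c t ∨ c' t = φ (c t) ∨ c' t = a) → Good q c')
    (good_a : Good ⦋0⦌ (OrderHom.const _ a))
    (f : ∀ q c, Good q c → K.obj (op q))
    (hf : ∀ q q' (θ : q' ⟶ q) c h h', K.map θ.op (f q c h) = f q' (c.comp θ.toOrderHom) h')
    (v : ∀ (q : SimplexCategory) (z : Z.obj (op q)), z ∈ A.obj (op q) → (Fin (q.len + 1) →o P))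
    (hv : ∀ q q' (θ : q' ⟶ q) z hz hz', v q' (Z.map θ.op z) hz' = (v q z hz).comp θ.toOrderHom)
    (gv : ∀ q z hz, Good q (v q z hz)) :
    ∃ F : Z ⟶ K, ∀ q z hz, F.app (op q) z = f q (v q z hz) (gv q z hz) := by
  have congr_f : ∀ q c c' h h', c = c' → f q c h = f q c' h' := by
    rintro q c _ h h' rfl
    rfl
  -- the constant map, then two homotopies on `A`: from `a` to `φ`, and from `φ` back to the
  -- identity
  let F₀ : Z ⟶ K :=
    { app := fun q => TypeCat.ofHom fun _ =>
        K.map (SimplexCategory.const q.unop ⦋0⦌ 0).op (f ⦋0⦌ _ good_a)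
      naturality := fun q q' θ => by
        ext z
        change _ = K.map θ (K.map _ _)
        rw [← Functor.map_comp_apply]
        rfl }
  have g1 : ∀ q c (h : Good q c) α, Good q (chainMix c (OrderHom.const _ a) φ ha α) :=
    fun q c h α => good q c _ h fun t => by
      change ite _ _ _ = _ ∨ ite _ _ _ = _ ∨ ite _ _ _ = _
      split_ifs <;> simp
  have g2 : ∀ q c (h : Good q c) α, Good q (chainMix c OrderHom.id φ hφ α) :=
    fun q c h α => good q c _ h fun t => by
      change ite _ _ _ = _ ∨ ite _ _ _ = _ ∨ ite _ _ _ = _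
      split_ifs <;> simp
  obtain ⟨F₁, hF₁⟩ := exists_extension_of_homotopic A 0 1
    (fun q z hz α => f q _ (g1 q _ (gv q z hz) α)) (fun q q' θ z hz hz' α => by
      rw [hf _ _ _ _ _ (by
        have := g1 q' _ (gv q' _ hz') (θ ≫ α)
        rw [hv _ _ _ _ hz] at this
        exact this)]
      apply congr_f
      rw [hv _ _ _ _ hz]
      rfl) F₀ (fun q z hz α hα => by
      change _ = K.map _ _
      rw [hf _ _ _ _ _ (good q _ _ (gv q z hz) fun t => Or.inr (Or.inr rfl))]
      apply congr_f
      ext t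
      exact if_neg (by rw [hα]; simp))
  obtain ⟨F₂, hF₂⟩ := exists_extension_of_homotopic A 1 0
    (fun q z hz α => f q _ (g2 q _ (gv q z hz) α)) (fun q q' θ z hz hz' α => by
      rw [hf _ _ _ _ _ (by
        have := g2 q' _ (gv q' _ hz') (θ ≫ α)
        rw [hv _ _ _ _ hz] at this
        exact this)]
      apply congr_f
      rw [hv _ _ _ _ hz]
      rfl) F₁ (fun q z hz α hα => by
      rw [hF₁ q z hz α hα]
      apply congr_f
      ext t
      exact (if_pos (hα t)).trans (if_pos (hα t)).symm)
  refine ⟨F₂, fun q z hz => ?_⟩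
  rw [hF₂ q z hz (SimplexCategory.const q ⦋1⦌ 0) (fun _ => rfl)]
  apply congr_f
  ext t
  change ite ((0 : Fin 2) = 1) (φ (v q z hz t)) (v q z hz t) = _
  exact if_neg (by decide)

/-! ### Postnikov stages -/

theorem map_map_op {K : SSet.{u}} {a b c : SimplexCategory} (f : a ⟶ b) (g : b ⟶ c)
    (x : K.obj (op c)) : K.map f.op (K.map g.op x) = K.map (f ≫ g).op x :=
  (Functor.map_comp_apply K g.op f.op x).symm

theorem hasLiftingProperty_boundary_succ {K L : SSet.{u}} {p : K ⟶ L} {n : ℕ} :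
    HasLiftingProperty (SSet.boundary.{u} (n + 1)).ι p ↔ HasFill p n Set.univ :=
  ⟨(isUnionOfFaces_boundary n).hasFill p,
    (isUnionOfFaces_boundary n).hasLiftingProperty ⟨0, trivial⟩ p⟩

theorem hasLiftingProperty_boundary_zero {K L : SSet.{u}} {p : K ⟶ L} :
    HasLiftingProperty (SSet.boundary.{u} 0).ι p ↔ ∀ x : L _⦋0⦌, ∃ y, p.app _ y = x := by
  have hb : ∀ q (z : (Δ[0] : SSet.{u}).obj q), z ∉ (SSet.boundary.{u} 0).obj q := by
    intro q z hz
    rw [SSet.boundary_zero] at hz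
    exact hz
  constructor
  · intro hp x
    obtain ⟨f, -, hf⟩ := exists_extension p (SSet.boundary.{u} 0) (fun q z hz => (hb q z hz).elim)
      (fun q q' θ z hz hz' => (hb q z hz).elim) (SSet.yonedaEquiv.symm x)
      (fun q z hz => (hb q z hz).elim)
    refine ⟨SSet.yonedaEquiv f, ?_⟩
    rw [← SSet.yonedaEquiv_comp, hf, Equiv.apply_symm_apply]
  · intro h
    refine ⟨fun {φ x} sq => ?_⟩
    obtain ⟨y, hy⟩ := h (SSet.yonedaEquiv x)
    refine ⟨⟨⟨SSet.yonedaEquiv.symm y, ?_, ?_⟩⟩⟩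
    · refine NatTrans.ext (funext fun q => ?_)
      ext ⟨z, hz⟩
      exact (hb q z hz).elim
    · rw [SSet.yonedaEquiv_symm_comp, hy, Equiv.symm_apply_apply]

theorem fibration_iff_hasFill {K L : SSet.{u}} {p : K ⟶ L} :
    Fibration p ↔ ∀ n (k : Fin (n + 2)), HasFill p n {k}ᶜ := by
  constructor
  · intro hp n k
    exact (isUnionOfFaces_horn n k).hasFill p inferInstance
  · intro h
    rw [fibration_iff]
    intro A B i hi
    simp only [J, MorphismProperty.iSup_iff] at hi
    obtain ⟨n, ⟨k⟩⟩ := hi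
    exact (isUnionOfFaces_horn n k).hasLiftingProperty ⟨k + 1, by simp⟩ p (h n k)

theorem FaceCompat.δ_eq {K : SSet.{u}} {n : ℕ} {S : Set (Fin (n + 3))}
    {y : Fin (n + 3) → K _⦋n + 1⦌} (h : FaceCompat S y) (i j : Fin (n + 2)) (hij : i ≤ j)
    (hi : i.castSucc ∈ S) (hj : j.succ ∈ S) : K.δ i (y j.succ) = K.δ j (y i.castSucc) :=
  h _ hj _ hi _ _ _ (SimplexCategory.δ_comp_δ hij)

theorem FaceCompat.of_injective {K L : SSet.{u}} (f : K ⟶ L) {n : ℕ}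
    (hf : ∀ m < n, Function.Injective (f.app (op ⦋m⦌))) {S : Set (Fin (n + 2))}
    {y : Fin (n + 2) → K _⦋n⦌} (h : FaceCompat S fun j => f.app _ (y j)) : FaceCompat S y := by
  cases n with
  | zero => exact faceCompat_zero
  | succ n =>
    refine FaceCompat.of_le fun i j hij hi hj => hf n (by omega) ?_
    have := h.δ_eq i j hij hi hj
    exact (NatTrans.naturality_apply f _ _).trans (this.trans
      (NatTrans.naturality_apply f _ _).symm)

section

variable (K : PSSet.{u})

/-- The projection of `K` to its Postnikov stage `K(n)`. -/
def toPostnikovStage (n : WithTop ℤ) : toSSet.obj K ⟶ toSSet.obj (postnikovStage K n) where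
  app _ := TypeCat.ofHom (Quotient.mk _)
  naturality _ _ _ := rfl

variable {K}

theorem postnikovStage_eq_iff {n : WithTop ℤ} {q : SimplexCategoryᵒᵖ} (x y : (toSSet.obj K).obj q) :
    (toPostnikovStage K n).app q x = (toPostnikovStage K n).app q y ↔
    ∀ k : SimplexCategory, ((k.len : ℤ) : WithTop ℤ) ≤ n → ∀ f : k ⟶ q.unop,
      (toSSet.obj K).map f.op x = (toSSet.obj K).map f.op y :=
  Quotient.eq (r := postnikovSetoid K n q)

theorem toPostnikovStage_surjective (n : WithTop ℤ) (q : SimplexCategoryᵒᵖ) :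
    Function.Surjective ((toPostnikovStage K n).app q) := Quotient.mk_surjective

theorem toPostnikovStage_injective {n : WithTop ℤ} {q : SimplexCategory}
    (hq : ((q.len : ℤ) : WithTop ℤ) ≤ n) :
    Function.Injective ((toPostnikovStage K n).app (op q)) := by
  intro x y h
  simpa using (postnikovStage_eq_iff x y).1 h q hq (𝟙 q)

/-- The map of Postnikov stages from `K(n)` to `K(n')`, for `n' ≤ n`. -/
noncomputable def postnikovMap (K : PSSet.{u}) {n n' : WithTop ℤ} (h : n' ≤ n) :
    toSSet.obj (postnikovStage K n) ⟶ toSSet.obj (postnikovStage K n') :=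
  toSSet.map ((postnikov.obj K).map (homOfLE h).op)

theorem toPostnikovStage_hasFill {n : WithTop ℤ} {d : ℕ} (hd : ((d : ℤ) : WithTop ℤ) ≤ n)
    (S : Set (Fin (d + 2))) : HasFill (toPostnikovStage K n) d S := by
  intro y hy x hx
  obtain ⟨z, rfl⟩ := toPostnikovStage_surjective _ _ x
  refine ⟨z, fun j hj => toPostnikovStage_injective (q := ⦋d⦌) hd ?_, rfl⟩
  exact (NatTrans.naturality_apply (toPostnikovStage K n) _ _).trans (hx j hj)

theorem postnikovMap_hasFill {n n' : WithTop ℤ} (h : n' ≤ n) {d : ℕ}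
    (hd : ((d : ℤ) : WithTop ℤ) ≤ n') (S : Set (Fin (d + 2))) : HasFill (postnikovMap K h) d S := by
  intro y hy x hx
  obtain ⟨z, rfl⟩ := toPostnikovStage_surjective _ _ x
  refine ⟨(toPostnikovStage K n).app _ z, fun j hj => ?_, rfl⟩
  obtain ⟨w, hw⟩ := toPostnikovStage_surjective _ _ (y j)
  have hx' := hx j hj
  rw [← hw] at hx' ⊢
  refine (NatTrans.naturality_apply (toPostnikovStage K n) _ _).symm.trans
    (congrArg ((toPostnikovStage K n).app _) ?_)
  refine toPostnikovStage_injective (q := ⦋d⦌) hd ?_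
  exact (NatTrans.naturality_apply (toPostnikovStage K n') _ _).trans hx'

/-- The maps of Postnikov stages with target `K(n')` lift against boundaries up to
dimension `n' + 1`; in dimension `0` they are surjective. -/
theorem postnikovMap_boundary {n n' : WithTop ℤ} (h : n' ≤ n) {d : ℕ}
    (hd : ((d : ℤ) : WithTop ℤ) ≤ n' + 1) :
    HasLiftingProperty (SSet.boundary.{u} d).ι (postnikovMap K h) := by
  cases d with
  | zero =>
    rw [hasLiftingProperty_boundary_zero]
    intro x
    obtain ⟨z, rfl⟩ := toPostnikovStage_surjective _ _ x
    exact ⟨(toPostnikovStage K n).app _ z, rfl⟩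
  | succ d =>
    rw [hasLiftingProperty_boundary_succ]
    refine postnikovMap_hasFill h ?_ _
    cases n' with
    | top => exact le_top
    | coe n' =>
      norm_cast at hd ⊢
      push_cast at hd
      omega

/-- A map from `m` elements and a set `T` do not cover a set with more than `m + T.card` elements.
-/
theorem exists_notMem_range {m k : ℕ} (f : Fin m → Fin k) (T : Finset (Fin k))
    (h : m + T.card < k) : ∃ j, j ∉ T ∧ ∀ t, f t ≠ j := by
  classical
  by_contra! hc
  have : (Finset.univ : Finset (Fin k)) ⊆ T ∪ Finset.univ.image f := by
    intro j _
    by_cases hj : j ∈ T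
    · exact Finset.mem_union_left _ hj
    · obtain ⟨t, ht⟩ := hc j hj
      exact Finset.mem_union_right _ (Finset.mem_image.2 ⟨t, Finset.mem_univ _, ht⟩)
  have h1 := Finset.card_le_card this
  have h2 := Finset.card_union_le T (Finset.univ.image f)
  have h3 : (Finset.univ.image f).card ≤ m := by
    simpa using Finset.card_image_le (s := Finset.univ) (f := f)
  simp at h1
  omega

theorem kanComplex_iff_exists_fill {K : SSet.{u}} :
    SSet.KanComplex K ↔ ∀ n (k : Fin (n + 2)) (y : Fin (n + 2) → K _⦋n⦌), FaceCompat {k}ᶜ y →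
      ∃ z : K _⦋n + 1⦌, ∀ j, j ≠ k → K.δ j z = y j := by
  refine (isFibrant_iff K).trans (fibration_iff_hasFill.trans ?_)
  refine forall_congr' fun n => forall_congr' fun k => forall_congr' fun y =>
    forall_congr' fun hy => ⟨fun h => ?_, fun h x _ => ?_⟩
  · obtain ⟨z, hz, -⟩ := h ((Limits.terminal.from K).app _ (K.map (SimplexCategory.σ 0).op (y 0)))
      fun _ _ => Subsingleton.elim _ _
    exact ⟨z, hz⟩
  · obtain ⟨z, hz⟩ := h
    exact ⟨z, hz, Subsingleton.elim _ _⟩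

theorem exists_fill {K : SSet.{u}} [hK : SSet.KanComplex K] {n : ℕ} (k : Fin (n + 2))
    {y : Fin (n + 2) → K _⦋n⦌} (hy : FaceCompat {k}ᶜ y) :
      ∃ z : K _⦋n + 1⦌, ∀ j, j ≠ k → K.δ j z = y j :=
  kanComplex_iff_exists_fill.1 hK n k y hy

/-- The simplices of `Δ[m]` which together with the vertex `k` have at most `N` vertices. -/
def coneSkeleton (m N : ℕ) (k : Fin (m + 1)) : (Δ[m] : SSet.{u}).Subcomplex where
  obj q := {z | (Finset.univ.image (SSet.stdSimplex.objEquiv z).toOrderHom ∪ {k}).card ≤ N}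
  map {q q'} θ z hz := by
    refine (Finset.card_le_card (Finset.union_subset_union_left ?_)).trans hz
    intro x hx
    obtain ⟨t, -, rfl⟩ := Finset.mem_image.1 hx
    exact Finset.mem_image.2 ⟨θ.unop.toOrderHom t, Finset.mem_univ _, rfl⟩

/-- A horn of dimension at most `n + 1` in `K(n)` lifts to `K`. A larger horn is filled after its
restriction to the simplices of `coneSkeleton` is lifted to `K`: this subcomplex is contractible
to the vertex `k`, and contains the `n`-skeleton of each face, which is all that matters in
`K(n)`. -/
theorem postnikovStage_kan [SSet.KanComplex (toSSet.obj K)] (n : WithTop ℤ) :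
    SSet.KanComplex (toSSet.obj (postnikovStage K n)) := by
  rw [kanComplex_iff_exists_fill]
  intro d k y hy
  choose w hw using fun j => toPostnikovStage_surjective (K := K) n (op ⦋d⦌) (y j)
  obtain rfl : (fun j => (toPostnikovStage K n).app (op ⦋d⦌) (w j)) = y := funext hw
  by_cases hd : ((d : ℤ) : WithTop ℤ) ≤ n
  · have hy' := FaceCompat.of_injective _ (fun m hm => toPostnikovStage_injective
      (q := ⦋m⦌) (le_trans (by exact_mod_cast hm.le) hd)) hy
    obtain ⟨z, hz⟩ := exists_fill k hy'
    refine ⟨(toPostnikovStage K n).app _ z, fun j hj => ?_⟩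
    exact (NatTrans.naturality_apply (toPostnikovStage K n) _ _).symm.trans
      (congrArg ((toPostnikovStage K n).app _) (hz j hj))
  · obtain ⟨n, rfl⟩ : ∃ m : ℤ, n = m := by
      cases n with
      | top => simp at hd
      | coe n => exact ⟨n, rfl⟩
    have hd' : n < d := by exact_mod_cast not_le.1 hd
    by_cases hn : n < 0
    · refine ⟨(toPostnikovStage K n).app _ (K.obj _).point, fun j hj =>
        (NatTrans.naturality_apply (toPostnikovStage K n) _ _).symm.trans ?_⟩
      refine (postnikovStage_eq_iff _ _).2 fun l hl => ?_
      have : (l.len : ℤ) ≤ n := by exact_mod_cast hl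
      omega
    · obtain ⟨n, rfl⟩ := Int.eq_ofNat_of_zero_le (not_lt.1 hn)
      have hdn : n < d := by omega
      obtain ⟨φ, hφ⟩ := (isUnionOfFaces_horn.{u} d k).exists_hom hy
      -- the bound `n + 2` on the number of vertices allows an `n`-simplex and the vertex `k`
      let D := coneSkeleton.{u} (d + 1) (n + 2) k
      have hD : D ≤ SSet.horn.{u} (d + 1) k := by
        intro q z hz
        obtain ⟨f, rfl⟩ := SSet.stdSimplex.objEquiv.symm.surjective z
        refine (isUnionOfFaces_horn.{u} d k _ _).2 ?_
        have hz' : (Finset.univ.image f.toOrderHom ∪ {k}).card ≤ n + 2 := hz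
        obtain ⟨j, hj⟩ : ∃ j, j ∉ (Finset.univ.image f.toOrderHom ∪ {k}) := by
          by_contra! hc
          rw [(Finset.eq_univ_iff_forall (s := Finset.univ.image f.toOrderHom ∪ {k})).2 hc] at hz'
          simp at hz'
          omega
        simp only [Finset.mem_union, Finset.mem_image, Finset.mem_univ, true_and,
          Finset.mem_singleton, not_or, not_exists] at hj
        exact ⟨j, hj.2, (factors_δ_iff f j).2 hj.1⟩
      -- the cells of `D` have dimension at most `n + 1`, where `K` lifts against boundaries
      have hcell : HasLiftingProperty (⊥ : (D : SSet.{u}).Subcomplex).ι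
          (toPostnikovStage K ((n : ℤ) : WithTop ℤ)) := by
        refine hasLiftingProperty_of_cells _ _ fun e ⟨x, hx, _⟩ => ?_
        have hx' : D.ι.app _ x ∈ (Δ[d + 1] : SSet.{u}).nonDegenerate e :=
          (SSet.nonDegenerate_iff_of_mono D.ι x).2 hx
        have hinj := SimplexCategory.mono_iff_injective.1
          ((SSet.stdSimplex.mem_nonDegenerate_iff_mono _).1 hx')
        have hle : e + 1 ≤ n + 2 := by
          refine le_trans ?_ ((Finset.card_le_card Finset.subset_union_left).trans x.2)
          exact (Finset.card_fin (e + 1)).ge.trans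
            (Finset.card_image_of_injective Finset.univ hinj).ge
        cases e with
        | zero =>
          exact hasLiftingProperty_boundary_zero.2 fun x => toPostnikovStage_surjective _ _ x
        | succ e =>
          refine hasLiftingProperty_boundary_succ.2 (toPostnikovStage_hasFill ?_ _)
          have : e ≤ n := by omega
          exact_mod_cast this
      obtain ⟨fD, -, hfD⟩ := exists_extension (toPostnikovStage K ((n : ℤ) : WithTop ℤ))
        (⊥ : (D : SSet.{u}).Subcomplex) (fun q z hz => (Set.notMem_empty _ hz).elim)
        (fun q q' θ z hz hz' => (Set.notMem_empty _ hz).elim)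
        (SSet.Subcomplex.homOfLE hD ≫ φ) (fun q z hz => (Set.notMem_empty _ hz).elim)
      obtain ⟨F, hF⟩ := exists_extension_of_contractible D (P := Fin (d + 2))
        (fun q c => (Finset.univ.image c ∪ {k}).card ≤ n + 2)
        -- the contraction `x ≤ max x k ≥ k` adds no vertex other than `k`
        ⟨fun x => max x k, fun x y h => max_le_max_right _ h⟩ k (fun x => le_max_left _ _)
        (fun x => le_max_right _ _)
        (fun q c c' hc hc' => by
          refine (Finset.card_le_card ?_).trans hc
          refine Finset.union_subset (fun x hx => ?_) Finset.subset_union_right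
          obtain ⟨t, -, rfl⟩ := Finset.mem_image.1 hx
          have h1 : c t ∈ Finset.univ.image c ∪ {k} :=
            Finset.mem_union_left _ (Finset.mem_image_of_mem _ (Finset.mem_univ _))
          have h2 : k ∈ Finset.univ.image c ∪ {k} := by simp
          rcases hc' t with h | h | h
          · rwa [h]
          · rw [h]
            change max (c t) k ∈ _
            rcases max_choice (c t) k with h | h <;> rwa [h]
          · rwa [h])
        (by
          refine (Finset.card_le_card (t := {k}) ?_).trans (by simp)
          intro x hx
          simpa using hx)
        (fun q c h => fD.app (op q)
          ⟨SSet.stdSimplex.objEquiv.symm (SimplexCategory.Hom.mk c), h⟩)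
        (fun q q' θ c h h' => (NatTrans.naturality_apply fD θ.op _).symm)
        (fun q z hz => (SSet.stdSimplex.objEquiv z).toOrderHom)
        (fun q q' θ z hz hz' => rfl) (fun q z hz => hz)
      have hF' : ∀ q z (hz : z ∈ D.obj (op q)), F.app (op q) z = fD.app (op q) ⟨z, hz⟩ :=
        fun q z hz => hF q z hz
      refine ⟨(toPostnikovStage K _).app _ (F.app (op ⦋d + 1⦌)
        (SSet.stdSimplex.objEquiv.symm (𝟙 _))), fun j hj =>
        (NatTrans.naturality_apply (toPostnikovStage K _) _ _).symm.trans ?_⟩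
      refine (postnikovStage_eq_iff _ _).2 fun l hl f => ?_
      have hl' : l.len ≤ n := by exact_mod_cast hl
      have hmem : SSet.stdSimplex.objEquiv.symm (f ≫ SimplexCategory.δ j) ∈ D.obj (op l) := by
        refine (Finset.card_union_le _ _).trans ?_
        have := Finset.card_image_le (s := Finset.univ)
          (f := (f ≫ SimplexCategory.δ j).toOrderHom)
        simp only [Finset.card_univ, Fintype.card_fin] at this
        have h3 : (f ≫ SimplexCategory.δ j).toOrderHom = (SSet.stdSimplex.objEquiv.{u}
          (SSet.stdSimplex.objEquiv.symm (f ≫ SimplexCategory.δ j))).toOrderHom := rfl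
        rw [h3] at this
        simp only [Finset.card_singleton]
        omega
      refine toPostnikovStage_injective hl ?_
      have e1 : (toSSet.obj K).map f.op ((toSSet.obj K).δ j (F.app (op ⦋d + 1⦌)
          (SSet.stdSimplex.objEquiv.symm (𝟙 _)))) = F.app (op l)
            (SSet.stdSimplex.objEquiv.symm (f ≫ SimplexCategory.δ j)) := by
        refine (congrArg _ (NatTrans.naturality_apply F (SimplexCategory.δ j).op _).symm).trans
          ((NatTrans.naturality_apply F f.op _).symm.trans ?_)
        exact congrArg (F.app (op l)) (congrArg SSet.stdSimplex.objEquiv.symm (by simp) :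
          SSet.stdSimplex.objEquiv.symm (f ≫ SimplexCategory.δ j ≫ 𝟙 _) = _)
      refine (congrArg _ (e1.trans (hF' _ _ hmem))).trans ?_
      refine (congrArg (fun t => t.app (op l) ⟨_, hmem⟩) hfD).trans ?_
      refine (hφ l (f ≫ SimplexCategory.δ j) (hD _ hmem) j hj f rfl).trans ?_
      exact (NatTrans.naturality_apply (toPostnikovStage K _) f.op _).symm

theorem postnikovMap_fibration [SSet.KanComplex (toSSet.obj K)] {n n' : WithTop ℤ} (h : n' ≤ n) :
    Fibration (postnikovMap K h) := by
  rw [fibration_iff_hasFill]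
  intro d k
  by_cases hd : ((d : ℤ) : WithTop ℤ) ≤ n'
  · exact postnikovMap_hasFill h hd _
  intro y hy x hx
  have := postnikovStage_kan (K := K) n
  obtain ⟨z, hz⟩ := exists_fill k hy
  refine ⟨z, hz, ?_⟩
  obtain ⟨z, rfl⟩ := toPostnikovStage_surjective _ _ z
  obtain ⟨x, rfl⟩ := toPostnikovStage_surjective _ _ x
  refine (postnikovStage_eq_iff _ _).2 fun l hl f => ?_
  have hl' : l.len < d := by
    have := (lt_of_le_of_lt hl (not_le.1 hd))
    exact_mod_cast this
  obtain ⟨j, hj, hj'⟩ := exists_notMem_range f.toOrderHom {k} (by simp; omega)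
  obtain ⟨g, rfl⟩ := (factors_δ_iff f j).2 hj'
  have hj : j ≠ k := by simpa using hj
  have h1 := (congrArg ((postnikovMap K h).app _) (hz j hj)).trans (hx j hj).symm
  have h2 : (toPostnikovStage K n').app _ ((toSSet.obj K).δ j z) =
      (toPostnikovStage K n').app _ ((toSSet.obj K).δ j x) := h1
  have h3 := (postnikovStage_eq_iff _ _).1 h2 l hl g
  exact (map_map_op _ _ _).symm.trans (h3.trans (map_map_op _ _ _))

/-- The homotopy groups of `K(n)` vanish above dimension `n`. More precisely, the last face of a
boundary in dimension `d ≥ n + 2` is determined by the others, since its `n`-skeleton lies in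
them, and so every filler of a horn in it is a filler of the boundary. -/
theorem postnikovStage_boundary [SSet.KanComplex (toSSet.obj K)] {n : WithTop ℤ} {d : ℕ}
    (hd : n + 2 ≤ ((d : ℤ) : WithTop ℤ)) :
    HasLiftingProperty (SSet.boundary.{u} d).ι
      (Limits.terminal.from (toSSet.obj (postnikovStage K n))) := by
  cases d with
  | zero =>
    exact hasLiftingProperty_boundary_zero.2
      fun x => ⟨((postnikovStage K n).obj _).point, Subsingleton.elim _ _⟩
  | succ d =>
    refine hasLiftingProperty_boundary_succ.2 fun y hy x hx => ?_
    have := postnikovStage_kan (K := K) n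
    obtain ⟨z, hz⟩ := exists_fill 0 (y := y) fun i _ j _ m f g h => hy i trivial j trivial m f g h
    refine ⟨z, fun j _ => ?_, Subsingleton.elim _ _⟩
    by_cases hj : j = 0
    · subst hj
      obtain ⟨w, hw⟩ := toPostnikovStage_surjective _ _ z
      obtain ⟨v, hv⟩ := toPostnikovStage_surjective _ _ (y 0)
      rw [← hv, ← hw]
      refine (NatTrans.naturality_apply (toPostnikovStage K n) _ _).symm.trans ?_
      refine (postnikovStage_eq_iff _ _).2 fun l hl f => toPostnikovStage_injective hl ?_
      have hl' : l.len + 2 ≤ d + 1 := by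
        have : (((l.len : ℤ) + 2 : ℤ) : WithTop ℤ) ≤ ((d + 1 : ℕ) : ℤ) :=
          le_trans (add_le_add hl le_rfl) hd
        exact_mod_cast this
      obtain ⟨j, hj, hj'⟩ := exists_notMem_range (f ≫ SimplexCategory.δ 0).toOrderHom {0}
        (by simp; omega)
      obtain ⟨g, hg⟩ := (factors_δ_iff (f ≫ SimplexCategory.δ 0) j).2 hj'
      have hj : j ≠ 0 := by simpa using hj
      have h1 := hy _ trivial _ trivial _ _ _ hg
      refine (NatTrans.naturality_apply (toPostnikovStage K n) _ _).trans
        (Eq.trans ?_ (NatTrans.naturality_apply (toPostnikovStage K n) _ _).symm)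
      rw [hv, h1, ← hz j hj]
      refine (congrArg _ (NatTrans.naturality_apply (toPostnikovStage K n) _ _)).trans ?_
      rw [hw]
      refine (map_map_op _ _ _).trans (Eq.trans ?_ (map_map_op _ _ _).symm)
      rw [hg]
    · exact hz j hj

end

/-! ### Lifting problems on products of simplices -/

/-- The vertex `j` is not in the image of `f`. -/
def Misses {q : SimplexCategory} {n : ℕ} (f : q ⟶ ⦋n⦌) (j : Fin (n + 1)) : Prop :=
  ∀ t, f.toOrderHom t ≠ j

theorem Misses.precomp {q q' : SimplexCategory} {n : ℕ} {f : q ⟶ ⦋n⦌} {j : Fin (n + 1)}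
    (h : Misses f j) (θ : q' ⟶ q) : Misses (θ ≫ f) j := fun _ => h _

theorem misses_δ {q : SimplexCategory} {n : ℕ} (g : q ⟶ ⦋n⦌) (j : Fin (n + 2)) :
    Misses (g ≫ SimplexCategory.δ j) j := fun _ => Fin.succAbove_ne _ _

theorem Misses.exists_eq {q : SimplexCategory} {n : ℕ} {f : q ⟶ ⦋n + 1⦌} {j : Fin (n + 2)}
    (h : Misses f j) : ∃ g, f = g ≫ SimplexCategory.δ j := (factors_δ_iff f j).2 h

theorem mem_boundary_iff {q : SimplexCategory} {n : ℕ} (f : q ⟶ ⦋n⦌) :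
    SSet.stdSimplex.objEquiv.symm f ∈ (SSet.boundary.{u} n).obj (op q) ↔
      ∃ j ∈ Set.univ, Misses f j := by
  refine (SSet.mem_boundary_iff_notMem_range (d := q.len) _).trans ?_
  simp only [Set.mem_range, not_exists, Set.mem_univ, true_and]
  rfl

theorem mem_horn_iff {q : SimplexCategory} {n : ℕ} (k : Fin (n + 1)) (f : q ⟶ ⦋n⦌) :
    SSet.stdSimplex.objEquiv.symm f ∈ (SSet.horn.{u} n k).obj (op q) ↔
      ∃ j ∈ ({k}ᶜ : Set (Fin (n + 1))), Misses f j := by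
  refine (SSet.mem_horn_iff_notMem_range (d := q.len) _ _).trans ?_
  simp only [Set.mem_range, not_exists, Set.mem_compl_iff, Set.mem_singleton_iff, exists_prop]
  rfl

/-- The right lifting property of `p` against the inclusion in `Δ[m] × Δ[d]` of the subcomplex of
the pairs which satisfy `D`, with maps from `Δ[m] × Δ[d]` encoded as natural families. -/
def Lifts {K L : SSet.{u}} (p : K ⟶ L) (m d : SimplexCategory)
    (D : ∀ q : SimplexCategory, (q ⟶ m) → (q ⟶ d) → Prop) : Prop :=
  ∀ (g : ∀ q : SimplexCategory, (q ⟶ m) → (q ⟶ d) → K.obj (op q))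
    (b : ∀ q : SimplexCategory, (q ⟶ m) → (q ⟶ d) → L.obj (op q)),
    (∀ q q' (θ : q' ⟶ q) z y, D q z y → K.map θ.op (g q z y) = g q' (θ ≫ z) (θ ≫ y)) →
    (∀ q q' (θ : q' ⟶ q) z y, L.map θ.op (b q z y) = b q' (θ ≫ z) (θ ≫ y)) →
    (∀ q z y, D q z y → p.app (op q) (g q z y) = b q z y) →
    ∃ G : ∀ q : SimplexCategory, (q ⟶ m) → (q ⟶ d) → K.obj (op q),
      (∀ q q' (θ : q' ⟶ q) z y, K.map θ.op (G q z y) = G q' (θ ≫ z) (θ ≫ y)) ∧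
      (∀ q z y, D q z y → G q z y = g q z y) ∧ ∀ q z y, p.app (op q) (G q z y) = b q z y

theorem lifts_of_hasLiftingProperty {K L : SSet.{u}} (p : K ⟶ L) {m d : SimplexCategory}
    (S : (SSet.stdSimplex.{u}.obj m).Subcomplex) (T : (SSet.stdSimplex.{u}.obj d).Subcomplex)
    (h : HasLiftingProperty (S.unionProd T).ι p) :
    Lifts p m d fun q z y => SSet.stdSimplex.objEquiv.symm z ∈ S.obj (op q) ∨
      SSet.stdSimplex.objEquiv.symm y ∈ T.obj (op q) := by
  intro g b hg hb hgb
  have key : ∀ q (x : (SSet.stdSimplex.{u}.obj m ⊗ SSet.stdSimplex.{u}.obj d).obj q),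
      x ∈ (S.unionProd T).obj q → x.1 ∈ S.obj q ∨ x.2 ∈ T.obj q := fun q x hx =>
    ((SSet.Subcomplex.mem_unionProd_iff _ _ _).1 hx).symm
  obtain ⟨f, hf, hf'⟩ := exists_extension p (S.unionProd T)
    (fun q x _ => g q.unop (SSet.stdSimplex.objEquiv x.1) (SSet.stdSimplex.objEquiv x.2))
    (fun q q' θ x hx _ => hg _ _ θ.unop _ _ (key q x hx))
    { app := fun q => TypeCat.ofHom fun x =>
        b q.unop (SSet.stdSimplex.objEquiv x.1) (SSet.stdSimplex.objEquiv x.2)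
      naturality := fun q q' θ => by
        ext x
        exact (hb _ _ θ.unop _ _).symm }
    (fun q x hx => hgb _ _ _ (key q x hx))
  refine ⟨fun q z y => f.app (op q)
    (SSet.stdSimplex.objEquiv.symm z, SSet.stdSimplex.objEquiv.symm y), fun q q' θ z y => ?_,
    fun q z y h => ?_, fun q z y => ?_⟩
  · exact (NatTrans.naturality_apply f θ.op
      (show (SSet.stdSimplex.{u}.obj m ⊗ SSet.stdSimplex.{u}.obj d).obj (op q) from
        (SSet.stdSimplex.objEquiv.symm z, SSet.stdSimplex.objEquiv.symm y))).symm
  · exact hf (op q) (SSet.stdSimplex.objEquiv.symm z, SSet.stdSimplex.objEquiv.symm y)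
      ((SSet.Subcomplex.mem_unionProd_iff _ _ _).2 h.symm)
  · exact congrArg (fun t => t.app (op q)
      (SSet.stdSimplex.objEquiv.symm z, SSet.stdSimplex.objEquiv.symm y)) hf'

theorem Lifts.congr {K L : SSet.{u}} {p : K ⟶ L} {m d : SimplexCategory}
    {D D' : ∀ q : SimplexCategory, (q ⟶ m) → (q ⟶ d) → Prop} (h : Lifts p m d D)
    (hD : ∀ q z y, D q z y ↔ D' q z y) : Lifts p m d D' := by
  obtain rfl : D = D' := by
    funext q z y
    exact propext (hD q z y)
  exact h

/-- The pairs of simplices of `Δ[m]` and `Δ[d]` one of whose components lies in the union of the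
faces in `S`, respectively in `T`. -/
def FacePair {m d : ℕ} (S : Set (Fin (m + 1))) (T : Set (Fin (d + 1))) (q : SimplexCategory)
    (z : q ⟶ ⦋m⦌) (y : q ⟶ ⦋d⦌) : Prop :=
  (∃ j ∈ S, Misses z j) ∨ ∃ j ∈ T, Misses y j

theorem lifts_boundary_horn {K L : SSet.{u}} (p : K ⟶ L) [Fibration p] (m d : ℕ) (k : Fin (d + 2)) :
    Lifts p ⦋m⦌ ⦋d + 1⦌ (FacePair Set.univ {k}ᶜ) :=
  (lifts_of_hasLiftingProperty p _ _ (SSet.anodyneExtensions_unionProd_ι (SSet.boundary.{u} m)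
    (SSet.horn.{u} (d + 1) k) (SSet.anodyneExtensions.horn_ι k) p (mem_fibrations p))).congr
    fun _ _ _ => or_congr (mem_boundary_iff _) (mem_horn_iff _ _)

theorem lifts_horn_boundary {K L : SSet.{u}} (p : K ⟶ L) [Fibration p] (m d : ℕ) (k : Fin (m + 2)) :
    Lifts p ⦋m + 1⦌ ⦋d⦌ (FacePair {k}ᶜ Set.univ) :=
  (lifts_of_hasLiftingProperty p _ _ (SSet.anodyneExtensions_unionProd_ι'
    (SSet.horn.{u} (m + 1) k) (SSet.boundary.{u} d) (SSet.anodyneExtensions.horn_ι k) p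
      (mem_fibrations p))).congr
    fun _ _ _ => or_congr (mem_horn_iff _ _) (mem_boundary_iff _)

theorem lifts_boundary_boundary {K L : SSet.{u}} (p : K ⟶ L) (m d : ℕ)
    (hp : ∀ q ≤ m + d, HasLiftingProperty (SSet.boundary.{u} q).ι p) :
    Lifts p ⦋m⦌ ⦋d⦌ (FacePair Set.univ Set.univ) := by
  refine (lifts_of_hasLiftingProperty p (SSet.boundary.{u} m) (SSet.boundary.{u} d)
    (hasLiftingProperty_of_cells _ _ fun q ⟨x, hx, _⟩ => hp q ?_)).congr
    fun _ _ _ => or_congr (mem_boundary_iff _) (mem_boundary_iff _)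
  have := SSet.hasDimensionLE_prod (X₁ := Δ[m]) (X₂ := Δ[d]) m d (m + d)
  exact SSet.dim_le_of_nonDegenerate (X := Δ[m] ⊗ Δ[d]) ⟨x, hx⟩ (m + d)

theorem not_misses_zero {q : SimplexCategory} (z : q ⟶ ⦋0⦌) (j : Fin 1) : ¬ Misses z j :=
  fun h => h 0 (Subsingleton.elim (α := Fin 1) _ _)

theorem misses_comp_σ_zero {q : SimplexCategory} {d : ℕ} {y : q ⟶ ⦋d + 1⦌} {j : Fin (d + 1)}
    (hj : j ≠ 0) (h : Misses y j.succ) : Misses (y ≫ SimplexCategory.σ 0) j := by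
  intro t ht
  apply h t
  have h' : Fin.predAbove 0 (y.toOrderHom t : Fin (d + 2)) = j := ht
  generalize (y.toOrderHom t : Fin (d + 2)) = x at *
  subst h'
  induction x using Fin.cases with
  | zero => exact (hj (by simp)).elim
  | succ x => simp

theorem misses_comp_σ_zero' {q : SimplexCategory} {d : ℕ} {y : q ⟶ ⦋d + 1⦌}
    (h : Misses y 0) (h' : Misses y 1) : Misses (y ≫ SimplexCategory.σ 0) 0 := by
  intro t ht
  have ht : Fin.predAbove 0 (y.toOrderHom t : Fin (d + 2)) = 0 := ht
  have h1 : (y.toOrderHom t : Fin (d + 2)) ≠ 0 := h t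
  have h2 : (y.toOrderHom t : Fin (d + 2)) ≠ 1 := h' t
  generalize (y.toOrderHom t : Fin (d + 2)) = x at *
  induction x using Fin.cases with
  | zero => exact h1 rfl
  | succ x =>
    apply h2
    simp at ht
    rw [ht]
    rfl

theorem misses_comp_δ_iff {q : SimplexCategory} {n : ℕ} (y : q ⟶ ⦋n⦌) (k : Fin (n + 2))
    (j : Fin (n + 1)) : Misses (y ≫ SimplexCategory.δ k) (k.succAbove j) ↔ Misses y j :=
  forall_congr' fun _ => not_congr (Fin.succAbove_right_inj (p := k))

/-- If `K` fills boundaries of dimension `N`, then it extends maps from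
`∂Δ[m] × Δ[d] ∪ Δ[m] × ∂Δ[d]` for `m + d = N`. The induction shifts dimension from `m` to `d`: the
face `0` of the first factor is the obstruction, and it is traded for a face of `Δ[d + 1]`. -/
theorem lifts_terminal_boundary {K : SSet.{u}} [SSet.KanComplex K] {N : ℕ}
    (hK : HasLiftingProperty (SSet.boundary.{u} N).ι (Limits.terminal.from K)) (m d : ℕ)
    (h : m + d = N) : Lifts (Limits.terminal.from K) ⦋m⦌ ⦋d⦌ (FacePair Set.univ Set.univ) := by
  classical
  induction m generalizing d with
  | zero =>
    obtain rfl : d = N := by omega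
    intro g b hg hb hgb
    have key : ∀ q (y : (Δ[d] : SSet.{u}).obj q), y ∈ (SSet.boundary.{u} d).obj q →
      FacePair (m := 0) Set.univ Set.univ q.unop (SimplexCategory.const _ _ 0)
        (SSet.stdSimplex.objEquiv y) := fun q y hy => Or.inr ((mem_boundary_iff _).1 hy)
    obtain ⟨f, hf⟩ := exists_extension_of_terminal (SSet.boundary.{u} d)
      (fun q y _ => g q.unop (SimplexCategory.const _ _ 0) (SSet.stdSimplex.objEquiv y))
      (fun q q' θ y hy _ => hg _ _ θ.unop _ _ (key q y hy))
    refine ⟨fun q _ y => f.app (op q) (SSet.stdSimplex.objEquiv.symm y), fun q q' θ z y => ?_,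
      fun q z y h => ?_, fun q z y => Subsingleton.elim _ _⟩
    · exact (NatTrans.naturality_apply f θ.op (SSet.stdSimplex.objEquiv.symm y)).symm
    · obtain rfl : z = SimplexCategory.const _ _ 0 := by
        ext t : 3
        exact Subsingleton.elim (α := Fin 1) _ _
      exact hf (op q) _ ((mem_boundary_iff _).2 (h.resolve_left fun ⟨j, _, hj⟩ =>
        not_misses_zero _ j hj))
  | succ m ih =>
    intro φ b hφ hb _
    let k : Fin (m + 2) := 0
    -- `Y` extends `φ`, except on the face `k` of the first factor
    obtain ⟨Y, hY, hYφ, -⟩ := lifts_horn_boundary (Limits.terminal.from K) m d k φ b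
      (fun q q' θ z y h => hφ q q' θ z y (h.imp (fun ⟨j, _, hj⟩ => ⟨j, trivial, hj⟩) id))
      hb (fun _ _ _ _ => Subsingleton.elim _ _)
    -- on `∂Δ[m + 1] × ∂Δ[d + 1]`, `w` is `φ` on the face `1` of the second factor and `Y` on the
    -- others
    let w : ∀ q : SimplexCategory, (q ⟶ ⦋m + 1⦌) → (q ⟶ ⦋d + 1⦌) → K.obj (op q) := fun q z y =>
      if Misses y 0 then Y q z (y ≫ SimplexCategory.σ 0) else φ q z (y ≫ SimplexCategory.σ 0)
    have hYφ' : ∀ q z y, (∃ j, j ≠ k ∧ Misses z j) → Y q z y = φ q z y := fun q z y h =>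
      hYφ q z y (Or.inl h)
    have hYφ'' : ∀ q z y j, Misses y j → Y q z y = φ q z y := fun q z y j h =>
      hYφ q z y (Or.inr ⟨j, trivial, h⟩)
    have hw₁ : ∀ q z y, (∃ j, j ≠ k ∧ Misses z j) → w q z y = φ q z (y ≫ SimplexCategory.σ 0) := by
      intro q z y h
      by_cases h0 : Misses y 0
      · exact (if_pos h0).trans (hYφ' _ _ _ h)
      · exact if_neg h0
    have hw₂ : ∀ q z y (j : Fin (d + 1)), j ≠ 0 → Misses y j.succ →
        w q z y = Y q z (y ≫ SimplexCategory.σ 0) := by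
      intro q z y j hj h
      by_cases h0 : Misses y 0
      · exact if_pos h0
      · exact (if_neg h0).trans (hYφ'' _ _ _ j (misses_comp_σ_zero hj h)).symm
    have hw₃ : ∀ q z y, Misses y 1 → w q z y = φ q z (y ≫ SimplexCategory.σ 0) := by
      intro q z y h
      by_cases h0 : Misses y 0
      · exact (if_pos h0).trans (hYφ'' _ _ _ _ (misses_comp_σ_zero' h0 h))
      · exact if_neg h0
    have hw : ∀ q q' (θ : q' ⟶ q) z y, (∃ j, Misses z j) →
        FacePair {k}ᶜ Set.univ q z y → K.map θ.op (w q z y) = w q' (θ ≫ z) (θ ≫ y) := by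
      rintro q q' θ z y hz (⟨j, hj, h⟩ | ⟨j, -, h⟩)
      · rw [hw₁ _ _ _ ⟨j, hj, h⟩, hw₁ _ _ _ ⟨j, hj, h.precomp θ⟩,
          hφ _ _ _ _ _ (Or.inl ⟨j, trivial, h⟩), Category.assoc]
      · induction j using Fin.cases with
        | zero =>
          change K.map θ.op (ite _ _ _) = ite _ _ _
          rw [if_pos h, if_pos (h.precomp θ), hY, Category.assoc]
        | succ j =>
          by_cases hj : j = 0
          · subst hj
            rw [hw₃ _ _ _ h, hw₃ _ _ _ (h.precomp θ),
              hφ _ _ _ _ _ (Or.inl (hz.imp fun j hj => ⟨trivial, hj⟩)), Category.assoc]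
          · rw [hw₂ _ _ _ j hj h, hw₂ _ _ _ j hj (h.precomp θ), hY, Category.assoc]
    -- the induction hypothesis extends `w` to `Δ[m] × Δ[d + 1]`, where `Δ[m]` is the face `k`
    obtain ⟨G, hG, hGw, -⟩ := ih (d + 1) (by omega)
      (fun q x y => w q (x ≫ SimplexCategory.δ k) y)
      (fun _ _ _ => (Limits.terminal.from K).app _
        (φ _ (SimplexCategory.const _ _ 0) (SimplexCategory.const _ _ 0)))
      (fun q q' θ x y h => by
        rw [hw _ _ _ _ _ ⟨k, misses_δ x k⟩, Category.assoc]
        refine h.imp (fun ⟨j, _, hj⟩ => ⟨k.succAbove j, Fin.succAbove_ne _ _,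
          (misses_comp_δ_iff x k j).2 hj⟩) id)
      (fun _ _ _ _ _ => Subsingleton.elim _ _) (fun _ _ _ _ => Subsingleton.elim _ _)
    have hG' : ∀ q x y, FacePair {k}ᶜ Set.univ q (x ≫ SimplexCategory.δ k) y →
        G q x y = w q (x ≫ SimplexCategory.δ k) y := by
      intro q x y h
      refine hGw _ _ _ (h.imp (fun ⟨j, hj, h⟩ => ?_) id)
      obtain ⟨j, rfl⟩ := Fin.exists_succAbove_eq hj
      exact ⟨j, trivial, (misses_comp_δ_iff x k j).1 h⟩
    -- `w` and `G` on `∂Δ[m + 1] × Δ[d + 1]` and `Y` on the faces other than `1` of the second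
    -- factor fit together; an extension of them restricts to the required one on the face `1`
    let v : ∀ q : SimplexCategory, (q ⟶ ⦋m + 1⦌) → (q ⟶ ⦋d + 1⦌) → K.obj (op q) := fun q z y =>
      if FacePair {k}ᶜ Set.univ q z y ∧ ∃ j, Misses z j then w q z y else
      if h : Misses z k then G q h.exists_eq.choose y else Y q z (y ≫ SimplexCategory.σ 0)
    have hv₁ : ∀ q z y, FacePair {k}ᶜ Set.univ q z y → (∃ j, Misses z j) → v q z y = w q z y :=
      fun q z y h h' => if_pos ⟨h, h'⟩
    have hv₂ : ∀ q x y, v q (x ≫ SimplexCategory.δ k) y = G q x y := by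
      intro q x y
      by_cases h : FacePair {k}ᶜ Set.univ q (x ≫ SimplexCategory.δ k) y
      · rw [hv₁ _ _ _ h ⟨k, misses_δ x k⟩, hG' _ _ _ h]
      · have hm := misses_δ x k
        refine (if_neg (fun h' => h h'.1)).trans ((dif_pos hm).trans ?_)
        have := hm.exists_eq.choose_spec
        rw [cancel_mono] at this
        rw [← this]
    have hv₃ : ∀ q z y j, j ≠ 1 → Misses y j → v q z y = Y q z (y ≫ SimplexCategory.σ 0) := by
      intro q z y j hj h
      by_cases hz : ∃ j, Misses z j
      · rw [hv₁ _ _ _ (Or.inr ⟨j, trivial, h⟩) hz]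
        induction j using Fin.cases with
        | zero => exact if_pos h
        | succ j => exact hw₂ _ _ _ j (fun h => hj (by subst h; rfl)) h
      · exact (if_neg (fun h => hz h.2)).trans (dif_neg (fun h => hz ⟨k, h⟩))
    obtain ⟨V, hV, hVv, -⟩ := lifts_boundary_horn (Limits.terminal.from K) (m + 1) d 1 v
      (fun _ _ _ => (Limits.terminal.from K).app _
        (φ _ (SimplexCategory.const _ _ 0) (SimplexCategory.const _ _ 0))) (by
        rintro q q' θ z y (⟨j, -, h⟩ | ⟨j, hj, h⟩)
        · by_cases hj : j = k
          · subst hj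
            obtain ⟨x, rfl⟩ := h.exists_eq
            rw [← Category.assoc, hv₂, hv₂, hG]
          · rw [hv₁ _ _ _ (Or.inl ⟨j, hj, h⟩) ⟨j, h⟩,
              hv₁ _ _ _ (Or.inl ⟨j, hj, h.precomp θ⟩) ⟨j, h.precomp θ⟩]
            exact hw _ _ _ _ _ ⟨j, h⟩ (Or.inl ⟨j, hj, h⟩)
        · rw [hv₃ _ _ _ j hj h, hv₃ _ _ _ j hj (h.precomp θ), hY, Category.assoc])
      (fun _ _ _ _ _ => Subsingleton.elim _ _) (fun _ _ _ _ => Subsingleton.elim _ _)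
    refine ⟨fun q z y => V q z (y ≫ SimplexCategory.δ 1), fun q q' θ z y => ?_, fun q z y h => ?_,
      fun _ _ _ => Subsingleton.elim _ _⟩
    · exact (hV _ _ _ _ _).trans (by simp)
    · have e : (y ≫ SimplexCategory.δ 1) ≫ SimplexCategory.σ 0 = y := by
        have := SimplexCategory.δ_comp_σ_succ (i := (0 : Fin (d + 1)))
        rw [Category.assoc]
        exact (congrArg (y ≫ ·) this).trans (Category.comp_id y)
      change V q z (y ≫ SimplexCategory.δ 1) = _
      rcases h with ⟨j, -, h⟩ | ⟨j, -, h⟩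
      · rw [hVv _ _ _ (Or.inl ⟨j, trivial, h⟩),
          hv₁ _ _ _ (Or.inr ⟨1, trivial, misses_δ y 1⟩) ⟨j, h⟩, hw₃ _ _ _ (misses_δ y 1), e]
      · have hm : Misses (y ≫ SimplexCategory.δ 1) ((1 : Fin (d + 2)).succAbove j) :=
          (misses_comp_δ_iff y 1 j).2 h
        have hne := Fin.succAbove_ne (1 : Fin (d + 2)) j
        rw [hVv _ _ _ (Or.inr ⟨_, hne, hm⟩), hv₃ _ _ _ _ hne hm, e]
        exact hYφ'' _ _ _ _ h

/-! ### Lifting simplices of the total space of a cosimplicial replacement -/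

/-- The map `σ` factors through `[k]` for some `k < r`: as a simplex of `Δ[m]`, it lies in the
skeleton of dimension `r - 1`. -/
def InSk (r : ℕ) {q m : SimplexCategory} (σ : q ⟶ m) : Prop :=
  ∃ k : SimplexCategory, k.len < r ∧ ∃ (a : q ⟶ k) (b : k ⟶ m), a ≫ b = σ

namespace InSk

variable {r : ℕ} {q q' m m' : SimplexCategory}

theorem precomp {σ : q ⟶ m} (h : InSk r σ) (θ : q' ⟶ q) : InSk r (θ ≫ σ) := by
  obtain ⟨k, hk, a, b, rfl⟩ := h
  exact ⟨k, hk, θ ≫ a, b, by simp⟩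

theorem postcomp {σ : q ⟶ m} (h : InSk r σ) (κ : m ⟶ m') : InSk r (σ ≫ κ) := by
  obtain ⟨k, hk, a, b, rfl⟩ := h
  exact ⟨k, hk, a, b ≫ κ, by simp⟩

theorem of_misses {a : q ⟶ ⦋r⦌} {j : Fin (r + 1)} (h : Misses a j) : InSk r a := by
  cases r with
  | zero => exact (not_misses_zero a j h).elim
  | succ r =>
    obtain ⟨g, rfl⟩ := h.exists_eq
    exact ⟨⦋r⦌, Nat.lt_succ_self r, g, SimplexCategory.δ j, rfl⟩

theorem surjective {a : q ⟶ ⦋r⦌} (h : ¬ InSk r a) : Function.Surjective a.toOrderHom := by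
  intro j
  by_contra! hc
  exact h (of_misses hc)

theorem of_le {s : WithTop ℤ} {σ : q ⟶ m} (h : InSkeleton s σ) (hs : s < (r : ℤ)) : InSk r σ := by
  obtain ⟨k, hk, a, b, rfl⟩ := h
  exact ⟨k, by exact_mod_cast lt_of_le_of_lt hk hs, a, b, rfl⟩

end InSk

/-- The idempotent endomorphism of `[r]` which sends `i + 1` to `i`. -/
def collapse {r : ℕ} (i : Fin r) : ⦋r⦌ ⟶ ⦋r⦌ :=
  SimplexCategory.mkHom ⟨fun j => if j = i.succ then i.castSucc else j, fun j k hjk => by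
    change (ite _ _ _ : Fin (r + 1)) ≤ ite _ _ _
    have hjk' : (j : ℕ) ≤ k := hjk
    split_ifs with h1 h2 h2
    · exact le_rfl
    · subst h1
      rw [Fin.le_def]
      simp at hjk' ⊢
      omega
    · subst h2
      have : (j : ℕ) ≠ i + 1 := fun h => h1 (Fin.ext (by simpa using h))
      rw [Fin.le_def]
      simp at hjk' ⊢
      omega
    · exact hjk⟩

theorem collapse_apply {r : ℕ} (i : Fin r) (j : Fin (r + 1)) :
    (collapse i).toOrderHom j = if j = i.succ then i.castSucc else j := rfl

theorem inSk_collapse {r : ℕ} (i : Fin r) {q : SimplexCategory} (a : q ⟶ ⦋r⦌) :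
    InSk r (a ≫ collapse i) := by
  refine InSk.of_misses (j := i.succ) fun t => ?_
  change ite ((a.toOrderHom t : Fin (r + 1)) = i.succ) _ _ ≠ _
  split_ifs with h
  · simp [Fin.ext_iff]
  · exact h

theorem collapse_comp {r : ℕ} {m : SimplexCategory} {i : Fin r} {b : ⦋r⦌ ⟶ m}
    (h : b.toOrderHom i.castSucc = b.toOrderHom i.succ) : collapse i ≫ b = b := by
  ext j : 3
  change b.toOrderHom (ite ((j : Fin (r + 1)) = i.succ) _ _) = _
  split_ifs with hj
  · rw [h, ← hj]
  · rfl

theorem collapse_collapse {r : ℕ} (i : Fin r) : collapse i ≫ collapse i = collapse i :=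
  collapse_comp (by rw [collapse_apply, collapse_apply]; simp)

/-- The relation which makes the values prescribed on a chain that is degenerate in two ways
agree. -/
theorem collapse_braid {r : ℕ} {i j : Fin r} (hij : i < j) :
    collapse i ≫ collapse j ≫ collapse i = collapse j ≫ collapse i := by
  refine collapse_comp ?_
  change (collapse i).toOrderHom ((collapse j).toOrderHom _) =
    (collapse i).toOrderHom ((collapse j).toOrderHom _)
  simp only [collapse_apply]
  have h1 : i.castSucc ≠ j.succ := by simp [Fin.ext_iff]; omega
  have h2 : i.succ ≠ j.succ := by simp [Fin.ext_iff]; omega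
  rw [if_neg h1, if_neg h2]
  simp

theorem exists_collapse_comp {r : ℕ} {m : SimplexCategory} {b : ⦋r⦌ ⟶ m}
    (h : ¬ Function.Injective b.toOrderHom) : ∃ i, collapse i ≫ b = b := by
  by_contra! hc
  apply h
  have : StrictMono (fun j : Fin (r + 1) => b.toOrderHom j) := by
    rw [Fin.strictMono_iff_lt_succ]
    intro i
    exact lt_of_le_of_ne (b.toOrderHom.monotone i.castSucc_le_succ)
      fun hi => hc i (collapse_comp hi)
  exact this.injective

/-- The `m`-simplices of the nerve of the simplex category. -/
abbrev Chain (m : SimplexCategory) := Fin (m.len + 1) ⥤ SimplexCategory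

theorem chainPullback_comp {l m n : SimplexCategory} (f : l ⟶ m) (g : m ⟶ n) (c : Chain n) :
    chainPullback (f ≫ g) c = chainPullback f (chainPullback g c) := rfl

/-- The data underlying a `d`-simplex of the total space of the cosimplicial replacement of `X`:
for each chain `c` in the simplex category and each simplex `(σ, τ)` of `Δ[m] × Δ[d]`, a simplex
of the value of `X` at the end of `c`. -/
abbrev ChainFamily (X : CosimplicialPSSet.{u}) (d : SimplexCategory) :=
  ∀ (m q : SimplexCategory) (_ : q ⟶ m) (_ : q ⟶ d) (c : Chain m),
    ((X.obj (c.obj (Fin.last m.len))).obj (op q)).X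

/-- A family satisfies the two naturality conditions for the simplices in `D`. -/
structure ChainFamily.NatOn {X : CosimplicialPSSet.{u}} {d : SimplexCategory}
    (f : ChainFamily X d) (D : ∀ m q : SimplexCategory, (q ⟶ m) → (q ⟶ d) → Prop) : Prop where
  simplicial : ∀ (m q q' : SimplexCategory) (θ : q' ⟶ q) (σ : q ⟶ m) (τ : q ⟶ d) (c : Chain m),
    D m q σ τ → ((X.obj (c.obj (Fin.last m.len))).map θ.op).toFun (f m q σ τ c) =
      f m q' (θ ≫ σ) (θ ≫ τ) c
  cosimplicial : ∀ (m m' q : SimplexCategory) (κ : m ⟶ m') (σ : q ⟶ m) (τ : q ⟶ d)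
    (c : Chain m'), D m q σ τ →
      ((X.map (chainLast κ c)).app (op q)).toFun (f m q σ τ (chainPullback κ c)) =
        f m' q (σ ≫ κ) τ c

theorem chainLast_comp_apply (X : CosimplicialPSSet.{u}) {l m n : SimplexCategory} (f : l ⟶ m)
    (g : m ⟶ n) (c : Chain n) (q : SimplexCategoryᵒᵖ) (x) :
    ((X.map (chainLast (f ≫ g) c)).app q).toFun x = ((X.map (chainLast g c)).app q).toFun
      (((X.map (chainLast f (chainPullback g c))).app q).toFun x) := by
  have h : X.map (chainLast (f ≫ g) c) =
      X.map (chainLast f (chainPullback g c)) ≫ X.map (chainLast g c) := by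
    rw [← X.map_comp]
    refine congrArg X.map ?_
    exact c.map_comp (homOfLE (g.toOrderHom.monotone (Fin.le_last _)))
      (homOfLE (Fin.le_last (g.toOrderHom (Fin.last _))))
  exact app_congr h q x

theorem map_eqToHom_apply {X : CosimplicialPSSet.{u}} {m : SimplexCategory}
    {q : SimplexCategoryᵒᵖ} (g : ∀ c : Chain m, ((X.obj (c.obj (Fin.last m.len))).obj q).X)
    {c c' : Chain m} (h : c' = c) (ℓ : c'.obj (Fin.last m.len) ⟶ c.obj (Fin.last m.len))
    (hℓ : ℓ = eqToHom (by rw [h])) : ((X.map ℓ).app q).toFun (g c') = g c := by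
  subst h
  subst hℓ
  exact app_congr (X.map_id _) q (g c')

theorem chainLast_collapse {r : ℕ} (i : Fin r) (c : Chain ⦋r⦌)
    (h : chainPullback (collapse i) c = c) :
    chainLast (collapse i) c = eqToHom (by rw [h]) := by
  have h1 := Functor.congr_hom h.symm
    (homOfLE (Fin.le_last ((collapse i).toOrderHom (Fin.last _))))
  refine Eq.trans h1 ?_
  have h2 : ∀ x y : Fin (r + 1), ∀ (f : x ⟶ y) (e : x = y), c.map f = eqToHom (by rw [e]) := by
    rintro x _ f rfl
    simp [Subsingleton.elim f (𝟙 _)]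
  have h3 := h2 _ _ ((collapse i).toOrderHom.monotone.functor.map
    (homOfLE (Fin.le_last ((collapse i).toOrderHom (Fin.last _))))) (by
      exact congrArg (fun t => t.toOrderHom (Fin.last r)) (collapse_collapse i))
  change eqToHom _ ≫ c.map _ ≫ eqToHom _ = _
  rw [h3]
  refine Eq.trans (congrArg _ (eqToHom_trans _ _)) (eqToHom_trans _ _)

theorem ChainFamily.NatOn.collapse_eq {X : CosimplicialPSSet.{u}} {d : SimplexCategory}
    {f : ChainFamily X d} {D : ∀ m q : SimplexCategory, (q ⟶ m) → (q ⟶ d) → Prop}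
    (hf : f.NatOn D) {r : ℕ} (i : Fin r) {c : Chain ⦋r⦌} (h : chainPullback (collapse i) c = c)
    {q : SimplexCategory} (x : q ⟶ ⦋r⦌) (τ : q ⟶ d) (hx : D _ _ x τ) :
    f ⦋r⦌ q (x ≫ collapse i) τ c = f ⦋r⦌ q x τ c :=
  (hf.cosimplicial _ _ _ (collapse i) x τ c hx).symm.trans
    (map_eqToHom_apply (f ⦋r⦌ q x τ) h _ (chainLast_collapse i c h))

theorem InSk.exists_misses {q : SimplexCategory} {r : ℕ} {a : q ⟶ ⦋r⦌} (h : InSk r a) :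
    ∃ j, Misses a j := by
  obtain ⟨k, hk, f, g, rfl⟩ := h
  by_contra! hc
  have hs : Function.Surjective g.toOrderHom := fun j => by
    have h1 := hc j
    unfold Misses at h1
    push Not at h1
    obtain ⟨t, ht⟩ := h1
    exact ⟨_, ht⟩
  have := Fintype.card_le_of_surjective _ hs
  simp at this
  omega

theorem InSk.of_comp {q m : SimplexCategory} {r : ℕ} {a : q ⟶ ⦋r⦌} {b : ⦋r⦌ ⟶ m}
    (h : InSk r (a ≫ b)) (hb : Function.Injective b.toOrderHom) : InSk r a := by
  obtain ⟨k, hk, f, g, e⟩ := h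
  by_contra hc
  have hs := InSk.surjective hc
  choose s hs' using hs
  have : Function.Injective (fun j => f.toOrderHom (s j)) := by
    intro i j hij
    have h1 : ∀ t, b.toOrderHom (a.toOrderHom t) = g.toOrderHom (f.toOrderHom t) := fun t =>
      congrArg (fun z : q ⟶ m => z.toOrderHom t) e.symm
    rw [← hs' i, ← hs' j]
    apply hb
    rw [h1, h1]
    exact congrArg _ hij
  have := Fintype.card_le_of_injective _ this
  simp at this
  omega

/-- The simplices `(σ, τ)` of `Δ[m] × Δ[d]` on which a lift is known after `r` steps: `σ` lies in
the `s`-skeleton, or it lies in the `t`-skeleton and `σ` has dimension less than `r` or `τ` lies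
in a face of `T`. -/
def SkDomain {d : ℕ} (T : Set (Fin (d + 1))) (s t : WithTop ℤ) (r : ℕ) (m q : SimplexCategory)
    (σ : q ⟶ m) (τ : q ⟶ ⦋d⦌) : Prop :=
  InSkeleton s σ ∨ (InSkeleton t σ ∧ (InSk r σ ∨ ∃ j ∈ T, Misses τ j))

section

variable {X X' : CosimplicialPSSet.{u}} (p : X ⟶ X') {s t : WithTop ℤ} {d : ℕ}
  {T : Set (Fin (d + 1))} {r : ℕ}

theorem SkDomain.precomp {m q q' : SimplexCategory} {σ : q ⟶ m} {τ : q ⟶ ⦋d⦌}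
    (h : SkDomain T s t r m q σ τ) (θ : q' ⟶ q) : SkDomain T s t r m q' (θ ≫ σ) (θ ≫ τ) := by
  rcases h with h | ⟨h, h'⟩
  · exact Or.inl (h.precomp θ)
  · refine Or.inr ⟨h.precomp θ, h'.imp (fun h' => h'.precomp θ) ?_⟩
    rintro ⟨j, hj, hτ⟩
    exact ⟨j, hj, hτ.precomp θ⟩

theorem SkDomain.postcomp {m m' q : SimplexCategory} {σ : q ⟶ m} {τ : q ⟶ ⦋d⦌}
    (h : SkDomain T s t r m q σ τ) (κ : m ⟶ m') : SkDomain T s t r m' q (σ ≫ κ) τ := by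
  rcases h with h | ⟨h, h'⟩
  · exact Or.inl (h.postcomp κ)
  · exact Or.inr ⟨h.postcomp κ, h'.imp (fun h' => h'.postcomp κ) id⟩

theorem SkDomain.inSkeleton (hst : s ≤ t) {m q : SimplexCategory} {σ : q ⟶ m} {τ : q ⟶ ⦋d⦌}
    (h : SkDomain T s t r m q σ τ) : InSkeleton t σ :=
  h.elim (fun h => h.mono hst) And.left

/-- The values of a lift on a chain `c` of length `r`. If `c` is degenerate, that is,
`chainPullback (collapse j) c = c` for some `j`, they are prescribed by the values in lower
dimension. If `c` is nondegenerate, the only condition is to extend the values given on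
`∂Δ[r] × Δ[d]` and on `Δ[r] × T`. -/
theorem exists_chain_lift (hsr : s < (r : ℤ)) (hrt : ((r : ℤ) : WithTop ℤ) ≤ t)
    (hp : ∀ i, Lifts (toSSet.map (p.app i)) ⦋r⦌ ⦋d⦌ (FacePair Set.univ T))
    {f : ChainFamily X ⦋d⦌} (hf : f.NatOn (SkDomain T s t r))
    {b : ChainFamily X' ⦋d⦌} (hb : b.NatOn fun _ _ σ _ => InSkeleton t σ)
    (hfb : ∀ m q σ τ c, SkDomain T s t r m q σ τ →
      ((p.app (c.obj (Fin.last m.len))).app (op q)).toFun (f m q σ τ c) = b m q σ τ c)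
    (c : Chain ⦋r⦌) :
    ∃ φ : ∀ q : SimplexCategory, (q ⟶ ⦋r⦌) → (q ⟶ ⦋d⦌) →
        ((X.obj (c.obj (Fin.last r))).obj (op q)).X,
      (∀ q q' (θ : q' ⟶ q) a τ, ((X.obj (c.obj (Fin.last r))).map θ.op).toFun (φ q a τ) =
        φ q' (θ ≫ a) (θ ≫ τ)) ∧
      (∀ q a τ, SkDomain T s t r ⦋r⦌ q a τ → φ q a τ = f ⦋r⦌ q a τ c) ∧
      (∀ q a τ, ((p.app (c.obj (Fin.last r))).app (op q)).toFun (φ q a τ) = b ⦋r⦌ q a τ c) ∧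
      ∀ j, chainPullback (collapse j) c = c → ∀ q a τ,
        φ q a τ = f ⦋r⦌ q (a ≫ collapse j) τ c := by
  have ht : ∀ {q : SimplexCategory} (a : q ⟶ ⦋r⦌), InSkeleton t a := fun a =>
    ⟨⦋r⦌, hrt, a, 𝟙 _, by simp⟩
  have hD : ∀ {q : SimplexCategory} {a : q ⟶ ⦋r⦌} (τ : q ⟶ ⦋d⦌), InSk r a →
      SkDomain T s t r ⦋r⦌ q a τ := fun τ h => Or.inr ⟨ht _, Or.inl h⟩
  have hcol : ∀ {q : SimplexCategory} (a : q ⟶ ⦋r⦌) (τ : q ⟶ ⦋d⦌) (i : Fin r),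
      SkDomain T s t r ⦋r⦌ q (a ≫ collapse i) τ := fun a τ i => hD τ (inSk_collapse i a)
  by_cases hc : ∃ i, chainPullback (collapse i) c = c
  · obtain ⟨i, hi⟩ := hc
    have braid : ∀ {i j : Fin r}, i < j → chainPullback (collapse i) c = c →
        chainPullback (collapse j) c = c → ∀ q (a : q ⟶ ⦋r⦌) (τ : q ⟶ ⦋d⦌),
        f ⦋r⦌ q (a ≫ collapse i) τ c = f ⦋r⦌ q (a ≫ collapse j) τ c := by
      intro i j hij hi hj q a τ
      have h1 := hf.collapse_eq j hj _ τ (hcol a τ i)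
      have h2 := hf.collapse_eq i hi _ τ ((hcol a τ i).postcomp (collapse j))
      have h3 := hf.collapse_eq i hi _ τ (hcol a τ j)
      rw [← h1, ← h2, ← h3]
      simp only [Category.assoc, collapse_braid hij]
    refine ⟨fun q a τ => f ⦋r⦌ q (a ≫ collapse i) τ c, fun q q' θ a τ => ?_,
      fun q a τ h => hf.collapse_eq i hi a τ h, fun q a τ => ?_, fun j hj q a τ => ?_⟩
    · refine (hf.simplicial _ _ _ θ _ τ c (hcol a τ i)).trans ?_
      exact congrArg (fun z => f ⦋r⦌ q' z (θ ≫ τ) c) (Category.assoc _ _ _).symm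
    · exact (hfb _ _ _ _ _ (hcol a τ i)).trans (hb.collapse_eq i hi a τ (ht a))
    · rcases lt_trichotomy i j with h | rfl | h
      · exact braid h hi hj q a τ
      · rfl
      · exact (braid h hj hi q a τ).symm
  · push Not at hc
    have hD' : ∀ {q : SimplexCategory} {a : q ⟶ ⦋r⦌} {τ : q ⟶ ⦋d⦌},
        SkDomain T s t r ⦋r⦌ q a τ ↔ FacePair Set.univ T q a τ := by
      intro q a τ
      constructor
      · rintro (h | ⟨-, h | h⟩)
        · obtain ⟨j, hj⟩ := (InSk.of_le h hsr).exists_misses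
          exact Or.inl ⟨j, trivial, hj⟩
        · obtain ⟨j, hj⟩ := h.exists_misses
          exact Or.inl ⟨j, trivial, hj⟩
        · exact Or.inr h
      · rintro (⟨j, -, hj⟩ | h)
        · exact hD τ (InSk.of_misses hj)
        · exact Or.inr ⟨ht a, Or.inr h⟩
    obtain ⟨φ, h1, h2, h3⟩ := hp (c.obj (Fin.last r)) (fun q a τ => f ⦋r⦌ q a τ c)
      (fun q a τ => b ⦋r⦌ q a τ c)
      (fun q q' θ a τ h => hf.simplicial _ _ _ θ a τ c (hD'.2 h))
      (fun q q' θ a τ => hb.simplicial _ _ _ θ a τ c (ht a))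
      (fun q a τ h => hfb _ _ _ _ _ (hD'.2 h))
    exact ⟨φ, h1, fun q a τ h => h2 q a τ (hD'.1 h), h3, fun j hj => (hc j hj).elim⟩

/-- A partial lift can be extended by one dimension. A simplex `σ` with image of dimension `r` has
a unique factorization `a ≫ b` through `[r]` with `a` surjective and `b` injective, and the value
on `c` is the image of the value on `chainPullback b c`, where `exists_chain_lift` applies. -/
theorem exists_chainFamily_succ
    (hp : s < (r : ℤ) → ((r : ℤ) : WithTop ℤ) ≤ t →
      ∀ i, Lifts (toSSet.map (p.app i)) ⦋r⦌ ⦋d⦌ (FacePair Set.univ T))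
    {f : ChainFamily X ⦋d⦌} (hf : f.NatOn (SkDomain T s t r))
    {b : ChainFamily X' ⦋d⦌} (hb : b.NatOn fun _ _ σ _ => InSkeleton t σ)
    (hfb : ∀ m q σ τ c, SkDomain T s t r m q σ τ →
      ((p.app (c.obj (Fin.last m.len))).app (op q)).toFun (f m q σ τ c) = b m q σ τ c) :
    ∃ f' : ChainFamily X ⦋d⦌, (f'.NatOn (SkDomain T s t (r + 1)) ∧
      (∀ m q σ τ c, SkDomain T s t (r + 1) m q σ τ →
        ((p.app (c.obj (Fin.last m.len))).app (op q)).toFun (f' m q σ τ c) = b m q σ τ c)) ∧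
      ∀ m q σ τ c, SkDomain T s t r m q σ τ → f' m q σ τ c = f m q σ τ c := by
  classical
  -- otherwise dimension `r` adds nothing
  by_cases hr : s < (r : ℤ) ∧ ((r : ℤ) : WithTop ℤ) ≤ t
  swap
  · have hD : ∀ m q σ τ, SkDomain T s t (r + 1) m q σ τ → SkDomain T s t r m q σ τ := by
      rintro m q σ τ (h | ⟨h, h' | h'⟩)
      · exact Or.inl h
      · by_cases hs : s < (r : ℤ)
        · exact Or.inr ⟨h, Or.inl (InSk.of_le h (not_le.1 fun ht => hr ⟨hs, ht⟩))⟩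
        · obtain ⟨k, hk, a, b, rfl⟩ := h'
          refine Or.inl ⟨k, le_trans ?_ (not_lt.1 hs), a, b, rfl⟩
          exact_mod_cast Nat.lt_succ_iff.1 hk
      · exact Or.inr ⟨h, Or.inr h'⟩
    exact ⟨f, ⟨⟨fun _ _ _ θ _ _ _ h => hf.simplicial _ _ _ θ _ _ _ (hD _ _ _ _ h),
      fun _ _ _ κ _ _ _ h => hf.cosimplicial _ _ _ κ _ _ _ (hD _ _ _ _ h)⟩,
      fun _ _ _ _ _ h => hfb _ _ _ _ _ (hD _ _ _ _ h)⟩, fun _ _ _ _ _ _ => rfl⟩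
  · obtain ⟨hsr, hrt⟩ := hr
    choose φ h1 h2 h3 h4 using fun c => exists_chain_lift p hsr hrt (hp hsr hrt) hf hb hfb c
    have ht : ∀ {q m : SimplexCategory} (a : q ⟶ ⦋r⦌) (b : ⦋r⦌ ⟶ m), InSkeleton t (a ≫ b) :=
      fun a b => ⟨⦋r⦌, hrt, a, b, rfl⟩
    have ht' : ∀ {q : SimplexCategory} (a : q ⟶ ⦋r⦌), InSkeleton t a :=
      fun a => ⟨⦋r⦌, hrt, a, 𝟙 _, by simp⟩
    have hcol : ∀ {q m : SimplexCategory} (a : q ⟶ ⦋r⦌) {b : ⦋r⦌ ⟶ m},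
        ¬ Function.Injective b.toOrderHom → InSk r (a ≫ b) := by
      intro q m a b h
      obtain ⟨i, hi⟩ := exists_collapse_comp h
      rw [← hi, ← Category.assoc]
      exact (inSk_collapse i a).postcomp b
    let g : ∀ (m q : SimplexCategory) (_ : q ⟶ ⦋r⦌) (_ : ⦋r⦌ ⟶ m) (_ : q ⟶ ⦋d⦌) (c : Chain m),
      ((X.obj (c.obj (Fin.last m.len))).obj (op q)).X := fun m q a b τ c =>
        ((X.map (chainLast b c)).app (op q)).toFun (φ (chainPullback b c) q a τ)
    let f' : ChainFamily X ⦋d⦌ := fun m q σ τ c =>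
      if SkDomain T s t r m q σ τ then f m q σ τ c
      else if h : ∃ (a : q ⟶ ⦋r⦌) (b : ⦋r⦌ ⟶ m), a ≫ b = σ then
        g m q h.choose h.choose_spec.choose τ c
      else f m q σ τ c
    have hf' : ∀ m q σ τ c, SkDomain T s t r m q σ τ → f' m q σ τ c = f m q σ τ c :=
      fun m q σ τ c h => if_pos h
    -- the value does not depend on the factorization through `[r]`
    have key : ∀ m q (a : q ⟶ ⦋r⦌) (b : ⦋r⦌ ⟶ m) τ c, f' m q (a ≫ b) τ c = g m q a b τ c := by
      intro m q a b τ c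
      by_cases hinj : Function.Injective b.toOrderHom
      · by_cases hD : SkDomain T s t r m q (a ≫ b) τ
        · have hD' : SkDomain T s t r ⦋r⦌ q a τ := by
            rcases hD with hD | ⟨-, hD | hD⟩
            · exact Or.inr ⟨ht' a, Or.inl ((InSk.of_le hD hsr).of_comp hinj)⟩
            · exact Or.inr ⟨ht' a, Or.inl (hD.of_comp hinj)⟩
            · exact Or.inr ⟨ht' a, Or.inr hD⟩
          rw [hf' _ _ _ _ _ hD]
          refine (hf.cosimplicial _ _ _ b a τ c hD').symm.trans ?_
          exact congrArg _ (h2 _ _ _ _ hD').symm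
        · have h : ∃ (a' : q ⟶ ⦋r⦌) (b' : ⦋r⦌ ⟶ m), a' ≫ b' = a ≫ b := ⟨a, b, rfl⟩
          have h5 : f' m q (a ≫ b) τ c = g m q h.choose h.choose_spec.choose τ c :=
            (if_neg hD).trans (dif_pos h)
          rw [h5]
          have hab := h.choose_spec.choose_spec
          generalize h.choose_spec.choose = b' at hab ⊢
          generalize h.choose = a' at hab ⊢
          have hns : ¬ InSk r (a ≫ b) := fun h => hD (Or.inr ⟨ht a b, Or.inl h⟩)
          have hsa : Function.Surjective a.toOrderHom :=
            InSk.surjective fun h => hns (h.postcomp b)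
          have hsa' : Function.Surjective a'.toOrderHom :=
            InSk.surjective fun h => hns (hab ▸ h.postcomp b')
          have hinj' : Function.Injective b'.toOrderHom := by
            by_contra h
            exact hns (hab ▸ hcol a' h)
          have hab' : ∀ x, b'.toOrderHom (a'.toOrderHom x) = b.toOrderHom (a.toOrderHom x) :=
            fun x => congrArg (fun z : q ⟶ m => z.toOrderHom x) hab
          have hbb : b' = b := by
            have hr : Set.range b'.toOrderHom = Set.range b.toOrderHom := by
              rw [← hsa'.range_comp, ← hsa.range_comp]
              exact congrArg Set.range (funext hab')
            have := (StrictMono.range_inj (b'.toOrderHom.monotone.strictMono_of_injective hinj')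
              (b.toOrderHom.monotone.strictMono_of_injective hinj)).1 hr
            ext x : 3
            exact congrFun this x
          subst hbb
          have haa : a' = a := by
            ext x : 3
            exact hinj (hab' x)
          rw [haa]
      · obtain ⟨i, hi⟩ := exists_collapse_comp hinj
        rw [hf' _ _ _ _ _ (Or.inr ⟨ht a b, Or.inl (hcol a hinj)⟩)]
        have hD : SkDomain T s t r ⦋r⦌ q (a ≫ collapse i) τ :=
          Or.inr ⟨ht' _, Or.inl (inSk_collapse i a)⟩
        have h5 := hf.cosimplicial _ _ _ b _ τ c hD
        rw [Category.assoc, hi] at h5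
        refine h5.symm.trans (congrArg _ (h4 _ i ?_ q a τ).symm)
        rw [← chainPullback_comp, hi]
    have hcase : ∀ m q σ τ, SkDomain T s t (r + 1) m q σ τ → SkDomain T s t r m q σ τ ∨
        ∃ (a : q ⟶ ⦋r⦌) (b : ⦋r⦌ ⟶ m), a ≫ b = σ := by
      rintro m q σ τ (h | ⟨h, ⟨k, hk, a, b, rfl⟩ | h'⟩)
      · exact Or.inl (Or.inl h)
      · rcases Nat.lt_succ_iff_lt_or_eq.1 hk with hk | rfl
        · exact Or.inl (Or.inr ⟨h, Or.inl ⟨k, hk, a, b, rfl⟩⟩)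
        · exact Or.inr ⟨a, b, rfl⟩
      · exact Or.inl (Or.inr ⟨h, Or.inr h'⟩)
    refine ⟨f', ⟨⟨fun m q q' θ σ τ c h => ?_, fun m m' q κ σ τ c h => ?_⟩,
      fun m q σ τ c h => ?_⟩, hf'⟩
    · rcases hcase _ _ _ _ h with h | ⟨a, b, rfl⟩
      · rw [hf' _ _ _ _ _ h, hf' _ _ _ _ _ (h.precomp θ)]
        exact hf.simplicial _ _ _ θ _ _ _ h
      · rw [key, ← Category.assoc, key]
        refine (app_map (X.map (chainLast b c)) θ.op _).symm.trans ?_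
        exact congrArg _ (h1 _ _ _ θ a τ)
    · rcases hcase _ _ _ _ h with h | ⟨a, b, rfl⟩
      · rw [hf' _ _ _ _ _ h, hf' _ _ _ _ _ (h.postcomp κ)]
        exact hf.cosimplicial _ _ _ κ _ _ _ h
      · rw [key, Category.assoc, key]
        exact (chainLast_comp_apply X b κ c (op q) _).symm
    · rcases hcase _ _ _ _ h with h | ⟨a, b', rfl⟩
      · rw [hf' _ _ _ _ _ h]
        exact hfb _ _ _ _ _ h
      · rw [key]
        refine Eq.trans ?_ (hb.cosimplicial _ _ _ b' a τ c (ht' a))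
        refine Eq.trans ?_ (congrArg _ (h3 _ _ _ _))
        exact (app_congr (p.naturality (chainLast b' c)) (op q) _)

/-- The relative lifting property of the total spaces of cosimplicial replacements. It reduces to
the lifting properties of the maps `p.app i` against products of simplices, with no condition on
matching objects: the matching maps of a cosimplicial replacement are projections, and the
complementary factors are the values of `X` on nondegenerate chains. -/
theorem exists_chainFamily_lift
    (hp : ∀ r : ℕ, s < (r : ℤ) → ((r : ℤ) : WithTop ℤ) ≤ t →
      ∀ i, Lifts (toSSet.map (p.app i)) ⦋r⦌ ⦋d⦌ (FacePair Set.univ T))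
    {f : ChainFamily X ⦋d⦌} (hf : f.NatOn (SkDomain T s t 0))
    {b : ChainFamily X' ⦋d⦌} (hb : b.NatOn fun _ _ σ _ => InSkeleton t σ)
    (hfb : ∀ m q σ τ c, SkDomain T s t 0 m q σ τ →
      ((p.app (c.obj (Fin.last m.len))).app (op q)).toFun (f m q σ τ c) = b m q σ τ c) :
    ∃ f' : ChainFamily X ⦋d⦌, f'.NatOn (fun _ _ σ _ => InSkeleton t σ) ∧
      (∀ m q σ τ c, InSkeleton t σ →
        ((p.app (c.obj (Fin.last m.len))).app (op q)).toFun (f' m q σ τ c) = b m q σ τ c) ∧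
      ∀ m q σ τ c, SkDomain T s t 0 m q σ τ → f' m q σ τ c = f m q σ τ c := by
  let G : ℕ → ChainFamily X ⦋d⦌ → Prop := fun r f => f.NatOn (SkDomain T s t r) ∧
    ∀ m q σ τ c, SkDomain T s t r m q σ τ →
      ((p.app (c.obj (Fin.last m.len))).app (op q)).toFun (f m q σ τ c) = b m q σ τ c
  have step : ∀ (r : ℕ) (f : { f // G r f }), ∃ f' : { f // G (r + 1) f },
      ∀ m q σ τ c, SkDomain T s t r m q σ τ → f'.1 m q σ τ c = f.1 m q σ τ c := by
    rintro r ⟨f, hf, hfb⟩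
    obtain ⟨f', h, h'⟩ := exists_chainFamily_succ p (hp r) hf hb hfb
    exact ⟨⟨f', h⟩, h'⟩
  choose next hnext using step
  let F : ∀ r, { f // G r f } := fun r => Nat.rec ⟨f, hf, hfb⟩ (fun r f => next r f) r
  have hle : ∀ {r r' : ℕ}, r ≤ r' → ∀ {m q σ τ}, SkDomain T s t r m q σ τ →
      SkDomain T s t r' m q σ τ := by
    rintro r r' h m q σ τ (h' | ⟨h1, ⟨k, hk, h2⟩ | h2⟩)
    · exact Or.inl h'
    · exact Or.inr ⟨h1, Or.inl ⟨k, hk.trans_le h, h2⟩⟩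
    · exact Or.inr ⟨h1, Or.inr h2⟩
  have hF : ∀ {r r' : ℕ}, r ≤ r' → ∀ m q σ τ c, SkDomain T s t r m q σ τ →
      (F r').1 m q σ τ c = (F r).1 m q σ τ c := by
    intro r r' h
    induction r', h using Nat.le_induction with
    | base => exact fun _ _ _ _ _ _ => rfl
    | succ r' h ih =>
      intro m q σ τ c hD
      exact (hnext r' (F r') m q σ τ c (hle h hD)).trans (ih m q σ τ c hD)
  have hdom : ∀ {r : ℕ} {m q : SimplexCategory} {σ : q ⟶ m} (τ : q ⟶ ⦋d⦌), InSkeleton t σ →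
      q.len < r → SkDomain T s t r m q σ τ := fun {r m q σ} τ h hr =>
    Or.inr ⟨h, Or.inl ⟨q, hr, 𝟙 q, σ, by simp⟩⟩
  have hF' : ∀ {r : ℕ} m q σ τ c, InSkeleton t σ → q.len < r →
      (F r).1 m q σ τ c = (F (q.len + 1)).1 m q σ τ c := fun m q σ τ c h hr =>
    hF (Nat.succ_le_of_lt hr) _ _ _ _ _ (hdom τ h (Nat.lt_succ_self _))
  -- the simplices over `q` are settled after `q.len + 1` steps
  refine ⟨fun m q σ τ c => (F (q.len + 1)).1 m q σ τ c,
    ⟨fun m q q' θ σ τ c h => ?_, fun m m' q κ σ τ c h => ?_⟩, fun m q σ τ c h => ?_,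
    fun m q σ τ c h => hF (Nat.zero_le (q.len + 1)) _ _ _ _ _ h⟩
  · have h1 : q.len < max q.len q'.len + 1 := by omega
    have h2 : q'.len < max q.len q'.len + 1 := by omega
    rw [← hF' m q σ τ c h h1, ← hF' m q' _ _ c (h.precomp θ) h2]
    exact (F _).2.1.simplicial _ _ _ θ _ _ _ (hdom τ h h1)
  · exact (F _).2.1.cosimplicial _ _ _ κ _ _ _ (hdom τ h (Nat.lt_succ_self _))
  · exact (F _).2.2 _ _ _ _ _ (hdom τ h (Nat.lt_succ_self _))

end

/-! ### The grid of total spaces of Postnikov stages -/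

/-- The lifting property of the map from `A` to `B ×_D C`, for a square with `f ≫ k = h ≫ g`,
against the union of the faces `j ∈ S` of `Δ[n + 1]`. -/
def SquareFill {A B C D : PSSet.{u}} (f : A ⟶ B) (h : A ⟶ C) (k : B ⟶ D) (g : C ⟶ D) (n : ℕ)
    (S : Set (Fin (n + 2))) : Prop :=
  ∀ y : Fin (n + 2) → (A _⦋n⦌).X, FaceCompat (K := toSSet.obj A) S y →
    ∀ (b : (B _⦋n + 1⦌).X) (c : (C _⦋n + 1⦌).X), (k.app _).toFun b = (g.app _).toFun c →
      (∀ j ∈ S, (B.δ j).toFun b = (f.app _).toFun (y j)) →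
      (∀ j ∈ S, (C.δ j).toFun c = (h.app _).toFun (y j)) →
      ∃ z : (A _⦋n + 1⦌).X, (∀ j ∈ S, (A.δ j).toFun z = y j) ∧ (f.app _).toFun z = b ∧
        (h.app _).toFun z = c

/-- The map from `A` to `B ×_D C` is surjective on vertices. -/
def SquareSurj {A B C D : PSSet.{u}} (f : A ⟶ B) (h : A ⟶ C) (k : B ⟶ D) (g : C ⟶ D) : Prop :=
  ∀ (b : (B _⦋0⦌).X) (c : (C _⦋0⦌).X), (k.app _).toFun b = (g.app _).toFun c →
      ∃ z : (A _⦋0⦌).X, (f.app _).toFun z = b ∧ (h.app _).toFun z = c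

theorem not_inSk_zero {q m : SimplexCategory} {σ : q ⟶ m} (h : InSk 0 σ) : False := by
  obtain ⟨k, hk, -⟩ := h
  exact Nat.not_lt_zero _ hk

section

variable {X X' : CosimplicialPSSet.{u}} (p : X ⟶ X') {s t : WithTop ℤ}

/-- `exists_chainFamily_lift` for the simplices of the total spaces. -/
theorem exists_totSimplex_lift {d : ℕ} {T : Set (Fin (d + 1))} (hst : s ≤ t)
    (hp : ∀ r : ℕ, s < (r : ℤ) → ((r : ℤ) : WithTop ℤ) ≤ t →
      ∀ i, Lifts (toSSet.map (p.app i)) ⦋r⦌ ⦋d⦌ (FacePair Set.univ T))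
    {f : ChainFamily X ⦋d⦌} (hf : f.NatOn (SkDomain T s t 0))
    (b : TotSimplex (cosimplicialReplacement.obj X') t ⦋d⦌)
    (hfb : ∀ m q σ τ c (h : SkDomain T s t 0 m q σ τ),
      ((p.app (c.obj (Fin.last m.len))).app (op q)).toFun (f m q σ τ c) =
        b.toFun m q σ (h.inSkeleton hst) τ c) :
    ∃ z : TotSimplex (cosimplicialReplacement.obj X) t ⦋d⦌,
      (∀ m q σ hσ τ c, ((p.app (c.obj (Fin.last m.len))).app (op q)).toFun
        (z.toFun m q σ hσ τ c) = b.toFun m q σ hσ τ c) ∧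
      ∀ m q σ τ c (h : SkDomain T s t 0 m q σ τ),
        z.toFun m q σ (h.inSkeleton hst) τ c = f m q σ τ c := by
  classical
  let b' : ChainFamily X' ⦋d⦌ := fun m q σ τ c =>
    if h : InSkeleton t σ then b.toFun m q σ h τ c
    else ((X'.obj (c.obj (Fin.last m.len))).obj (op q)).point
  have hb' : ∀ m q σ τ c (h : InSkeleton t σ), b' m q σ τ c = b.toFun m q σ h τ c :=
    fun m q σ τ c h => dif_pos h
  have hbn : b'.NatOn fun _ _ σ _ => InSkeleton t σ := by
    refine ⟨fun m q q' θ σ τ c h => ?_, fun m m' q κ σ τ c h => ?_⟩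
    · rw [hb' _ _ _ _ _ h, hb' _ _ _ _ _ (h.precomp θ)]
      exact congrFun (b.map_simplicial m q q' θ σ h τ) c
    · rw [hb' _ _ _ _ _ h, hb' _ _ _ _ _ (h.postcomp κ)]
      exact congrFun (b.map_cosimplicial m m' q κ σ h τ) c
  obtain ⟨f', hf', h1, h2⟩ := exists_chainFamily_lift p hp hf hbn
    (fun m q σ τ c h => (hfb m q σ τ c h).trans (hb' _ _ _ _ _ _).symm)
  exact ⟨{ toFun := fun m q σ _ τ c => f' m q σ τ c
           map_simplicial := fun m q q' θ σ h τ => funext fun c =>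
             hf'.simplicial m q q' θ σ τ c h
           map_cosimplicial := fun m m' q κ σ h τ => funext fun c =>
             hf'.cosimplicial m m' q κ σ τ c h },
    fun m q σ hσ τ c => (h1 m q σ τ c hσ).trans (hb' _ _ _ _ _ hσ),
    fun m q σ τ c h => h2 m q σ τ c h⟩

/-- The map from `Tot_t Π X` to the pullback of `Tot_t Π X'` and `Tot_s Π X` over `Tot_s Π X'`
lifts against the faces in `S`, if the maps `p.app i` lift against the products with
`∂Δ[r] ⊆ Δ[r]` for `s < r ≤ t`. -/
theorem tot_squareFill (hst : s ≤ t) {n : ℕ} {S : Set (Fin (n + 2))}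
    (hp : ∀ r : ℕ, s < (r : ℤ) → ((r : ℤ) : WithTop ℤ) ≤ t →
      ∀ i, Lifts (toSSet.map (p.app i)) ⦋r⦌ ⦋n + 1⦌ (FacePair Set.univ S)) :
    SquareFill ((tot.map (cosimplicialReplacement.map p)).app (op t))
      ((tot.obj (cosimplicialReplacement.obj X)).map (homOfLE hst).op)
      ((tot.obj (cosimplicialReplacement.obj X')).map (homOfLE hst).op)
      ((tot.map (cosimplicialReplacement.map p)).app (op s)) n S := by
  classical
  intro y hy (b : TotSimplex _ t _) (c : TotSimplex _ s _) hbc hb hc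
  change ∀ j : Fin (n + 2), TotSimplex (cosimplicialReplacement.obj X) t ⦋n⦌ at y
  let f : ChainFamily X ⦋n + 1⦌ := fun m q σ τ e =>
    if h : InSkeleton s σ then c.toFun m q σ h τ e
    else if h' : InSkeleton t σ ∧ ∃ j ∈ S, ∃ τ' : q ⟶ ⦋n⦌, τ' ≫ SimplexCategory.δ j = τ then
      (y h'.2.choose).toFun m q σ h'.1 h'.2.choose_spec.2.choose e
    else ((X.obj (e.obj (Fin.last m.len))).obj (op q)).point
  have hf : ∀ m q σ τ e (h : InSkeleton s σ), f m q σ τ e = c.toFun m q σ h τ e :=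
    fun m q σ τ e h => dif_pos h
  have hf' : ∀ m q σ (τ : q ⟶ ⦋n⦌) e (h : InSkeleton t σ) (j) (_ : j ∈ S),
      f m q σ (τ ≫ SimplexCategory.δ j) e = (y j).toFun m q σ h τ e := by
    intro m q σ τ e h j hj
    by_cases hs : InSkeleton s σ
    · rw [hf _ _ _ _ _ hs]
      exact congrFun (congrArg (fun z : TotSimplex (cosimplicialReplacement.obj X) s ⦋n⦌ =>
        z.toFun m q σ hs τ) (hc j hj)) e
    · have h' : InSkeleton t σ ∧ ∃ j' ∈ S, ∃ τ' : q ⟶ ⦋n⦌, τ' ≫ SimplexCategory.δ j' =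
        τ ≫ SimplexCategory.δ j := ⟨h, j, hj, τ, rfl⟩
      have h1 : f m q σ (τ ≫ SimplexCategory.δ j) e =
          (y h'.2.choose).toFun m q σ h'.1 h'.2.choose_spec.2.choose e :=
        (dif_neg hs).trans (dif_pos h')
      rw [h1]
      have h2 := hy _ h'.2.choose_spec.1 j hj q _ _ h'.2.choose_spec.2.choose_spec
      have h3 := congrFun (congrArg (fun z : TotSimplex (cosimplicialReplacement.obj X) t q =>
        z.toFun m q σ h (𝟙 q)) h2) e
      change (y _).toFun m q σ h (𝟙 q ≫ _) e = (y j).toFun m q σ h (𝟙 q ≫ τ) e at h3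
      rw [Category.id_comp, Category.id_comp] at h3
      exact h3
  have hcase : ∀ m q σ τ, SkDomain S s t 0 m q σ τ → InSkeleton s σ ∨ (InSkeleton t σ ∧
      ∃ j ∈ S, ∃ τ' : q ⟶ ⦋n⦌, τ = τ' ≫ SimplexCategory.δ j) := by
    rintro m q σ τ (h | ⟨h, h' | ⟨j, hj, h'⟩⟩)
    · exact Or.inl h
    · exact (not_inSk_zero h').elim
    · exact Or.inr ⟨h, j, hj, h'.exists_eq⟩
  obtain ⟨z, hz, hz'⟩ := exists_totSimplex_lift (T := S) p hst hp (f := f)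
    ⟨fun m q q' θ σ τ e h => by
      rcases hcase _ _ _ _ h with h | ⟨h1, j, hj, τ, rfl⟩
      · rw [hf _ _ _ _ _ h, hf _ _ _ _ _ (h.precomp θ)]
        exact congrFun (c.map_simplicial m q q' θ σ h τ) e
      · rw [hf' _ _ _ _ _ h1 _ hj, ← Category.assoc, hf' _ _ _ _ _ (h1.precomp θ) _ hj]
        exact congrFun ((y j).map_simplicial m q q' θ σ h1 τ) e, fun m m' q κ σ τ e h => by
      rcases hcase _ _ _ _ h with h | ⟨h1, j, hj, τ, rfl⟩
      · rw [hf _ _ _ _ _ h, hf _ _ _ _ _ (h.postcomp κ)]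
        exact congrFun (c.map_cosimplicial m m' q κ σ h τ) e
      · rw [hf' _ _ _ _ _ h1 _ hj, hf' _ _ _ _ _ (h1.postcomp κ) _ hj]
        exact congrFun ((y j).map_cosimplicial m m' q κ σ h1 τ) e⟩ b
    (fun m q σ τ e h => by
      have ht := h.inSkeleton hst
      rcases hcase _ _ _ _ h with h | ⟨h1, j, hj, τ, rfl⟩
      · rw [hf _ _ _ _ _ h]
        exact (congrFun (congrArg (fun z : TotSimplex (cosimplicialReplacement.obj X') s ⦋n + 1⦌ =>
          z.toFun m q σ h τ) hbc) e).symm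
      · rw [hf' _ _ _ _ _ ht _ hj]
        exact (congrFun (congrArg (fun z : TotSimplex (cosimplicialReplacement.obj X') t ⦋n⦌ =>
          z.toFun m q σ ht τ) (hb j hj)) e).symm)
  refine ⟨z, fun j hj => ?_, ?_, ?_⟩
  · refine TotSimplex.ext ?_
    funext m q σ h τ e
    exact (hz' m q σ (τ ≫ SimplexCategory.δ j) e (Or.inr ⟨h, Or.inr ⟨j, hj, misses_δ τ j⟩⟩)).trans
      (hf' _ _ _ _ _ h _ hj)
  · refine TotSimplex.ext ?_
    funext m q σ h τ e
    exact hz m q σ h τ e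
  · refine TotSimplex.ext ?_
    funext m q σ h τ e
    exact (hz' m q σ τ e (Or.inl h)).trans (hf _ _ _ _ _ h)

theorem tot_squareSurj (hst : s ≤ t)
    (hp : ∀ r : ℕ, s < (r : ℤ) → ((r : ℤ) : WithTop ℤ) ≤ t →
      ∀ i, Lifts (toSSet.map (p.app i)) ⦋r⦌ ⦋0⦌ (FacePair Set.univ Set.univ)) :
    SquareSurj ((tot.map (cosimplicialReplacement.map p)).app (op t))
      ((tot.obj (cosimplicialReplacement.obj X)).map (homOfLE hst).op)
      ((tot.obj (cosimplicialReplacement.obj X')).map (homOfLE hst).op)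
      ((tot.map (cosimplicialReplacement.map p)).app (op s)) := by
  classical
  intro (b : TotSimplex _ t _) (c : TotSimplex _ s _) hbc
  let f : ChainFamily X ⦋0⦌ := fun m q σ τ e =>
    if h : InSkeleton s σ then c.toFun m q σ h τ e
    else ((X.obj (e.obj (Fin.last m.len))).obj (op q)).point
  have hf : ∀ m q σ τ e (h : InSkeleton s σ), f m q σ τ e = c.toFun m q σ h τ e :=
    fun m q σ τ e h => dif_pos h
  have hcase : ∀ m q σ τ, SkDomain (d := 0) Set.univ s t 0 m q σ τ → InSkeleton s σ := by
    rintro m q σ τ (h | ⟨h, h' | ⟨j, hj, h'⟩⟩)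
    · exact h
    · exact (not_inSk_zero h').elim
    · exact (not_misses_zero τ j h').elim
  obtain ⟨z, hz, hz'⟩ := exists_totSimplex_lift (T := Set.univ) p hst hp (f := f)
    ⟨fun m q q' θ σ τ e h => by
      have h := hcase _ _ _ _ h
      rw [hf _ _ _ _ _ h, hf _ _ _ _ _ (h.precomp θ)]
      exact congrFun (c.map_simplicial m q q' θ σ h τ) e, fun m m' q κ σ τ e h => by
      have h := hcase _ _ _ _ h
      rw [hf _ _ _ _ _ h, hf _ _ _ _ _ (h.postcomp κ)]
      exact congrFun (c.map_cosimplicial m m' q κ σ h τ) e⟩ b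
    (fun m q σ τ e h => by
      have h := hcase _ _ _ _ h
      rw [hf _ _ _ _ _ h]
      exact (congrFun (congrArg (fun z : TotSimplex (cosimplicialReplacement.obj X') s ⦋0⦌ =>
        z.toFun m q σ h τ) hbc) e).symm)
  refine ⟨z, ?_, ?_⟩
  · refine TotSimplex.ext ?_
    funext m q σ h τ e
    exact hz m q σ h τ e
  · refine TotSimplex.ext ?_
    funext m q σ h τ e
    exact (hz' m q σ τ e (Or.inl h)).trans (hf _ _ _ _ _ h)

end

theorem SquareFill.hasFill {A B C D : PSSet.{u}} {f : A ⟶ B} {h : A ⟶ C} {k : B ⟶ D} {g : C ⟶ D}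
    {n : ℕ} {S : Set (Fin (n + 2))} (H : SquareFill f h k g n S)
    (hB : ∀ q, Subsingleton (B.obj q).X) (hD : ∀ q, Subsingleton (D.obj q).X) :
    HasFill (toSSet.map h) n S := fun y hy c hc => by
  obtain ⟨z, h1, -, h2⟩ := H y hy (B.obj _).point c ((hD _).elim _ _)
    (fun _ _ => (hB _).elim _ _) hc
  exact ⟨z, h1, h2⟩

theorem SquareFill.hasFill' {A B C D : PSSet.{u}} {f : A ⟶ B} {h : A ⟶ C} {k : B ⟶ D} {g : C ⟶ D}
    {n : ℕ} {S : Set (Fin (n + 2))} (H : SquareFill f h k g n S)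
    (hC : ∀ q, Subsingleton (C.obj q).X) (hD : ∀ q, Subsingleton (D.obj q).X) :
    HasFill (toSSet.map f) n S := fun y hy b hb => by
  obtain ⟨z, h1, h2, -⟩ := H y hy b (C.obj _).point ((hD _).elim _ _) hb
    (fun _ _ => (hC _).elim _ _)
  exact ⟨z, h1, h2⟩

/-- The bitower `(n, s) ↦ Tot_s Π X(n)`. -/
noncomputable def grid : CosimplicialPSSet.{u} ⥤ ((WithTop ℤ)ᵒᵖ ⥤ Tower.{u}) :=
  levelwisePostnikov ⋙ (Functor.whiskeringRight (WithTop ℤ)ᵒᵖ _ _).obj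
    (cosimplicialReplacement ⋙ tot)

section
variable (W : (WithTop ℤ)ᵒᵖ ⥤ Tower.{u})

/-- The space at the position `(n, s)`. -/
noncomputable abbrev node (n s : WithTop ℤ) : PSSet.{u} := (W.obj (op n)).obj (op s)

/-- The map which lowers the Postnikov degree from `n` to `n'`. -/
noncomputable abbrev lowerN {n' n : WithTop ℤ} (h : n' ≤ n) (s : WithTop ℤ) :
    node W n s ⟶ node W n' s :=
  (W.map (homOfLE h).op).app (op s)

/-- The map which lowers the cosimplicial degree from `s` to `s'`. -/
noncomputable abbrev lowerS (n : WithTop ℤ) {s' s : WithTop ℤ} (h : s' ≤ s) :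
    node W n s ⟶ node W n s' :=
  (W.obj (op n)).map (homOfLE h).op

/-- The properties of the bitower `(n, s) ↦ Tot_s Π X(n)` on which the comparison of its two edge
towers rests: the maps from each corner to the pullback of its square are fibrations; lowering `n`
lifts boundaries where the total dimension `d + s` is small, and the map from `s = ⊤` lifts
boundaries where it is large. -/
structure IsGrid : Prop where
  horn : ∀ {n' n s' s : WithTop ℤ} (hn : n' ≤ n) (hs : s' ≤ s) (d : ℕ) (k : Fin (d + 2)),
    SquareFill (lowerN W hn s) (lowerS W n hs) (lowerS W n' hs) (lowerN W hn s') d {k}ᶜ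
  boundary : ∀ {n : WithTop ℤ} {n' s : ℤ} {s' : WithTop ℤ} (hn : (n' : WithTop ℤ) ≤ n)
    (hs : s' ≤ (s : WithTop ℤ)) (d : ℕ), d + s ≤ n' →
    SquareFill (lowerN W hn s) (lowerS W n hs) (lowerS W n' hs) (lowerN W hn s') d Set.univ
  surj : ∀ {n : WithTop ℤ} {n' s : ℤ} {s' : WithTop ℤ} (hn : (n' : WithTop ℤ) ≤ n)
    (hs : s' ≤ (s : WithTop ℤ)), s ≤ n' + 1 →
    SquareSurj (lowerN W hn s) (lowerS W n hs) (lowerS W n' hs) (lowerN W hn s')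
  top : ∀ (n s : ℤ) (d : ℕ), n ≤ d + s →
    HasFill (toSSet.map (lowerS W n (le_top : (s : WithTop ℤ) ≤ ⊤))) d Set.univ
  top_surj : ∀ (n s : ℤ), n + 1 ≤ s → ∀ x : (node W n s _⦋0⦌).X, ∃ y,
    ((lowerS W n (le_top : (s : WithTop ℤ) ≤ ⊤)).app _).toFun y = x
  subsingleton_n : ∀ (n s : WithTop ℤ), n < 0 → ∀ q, Subsingleton ((node W n s).obj q).X
  subsingleton_s : ∀ (n s : WithTop ℤ), s < 0 → ∀ q, Subsingleton ((node W n s).obj q).X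

end

theorem Lifts.of_subsingleton {K L : SSet.{u}} (p : K ⟶ L) {m d : SimplexCategory}
    {D : ∀ q : SimplexCategory, (q ⟶ m) → (q ⟶ d) → Prop} (hL : ∀ q, Subsingleton (L.obj q))
    (h : Lifts (Limits.terminal.from K) m d D) : Lifts p m d D := fun g b hg _ _ => by
  obtain ⟨G, h1, h2, -⟩ := h g (fun q z y => (Limits.terminal.from K).app _ (g q z y))
    hg (fun _ _ _ _ _ => Subsingleton.elim _ _) (fun _ _ _ _ => Subsingleton.elim _ _)
  exact ⟨G, h1, h2, fun _ _ _ => (hL _).elim _ _⟩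

theorem postnikovStage_subsingleton (K : PSSet.{u}) {n : WithTop ℤ} (hn : n < 0)
    (q : SimplexCategoryᵒᵖ) : Subsingleton ((postnikovStage K n).obj q).X := ⟨fun x y => by
  obtain ⟨x, rfl⟩ := toPostnikovStage_surjective (K := K) _ _ x
  obtain ⟨y, rfl⟩ := toPostnikovStage_surjective (K := K) _ _ y
  refine (postnikovStage_eq_iff _ _).2 fun k hk => ?_
  have : ((k.len : ℤ) : WithTop ℤ) < 0 := hk.trans_lt hn
  have : (k.len : ℤ) < 0 := by exact_mod_cast this
  omega⟩

theorem totStage_subsingleton (X : CosimplicialPSSet.{u}) {s : WithTop ℤ} (hs : s < 0)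
    (q : SimplexCategoryᵒᵖ) : Subsingleton ((totStage X s).obj q).X := ⟨fun x y => by
  refine TotSimplex.ext ?_
  funext m q σ ⟨k, hk, _⟩
  have : ((k.len : ℤ) : WithTop ℤ) < 0 := hk.trans_lt hs
  have : (k.len : ℤ) < 0 := by exact_mod_cast this
  omega⟩

theorem totStage_subsingleton' (X : CosimplicialPSSet.{u}) (s : WithTop ℤ)
    (hX : ∀ m q, Subsingleton ((X.obj m).obj q).X)
    (q : SimplexCategoryᵒᵖ) : Subsingleton ((totStage X s).obj q).X := ⟨fun x y => by
  refine TotSimplex.ext ?_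
  funext m q σ h τ
  exact (hX _ _).elim _ _⟩

theorem cosimplicialReplacement_subsingleton (X : CosimplicialPSSet.{u})
    (hX : ∀ m q, Subsingleton ((X.obj m).obj q).X) (m q) :
    Subsingleton (((cosimplicialReplacement.obj X).obj m).obj q).X :=
  ⟨fun _ _ => funext fun _ => (hX _ _).elim _ _⟩

theorem isGrid {X : CosimplicialPSSet.{u}} (hX : IsLevelKan X) : IsGrid (grid.obj X) := by
  have hsub : ∀ (n s : WithTop ℤ), n < 0 → ∀ q, Subsingleton ((node (grid.obj X) n s).obj q).X :=
    fun n s hn => totStage_subsingleton' _ _ (cosimplicialReplacement_subsingleton _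
        fun m q => postnikovStage_subsingleton _ hn q)
  -- lifting properties of `X(n)` over a point, with `X(min n (-1))` in the role of the point
  have hpt : ∀ (n s : ℤ) (d : ℕ), n + 1 ≤ d + s →
      ∀ r : ℕ, (s : WithTop ℤ) < (r : ℤ) → ((r : ℤ) : WithTop ℤ) ≤ ⊤ → ∀ i,
      Lifts (toSSet.map (((levelwisePostnikov.obj X).map
        (homOfLE (min_le_left (n : WithTop ℤ) (-1 : ℤ))).op).app i)) ⦋r⦌ ⦋d⦌
        (FacePair Set.univ Set.univ) := by
    intro n s d h r hr _ i
    have hr' : s < r := by exact_mod_cast hr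
    have := hX i
    have := postnikovStage_kan (K := X.obj i) (n : WithTop ℤ)
    refine Lifts.of_subsingleton _ (fun q => postnikovStage_subsingleton (X.obj i)
      (lt_of_le_of_lt (min_le_right _ _) (by exact_mod_cast (by norm_num : (-1 : ℤ) < 0))) q) ?_
    refine lifts_terminal_boundary (N := r + d) (postnikovStage_boundary ?_) r d rfl
    have h2 : n + 2 ≤ ((r + d : ℕ) : ℤ) := by push_cast; omega
    exact (WithTop.coe_le_coe.2 h2 : ((n + 2 : ℤ) : WithTop ℤ) ≤ ((r + d : ℕ) : ℤ))
  refine ⟨fun {n' n s' s} hn hs d k => tot_squareFill _ hs fun r _ _ i => ?_,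
    fun {n n' s s'} hn hs d hd => tot_squareFill _ hs fun r _ hr i => ?_,
    fun {n n' s s'} hn hs hd => tot_squareSurj _ hs fun r _ hr i => ?_,
    fun n s d hd => ?_, fun n s hd x => ?_, hsub, fun n s hs => totStage_subsingleton _ hs⟩
  · have := hX i
    have := postnikovMap_fibration (K := X.obj i) hn
    exact lifts_boundary_horn (postnikovMap (X.obj i) hn) r d k
  · refine lifts_boundary_boundary (postnikovMap (X.obj i) hn) r (d + 1) fun q hq =>
      postnikovMap_boundary hn ?_
    have hr' : (r : ℤ) ≤ s := by exact_mod_cast hr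
    exact_mod_cast (by omega : (q : ℤ) ≤ n' + 1)
  · refine lifts_boundary_boundary (postnikovMap (X.obj i) hn) r 0 fun q hq =>
      postnikovMap_boundary hn ?_
    have hr' : (r : ℤ) ≤ s := by exact_mod_cast hr
    exact_mod_cast (by omega : (q : ℤ) ≤ n' + 1)
  · refine (tot_squareFill _ (le_top : (s : WithTop ℤ) ≤ ⊤)
      (hpt n s (d + 1) (by push_cast; omega))).hasFill (hsub _ _ ?_) (hsub _ _ ?_) <;>
    exact lt_of_le_of_lt (min_le_right _ _) (by exact_mod_cast (by norm_num : (-1 : ℤ) < 0))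
  · have hneg : min (n : WithTop ℤ) (-1 : ℤ) < 0 :=
      lt_of_le_of_lt (min_le_right _ _) (by exact_mod_cast (by norm_num : (-1 : ℤ) < 0))
    obtain ⟨z, -, hz⟩ := tot_squareSurj _ (le_top : (s : WithTop ℤ) ≤ ⊤)
      (hpt n s 0 (by push_cast; omega)) ((node (grid.obj X) _ ⊤).obj _).point x
      ((hsub _ _ hneg _).elim _ _)
    exact ⟨z, hz⟩

/-! ### The towers of fibrations -/

theorem fibration_of_hasFill {K L : SSet.{u}} {p : K ⟶ L} (h : ∀ n k, HasFill p n {k}ᶜ) :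
    SSet.modelCategoryQuillen.J.rlp p :=
  (SSet.modelCategoryQuillen.fibration_iff p).1 (fibration_iff_hasFill.2 h)

theorem coe_neg_one_lt : ((-1 : ℤ) : WithTop ℤ) < 0 := by
  exact_mod_cast (by norm_num : (-1 : ℤ) < 0)

/-- The maps `Tot_t Π Y ⟶ Tot_s Π Y` are fibrations. -/
theorem tot_hasFill {Y : CosimplicialPSSet.{u}} (hY : IsLevelKan Y) {s t : WithTop ℤ} (hst : s ≤ t)
    {d : ℕ} (k : Fin (d + 2)) : HasFill
      (toSSet.map ((tot.obj (cosimplicialReplacement.obj Y)).map (homOfLE hst).op)) d {k}ᶜ := by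
  let p : Y ⟶ (levelwisePostnikov.obj Y).obj (op ((-1 : ℤ) : WithTop ℤ)) :=
    Functor.whiskerLeft Y toPostnikovTop ≫ (levelwisePostnikov.obj Y).map (homOfLE le_top).op
  have hsub : ∀ s q, Subsingleton (((tot.obj (cosimplicialReplacement.obj
      ((levelwisePostnikov.obj Y).obj (op ((-1 : ℤ) : WithTop ℤ))))).obj (op s)).obj q).X :=
    fun s => totStage_subsingleton' _ _ (cosimplicialReplacement_subsingleton _
      fun m q => postnikovStage_subsingleton _ coe_neg_one_lt q)
  refine (tot_squareFill p hst fun r _ _ i => ?_).hasFill (hsub _) (hsub _)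
  have := hY i
  exact Lifts.of_subsingleton _ (fun q => postnikovStage_subsingleton _ coe_neg_one_lt q)
    (lifts_boundary_horn _ r d k)

theorem tot_isFibrationTower {Y : CosimplicialPSSet.{u}} (hY : IsLevelKan Y) :
    (tot.obj (cosimplicialReplacement.obj Y)).IsFibrationTower where
  fibration s := fibration_of_hasFill fun d k =>
    tot_hasFill hY (WithTop.coe_le_coe.2 (by omega : s - 1 ≤ s)) k
  subsingleton s hs q := totStage_subsingleton _ (s := (s : WithTop ℤ)) (by exact_mod_cast hs) q
  limit q x hx := by
    change ∀ s : ℤ, TotSimplex (cosimplicialReplacement.obj Y) s q.unop at x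
    have hx' : ∀ (s : ℤ) (k : ℕ) (m q') (σ : q' ⟶ m) (h : InSkeleton (s : WithTop ℤ) σ) τ,
        (x (s + k)).toFun m q' σ (h.mono (by exact_mod_cast (by omega : s ≤ s + k))) τ =
          (x s).toFun m q' σ h τ := by
      intro s k
      induction k with
      | zero =>
        intro m q' σ h τ
        have : ∀ s' (e : s' = s) h', (x s').toFun m q' σ h' τ = (x s).toFun m q' σ h τ := by
          rintro s' rfl _; rfl
        exact this _ (by simp) _
      | succ k ih =>
        intro m q' σ h τ
        rw [← ih m q' σ h τ]
        have : ∀ s' (e : s' - 1 = s + k) (h1 : InSkeleton (s' : WithTop ℤ) σ)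
            (h2 : InSkeleton ((s + k : ℤ) : WithTop ℤ) σ),
            (x s').toFun m q' σ h1 τ = (x (s + k)).toFun m q' σ h2 τ := by
          intro s' e
          rw [← e]
          intro h1 h2
          exact congrArg (fun z : TotSimplex (cosimplicialReplacement.obj Y)
            ((s' - 1 : ℤ) : WithTop ℤ) q.unop => z.toFun m q' σ h2 τ) (hx s')
        exact this _ (by push_cast; ring) _ _
    have hsk : ∀ {m q' : SimplexCategory} (σ : q' ⟶ m),
        InSkeleton (((q'.len : ℕ) : ℤ) : WithTop ℤ) σ :=
      fun {m q'} σ => ⟨q', le_rfl, 𝟙 _, σ, by simp⟩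
    have hx2 : ∀ (s s' : ℤ) (m q') (σ : q' ⟶ m) (h : InSkeleton (s : WithTop ℤ) σ)
        (h' : InSkeleton (s' : WithTop ℤ) σ) τ,
        (x s).toFun m q' σ h τ = (x s').toFun m q' σ h' τ := by
      have key : ∀ (s s' : ℤ) (_ : s ≤ s') (m q') (σ : q' ⟶ m) (h : InSkeleton (s : WithTop ℤ) σ)
        (h' : InSkeleton (s' : WithTop ℤ) σ) τ,
        (x s).toFun m q' σ h τ = (x s').toFun m q' σ h' τ := by
        intro s s' hs m q' σ h h' τ
        obtain ⟨k, rfl⟩ := Int.le.dest hs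
        exact (hx' s k m q' σ h τ).symm
      intro s s' m q' σ h h' τ
      rcases le_total s s' with hs | hs
      · exact key s s' hs _ _ _ _ _ _
      · exact (key s' s hs _ _ _ _ _ _).symm
    -- every simplex over `q'` lies in the skeleton of dimension `q'.len`
    let y : TotSimplex (cosimplicialReplacement.obj Y) ⊤ q.unop :=
      { toFun := fun m q' σ _ τ => (x q'.len).toFun m q' σ (hsk σ) τ
        map_simplicial := fun m q' q'' θ σ h τ =>
          ((x q'.len).map_simplicial m q' q'' θ σ (hsk σ) τ).trans (hx2 _ _ _ _ _ _ _ _)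
        map_cosimplicial := fun m m' q' κ σ h τ =>
          (x q'.len).map_cosimplicial m m' q' κ σ (hsk σ) τ }
    refine ⟨y, fun s => TotSimplex.ext ?_, fun z hz => TotSimplex.ext ?_⟩
    · funext m q' σ h τ
      exact hx2 _ _ _ _ _ _ _ _
    · funext m q' σ h τ
      exact congrArg (fun z : TotSimplex (cosimplicialReplacement.obj Y)
        ((q'.len : ℤ) : WithTop ℤ) q.unop => z.toFun m q' σ (hsk σ) τ) (hz q'.len)

theorem postnikovTower_isFibrationTower {X : CosimplicialPSSet.{u}} (hX : IsLevelKan X) :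
    (postnikovTower.obj X).IsFibrationTower where
  fibration n := by
    refine fibration_of_hasFill fun d k => ?_
    exact ((isGrid hX).horn (WithTop.coe_le_coe.2 (by omega : n - 1 ≤ n))
      (le_top : ((-1 : ℤ) : WithTop ℤ) ≤ ⊤) d k).hasFill'
      ((isGrid hX).subsingleton_s _ _ coe_neg_one_lt)
      ((isGrid hX).subsingleton_s _ _ coe_neg_one_lt)
  subsingleton n hn q := (isGrid hX).subsingleton_n _ _ (by exact_mod_cast hn) q
  limit q x hx := by
    let P : WithTop ℤ → CosimplicialPSSet.{u} := fun n => (levelwisePostnikov.obj X).obj (op n)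
    change ∀ n : ℤ, TotSimplex (cosimplicialReplacement.obj (P n)) ⊤ q.unop at x
    -- the limit is computed simplexwise, since `X(⊤)` agrees with `X(n)` in dimensions up to `n`
    let pr : ∀ (n : WithTop ℤ) (i : SimplexCategory) (q' : SimplexCategory),
        (((P ⊤).obj i).obj (op q')).X → (((P n).obj i).obj (op q')).X := fun n i q' =>
      (postnikovMap (X.obj i) (le_top : n ≤ ⊤)).app (op q')
    let dn : ∀ (n : ℤ) (i q' : SimplexCategory),
        (((P n).obj i).obj (op q')).X → (((P (n - 1 : ℤ)).obj i).obj (op q')).X := fun n i q' =>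
      (postnikovMap (X.obj i) (WithTop.coe_le_coe.2 (by omega : n - 1 ≤ n))).app (op q')
    have pr_step : ∀ (n : ℤ) (i q' : SimplexCategory) w,
        dn n i q' (pr n i q' w) = pr ((n - 1 : ℤ) : WithTop ℤ) i q' w := by
      intro n i q' w
      obtain ⟨w, rfl⟩ := toPostnikovStage_surjective (K := X.obj i) _ _ w
      rfl
    have pr_bij : ∀ (n : ℤ) (i q' : SimplexCategory), (q'.len : ℤ) ≤ n →
        Function.Bijective (pr n i q') := by
      intro n i q' h
      constructor
      · intro v w hvw
        obtain ⟨v, rfl⟩ := toPostnikovStage_surjective (K := X.obj i) _ _ v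
        obtain ⟨w, rfl⟩ := toPostnikovStage_surjective (K := X.obj i) _ _ w
        exact congrArg _ (toPostnikovStage_injective (n := (n : WithTop ℤ))
          (WithTop.coe_le_coe.2 h) hvw)
      · intro v
        obtain ⟨v, rfl⟩ := toPostnikovStage_surjective (K := X.obj i) _ _ v
        exact ⟨(toPostnikovStage (X.obj i) ⊤).app _ v, rfl⟩
    have pr_surj : ∀ (q' i : SimplexCategory) v, ∃ w, pr ((q'.len : ℤ) : WithTop ℤ) i q' w = v :=
      fun q' i v => (pr_bij q'.len i q' le_rfl).2 v
    choose Y hY using fun m q' (σ : q' ⟶ m) τ c => pr_surj q' _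
      ((x q'.len).toFun m q' σ ⟨q', le_top, 𝟙 _, σ, by simp⟩ τ c)
    have hxs : ∀ (n : ℤ) m q' (σ : q' ⟶ m) h τ c,
        dn n _ q' ((x n).toFun m q' σ h τ c) = (x (n - 1)).toFun m q' σ h τ c :=
      fun n m q' σ h τ c => congrFun (congrArg (fun z : TotSimplex
        (cosimplicialReplacement.obj (P (n - 1 : ℤ))) ⊤ q.unop => z.toFun m q' σ h τ) (hx n)) c
    -- `Y` lifts the component at `n = q'.len`; it lifts all the others by induction in both
    -- directions
    have up : ∀ (k : ℕ) m q' (σ : q' ⟶ m) h τ c,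
        pr ((q'.len + k : ℤ) : WithTop ℤ) _ q' (Y m q' σ τ c) =
          (x (q'.len + k)).toFun m q' σ h τ c := by
      intro k
      induction k with
      | zero =>
        intro m q' σ h τ c
        have : ∀ (n : ℤ) (e : n = q'.len),
            pr (n : WithTop ℤ) _ q' (Y m q' σ τ c) = (x n).toFun m q' σ h τ c := by
          rintro _ rfl
          exact hY m q' σ τ c
        exact this _ (by simp)
      | succ k ih =>
        intro m q' σ h τ c
        have : ∀ n : ℤ, n - 1 = q'.len + k →
            pr (n : WithTop ℤ) _ q' (Y m q' σ τ c) = (x n).toFun m q' σ h τ c := by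
          intro n e
          have ih' : pr ((n - 1 : ℤ) : WithTop ℤ) _ q' (Y m q' σ τ c) =
            (x (n - 1)).toFun m q' σ h τ c := by
            rw [e]; exact ih m q' σ h τ c
          obtain ⟨w, hw⟩ := (pr_bij n _ q' (by omega)).2 ((x n).toFun m q' σ h τ c)
          rw [← hw]
          refine congrArg _ ((pr_bij (n - 1) _ q' (by omega)).1 ?_)
          rw [ih', ← pr_step, hw]
          exact (hxs n m q' σ h τ c).symm
        exact this _ (by push_cast; ring)
    have all : ∀ (n : ℤ) m q' (σ : q' ⟶ m) h τ c,
        pr (n : WithTop ℤ) _ q' (Y m q' σ τ c) = (x n).toFun m q' σ h τ c := by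
      intro n m q' σ h τ c
      rcases le_total (q'.len : ℤ) n with hn | hn
      · obtain ⟨k, rfl⟩ := Int.le.dest hn
        exact up k m q' σ h τ c
      · induction n, hn using Int.leInductionDown with
        | base => exact hY m q' σ τ c
        | pred n hn ih => rw [← pr_step, ih, ← hxs]
    let y : TotSimplex (cosimplicialReplacement.obj (P ⊤)) ⊤ q.unop :=
      { toFun := fun m q' σ _ τ => Y m q' σ τ
        map_simplicial := fun m q' q'' θ σ h τ => funext fun c => by
          refine (pr_bij (max q'.len q''.len) _ q'' (le_max_right _ _)).1 ?_
          refine Eq.trans ?_ (all _ _ _ _ (h.precomp θ) _ _).symm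
          refine (NatTrans.naturality_apply (postnikovMap (X.obj _) le_top) θ.op _).trans ?_
          refine (congrArg _ (all _ _ _ _ h _ _)).trans ?_
          exact congrFun ((x _).map_simplicial m q' q'' θ σ h τ) c
        map_cosimplicial := fun m m' q' κ σ h τ => funext fun c => by
          refine (pr_bij q'.len _ q' le_rfl).1 ?_
          refine Eq.trans ?_ (all _ _ _ _ (h.postcomp κ) _ _).symm
          refine Eq.trans ?_ (congrFun ((x q'.len).map_cosimplicial m m' q' κ σ h τ) c)
          refine Eq.trans ?_ (congrArg _ (all _ _ _ _ h _ _))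
          exact app_congr (((levelwisePostnikov.obj X).map (homOfLE
            (le_top : ((q'.len : ℤ) : WithTop ℤ) ≤ ⊤)).op).naturality (chainLast κ c)) (op q') _ }
    refine ⟨y, fun n => TotSimplex.ext ?_, fun z hz => TotSimplex.ext ?_⟩
    · funext m q' σ h τ c
      exact all _ _ _ _ _ _ _
    · funext m q' σ h τ c
      refine (pr_bij q'.len _ q' le_rfl).1 ?_
      refine Eq.trans ?_ (all _ _ _ _ h _ _).symm
      exact congrFun (congrArg (fun z : TotSimplex (cosimplicialReplacement.obj
        (P (q'.len : ℤ))) ⊤ q.unop => z.toFun m q' σ h τ) (hz q'.len)) c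

/-! ### Homotopy groups of pointed Kan complexes -/

/-- The face `j` of a simplex, for a natural number `j`; the base point if `j` is out of range, so
that the simplicial identities and their use for spherical simplices need no bounds. -/
def face (K : PSSet.{u}) {n : ℕ} (j : ℕ) (x : (K _⦋n + 1⦌).X) : (K _⦋n⦌).X :=
  if h : j < n + 2 then (K.δ ⟨j, h⟩).toFun x else (K _⦋n⦌).point

section
variable {K L : PSSet.{u}} {n : ℕ}

theorem face_eq (j : Fin (n + 2)) (x : (K _⦋n + 1⦌).X) : face K j x = (K.δ j).toFun x :=
  dif_pos j.2

theorem face_eq' {j : ℕ} (hj : j < n + 2) (x : (K _⦋n + 1⦌).X) :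
    face K j x = (K.δ ⟨j, hj⟩).toFun x :=
  dif_pos hj

theorem face_of_le {j : ℕ} (hj : n + 2 ≤ j) (x : (K _⦋n + 1⦌).X) :
    face K j x = (K _⦋n⦌).point :=
  dif_neg (not_lt.2 hj)

@[simp]
theorem face_point (j : ℕ) : face K j (K _⦋n + 1⦌).point = (K _⦋n⦌).point := by
  unfold face
  split_ifs with h
  · exact (K.δ _).map_point
  · rfl

theorem app_face (f : K ⟶ L) (j : ℕ) (x : (K _⦋n + 1⦌).X) :
    (f.app _).toFun (face K j x) = face L j ((f.app _).toFun x) := by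
  unfold face
  split_ifs with h
  · exact app_map f _ x
  · exact (f.app _).map_point

theorem face_face {a b : ℕ} (hab : a ≤ b) (x : (K _⦋n + 2⦌).X) :
    face K a (face K (b + 1) x) = face K b (face K a x) := by
  by_cases hb : b < n + 2
  · have hb' : b + 1 < n + 3 := by omega
    rw [face_eq' hb', face_eq' (by omega : a < n + 2), face_eq' hb, face_eq' (by omega : a < n + 3)]
    have := SimplicialObject.δ_comp_δ K (n := n) (i := ⟨a, by omega⟩) (j := ⟨b, hb⟩) hab
    exact congrFun (congrArg Pointed.Hom.toFun this) x
  · rw [face_of_le (by omega : n + 2 ≤ b), face_of_le (by omega : n + 3 ≤ b + 1), face_point]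

theorem IsSpherical.map_misses {x : (K _⦋n⦌).X} (hx : IsSpherical K n x) {m : SimplexCategory}
    {f : m ⟶ ⦋n⦌} {j : Fin (n + 1)} (hf : Misses f j) :
    (K.map f.op).toFun x = (K.obj (op m)).point := by
  cases n with
  | zero => exact (not_misses_zero f j hf).elim
  | succ n =>
    obtain ⟨g, rfl⟩ := hf.exists_eq
    have h1 : (K.map (SimplexCategory.δ j).op).toFun x = _ := hx ⦋n⦌ _ (Nat.lt_succ_self n)
    have h2 := congrArg (K.map g.op).toFun h1
    rw [(K.map g.op).map_point] at h2
    refine Eq.trans ?_ h2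
    simp

theorem IsSpherical.face {x : (K _⦋n + 1⦌).X} (hx : IsSpherical K (n + 1) x) (j : ℕ) :
    face K j x = (K _⦋n⦌).point := by
  unfold CosimplicialSpace.face
  split_ifs with h
  · exact hx _ _ (Nat.lt_succ_self n)
  · rfl

theorem isSpherical_of_face {x : (K _⦋n + 1⦌).X} (hx : ∀ j, face K j x = (K _⦋n⦌).point) :
    IsSpherical K (n + 1) x := by
  intro m f hf
  have : InSk (n + 1) f := ⟨m, hf, 𝟙 _, f, by simp⟩
  obtain ⟨j, hj⟩ := this.exists_misses
  obtain ⟨g, rfl⟩ := hj.exists_eq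
  have h1 := hx j
  rw [face_eq] at h1
  have h2 := congrArg (K.map g.op).toFun h1
  rw [(K.map g.op).map_point] at h2
  refine Eq.trans ?_ h2
  simp [SimplicialObject.δ]

theorem isSpherical_point : IsSpherical K n (K _⦋n⦌).point := (Spherical.base K n).2

theorem isSpherical_zero (x : (K _⦋0⦌).X) : IsSpherical K 0 x := fun _ _ h =>
  (Nat.not_lt_zero _ h).elim

theorem IsSpherical.app {x : (K _⦋n⦌).X} (hx : IsSpherical K n x) (f : K ⟶ L) :
    IsSpherical L n ((f.app _).toFun x) := (Spherical.map f ⟨x, hx⟩).2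

theorem faceCompat_of_isSpherical {S : Set (Fin (n + 2))} {y : Fin (n + 2) → (K _⦋n⦌).X}
    (hy : ∀ j ∈ S, IsSpherical K n (y j)) : FaceCompat (K := toSSet.obj K) S y := by
  intro i hi j hj m f g hfg
  by_cases hij : i = j
  · subst hij
    rw [(cancel_mono _).1 hfg]
  · have aux : ∀ {i j : Fin (n + 2)}, i ≠ j → ∀ {f g : m ⟶ ⦋n⦌},
        f ≫ SimplexCategory.δ i = g ≫ SimplexCategory.δ j → ∃ k, Misses f k := by
      intro i j hij f g hfg
      obtain ⟨k, hk⟩ := Fin.exists_succAbove_eq (Ne.symm hij)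
      refine ⟨k, fun t ht => ?_⟩
      have h1 : (f ≫ SimplexCategory.δ i).toOrderHom t = j := by
        change i.succAbove (f.toOrderHom t) = j
        rw [ht, hk]
      rw [hfg] at h1
      exact Fin.succAbove_ne j _ h1
    obtain ⟨k, hk⟩ := aux hij hfg
    obtain ⟨l, hl⟩ := aux (Ne.symm hij) hfg.symm
    exact ((hy i hi).map_misses hk).trans ((hy j hj).map_misses hl).symm

theorem face_σ_self (j : Fin (n + 1)) (x : (K _⦋n⦌).X) : face K j ((K.σ j).toFun x) = x := by
  have h := face_eq (K := K) j.castSucc ((K.σ j).toFun x)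
  refine (Fin.val_castSucc j ▸ h).trans ?_
  exact congrFun (congrArg Pointed.Hom.toFun (SimplicialObject.δ_comp_σ_self K (i := j))) x

theorem face_σ_succ (j : Fin (n + 1)) (x : (K _⦋n⦌).X) : face K (j + 1) ((K.σ j).toFun x) = x := by
  have h := face_eq (K := K) j.succ ((K.σ j).toFun x)
  refine (Fin.val_succ j ▸ h).trans ?_
  exact congrFun (congrArg Pointed.Hom.toFun (SimplicialObject.δ_comp_σ_succ K (i := j))) x

theorem IsSpherical.face_σ {x : (K _⦋n⦌).X} (hx : IsSpherical K n x) (j : Fin (n + 1)) {t : ℕ}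
    (h1 : t ≠ j) (h2 : t ≠ j + 1) :
    CosimplicialSpace.face K t ((K.σ j).toFun x) = (K _⦋n⦌).point := by
  by_cases ht : t < n + 2
  · rw [face_eq' ht]
    let t' : Fin (n + 2) := ⟨t, ht⟩
    have hninj : ¬ Function.Injective
        (SimplexCategory.δ t' ≫ SimplexCategory.σ j).toOrderHom := by
      intro hinj
      obtain ⟨k, hk⟩ := Fin.exists_succAbove_eq (x := j.castSucc) (y := t')
        (by intro h; exact h1 (congrArg Fin.val h).symm)
      obtain ⟨l, hl⟩ := Fin.exists_succAbove_eq (x := j.succ) (y := t')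
        (by intro h; exact h2 (by simpa using (congrArg Fin.val h).symm))
      have hkl : k = l := hinj (by
        change j.predAbove (t'.succAbove k) = j.predAbove (t'.succAbove l)
        rw [hk, hl]; simp)
      subst hkl
      rw [hk] at hl
      exact (Fin.castSucc_lt_succ (i := j)).ne hl
    have hsurj := fun h => hninj (Finite.injective_iff_surjective.2 h)
    obtain ⟨k, hk⟩ := not_forall.1 hsurj
    have hk := not_exists.1 hk
    refine Eq.trans ?_ (hx.map_misses (f := SimplexCategory.δ t' ≫ SimplexCategory.σ j) (j := k) hk)
    simp [SimplicialObject.δ, SimplicialObject.σ, t']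
  · exact face_of_le (by omega) _

/-- Horn filling with natural numbers as indices of the faces. -/
theorem exists_fill_nat {A B : PSSet.{u}} {p : A ⟶ B} {n k : ℕ} (hk : k < n + 3)
    (hp : HasFill (toSSet.map p) (n + 1) {⟨k, hk⟩}ᶜ)
    (G : ℕ → (A _⦋n + 1⦌).X)
    (hG : ∀ a b, a ≤ b → b < n + 2 → a ≠ k → b + 1 ≠ k → face A a (G (b + 1)) = face A b (G a))
    (w : (B _⦋n + 2⦌).X) (hw : ∀ a < n + 3, a ≠ k → face B a w = (p.app _).toFun (G a)) :
    ∃ z : (A _⦋n + 2⦌).X, (p.app _).toFun z = w ∧ ∀ a < n + 3, a ≠ k → face A a z = G a := by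
  obtain ⟨z, h1, h2⟩ := hp (fun j => G j) (FaceCompat.of_le fun i j hij hi hj => by
    have h := hG i j hij j.2 (fun h => hi (Fin.ext h)) (fun h => hj (Fin.ext (by simpa using h)))
    rw [face_eq, face_eq] at h
    exact h) w (fun j hj => by
    have h := hw j j.2 (fun h => hj (Fin.ext h))
    rw [face_eq] at h
    exact h)
  refine ⟨z, h2, fun a ha hak => ?_⟩
  exact (face_eq' ha _).trans (h1 ⟨a, ha⟩ (fun h => hak (congrArg Fin.val h)))

theorem SquareFill.exists_fill {A B C D : PSSet.{u}} {f : A ⟶ B} {h : A ⟶ C} {k : B ⟶ D}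
    {g : C ⟶ D} {S : Set (Fin (n + 2))} (H : SquareFill f h k g n S) (G : ℕ → (A _⦋n⦌).X)
    (hG : ∀ j, IsSpherical A n (G j)) (b : (B _⦋n + 1⦌).X) (c : (C _⦋n + 1⦌).X)
    (hbc : (k.app _).toFun b = (g.app _).toFun c)
    (hb : ∀ j (hj : j < n + 2), ⟨j, hj⟩ ∈ S → face B j b = (f.app _).toFun (G j))
    (hc : ∀ j (hj : j < n + 2), ⟨j, hj⟩ ∈ S → face C j c = (h.app _).toFun (G j)) :
    ∃ z : (A _⦋n + 1⦌).X, (∀ j (hj : j < n + 2), ⟨j, hj⟩ ∈ S → face A j z = G j) ∧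
      (f.app _).toFun z = b ∧ (h.app _).toFun z = c := by
  obtain ⟨z, h1, h2⟩ := H (fun j => G j) (faceCompat_of_isSpherical fun j _ => hG j) b c hbc
    (fun j hj => (face_eq j b).symm.trans (hb j j.2 hj))
    (fun j hj => (face_eq j c).symm.trans (hc j j.2 hj))
  exact ⟨z, fun j hj hS => (face_eq' hj z).trans (h1 ⟨j, hj⟩ hS), h2⟩

theorem HasFill.exists_fill {A B : PSSet.{u}} {f : A ⟶ B} {S : Set (Fin (n + 2))}
    (H : HasFill (toSSet.map f) n S) (G : ℕ → (A _⦋n⦌).X)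
    (hG : ∀ j, IsSpherical A n (G j)) (b : (B _⦋n + 1⦌).X)
    (hb : ∀ j (hj : j < n + 2), ⟨j, hj⟩ ∈ S → face B j b = (f.app _).toFun (G j)) :
    ∃ z : (A _⦋n + 1⦌).X, (∀ j (hj : j < n + 2), ⟨j, hj⟩ ∈ S → face A j z = G j) ∧
      (f.app _).toFun z = b := by
  obtain ⟨z, h1, h2⟩ := H (fun j => G j) (faceCompat_of_isSpherical fun j _ => hG j) b
    (fun j hj => (face_eq j b).symm.trans (hb j j.2 hj))
  exact ⟨z, fun j hj hS => (face_eq' hj z).trans (h1 ⟨j, hj⟩ hS), h2⟩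

/-- The face which is missing from a family of spherical faces is spherical. -/
theorem isSpherical_missing_face {z : (K _⦋n + 1⦌).X} {k : ℕ}
    (h : ∀ j < n + 2, j ≠ k → IsSpherical K n (face K j z)) : IsSpherical K n (face K k z) := by
  cases n with
  | zero => exact isSpherical_zero _
  | succ n =>
    have h' : ∀ j, j ≠ k → IsSpherical K (n + 1) (face K j z) := by
      intro j hj
      by_cases hjn : j < n + 3
      · exact h j hjn hj
      · rw [face_of_le (by omega)]
        exact isSpherical_point
    refine isSpherical_of_face fun j => ?_
    rcases lt_or_ge j k with hj | hj
    · obtain ⟨k, rfl⟩ : ∃ k', k = k' + 1 := ⟨k - 1, by omega⟩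
      rw [face_face (by omega)]
      exact (h' j (by omega)).face k
    · rw [← face_face hj]
      exact (h' (j + 1) (by omega)).face k

/-- `e` is a homotopy from `x` to `y`: an `(n + 1)`-simplex with faces `0` and `1` equal to `x`
and `y`, and the other faces equal to the base point. -/
structure IsEdge (K : PSSet.{u}) {n : ℕ} (x y : (K _⦋n⦌).X) (e : (K _⦋n + 1⦌).X) : Prop where
  zero : face K 0 e = x
  one : face K 1 e = y
  other : ∀ j, 1 < j → face K j e = (K _⦋n⦌).point

theorem IsEdge.app {x y : (K _⦋n⦌).X} {e : (K _⦋n + 1⦌).X} (h : IsEdge K x y e) (f : K ⟶ L) :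
    IsEdge L ((f.app _).toFun x) ((f.app _).toFun y) ((f.app _).toFun e) :=
  ⟨by rw [← app_face, h.zero], by rw [← app_face, h.one],
    fun j hj => by rw [← app_face, h.other j hj]; exact (f.app _).map_point⟩

theorem Spherical.homotopic_iff {x y : Spherical K n} :
    x.Homotopic y ↔ ∃ e, IsEdge K x.1 y.1 e := by
  constructor
  · rintro ⟨e, h0, h1, h⟩
    refine ⟨e, (face_eq 0 e).trans h0, (face_eq' (by omega : 1 < n + 2) e).trans h1,
      fun j hj => ?_⟩
    by_cases hjn : j < n + 2
    · exact (face_eq' hjn e).trans (h ⟨j, hjn⟩ hj)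
    · exact face_of_le (by omega) e
  · rintro ⟨e, h⟩
    exact ⟨e, (face_eq 0 e).symm.trans h.zero, (face_eq' (by omega : 1 < n + 2) e).symm.trans h.one,
      fun j hj => (face_eq j e).symm.trans (h.other j hj)⟩

theorem IsSpherical.isEdge_refl {x : (K _⦋n⦌).X} (hx : IsSpherical K n x) :
    IsEdge K x x ((K.σ 0).toFun x) :=
  ⟨face_σ_self 0 x, face_σ_succ 0 x, fun j hj => hx.face_σ 0 (by simp; omega) (by simp; omega)⟩

/-- Homotopies `e₀ : x ∼ y`, `e₁ : x ∼ z` and `e₂ : y ∼ z` are the faces of a simplex, if two of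
them are given; `k` is the index of the third one. -/
theorem exists_edge_fill {A B : PSSet.{u}} {p : A ⟶ B} (hp : ∀ n k, HasFill (toSSet.map p) n {k}ᶜ)
    {x y z : (A _⦋n⦌).X} (k : ℕ) (hk : k < 3) (e₀ e₁ e₂ : (A _⦋n + 1⦌).X)
    (h₀ : k ≠ 0 → IsEdge A x y e₀) (h₁ : k ≠ 1 → IsEdge A x z e₁) (h₂ : k ≠ 2 → IsEdge A y z e₂)
    (w : (B _⦋n + 2⦌).X) (hw₀ : k ≠ 0 → face B 0 w = (p.app _).toFun e₀)
    (hw₁ : k ≠ 1 → face B 1 w = (p.app _).toFun e₁)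
    (hw₂ : k ≠ 2 → face B 2 w = (p.app _).toFun e₂)
    (hw : ∀ j, 2 < j → face B j w = (B _⦋n + 1⦌).point) :
    ∃ v : (A _⦋n + 2⦌).X, (p.app _).toFun v = w ∧ IsEdge A x y (face A 0 v) ∧
      IsEdge A x z (face A 1 v) ∧ IsEdge A y z (face A 2 v) := by
  let G : ℕ → (A _⦋n + 1⦌).X := fun j =>
    if j = 0 then e₀ else if j = 1 then e₁ else if j = 2 then e₂ else (A _⦋n + 1⦌).point
  have G3 : ∀ j, 2 < j → G j = (A _⦋n + 1⦌).point := fun j hj => by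
    simp only [G]; rw [if_neg (by omega), if_neg (by omega), if_neg (by omega)]
  obtain ⟨v, hv, hv'⟩ := exists_fill_nat (p := p) (k := k) (by omega : k < n + 3) (hp _ _) G (by
    intro a b hab hb ha hbk
    have hx : face A 0 (G 1) = face A 0 (G 0) ∨ k = 0 ∨ k = 1 := by
      by_cases h0 : k = 0; · exact Or.inr (Or.inl h0)
      by_cases h1 : k = 1; · exact Or.inr (Or.inr h1)
      exact Or.inl ((h₁ h1).zero.trans (h₀ h0).zero.symm)
    have hy : face A 0 (G 2) = face A 1 (G 0) ∨ k = 0 ∨ k = 2 := by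
      by_cases h0 : k = 0; · exact Or.inr (Or.inl h0)
      by_cases h1 : k = 2; · exact Or.inr (Or.inr h1)
      exact Or.inl ((h₂ h1).zero.trans (h₀ h0).one.symm)
    have hz : face A 1 (G 2) = face A 1 (G 1) ∨ k = 1 ∨ k = 2 := by
      by_cases h0 : k = 1; · exact Or.inr (Or.inl h0)
      by_cases h1 : k = 2; · exact Or.inr (Or.inr h1)
      exact Or.inl ((h₂ h1).one.trans (h₁ h0).one.symm)
    have hpt : ∀ c, c ≠ k → ∀ b, 1 < b → face A b (G c) = (A _⦋n⦌).point := by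
      intro c hc b hb
      rcases (by omega : c = 0 ∨ c = 1 ∨ c = 2 ∨ 2 < c) with rfl | rfl | rfl | h
      · exact (h₀ (Ne.symm hc)).other b hb
      · exact (h₁ (Ne.symm hc)).other b hb
      · exact (h₂ (Ne.symm hc)).other b hb
      · rw [G3 c h, face_point]
    rcases (by omega : (a = 0 ∧ b = 0) ∨ (a = 0 ∧ b = 1) ∨ (a = 1 ∧ b = 1) ∨ 1 < b) with
      ⟨rfl, rfl⟩ | ⟨rfl, rfl⟩ | ⟨rfl, rfl⟩ | h
    · exact hx.resolve_right (by omega)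
    · exact hy.resolve_right (by omega)
    · exact hz.resolve_right (by omega)
    · rw [hpt a ha b h, G3 (b + 1) (by omega), face_point]) w (by
    intro a _ hak
    rcases (by omega : a = 0 ∨ a = 1 ∨ a = 2 ∨ 2 < a) with rfl | rfl | rfl | h
    · exact hw₀ (Ne.symm hak)
    · exact hw₁ (Ne.symm hak)
    · exact hw₂ (Ne.symm hak)
    · rw [hw a h, G3 a h]
      exact ((p.app _).map_point).symm)
  have hv3 : ∀ j, 2 < j → face A j v = (A _⦋n + 1⦌).point := by
    intro j hj
    by_cases hjn : j < n + 3
    · rw [hv' j hjn (by omega), G3 j hj]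
    · exact face_of_le (by omega) v
  have hother : ∀ c, c < 3 → ∀ j, 1 < j → face A j (face A c v) = (A _⦋n⦌).point := by
    intro c hc j hj
    rw [← face_face (by omega), hv3 _ (by omega), face_point]
  have g0 : k ≠ 0 → face A 0 v = e₀ := fun h => hv' 0 (by omega) (Ne.symm h)
  have g1 : k ≠ 1 → face A 1 v = e₁ := fun h => hv' 1 (by omega) (Ne.symm h)
  have g2 : k ≠ 2 → face A 2 v = e₂ := fun h => hv' 2 (by omega) (Ne.symm h)
  have i0 : face A 0 (face A 1 v) = face A 0 (face A 0 v) := face_face le_rfl v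
  have i1 : face A 0 (face A 2 v) = face A 1 (face A 0 v) := face_face (by omega) v
  have i2 : face A 1 (face A 2 v) = face A 1 (face A 1 v) := face_face le_rfl v
  have r0 : face A 0 (face A 0 v) = x := by
    by_cases h : k = 0
    · rw [← i0, g1 (by omega)]; exact (h₁ (by omega)).zero
    · rw [g0 h]; exact (h₀ h).zero
  have r1 : face A 1 (face A 0 v) = y := by
    by_cases h : k = 0
    · rw [← i1, g2 (by omega)]; exact (h₂ (by omega)).zero
    · rw [g0 h]; exact (h₀ h).one
  have r2 : face A 1 (face A 1 v) = z := by
    by_cases h : k = 1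
    · rw [← i2, g2 (by omega)]; exact (h₂ (by omega)).one
    · rw [g1 h]; exact (h₁ h).one
  exact ⟨v, hv, ⟨r0, r1, hother 0 (by omega)⟩, ⟨i0.trans r0, r2, hother 1 (by omega)⟩,
    ⟨i1.trans r1, i2.trans r2, hother 2 (by omega)⟩⟩

end

/-- The point. -/
def pointPSSet : PSSet.{u} := (Functor.const _).obj (Pointed.of PUnit.unit)

/-- The map to the point. -/
def toPoint (K : PSSet.{u}) : K ⟶ pointPSSet where
  app _ := ⟨fun _ => PUnit.unit, rfl⟩
  naturality _ _ _ := rfl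

instance subsingleton_pointPSSet (q : SimplexCategoryᵒᵖ) : Subsingleton (pointPSSet.{u}.obj q).X :=
  inferInstanceAs (Subsingleton PUnit)

/-- Kan fibrations, in terms of simplices. -/
def IsFib {A B : PSSet.{u}} (p : A ⟶ B) : Prop := ∀ n k, HasFill (toSSet.map p) n {k}ᶜ

/-- Kan complexes, in terms of simplices. -/
def IsKan (K : PSSet.{u}) : Prop := IsFib (toPoint K)

theorem IsFib.of_subsingleton {A B : PSSet.{u}} {p : A ⟶ B} (hp : IsFib p)
    (hB : ∀ q, Subsingleton (B.obj q).X) : IsKan A := fun n k y hy x _ => by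
  obtain ⟨z, hz, -⟩ := hp n k y hy (B.obj _).point fun _ _ => (hB _).elim _ _
  exact ⟨z, hz, Subsingleton.elim (α := (pointPSSet.{u}.obj (op ⦋n + 1⦌)).X) _ _⟩

theorem IsFib.fiber {A B : PSSet.{u}} {p : A ⟶ B} (hp : IsFib p) :
    IsKan (fiber p) := fun n k y hy x _ => by
  obtain ⟨z, hz, hz'⟩ := hp n k (fun j => (y j).1)
    (fun i hi j hj m f g h => congrArg Subtype.val (hy i hi j hj m f g h)) (B.obj _).point
    (fun j hj => ((B.δ j).map_point).trans (y j).2.symm)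
  exact ⟨⟨z, hz'⟩, fun j hj => Subtype.ext (hz j hj),
    Subsingleton.elim (α := (pointPSSet.{u}.obj (op ⦋n + 1⦌)).X) _ _⟩

section

variable {K L : PSSet.{u}} {n : ℕ}

theorem IsKan.exists_edge_fill (hK : IsKan K) {x y z : (K _⦋n⦌).X} (k : ℕ) (hk : k < 3)
    (e₀ e₁ e₂ : (K _⦋n + 1⦌).X)
    (h₀ : k ≠ 0 → IsEdge K x y e₀) (h₁ : k ≠ 1 → IsEdge K x z e₁) (h₂ : k ≠ 2 → IsEdge K y z e₂) :
    ∃ v : (K _⦋n + 2⦌).X, IsEdge K x y (face K 0 v) ∧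
      IsEdge K x z (face K 1 v) ∧ IsEdge K y z (face K 2 v) := by
  obtain ⟨v, -, hv⟩ := CosimplicialSpace.exists_edge_fill hK k hk e₀ e₁ e₂ h₀ h₁ h₂
    (pointPSSet.obj _).point (fun _ => Subsingleton.elim _ _) (fun _ => Subsingleton.elim _ _)
    (fun _ => Subsingleton.elim _ _) (fun _ _ => Subsingleton.elim _ _)
  exact ⟨v, hv⟩

theorem IsKan.edge_symm (hK : IsKan K) {x y : (K _⦋n⦌).X} (hx : IsSpherical K n x)
    {e : (K _⦋n + 1⦌).X} (h : IsEdge K x y e) : ∃ e', IsEdge K y x e' := by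
  obtain ⟨v, -, -, hv⟩ := hK.exists_edge_fill 2 (by omega) e _ e (fun _ => h)
    (fun _ => hx.isEdge_refl) (fun h => (h rfl).elim)
  exact ⟨_, hv⟩

theorem IsKan.edge_trans (hK : IsKan K) {x y z : (K _⦋n⦌).X} {e e' : (K _⦋n + 1⦌).X}
    (h : IsEdge K x y e) (h' : IsEdge K y z e') : ∃ e', IsEdge K x z e' := by
  obtain ⟨v, -, hv, -⟩ := hK.exists_edge_fill 1 (by omega) e e e' (fun _ => h)
    (fun h => (h rfl).elim) (fun _ => h')
  exact ⟨_, hv⟩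

theorem IsKan.mk_eq_iff (hK : IsKan K) {x y : Spherical K n} :
    Htpy.mk x = Htpy.mk y ↔ ∃ e, IsEdge K x.1 y.1 e := by
  have heq : Equivalence (Spherical.Homotopic (K := K) (i := n)) := by
    refine ⟨fun x => Spherical.homotopic_iff.2 ⟨_, x.2.isEdge_refl⟩, fun {x y} h => ?_,
      fun {x y z} h h' => ?_⟩
    · obtain ⟨e, he⟩ := Spherical.homotopic_iff.1 h
      exact Spherical.homotopic_iff.2 (hK.edge_symm x.2 he)
    · obtain ⟨e, he⟩ := Spherical.homotopic_iff.1 h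
      obtain ⟨e', he'⟩ := Spherical.homotopic_iff.1 h'
      exact Spherical.homotopic_iff.2 (hK.edge_trans he he')
  rw [← Spherical.homotopic_iff]
  exact (Quot.eq).trans heq.eqvGen_iff

theorem Htpy.exists_mk (a : Htpy K n) : ∃ x, Htpy.mk x = a := Quot.exists_rep a

theorem exists_isEdge_of_fill {f : K ⟶ L} (hf : HasFill (toSSet.map f) n Set.univ)
    {x y : (K _⦋n⦌).X} (hx : IsSpherical K n x) (hy : IsSpherical K n y) {e : (L _⦋n + 1⦌).X}
    (he : IsEdge L ((f.app _).toFun x) ((f.app _).toFun y) e) :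
    ∃ e', IsEdge K x y e' ∧ (f.app _).toFun e' = e := by
  obtain ⟨e', h, h'⟩ := hf.exists_fill (fun j => if j = 0 then x else if j = 1 then y else
    (K _⦋n⦌).point) (fun j => by split_ifs; exacts [hx, hy, isSpherical_point]) e (fun j hj _ => by
      split_ifs with h0 h1
      · rw [h0, he.zero]
      · rw [h1, he.one]
      · exact (he.other j (by omega)).trans (f.app _).map_point.symm)
  refine ⟨e', ⟨(h 0 (by omega) trivial), (h 1 (by omega) trivial), fun j hj => ?_⟩, h'⟩
  by_cases hjn : j < n + 2
  · exact (h j hjn trivial).trans (by rw [if_neg (by omega), if_neg (by omega)])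
  · exact face_of_le (by omega) _

theorem Htpy.map_injective {f : K ⟶ L} (hf : HasFill (toSSet.map f) n Set.univ)
    (hK : IsKan K) (hL : IsKan L) : Function.Injective (Htpy.map f n) := by
  intro a b hab
  obtain ⟨x, rfl⟩ := a.exists_mk
  obtain ⟨y, rfl⟩ := b.exists_mk
  obtain ⟨e, he⟩ := hL.mk_eq_iff.1 hab
  obtain ⟨e', he', -⟩ := exists_isEdge_of_fill hf x.2 y.2 he
  exact hK.mk_eq_iff.2 ⟨e', he'⟩

/-- Every spherical simplex of dimension `n` lifts along `f` to a spherical simplex. -/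
def LiftsSpherical (f : K ⟶ L) (n : ℕ) : Prop := ∀ v, IsSpherical L n v →
  ∃ x, IsSpherical K n x ∧ (f.app _).toFun x = v

theorem LiftsSpherical.of_fill {f : K ⟶ L} (hf : HasFill (toSSet.map f) n Set.univ) :
    LiftsSpherical f (n + 1) := fun v hv => by
  obtain ⟨x, h, h'⟩ := hf.exists_fill (fun _ => (K _⦋n⦌).point) (fun _ => isSpherical_point) v
    (fun j hj _ => (hv.face j).trans (f.app _).map_point.symm)
  refine ⟨x, isSpherical_of_face fun j => ?_, h'⟩
  by_cases hjn : j < n + 2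
  · exact h j hjn trivial
  · exact face_of_le (by omega) _

theorem Htpy.map_surjective {f : K ⟶ L} (hf : LiftsSpherical f n) :
    Function.Surjective (Htpy.map f n) := by
  intro b
  obtain ⟨y, rfl⟩ := b.exists_mk
  obtain ⟨x, hx, h⟩ := hf y.1 y.2
  exact ⟨Htpy.mk ⟨x, hx⟩, congrArg Htpy.mk (Subtype.ext h)⟩

theorem face_fiberι {A B : PSSet.{u}} (p : A ⟶ B) (j : ℕ) (x : ((fiber p) _⦋n + 1⦌).X) :
    (face (fiber p) j x).1 = face A j x.1 := app_face (fiberι p) j x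

theorem IsEdge.fiberι {A B : PSSet.{u}} {p : A ⟶ B} {x y : ((fiber p) _⦋n⦌).X}
    {e : ((fiber p) _⦋n + 1⦌).X} (h : IsEdge (fiber p) x y e) : IsEdge A x.1 y.1 e.1 :=
  h.app (CosimplicialSpace.fiberι p)

theorem IsEdge.fiber_mk {A B : PSSet.{u}} {p : A ⟶ B} {x y : ((fiber p) _⦋n⦌).X}
    {e : (A _⦋n + 1⦌).X} (h : IsEdge A x.1 y.1 e) (he : (p.app _).toFun e = (B _⦋n + 1⦌).point) :
    IsEdge (fiber p) x y ⟨e, he⟩ :=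
  ⟨Subtype.ext ((face_fiberι p 0 _).trans h.zero), Subtype.ext ((face_fiberι p 1 _).trans h.one),
    fun j hj => Subtype.ext ((face_fiberι p j _).trans (h.other j hj))⟩

/-- The action of the homotopy of the base on the homotopy of the fibre, with representatives
fixed in the fibre. -/
theorem IsFib.isFiberAction_iff {A B : PSSet.{u}} {p : A ⟶ B} (hp : IsFib p)
    {α : Htpy B (n + 1)} {x y : Spherical (CosimplicialSpace.fiber p) n} :
    IsFiberAction p α (Htpy.mk x) (Htpy.mk y) ↔ ∃ (e : (A _⦋n + 1⦌).X) (z : Spherical B (n + 1)),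
      Htpy.mk z = α ∧ (p.app _).toFun e = z.1 ∧ IsEdge A x.1.1 y.1.1 e := by
  constructor
  · rintro ⟨e, z, x', y', hz, hx, hy, hez, h0, h1, h⟩
    have he : IsEdge A x'.1.1 y'.1.1 e := ⟨(face_eq 0 e).trans h0,
      (face_eq' (by omega : 1 < n + 2) e).trans h1, fun j hj => by
        by_cases hjn : j < n + 2
        · exact (face_eq' hjn e).trans (h ⟨j, hjn⟩ hj)
        · exact face_of_le (by omega) e⟩
    obtain ⟨a, ha⟩ := hp.fiber.mk_eq_iff.1 hx.symm
    obtain ⟨b, hb⟩ := hp.fiber.mk_eq_iff.1 hy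
    obtain ⟨v, hv, -, h1, -⟩ := CosimplicialSpace.exists_edge_fill hp 1 (by omega) a.1 e e
      (fun _ => ha.fiberι) (fun h => (h rfl).elim) (fun _ => he) ((B.σ 1).toFun z.1)
      (fun _ => (z.2.face_σ 1 (by simp) (by simp)).trans a.2.symm) (fun h => (h rfl).elim)
      (fun _ => (face_σ_succ 1 z.1).trans hez.symm)
      (fun j hj => z.2.face_σ 1 (by simp; omega) (by simp; omega))
    have hv1 : (p.app _).toFun (face A 1 v) = z.1 := by
      rw [app_face, hv]
      exact face_σ_self 1 z.1
    obtain ⟨w, hw, -, h2, -⟩ := CosimplicialSpace.exists_edge_fill hp 1 (by omega)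
      (face A 1 v) e b.1
      (fun _ => h1) (fun h => (h rfl).elim) (fun _ => hb.fiberι) ((B.σ 0).toFun z.1)
      (fun _ => (face_σ_self 0 z.1).trans hv1.symm) (fun h => (h rfl).elim)
      (fun _ => (z.2.face_σ 0 (by simp) (by simp)).trans b.2.symm)
      (fun j hj => z.2.face_σ 0 (by simp; omega) (by simp; omega))
    refine ⟨face A 1 w, z, hz, ?_, h2⟩
    rw [app_face, hw]
    exact face_σ_succ 0 z.1
  · rintro ⟨e, z, hz, hez, he⟩
    exact ⟨e, z, x, y, hz, rfl, rfl, hez, (face_eq 0 e).symm.trans he.zero,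
      (face_eq' (by omega : 1 < n + 2) e).symm.trans he.one,
      fun j hj => (face_eq j e).symm.trans (he.other j hj)⟩

/-- The faces `j`, `j + 1` and `j + 2` of `e` are `x`, `y` and `z`, and the others are the base
point. For spherical simplices `x`, `y`, `z` this means that the class of `y` is the product of
those of `x` and `z`, up to the order of the factors. -/
structure IsTriangle (K : PSSet.{u}) {n : ℕ} (j : ℕ) (x y z : (K _⦋n⦌).X) (e : (K _⦋n + 1⦌).X) :
    Prop where
  first : face K j e = x
  second : face K (j + 1) e = y
  third : face K (j + 2) e = z
  other : ∀ t, t ≠ j → t ≠ j + 1 → t ≠ j + 2 → face K t e = (K _⦋n⦌).point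

/-- Four triangles which share six simplices like the faces of a tetrahedron share its edges: if
three of them exist then so does the fourth one, whose index is `k`. -/
theorem IsKan.exists_triangle_fill (hK : IsKan K) (j : ℕ) (hj : j < n)
    {x₀₁ x₀₂ x₀₃ x₁₂ x₁₃ x₂₃ : (K _⦋n⦌).X} (k : ℕ) (hk : k < 4) (f₀ f₁ f₂ f₃ : (K _⦋n + 1⦌).X)
    (h₀ : k ≠ 0 → IsTriangle K j x₂₃ x₁₃ x₁₂ f₀) (h₁ : k ≠ 1 → IsTriangle K j x₂₃ x₀₃ x₀₂ f₁)
    (h₂ : k ≠ 2 → IsTriangle K j x₁₃ x₀₃ x₀₁ f₂) (h₃ : k ≠ 3 → IsTriangle K j x₁₂ x₀₂ x₀₁ f₃) :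
    ∃ g₀ g₁ g₂ g₃, IsTriangle K j x₂₃ x₁₃ x₁₂ g₀ ∧ IsTriangle K j x₂₃ x₀₃ x₀₂ g₁ ∧
      IsTriangle K j x₁₃ x₀₃ x₀₁ g₂ ∧ IsTriangle K j x₁₂ x₀₂ x₀₁ g₃ := by
  -- the triangles are the faces `j`, …, `j + 3` of an `(n + 2)`-simplex with the other faces
  -- trivial
  let G : ℕ → (K _⦋n + 1⦌).X := fun t => if t = j then f₀ else if t = j + 1 then f₁ else
    if t = j + 2 then f₂ else if t = j + 3 then f₃ else (K _⦋n + 1⦌).point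
  have G0 : G j = f₀ := if_pos rfl
  have G1 : G (j + 1) = f₁ := (if_neg (by omega)).trans (if_pos rfl)
  have G2 : G (j + 2) = f₂ := by
    simp only [G]; rw [if_neg (by omega), if_neg (by omega), if_pos trivial]
  have G3 : G (j + 3) = f₃ := by
    simp only [G]; rw [if_neg (by omega), if_neg (by omega), if_neg (by omega), if_pos trivial]
  have Gp : ∀ t, t < j ∨ j + 3 < t → G t = (K _⦋n + 1⦌).point := fun t ht => by
    simp only [G]
    rw [if_neg (by omega), if_neg (by omega), if_neg (by omega), if_neg (by omega)]
  have hpt : ∀ t, t ≠ j + k → ∀ b, b < j ∨ j + 2 < b → face K b (G t) = (K _⦋n⦌).point := by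
    intro t ht b hb
    rcases (by omega : t = j ∨ t = j + 1 ∨ t = j + 2 ∨ t = j + 3 ∨ (t < j ∨ j + 3 < t)) with
      rfl | rfl | rfl | rfl | h
    · rw [G0]; exact (h₀ (by omega)).other b (by omega) (by omega) (by omega)
    · rw [G1]; exact (h₁ (by omega)).other b (by omega) (by omega) (by omega)
    · rw [G2]; exact (h₂ (by omega)).other b (by omega) (by omega) (by omega)
    · rw [G3]; exact (h₃ (by omega)).other b (by omega) (by omega) (by omega)
    · rw [Gp t h, face_point]
  obtain ⟨v, -, hv⟩ := exists_fill_nat (p := toPoint K) (k := j + k) (by omega : j + k < n + 3)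
    (hK _ _) G (by
      intro a b hab hb ha hbk
      by_cases ha1 : a < j
      · rw [hpt (b + 1) hbk a (Or.inl ha1), Gp a (Or.inl ha1), face_point]
      by_cases hb1 : j + 2 < b
      · rw [hpt a ha b (Or.inr hb1), Gp (b + 1) (Or.inr (by omega)), face_point]
      rcases (by omega : (a = j ∧ b = j) ∨ (a = j ∧ b = j + 1) ∨ (a = j ∧ b = j + 2) ∨
          (a = j + 1 ∧ b = j + 1) ∨ (a = j + 1 ∧ b = j + 2) ∨ (a = j + 2 ∧ b = j + 2)) with
        ⟨rfl, rfl⟩ | ⟨rfl, rfl⟩ | ⟨rfl, rfl⟩ | ⟨rfl, rfl⟩ | ⟨rfl, rfl⟩ | ⟨rfl, rfl⟩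
      · rw [G0, G1, (h₀ (by omega)).first, (h₁ (by omega)).first]
      · rw [G0, G2, (h₀ (by omega)).second, (h₂ (by omega)).first]
      · rw [G0, G3, (h₀ (by omega)).third, (h₃ (by omega)).first]
      · rw [G1, G2, (h₁ (by omega)).second, (h₂ (by omega)).second]
      · rw [G1, G3, (h₁ (by omega)).third, (h₃ (by omega)).second]
      · rw [G2, G3, (h₂ (by omega)).third, (h₃ (by omega)).third]) (pointPSSet.obj _).point
    (fun _ _ _ => Subsingleton.elim _ _)
  have hvp : ∀ t, t < j ∨ j + 3 < t → face K t v = (K _⦋n + 1⦌).point := by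
    intro t ht
    by_cases htn : t < n + 3
    · rw [hv t htn (by omega), Gp t ht]
    · exact face_of_le (by omega) v
  have hother : ∀ c, c < 4 → ∀ t, t < j ∨ j + 2 < t →
      face K t (face K (j + c) v) = (K _⦋n⦌).point := by
    rintro c hc t (ht | ht)
    · obtain ⟨c', hc'⟩ : ∃ c', j + c = c' + 1 := ⟨j + c - 1, by omega⟩
      rw [hc', face_face (by omega), hvp t (Or.inl ht), face_point]
    · rw [← face_face (by omega), hvp (t + 1) (Or.inr (by omega)), face_point]
  have g0 : k ≠ 0 → face K j v = f₀ := fun h => (hv j (by omega) (by omega)).trans G0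
  have g1 : k ≠ 1 → face K (j + 1) v = f₁ := fun h => (hv (j + 1) (by omega) (by omega)).trans G1
  have g2 : k ≠ 2 → face K (j + 2) v = f₂ := fun h => (hv (j + 2) (by omega) (by omega)).trans G2
  have g3 : k ≠ 3 → face K (j + 3) v = f₃ := fun h => (hv (j + 3) (by omega) (by omega)).trans G3
  have e23 : face K j (face K (j + 1) v) = face K j (face K j v) := face_face le_rfl v
  have e13 : face K j (face K (j + 2) v) = face K (j + 1) (face K j v) := face_face (by omega) v
  have e12 : face K j (face K (j + 3) v) = face K (j + 2) (face K j v) := face_face (by omega) v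
  have e03 : face K (j + 1) (face K (j + 2) v) = face K (j + 1) (face K (j + 1) v) :=
    face_face le_rfl v
  have e02 : face K (j + 1) (face K (j + 3) v) = face K (j + 2) (face K (j + 1) v) :=
    face_face (by omega) v
  have e01 : face K (j + 2) (face K (j + 3) v) = face K (j + 2) (face K (j + 2) v) :=
    face_face le_rfl v
  have r23 : face K j (face K j v) = x₂₃ := by
    by_cases h : k = 0
    · rw [← e23, g1 (by omega)]; exact (h₁ (by omega)).first
    · rw [g0 h]; exact (h₀ h).first
  have r13 : face K (j + 1) (face K j v) = x₁₃ := by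
    by_cases h : k = 0
    · rw [← e13, g2 (by omega)]; exact (h₂ (by omega)).first
    · rw [g0 h]; exact (h₀ h).second
  have r12 : face K (j + 2) (face K j v) = x₁₂ := by
    by_cases h : k = 0
    · rw [← e12, g3 (by omega)]; exact (h₃ (by omega)).first
    · rw [g0 h]; exact (h₀ h).third
  have r03 : face K (j + 1) (face K (j + 1) v) = x₀₃ := by
    by_cases h : k = 1
    · rw [← e03, g2 (by omega)]; exact (h₂ (by omega)).second
    · rw [g1 h]; exact (h₁ h).second
  have r02 : face K (j + 2) (face K (j + 1) v) = x₀₂ := by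
    by_cases h : k = 1
    · rw [← e02, g3 (by omega)]; exact (h₃ (by omega)).second
    · rw [g1 h]; exact (h₁ h).third
  have r01 : face K (j + 2) (face K (j + 2) v) = x₀₁ := by
    by_cases h : k = 2
    · rw [← e01, g3 (by omega)]; exact (h₃ (by omega)).third
    · rw [g2 h]; exact (h₂ h).third
  exact ⟨face K j v, face K (j + 1) v, face K (j + 2) v, face K (j + 3) v,
    ⟨r23, r13, r12, fun t _ _ _ => hother 0 (by omega) t (by omega)⟩,
    ⟨e23.trans r23, r03, r02, fun t _ _ _ => hother 1 (by omega) t (by omega)⟩,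
    ⟨e13.trans r13, e03.trans r03, r01, fun t _ _ _ => hother 2 (by omega) t (by omega)⟩,
    ⟨e12.trans r12, e02.trans r02, e01.trans r01, fun t _ _ _ => hother 3 (by omega) t (by omega)⟩⟩

theorem IsSpherical.triangle_left {x : (K _⦋n⦌).X} (hx : IsSpherical K n x) {j : ℕ} (hj : j < n) :
    IsTriangle K j x x (K _⦋n⦌).point ((K.σ ⟨j, by omega⟩).toFun x) :=
  ⟨face_σ_self ⟨j, by omega⟩ x, face_σ_succ ⟨j, by omega⟩ x, hx.face_σ _ (by simp) (by simp),
    fun t h1 h2 _ => hx.face_σ _ h1 h2⟩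

theorem IsSpherical.triangle_right {x : (K _⦋n⦌).X} (hx : IsSpherical K n x) {j : ℕ} (hj : j < n) :
    IsTriangle K j (K _⦋n⦌).point x x ((K.σ ⟨j + 1, by omega⟩).toFun x) :=
  ⟨hx.face_σ _ (by simp) (by simp; omega), face_σ_self ⟨j + 1, by omega⟩ x,
    face_σ_succ ⟨j + 1, by omega⟩ x, fun t _ h2 h3 => hx.face_σ _ h2 h3⟩

theorem IsKan.triangle_shift (hK : IsKan K) {j : ℕ} (hj : j < n) {x y : (K _⦋n⦌).X}
    (hx : IsSpherical K n x) (hy : IsSpherical K n y) :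
    (∃ e, IsTriangle K j x y (K _⦋n⦌).point e) ↔ ∃ e, IsTriangle K j (K _⦋n⦌).point x y e := by
  constructor
  · rintro ⟨e, he⟩
    obtain ⟨g, -, -, -, hg, -⟩ := hK.exists_triangle_fill j hj 0 (by omega) e _ _ _
      (fun h => (h rfl).elim) (fun _ => hy.triangle_right hj) (fun _ => he)
      (fun _ => hy.triangle_left hj)
    exact ⟨g, hg⟩
  · rintro ⟨e, he⟩
    obtain ⟨-, -, -, g, -, -, -, hg⟩ := hK.exists_triangle_fill j hj 3 (by omega) _ _ _ e
      (fun _ => hx.triangle_right hj) (fun _ => he) (fun _ => hx.triangle_left hj)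
      (fun h => (h rfl).elim)
    exact ⟨g, hg⟩

/-- Homotopies may be placed at any position of the simplex. -/
theorem IsKan.edge_iff_triangle (hK : IsKan K) {j : ℕ} (hj : j < n) {x y : (K _⦋n⦌).X}
    (hx : IsSpherical K n x) (hy : IsSpherical K n y) :
    (∃ e, IsEdge K x y e) ↔ ∃ e, IsTriangle K j x y (K _⦋n⦌).point e := by
  induction j with
  | zero =>
    exact exists_congr fun e => ⟨fun h => ⟨h.zero, h.one, h.other 2 (by omega),
      fun t _ _ _ => h.other t (by omega)⟩, fun h => ⟨h.first, h.second, fun t ht => by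
        by_cases h2 : t = 2
        · rw [h2]; exact h.third
        · exact h.other t (by omega) (by omega) (by omega)⟩⟩
  | succ j ih =>
    rw [ih (by omega), hK.triangle_shift (by omega) hx hy]
    exact exists_congr fun e => ⟨fun h => ⟨h.second, h.third, h.other _ (by omega) (by omega)
      (by omega), fun t _ _ _ => by
        by_cases h2 : t = j
        · rw [h2]; exact h.first
        · exact h.other t (by omega) (by omega) (by omega)⟩,
      fun h => ⟨h.other _ (by omega) (by omega) (by omega), h.first, h.second, fun t _ _ _ => by
        by_cases h2 : t = j + 1 + 2
        · rw [h2]; exact h.third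
        · exact h.other t (by omega) (by omega) (by omega)⟩⟩

theorem Htpy.isMul_iff {a b c : Htpy K (n + 1)} :
    IsMul a b c ↔ ∃ (e : (K _⦋n + 2⦌).X) (x y z : Spherical K (n + 1)), mk x = a ∧ mk y = b ∧
      mk z = c ∧ IsTriangle K n y.1 z.1 x.1 e := by
  have h0 : n < n + 1 + 2 := by omega
  have h1 : n + 1 < n + 1 + 2 := by omega
  have h2 : n + 2 < n + 1 + 2 := by omega
  constructor
  · rintro ⟨e, x, y, z, hx, hy, hz, e0, e1, e2, h⟩
    refine ⟨e, x, y, z, hx, hy, hz, (face_eq' h0 e).trans e0, (face_eq' h1 e).trans e1,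
      (face_eq' h2 e).trans e2, fun t _ _ _ => ?_⟩
    by_cases ht : t < n + 3
    · exact (face_eq' ht e).trans (h ⟨t, ht⟩ (show t < n by omega))
    · exact face_of_le (by omega) e
  · rintro ⟨e, x, y, z, hx, hy, hz, h⟩
    exact ⟨e, x, y, z, hx, hy, hz, (face_eq' h0 e).symm.trans h.first,
      (face_eq' h1 e).symm.trans h.second, (face_eq' h2 e).symm.trans h.third,
      fun j hj => (face_eq j e).symm.trans (h.other j (by omega) (by omega) (by omega))⟩

theorem IsKan.isMul_unique (hK : IsKan K) {a b c c' : Htpy K (n + 1)} (h : Htpy.IsMul a b c)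
    (h' : Htpy.IsMul a b c') : c = c' := by
  obtain ⟨e, x, y, z, hx, hy, rfl, he⟩ := Htpy.isMul_iff.1 h
  obtain ⟨e', x', y', z', hx', hy', rfl, he'⟩ := Htpy.isMul_iff.1 h'
  have hn : n < n + 1 := by omega
  obtain ⟨u, hu⟩ := (hK.triangle_shift hn x.2 x'.2).1
    ((hK.edge_iff_triangle hn x.2 x'.2).1 (hK.mk_eq_iff.1 (hx.trans hx'.symm)))
  obtain ⟨v, hv⟩ := (hK.edge_iff_triangle hn y'.2 y.2).1 (hK.mk_eq_iff.1 (hy'.trans hy.symm))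
  -- replace `x` by `x'`, then `y` by `y'`
  obtain ⟨-, -, e, -, -, -, he, -⟩ := hK.exists_triangle_fill n hn 2 (by omega) _ _ e _
    (fun _ => y.2.triangle_left hn) (fun _ => he) (fun h => (h rfl).elim) (fun _ => hu)
  obtain ⟨-, e, -, -, -, he, -, -⟩ := hK.exists_triangle_fill n hn 1 (by omega) _ e _ _
    (fun _ => hv) (fun h => (h rfl).elim) (fun _ => he) (fun _ => x'.2.triangle_right hn)
  obtain ⟨-, w, -, -, -, hw, -, -⟩ := hK.exists_triangle_fill n hn 1 (by omega) _ e _ _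
    (fun _ => y'.2.triangle_right hn) (fun h => (h rfl).elim) (fun _ => he') (fun _ => he)
  exact (hK.mk_eq_iff.2 ((hK.edge_iff_triangle hn z'.2 z.2).2
    ((hK.triangle_shift hn z'.2 z.2).2 ⟨w, hw⟩))).symm

end

/-! ### Linked classes -/

section

variable {A B C D : PSSet.{u}} {f : A ⟶ B} {h : A ⟶ C} {k : B ⟶ D} {g : C ⟶ D} {n : ℕ}

theorem SquareFill.lift_edge (H : SquareFill f h k g n {1}ᶜ) {x : (A _⦋n⦌).X}
    (hx : IsSpherical A n x) {y z b c} (hb : IsEdge B ((f.app _).toFun x) y b)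
    (hc : IsEdge C ((h.app _).toFun x) z c) (hbc : (k.app _).toFun b = (g.app _).toFun c) :
    ∃ e x', IsSpherical A n x' ∧ IsEdge A x x' e ∧ (f.app _).toFun e = b ∧
      (h.app _).toFun e = c ∧ (f.app _).toFun x' = y ∧ (h.app _).toFun x' = z := by
  obtain ⟨e, he, h1, h2⟩ := H.exists_fill (fun j => if j = 0 then x else (A _⦋n⦌).point)
    (fun j => by split_ifs; exacts [hx, isSpherical_point]) b c hbc (fun j hj hj1 => by
      split_ifs with h0
      · rw [h0, hb.zero]
      · exact (hb.other j (by
          have : j ≠ 1 := fun h => hj1 (Fin.ext h)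
          omega)).trans (f.app _).map_point.symm) (fun j hj hj1 => by
      split_ifs with h0
      · rw [h0, hc.zero]
      · exact (hc.other j (by
          have : j ≠ 1 := fun h => hj1 (Fin.ext h)
          omega)).trans (h.app _).map_point.symm)
  have he' : ∀ j < n + 2, j ≠ 1 → face A j e = if j = 0 then x else (A _⦋n⦌).point :=
    fun j hj hj1 => he j hj fun h => hj1 (congrArg Fin.val h)
  refine ⟨e, face A 1 e, isSpherical_missing_face fun j hj hj1 => ?_,
    ⟨he' 0 (by omega) (by omega), rfl,
    fun j hj => ?_⟩, h1, h2, ?_, ?_⟩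
  · rw [he' j hj hj1]
    split_ifs
    exacts [hx, isSpherical_point]
  · by_cases hjn : j < n + 2
    · rw [he' j hjn (by omega), if_neg (by omega)]
    · exact face_of_le (by omega) e
  · rw [app_face, h1, hb.one]
  · rw [app_face, h2, hc.one]

theorem IsFib.lift_edge (H : IsFib f) {x : (A _⦋n⦌).X}
    (hx : IsSpherical A n x) {y b} (hb : IsEdge B ((f.app _).toFun x) y b) :
    ∃ e x', IsSpherical A n x' ∧ IsEdge A x x' e ∧ (f.app _).toFun e = b ∧
      (f.app _).toFun x' = y := by
  have H' : SquareFill f (toPoint A) (toPoint B) (𝟙 pointPSSet) n {1}ᶜ :=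
    fun y hy b c _ hb _ => by
      obtain ⟨z, h1, h2⟩ := H n 1 y hy b hb
      exact ⟨z, h1, h2, Subsingleton.elim _ _⟩
  obtain ⟨e, x', h1, h2, h3, -, h4, -⟩ := H'.lift_edge hx hb (z := (pointPSSet.obj _).point)
    (c := (pointPSSet.obj _).point)
    ⟨Subsingleton.elim _ _, Subsingleton.elim _ _, fun _ _ => Subsingleton.elim _ _⟩
    (Subsingleton.elim _ _)
  exact ⟨e, x', h1, h2, h3, h4⟩

theorem SquareFill.lift_spherical (H : SquareFill f h k g n Set.univ) {b c}
    (hb : IsSpherical B (n + 1) b) (hc : IsSpherical C (n + 1) c)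
    (hbc : (k.app _).toFun b = (g.app _).toFun c) :
    ∃ x, IsSpherical A (n + 1) x ∧ (f.app _).toFun x = b ∧ (h.app _).toFun x = c := by
  obtain ⟨x, h1, h2⟩ := H.exists_fill (fun _ => (A _⦋n⦌).point) (fun _ => isSpherical_point) b c hbc
    (fun j hj _ => (hb.face j).trans (f.app _).map_point.symm)
    (fun j hj _ => (hc.face j).trans (h.app _).map_point.symm)
  refine ⟨x, isSpherical_of_face fun j => ?_, h2⟩
  by_cases hjn : j < n + 2
  · exact h1 j hjn trivial
  · exact face_of_le (by omega) _

theorem isSpherical_fiber {p : A ⟶ B} {x : ((fiber p) _⦋n⦌).X} (hx : IsSpherical A n x.1) :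
    IsSpherical (fiber p) n x := fun m f hm => Subtype.ext (hx m f hm)

theorem isEdge_point {x y : (A _⦋n⦌).X} (hx : x = (A _⦋n⦌).point) (hy : y = (A _⦋n⦌).point) :
    IsEdge A x y (A _⦋n + 1⦌).point :=
  ⟨(face_point 0).trans hx.symm, (face_point 1).trans hy.symm, fun j _ => face_point j⟩

theorem IsEdge.congr_left {x x' y : (A _⦋n⦌).X} {e : (A _⦋n + 1⦌).X} (h : IsEdge A x y e)
    (hx : x = x') : IsEdge A x' y e := hx ▸ h

end

section Grid

variable {W : (WithTop ℤ)ᵒᵖ ⥤ Tower.{u}}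

/-- The image of a simplex in lower Postnikov degree. -/
noncomputable abbrev rN {n' n : WithTop ℤ} (h : n' ≤ n) (s : WithTop ℤ) {q : SimplexCategoryᵒᵖ}
    (x : ((node W n s).obj q).X) : ((node W n' s).obj q).X := ((lowerN W h s).app q).toFun x

/-- The image of a simplex in lower cosimplicial degree. -/
noncomputable abbrev rS (n : WithTop ℤ) {s' s : WithTop ℤ} (h : s' ≤ s) {q : SimplexCategoryᵒᵖ}
    (x : ((node W n s).obj q).X) : ((node W n s').obj q).X := ((lowerS W n h).app q).toFun x

theorem lowerN_comp {n'' n' n : WithTop ℤ} (h : n' ≤ n) (h' : n'' ≤ n') (s : WithTop ℤ) :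
    lowerN W h s ≫ lowerN W h' s = lowerN W (h'.trans h) s :=
  (congrArg (fun z => NatTrans.app z (op s)) (W.map_comp (homOfLE h).op (homOfLE h').op)).symm

theorem lowerS_comp (n : WithTop ℤ) {s'' s' s : WithTop ℤ} (h : s' ≤ s) (h' : s'' ≤ s') :
    lowerS W n h ≫ lowerS W n h' = lowerS W n (h'.trans h) :=
  ((W.obj (op n)).map_comp (homOfLE h).op (homOfLE h').op).symm

theorem lower_comm {n' n s' s : WithTop ℤ} (h : n' ≤ n) (h' : s' ≤ s) :
    lowerN W h s ≫ lowerS W n' h' = lowerS W n h' ≫ lowerN W h s' :=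
  ((W.map (homOfLE h).op).naturality (homOfLE h').op).symm

theorem rN_rN {n'' n' n : WithTop ℤ} (h : n' ≤ n) (h' : n'' ≤ n') (s : WithTop ℤ)
    {q : SimplexCategoryᵒᵖ} (x : ((node W n s).obj q).X) :
    rN h' s (rN h s x) = rN (h'.trans h) s x := app_congr (lowerN_comp h h' s) q x

theorem rS_rS (n : WithTop ℤ) {s'' s' s : WithTop ℤ} (h : s' ≤ s) (h' : s'' ≤ s')
    {q : SimplexCategoryᵒᵖ} (x : ((node W n s).obj q).X) :
    rS n h' (rS n h x) = rS n (h'.trans h) x := app_congr (lowerS_comp n h h') q x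

theorem rS_rN {n' n s' s : WithTop ℤ} (h : n' ≤ n) (h' : s' ≤ s)
    {q : SimplexCategoryᵒᵖ} (x : ((node W n s).obj q).X) :
    rS n' h' (rN h s x) = rN h s' (rS n h' x) := app_congr (lower_comm h h') q x

theorem rN_point {n' n : WithTop ℤ} (h : n' ≤ n) (s : WithTop ℤ) (q : SimplexCategoryᵒᵖ) :
    rN h s ((node W n s).obj q).point = ((node W n' s).obj q).point :=
  ((lowerN W h s).app q).map_point

theorem rS_point (n : WithTop ℤ) {s' s : WithTop ℤ} (h : s' ≤ s) (q : SimplexCategoryᵒᵖ) :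
    rS n h ((node W n s).obj q).point = ((node W n s').obj q).point :=
  ((lowerS W n h).app q).map_point

variable (hW : IsGrid W)
include hW

theorem IsGrid.isFib_lowerS (n : WithTop ℤ) {s' s : WithTop ℤ} (h : s' ≤ s) :
    IsFib (lowerS W n h) := fun d k =>
  (hW.horn (min_le_left n ((-1 : ℤ) : WithTop ℤ)) h d k).hasFill
    (hW.subsingleton_n _ _ (lt_of_le_of_lt (min_le_right _ _) coe_neg_one_lt))
    (hW.subsingleton_n _ _ (lt_of_le_of_lt (min_le_right _ _) coe_neg_one_lt))

theorem IsGrid.isFib_lowerN {n' n : WithTop ℤ} (h : n' ≤ n) (s : WithTop ℤ) :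
    IsFib (lowerN W h s) := fun d k =>
  (hW.horn h (min_le_left s ((-1 : ℤ) : WithTop ℤ)) d k).hasFill'
    (hW.subsingleton_s _ _ (lt_of_le_of_lt (min_le_right _ _) coe_neg_one_lt))
    (hW.subsingleton_s _ _ (lt_of_le_of_lt (min_le_right _ _) coe_neg_one_lt))

theorem IsGrid.isKan (n s : WithTop ℤ) : IsKan (node W n s) :=
  (hW.isFib_lowerS n (min_le_left s ((-1 : ℤ) : WithTop ℤ))).of_subsingleton
    (hW.subsingleton_s _ _ (lt_of_le_of_lt (min_le_right _ _) coe_neg_one_lt))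

theorem IsGrid.fill_lowerN {n : WithTop ℤ} {n' s : ℤ} (h : (n' : WithTop ℤ) ≤ n) {d : ℕ}
    (hd : d + s ≤ n') : HasFill (toSSet.map (lowerN W h s)) d Set.univ :=
  (hW.boundary h (min_le_left (s : WithTop ℤ) ((-1 : ℤ) : WithTop ℤ)) d hd).hasFill'
    (hW.subsingleton_s _ _ (lt_of_le_of_lt (min_le_right _ _) coe_neg_one_lt))
    (hW.subsingleton_s _ _ (lt_of_le_of_lt (min_le_right _ _) coe_neg_one_lt))

theorem IsGrid.square_spherical {n s' : WithTop ℤ} {n' s : ℤ} (h : (n' : WithTop ℤ) ≤ n)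
    (h' : s' ≤ (s : WithTop ℤ)) {i : ℕ} (hi : i + s ≤ n' + 1) {b c}
    (hb : IsSpherical (node W n' s) i b) (hc : IsSpherical (node W n s') i c)
    (hbc : rS n' h' b = rN h s' c) :
    ∃ x, IsSpherical (node W n s) i x ∧ rN h s x = b ∧ rS n h' x = c := by
  cases i with
  | zero =>
    obtain ⟨z, hz⟩ := hW.surj h h' (by simpa using hi) b c hbc
    exact ⟨z, isSpherical_zero z, hz⟩
  | succ i => exact (hW.boundary h h' i (by push_cast at hi; omega)).lift_spherical hb hc hbc

theorem IsGrid.lifts_lowerN {n : WithTop ℤ} {n' s : ℤ} (h : (n' : WithTop ℤ) ≤ n) {i : ℕ}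
    (hi : i + s ≤ n' + 1) : LiftsSpherical (lowerN W h s) i := fun v hv => by
  have hs : min (s : WithTop ℤ) ((-1 : ℤ) : WithTop ℤ) < 0 :=
    lt_of_le_of_lt (min_le_right _ _) coe_neg_one_lt
  obtain ⟨x, h1, h2, -⟩ := hW.square_spherical h
    (min_le_left (s : WithTop ℤ) ((-1 : ℤ) : WithTop ℤ))
    hi hv (isSpherical_point) ((hW.subsingleton_s _ _ hs _).elim _ _)
  exact ⟨x, h1, h2⟩

theorem IsGrid.lifts_lowerS {n s : ℤ} {i : ℕ} (hi : n + 1 ≤ i + s) :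
    LiftsSpherical (lowerS W n (le_top : (s : WithTop ℤ) ≤ ⊤)) i := by
  cases i with
  | zero =>
    intro v _
    obtain ⟨x, hx⟩ := hW.top_surj n s (by simpa using hi) v
    exact ⟨x, isSpherical_zero x, hx⟩
  | succ i => exact LiftsSpherical.of_fill (hW.top n s i (by push_cast at hi; omega))

end Grid

section Grid

variable {W : (WithTop ℤ)ᵒᵖ ⥤ Tower.{u}}

/-- A sphere `a` in the fibre of `W (⊤, s) ⟶ W (⊤, s - 1)` and a sphere `u` in the fibre of
`W (s + i, ⊤) ⟶ W (s + i - 1, ⊤)` are linked if they have the same image in `W (s + i, s)`, and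
`u` vanishes in `W (s + i, s - 1)`. -/
structure IsLinked (W : (WithTop ℤ)ᵒᵖ ⥤ Tower.{u}) (s : ℤ) (i : ℕ) (a : ((node W ⊤ s) _⦋i⦌).X)
    (u : ((node W ((s + i : ℤ) : WithTop ℤ) ⊤) _⦋i⦌).X) : Prop where
  spherical_left : IsSpherical _ i a
  spherical_right : IsSpherical _ i u
  left : rS (W := W) ⊤ (WithTop.coe_le_coe.2 (by omega : s - 1 ≤ s)) a = ((node W _ _) _⦋i⦌).point
  right : rN (W := W) (WithTop.coe_le_coe.2 (by omega : s + i - 1 ≤ s + i)) ⊤ u =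
    ((node W _ _) _⦋i⦌).point
  right' : rS (W := W) _ (le_top : ((s - 1 : ℤ) : WithTop ℤ) ≤ ⊤) u = ((node W _ _) _⦋i⦌).point
  eq : rN (W := W) le_top (s : WithTop ℤ) a = rS (W := W) _ le_top u

/-- The edge `n = ⊤` of the grid: the tower `s ↦ Tot_s Π X`. -/
abbrev gridTot (W : (WithTop ℤ)ᵒᵖ ⥤ Tower.{u}) : Tower.{u} := W.obj (op ⊤)

/-- The edge `s = ⊤` of the grid: the tower `n ↦ Tot_∞ Π X(n)`. -/
noncomputable abbrev gridPost (W : (WithTop ℤ)ᵒᵖ ⥤ Tower.{u}) : Tower.{u} :=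
  W ⋙ (evaluation (WithTop ℤ)ᵒᵖ PSSet.{u}).obj (op ⊤)

namespace IsLinked

variable {s : ℤ} {i : ℕ} {a : ((node W ⊤ s) _⦋i⦌).X}
    {u : ((node W ((s + i : ℤ) : WithTop ℤ) ⊤) _⦋i⦌).X}

/-- The sphere in the fibre of the first tower. -/
noncomputable def fst (L : IsLinked W s i a u) : Spherical ((gridTot W).fib s) i :=
  ⟨⟨a, L.left⟩, isSpherical_fiber (p := (gridTot W).step s) L.spherical_left⟩

/-- The sphere in the fibre of the second tower. -/
noncomputable def snd (L : IsLinked W s i a u) : Spherical ((gridPost W).fib (s + i)) i :=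
  ⟨⟨u, L.right⟩, isSpherical_fiber (p := (gridPost W).step (s + i)) L.spherical_right⟩

end IsLinked

theorem isLinked_point (s : ℤ) (i : ℕ) :
    IsLinked W s i ((node W _ _) _⦋i⦌).point ((node W _ _) _⦋i⦌).point :=
  ⟨isSpherical_point, isSpherical_point, rS_point _ _ _, rN_point _ _ _, rS_point _ _ _,
    (rN_point _ _ _).trans (rS_point _ _ _).symm⟩

variable (hW : IsGrid W)
include hW

/-- A class of the first tower which survives to the second page is represented by one half of a
linked pair. -/
theorem IsGrid.exists_isLinked_left {s : ℤ} {i : ℕ} (a : Htpy ((gridTot W).fib s) i)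
    (ha : (gridTot W).IsCycle 1 s i a) :
    ∃ a' u, ∃ L : IsLinked W s i a' u, Htpy.mk L.fst = a := by
  obtain ⟨x, rfl⟩ := a.exists_mk
  obtain ⟨b, hb⟩ := ha
  obtain ⟨b, rfl⟩ := b.exists_mk
  have hx := x.2.app ((gridTot W).fibι s)
  change IsSpherical (node W ⊤ s) i x.1.1 at hx
  have hx0 : rS (W := W) ⊤ (WithTop.coe_le_coe.2 (by omega : s - 1 ≤ s)) x.1.1 =
    ((node W _ _) _⦋i⦌).point := x.1.2
  obtain ⟨e, he⟩ := (hW.isKan ⊤ s).mk_eq_iff.1 hb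
  -- `x` lifts to `b'` in `W (⊤, s + 1)`, and the image of `b'` in `W (s + i, s + 1)` lifts to
  -- `s = ⊤`
  obtain ⟨-, b', hb', -, -, hbx⟩ := (hW.isFib_lowerS ⊤ (WithTop.coe_le_coe.2
    (by omega : s ≤ s + (1 : ℕ)))).lift_edge b.2 he
  obtain ⟨u₀, hu₀, hub⟩ := hW.lifts_lowerS (n := s + i) (s := s + (1 : ℕ)) (i := i)
    (by push_cast; omega) _ (hb'.app (lowerN W le_top _))
  have hu₀x : rS (W := W) _ (le_top : (s : WithTop ℤ) ≤ ⊤) u₀ = rN le_top _ x.1.1 := by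
    rw [← rS_rS (W := W) _ le_top (WithTop.coe_le_coe.2 (by omega : s ≤ s + (1 : ℕ))) u₀]
    refine (congrArg _ hub).trans ?_
    exact (rS_rN (W := W) _ _ b').trans (congrArg _ hbx)
  have hu₀' : rS (W := W) _ (le_top : ((s - 1 : ℤ) : WithTop ℤ) ≤ ⊤) u₀ =
      ((node W _ _) _⦋i⦌).point := by
    rw [← rS_rS (W := W) _ le_top (WithTop.coe_le_coe.2 (by omega : s - 1 ≤ s)) u₀, hu₀x,
      rS_rN, hx0, rN_point]
  -- `u₀` need not vanish in `W (s + i - 1, ⊤)`, but it is homotopic to the point there, by a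
  -- homotopy which is trivial in cosimplicial degree `s - 1`; it lifts to a homotopy of `u₀` to
  -- some `u`
  obtain ⟨f, hf, hf'⟩ := exists_isEdge_of_fill (hW.top (s + i - 1) (s - 1) i (by omega))
    (x := rN (W := W) (WithTop.coe_le_coe.2 (by omega : s + i - 1 ≤ s + i)) ⊤ u₀)
    (y := ((node W _ _) _⦋i⦌).point) (hu₀.app _) isSpherical_point
    (e := ((node W _ _) _⦋i + 1⦌).point) (isEdge_point
      ((rS_rN (W := W) (WithTop.coe_le_coe.2 (by omega : s + i - 1 ≤ s + i))
        (le_top : ((s - 1 : ℤ) : WithTop ℤ) ≤ ⊤) u₀).trans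
        ((congrArg _ hu₀').trans (rN_point (W := W) _ _ _)))
      (rS_point (W := W) ((s + i - 1 : ℤ) : WithTop ℤ)
        (le_top : ((s - 1 : ℤ) : WithTop ℤ) ≤ ⊤) (op ⦋i⦌)))
  obtain ⟨ê, u, hu, hê, h1, h2, h3, h4⟩ := (hW.horn (WithTop.coe_le_coe.2
    (by omega : s + i - 1 ≤ s + i)) (le_top : ((s - 1 : ℤ) : WithTop ℤ) ≤ ⊤) i 1).lift_edge hu₀ hf
    (c := ((node W _ _) _⦋i + 1⦌).point) (z := ((node W _ _) _⦋i⦌).point)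
    (isEdge_point hu₀' rfl) (hf'.trans (rN_point (W := W) _ _ _).symm)
  -- the image of this homotopy in `W (s + i, s)` lifts to a homotopy of `x` in the fibre
  obtain ⟨ε, a, ha, hε, k1, k2, k3, k4⟩ := (hW.horn (le_top : ((s + i : ℤ) : WithTop ℤ) ≤ ⊤)
    (WithTop.coe_le_coe.2 (by omega : s - 1 ≤ s)) i 1).lift_edge hx
    (b := rS (W := W) _ le_top ê) (y := rS (W := W) _ le_top u)
    ((hê.app (lowerS W ((s + i : ℤ) : WithTop ℤ) (le_top : (s : WithTop ℤ) ≤ ⊤))).congr_left hu₀x)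
    (c := ((node W _ _) _⦋i + 1⦌).point) (z := ((node W _ _) _⦋i⦌).point)
    (isEdge_point hx0 rfl)
    ((rS_rS (W := W) _ _ _ ê).trans (h2.trans (rN_point (W := W) _ _ _).symm))
  let L : IsLinked W s i a u := ⟨ha, hu, k4, h3, h4, k3⟩
  refine ⟨a, u, L, ?_⟩
  exact ((hW.isFib_lowerS ⊤ _).fiber.mk_eq_iff.2 ⟨_, hε.fiber_mk k2⟩).symm

/-- Every class of the second tower is represented by one half of a linked pair. -/
theorem IsGrid.exists_isLinked_right {s : ℤ} {i : ℕ} (g : Htpy ((gridPost W).fib (s + i)) i) :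
    ∃ a u, ∃ L : IsLinked W s i a u, Htpy.mk L.snd = g := by
  obtain ⟨g, rfl⟩ := g.exists_mk
  have hg := g.2.app ((gridPost W).fibι (s + i))
  change IsSpherical (node W ((s + i : ℤ) : WithTop ℤ) ⊤) i g.1.1 at hg
  have hg0 : rN (W := W) (WithTop.coe_le_coe.2 (by omega : s + i - 1 ≤ s + i)) ⊤ g.1.1 =
    ((node W _ _) _⦋i⦌).point := g.1.2
  -- the image of `g` in `W (s + i, s - 1)` is homotopic to the point, as it vanishes in
  -- `W (s + i - 1, s - 1)`; the homotopy lifts to the fibre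
  obtain ⟨f, hf, hf'⟩ := exists_isEdge_of_fill (hW.fill_lowerN
    (WithTop.coe_le_coe.2 (by omega : s + i - 1 ≤ s + i)) (s := s - 1) (d := i) (by omega))
    (x := rS (W := W) _ le_top g.1.1) (y := ((node W _ _) _⦋i⦌).point) (hg.app _) isSpherical_point
    (e := ((node W _ _) _⦋i + 1⦌).point) (isEdge_point
      ((rS_rN (W := W) (WithTop.coe_le_coe.2 (by omega : s + i - 1 ≤ s + i))
        (le_top : ((s - 1 : ℤ) : WithTop ℤ) ≤ ⊤) g.1.1).symm.trans
        ((congrArg _ hg0).trans (rS_point (W := W) _ _ _)))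
      (rN_point (W := W) (WithTop.coe_le_coe.2 (by omega : s + i - 1 ≤ s + i))
        ((s - 1 : ℤ) : WithTop ℤ) (op ⦋i⦌)))
  obtain ⟨ê, u, hu, hê, h1, h2, h3, h4⟩ := (hW.horn (WithTop.coe_le_coe.2
    (by omega : s + i - 1 ≤ s + i)) (le_top : ((s - 1 : ℤ) : WithTop ℤ) ≤ ⊤) i 1).lift_edge hg
    (b := ((node W _ _) _⦋i + 1⦌).point) (y := ((node W _ _) _⦋i⦌).point)
    (isEdge_point hg0 rfl) hf ((rS_point (W := W) _ _ _).trans hf'.symm)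
  obtain ⟨a, ha, k1, k2⟩ := hW.square_spherical (le_top : ((s + i : ℤ) : WithTop ℤ) ≤ ⊤)
    (WithTop.coe_le_coe.2 (by omega : s - 1 ≤ s)) (i := i) (by omega)
    (b := rS (W := W) _ le_top u) (c := ((node W _ _) _⦋i⦌).point) (hu.app _) isSpherical_point
    ((rS_rS (W := W) _ _ _ u).trans (h4.trans (rN_point (W := W) _ _ _).symm))
  let L : IsLinked W s i a u := ⟨ha, hu, k2, h3, h4, k1⟩
  refine ⟨a, u, L, ?_⟩
  exact ((hW.isFib_lowerN _ ⊤).fiber.mk_eq_iff.2 ⟨_, hê.fiber_mk h1⟩).symm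

end Grid

/-! ### Comparison of the terms along linked pairs -/

/-- A morphism which is bijective on terms and abutments and reflects all the relations is an
isomorphism. -/
theorem SpectralSequence.isIso_of_bijective {S S' : SpectralSequence.{u}} (f : S ⟶ S')
    (hp : ∀ k s i, Function.Bijective (f.page k s i)) (hab : ∀ i, Function.Bijective (f.ab i))
    (hmul : ∀ k s i x y z, S'.IsMul k s i (f.page _ _ _ x) (f.page _ _ _ y) (f.page _ _ _ z) →
      S.IsMul k s i x y z)
    (hact : ∀ k s i x y z, S'.IsAct k s i (f.page _ _ _ x) (f.page _ _ _ y) (f.page _ _ _ z) →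
      S.IsAct k s i x y z)
    (hnext : ∀ k s i x y, S'.IsNext k s i (f.page _ _ _ x) (f.page _ _ _ y) → S.IsNext k s i x y)
    (habmul : ∀ i x y z, S'.AbIsMul i (f.ab _ x) (f.ab _ y) (f.ab _ z) → S.AbIsMul i x y z)
    (hfil : ∀ s i z, S'.Fil s i (f.ab i z) → S.Fil s i z)
    (hdet : ∀ k s i z x, S'.Detects k s i (f.ab i z) (f.page k s i x) → S.Detects k s i z x) :
    IsIso f := by
  let e : ∀ k s i, S.E k s i ≃ S'.E k s i := fun k s i => Equiv.ofBijective _ (hp k s i)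
  let a : ∀ i, S.Ab i ≃ S'.Ab i := fun i => Equiv.ofBijective _ (hab i)
  have he : ∀ k s i x, f.page k s i ((e k s i).symm x) = x := fun k s i x =>
    (e k s i).apply_symm_apply x
  have ha : ∀ i x, f.ab i ((a i).symm x) = x := fun i x => (a i).apply_symm_apply x
  let g : S' ⟶ S := SpectralSequence.Hom.mk (fun k s i => (e k s i).symm) (fun i => (a i).symm)
    (fun k s i => (e k s i).symm_apply_eq.2 (f.page_zero k s i).symm)
    (fun k s i x y z h => hmul _ _ _ _ _ _ (by rwa [he, he, he]))
    (fun k s i x y z h => hact _ _ _ _ _ _ (by rwa [he, he, he]))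
    (fun k s i x y h => hnext _ _ _ _ _ (by rwa [he, he]))
    (fun i => (a i).symm_apply_eq.2 (f.ab_zero i).symm)
    (fun i x y z h => habmul _ _ _ _ (by rwa [ha, ha, ha]))
    (fun s i z h => hfil _ _ _ (by rwa [ha]))
    (fun k s i z x h => hdet _ _ _ _ _ (by rwa [ha, he]))
  exact ⟨g, SpectralSequence.hom_ext (fun k s i x => (e k s i).symm_apply_apply x)
    (fun i x => (a i).symm_apply_apply x), SpectralSequence.hom_ext he ha⟩

section

variable {A B C D : PSSet.{u}} {f : A ⟶ B} {h : A ⟶ C} {k : B ⟶ D} {g : C ⟶ D} {n : ℕ}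

theorem IsEdge.isSpherical {x y : (A _⦋n⦌).X} {e : (A _⦋n + 1⦌).X} (he : IsEdge A x y e)
    (hx : x = (A _⦋n⦌).point) (hy : y = (A _⦋n⦌).point) : IsSpherical A (n + 1) e := by
  refine isSpherical_of_face fun j => ?_
  rcases (by omega : j = 0 ∨ j = 1 ∨ 1 < j) with rfl | rfl | hj
  · exact he.zero.trans hx
  · exact he.one.trans hy
  · exact he.other j hj

theorem IsEdge.congr {x x' y y' : (A _⦋n⦌).X} {e : (A _⦋n + 1⦌).X} (h : IsEdge A x y e)
    (hx : x = x') (hy : y = y') : IsEdge A x' y' e := hx ▸ hy ▸ h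

theorem IsTriangle.app {j : ℕ} {x y z : (A _⦋n⦌).X} {e : (A _⦋n + 1⦌).X}
    (he : IsTriangle A j x y z e) (f : A ⟶ B) : IsTriangle B j ((f.app _).toFun x)
      ((f.app _).toFun y) ((f.app _).toFun z) ((f.app _).toFun e) :=
  ⟨by rw [← app_face, he.first], by rw [← app_face, he.second], by rw [← app_face, he.third],
    fun t h1 h2 h3 => by
      rw [← app_face, he.other t h1 h2 h3]
      exact (f.app _).map_point⟩

theorem isTriangle_point {j : ℕ} {x y z : (A _⦋n⦌).X} (hx : x = (A _⦋n⦌).point)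
    (hy : y = (A _⦋n⦌).point) (hz : z = (A _⦋n⦌).point) :
    IsTriangle A j x y z (A _⦋n + 1⦌).point :=
  ⟨(face_point j).trans hx.symm, (face_point _).trans hy.symm, (face_point _).trans hz.symm,
    fun t _ _ _ => face_point t⟩

theorem IsTriangle.congr {j : ℕ} {x y z x' z' : (A _⦋n⦌).X} {e : (A _⦋n + 1⦌).X}
    (h : IsTriangle A j x y z e) (hx : x = x') (hz : z = z') : IsTriangle A j x' y z' e :=
  hx ▸ hz ▸ h

theorem IsTriangle.fiber_mk {p : A ⟶ B} {j : ℕ} {x y z : ((fiber p) _⦋n⦌).X}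
    {e : (A _⦋n + 1⦌).X} (h : IsTriangle A j x.1 y.1 z.1 e)
    (he : (p.app _).toFun e = (B _⦋n + 1⦌).point) : IsTriangle (fiber p) j x y z ⟨e, he⟩ :=
  ⟨Subtype.ext ((face_fiberι p _ _).trans h.first),
    Subtype.ext ((face_fiberι p _ _).trans h.second),
    Subtype.ext ((face_fiberι p _ _).trans h.third),
    fun t h1 h2 h3 => Subtype.ext ((face_fiberι p t _).trans (h.other t h1 h2 h3))⟩

/-- The product of two spheres can be formed compatibly with given products in `B` and `C`. -/
theorem SquareFill.lift_triangle (H : SquareFill f h k g (n + 1) {⟨n + 1, by omega⟩}ᶜ)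
    {x z : (A _⦋n + 1⦌).X} (hx : IsSpherical A (n + 1) x) (hz : IsSpherical A (n + 1) z) {y y' b c}
    (hb : IsTriangle B n ((f.app _).toFun x) y ((f.app _).toFun z) b)
    (hc : IsTriangle C n ((h.app _).toFun x) y' ((h.app _).toFun z) c)
    (hbc : (k.app _).toFun b = (g.app _).toFun c) :
    ∃ e w, IsSpherical A (n + 1) w ∧ IsTriangle A n x w z e ∧ (f.app _).toFun e = b ∧
      (h.app _).toFun e = c ∧ (f.app _).toFun w = y ∧ (h.app _).toFun w = y' := by
  let G : ℕ → (A _⦋n + 1⦌).X := fun j => if j = n then x else if j = n + 2 then z else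
    (A _⦋n + 1⦌).point
  have hG : ∀ j, IsSpherical A (n + 1) (G j) := fun j => by
    simp only [G]
    split_ifs
    exacts [hx, hz, isSpherical_point]
  have G0 : G n = x := if_pos rfl
  have G2 : G (n + 2) = z := (if_neg (by omega)).trans (if_pos rfl)
  have Gp : ∀ j, j ≠ n → j ≠ n + 2 → G j = (A _⦋n + 1⦌).point := fun j h1 h2 =>
    (if_neg h1).trans (if_neg h2)
  have aux : ∀ {B : PSSet.{u}} (f : A ⟶ B) (y b)
      (_ : IsTriangle B n ((f.app _).toFun x) y ((f.app _).toFun z) b) (j) (hj : j < n + 1 + 2)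
      (_ : (⟨j, hj⟩ : Fin (n + 1 + 2)) ∈ ({⟨n + 1, by omega⟩}ᶜ : Set (Fin (n + 1 + 2)))),
      face B j b = (f.app _).toFun (G j) := by
    intro B f y b hb j hj hj1
    have hj1' : j ≠ n + 1 := fun h => hj1 (Fin.ext h)
    by_cases h0 : j = n
    · rw [h0, hb.first, G0]
    by_cases h2 : j = n + 2
    · rw [h2, hb.third, G2]
    · rw [hb.other j h0 hj1' h2, Gp j h0 h2]
      exact (f.app _).map_point.symm
  obtain ⟨e, he, h1, h2⟩ := H.exists_fill G hG b c hbc (aux f y b hb) (aux h y' c hc)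
  have he' : ∀ j < n + 3, j ≠ n + 1 → face A j e = G j :=
    fun j hj hj1 => he j hj fun h => hj1 (congrArg Fin.val h)
  refine ⟨e, face A (n + 1) e, isSpherical_missing_face fun j hj hj1 => ?_,
    ⟨(he' n (by omega) (by omega)).trans G0, rfl, (he' (n + 2) (by omega) (by omega)).trans G2,
    fun j h1 h2 h3 => ?_⟩, h1, h2, ?_, ?_⟩
  · rw [he' j hj hj1]
    exact hG j
  · by_cases hjn : j < n + 3
    · rw [he' j hjn h2, Gp j h1 h3]
    · exact face_of_le (by omega) e
  · rw [app_face, h1, hb.second]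
  · rw [app_face, h2, hc.second]

end

section Grid

variable {W : (WithTop ℤ)ᵒᵖ ⥤ Tower.{u}}

/-- Classes of the stages `W (⊤, t)` and `W (m, ⊤)` correspond if they have the same image in
`W (m, t)`. -/
def Corresponds (W : (WithTop ℤ)ᵒᵖ ⥤ Tower.{u}) (i : ℕ) (t m : ℤ)
    (x : Htpy ((gridTot W).stage t) i) (y : Htpy ((gridPost W).stage m) i) : Prop :=
  Htpy.map (lowerN W (le_top : (m : WithTop ℤ) ≤ ⊤) t) i x =
    Htpy.map (lowerS W m (le_top : (t : WithTop ℤ) ≤ ⊤)) i y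

theorem corresponds_zero (i : ℕ) (t m : ℤ) :
    Corresponds W i t m (Htpy.zero _ i) (Htpy.zero _ i) :=
  (Htpy.map_zero _ i).trans (Htpy.map_zero _ i).symm

theorem Corresponds.restrict {i : ℕ} {t m t' m' : ℤ} {x y} (h : Corresponds W i t m x y)
    (ht : t' ≤ t) (hm : m' ≤ m) : Corresponds W i t' m' (Htpy.map ((gridTot W).down ht) i x)
      (Htpy.map ((gridPost W).down hm) i y) := by
  have hm' : (m' : WithTop ℤ) ≤ m := WithTop.coe_le_coe.2 hm
  have ht' : (t' : WithTop ℤ) ≤ t := WithTop.coe_le_coe.2 ht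
  have h1 : lowerS W ⊤ ht' ≫ lowerN W (le_top : (m' : WithTop ℤ) ≤ ⊤) t' =
      lowerN W (le_top : (m : WithTop ℤ) ≤ ⊤) t ≫ (lowerN W hm' t ≫ lowerS W m' ht') := by
    rw [← lower_comm, ← Category.assoc, lowerN_comp]
  have h2 : lowerN W hm' ⊤ ≫ lowerS W m' (le_top : (t' : WithTop ℤ) ≤ ⊤) =
      lowerS W m (le_top : (t : WithTop ℤ) ≤ ⊤) ≫ (lowerN W hm' t ≫ lowerS W m' ht') := by
    rw [lower_comm, lower_comm, ← Category.assoc, lowerS_comp]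
  refine (Tower.comp_apply _ _ i x).symm.trans (Eq.trans ?_ (Tower.comp_apply _ _ i y))
  change Htpy.map (lowerS W ⊤ ht' ≫ lowerN W le_top t') i x =
    Htpy.map (lowerN W hm' ⊤ ≫ lowerS W m' le_top) i y
  exact (congrArg (fun f => Htpy.map f i x) h1).trans ((Tower.comp_apply _ _ i x).trans
    ((congrArg _ h).trans ((Tower.comp_apply _ _ i y).symm.trans
      (congrArg (fun f => Htpy.map f i y) h2).symm)))

theorem corresponds_fromLim {i : ℕ} (t m : ℤ) (z : Htpy (node W ⊤ ⊤) i) :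
    Corresponds W i t m (Htpy.map ((gridTot W).fromLim t) i z)
      (Htpy.map ((gridPost W).fromLim m) i z) :=
  (Tower.square_apply (lower_comm (W := W) (le_top : (m : WithTop ℤ) ≤ ⊤)
    (le_top : (t : WithTop ℤ) ≤ ⊤)) i z).symm

theorem IsLinked.corresponds {s : ℤ} {i : ℕ} {a u} (L : IsLinked W s i a u) :
    Corresponds W i s (s + i) (Htpy.map ((gridTot W).fibι s) i (Htpy.mk L.fst))
      (Htpy.map ((gridPost W).fibι (s + i)) i (Htpy.mk L.snd)) :=
  congrArg Htpy.mk (Subtype.ext L.eq)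

variable (hW : IsGrid W)
include hW

/-- For `m = t + i` both `W (⊤, t)` and `W (m, ⊤)` inject into `W (m, t)` on `π_i`. -/
theorem IsGrid.corresponds_inj {i : ℕ} {t m : ℤ} (h : m = t + i) {x y x' y'}
    (hxy : Corresponds W i t m x y) (hxy' : Corresponds W i t m x' y') : x = x' ↔ y = y' := by
  constructor
  · rintro rfl
    exact Htpy.map_injective (hW.top m t i (by omega)) (hW.isKan _ _) (hW.isKan _ _)
      (hxy.symm.trans hxy')
  · rintro rfl
    exact Htpy.map_injective (hW.fill_lowerN le_top (by omega)) (hW.isKan _ _) (hW.isKan _ _)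
      (hxy.trans hxy'.symm)

theorem IsGrid.exists_corresponds_right {i : ℕ} {t m : ℤ} (h : m + 1 ≤ i + t)
    (x : Htpy ((gridTot W).stage t) i) : ∃ y, Corresponds W i t m x y := by
  obtain ⟨y, hy⟩ := Htpy.map_surjective (hW.lifts_lowerS h) (Htpy.map (lowerN W le_top _) i x)
  exact ⟨y, hy.symm⟩

theorem IsGrid.exists_corresponds_left {i : ℕ} {t m : ℤ} (h : i + t ≤ m + 1)
    (y : Htpy ((gridPost W).stage m) i) : ∃ x, Corresponds W i t m x y :=
  Htpy.map_surjective (hW.lifts_lowerN le_top h) (Htpy.map (lowerS W m le_top) i y)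

theorem IsGrid.isCycle_iff {s : ℤ} {i : ℕ} {a u} (L : IsLinked W s i a u) (k : ℕ) :
    (gridTot W).IsCycle (k + 1) s i (Htpy.mk L.fst) ↔
      (gridPost W).IsCycle k (s + i) i (Htpy.mk L.snd) := by
  constructor
  · rintro ⟨x, hx⟩
    obtain ⟨y, hxy⟩ := hW.exists_corresponds_right (m := s + i + k) (by push_cast; omega) x
    exact ⟨y, (hW.corresponds_inj rfl (hxy.restrict (by omega) (by omega)) L.corresponds).1 hx⟩
  · rintro ⟨y, hy⟩
    obtain ⟨x, hxy⟩ := hW.exists_corresponds_left (t := s + (k + 1 : ℕ)) (by push_cast; omega) y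
    exact ⟨x, (hW.corresponds_inj rfl (hxy.restrict (by omega) (by omega)) L.corresponds).2 hy⟩

theorem IsGrid.exists_action_right {s : ℤ} {i : ℕ} {a u a' u'} (L : IsLinked W s i a u)
    (L' : IsLinked W s i a' u') {α}
    (h : IsFiberAction ((gridTot W).step s) α (Htpy.mk L.fst) (Htpy.mk L'.fst)) :
    ∃ β, Corresponds W (i + 1) (s - 1) (s + i - 1) α β ∧
      IsFiberAction ((gridPost W).step (s + i)) β (Htpy.mk L.snd) (Htpy.mk L'.snd) := by
  obtain ⟨e, z, rfl, hez, he⟩ := (hW.isFib_lowerS ⊤ _).isFiberAction_iff.1 h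
  obtain ⟨e', he', hee⟩ := exists_isEdge_of_fill (hW.top (s + i) s i (by omega))
    L.spherical_right L'.spherical_right
    ((he.app (lowerN W (le_top : ((s + i : ℤ) : WithTop ℤ) ≤ ⊤) s)).congr L.eq L'.eq)
  refine ⟨Htpy.mk ⟨rN (W := W) (WithTop.coe_le_coe.2 (by omega : s + i - 1 ≤ s + i)) ⊤ e',
    (he'.app _).isSpherical L.right L'.right⟩, congrArg Htpy.mk (Subtype.ext ?_),
    (hW.isFib_lowerN _ ⊤).isFiberAction_iff.2 ⟨e', _, rfl, rfl, he'⟩⟩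
  have h1 : (s - 1 : ℤ) ≤ (s : WithTop ℤ) := WithTop.coe_le_coe.2 (by omega)
  have h2 : (s + i - 1 : ℤ) ≤ ((s + i : ℤ) : WithTop ℤ) := WithTop.coe_le_coe.2 (by omega)
  change rN (W := W) le_top _ z.1 = rS (W := W) _ le_top (rN (W := W) h2 ⊤ e')
  have e1 : rS (W := W) ⊤ h1 e = z.1 := hez
  rw [← e1, ← rS_rN, ← rN_rN (W := W) (le_top : ((s + i : ℤ) : WithTop ℤ) ≤ ⊤) h2]
  have e2 : rN (W := W) (le_top : ((s + i : ℤ) : WithTop ℤ) ≤ ⊤) s e = rS (W := W) _ le_top e' :=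
    hee.symm
  rw [e2, rS_rN, rS_rS, rS_rN]

theorem IsGrid.exists_action_left {s : ℤ} {i : ℕ} {a u a' u'} (L : IsLinked W s i a u)
    (L' : IsLinked W s i a' u') {β}
    (h : IsFiberAction ((gridPost W).step (s + i)) β (Htpy.mk L.snd) (Htpy.mk L'.snd)) :
    ∃ α, Corresponds W (i + 1) (s - 1) (s + i - 1) α β ∧
      IsFiberAction ((gridTot W).step s) α (Htpy.mk L.fst) (Htpy.mk L'.fst) := by
  obtain ⟨e', z, rfl, hez, he'⟩ := (hW.isFib_lowerN _ ⊤).isFiberAction_iff.1 h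
  obtain ⟨e, he, hee⟩ := exists_isEdge_of_fill (hW.fill_lowerN
    (le_top : ((s + i : ℤ) : WithTop ℤ) ≤ ⊤) (s := s) (d := i) (by omega))
    L.spherical_left L'.spherical_left
    ((he'.app (lowerS W ((s + i : ℤ) : WithTop ℤ) (le_top : (s : WithTop ℤ) ≤ ⊤))).congr
      L.eq.symm L'.eq.symm)
  refine ⟨Htpy.mk ⟨rS (W := W) ⊤ (WithTop.coe_le_coe.2 (by omega : s - 1 ≤ s)) e,
    (he.app _).isSpherical L.left L'.left⟩, congrArg Htpy.mk (Subtype.ext ?_),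
    (hW.isFib_lowerS ⊤ _).isFiberAction_iff.2 ⟨e, _, rfl, rfl, he⟩⟩
  have h1 : (s - 1 : ℤ) ≤ (s : WithTop ℤ) := WithTop.coe_le_coe.2 (by omega)
  have h2 : (s + i - 1 : ℤ) ≤ ((s + i : ℤ) : WithTop ℤ) := WithTop.coe_le_coe.2 (by omega)
  change rN (W := W) le_top _ (rS (W := W) ⊤ h1 e) = rS (W := W) _ le_top z.1
  have e1 : rN (W := W) h2 ⊤ e' = z.1 := hez
  rw [← e1, ← rS_rN, ← rN_rN (W := W) (le_top : ((s + i : ℤ) : WithTop ℤ) ≤ ⊤) h2]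
  have e2 : rN (W := W) (le_top : ((s + i : ℤ) : WithTop ℤ) ≤ ⊤) s e = rS (W := W) _ le_top e' :=
    hee
  rw [e2, rS_rN, rS_rS, rS_rN]

theorem IsGrid.exists_mul {s : ℤ} {i : ℕ} {a u b v} (L : IsLinked W s (i + 1) a u)
    (L' : IsLinked W s (i + 1) b v) :
    ∃ c w, ∃ L'' : IsLinked W s (i + 1) c w,
      Htpy.IsMul (Htpy.mk L.fst) (Htpy.mk L'.fst) (Htpy.mk L''.fst) ∧
      Htpy.IsMul (Htpy.mk L.snd) (Htpy.mk L'.snd) (Htpy.mk L''.snd) := by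
  have h1 : (s - 1 : ℤ) ≤ (s : WithTop ℤ) := WithTop.coe_le_coe.2 (by omega)
  have h2 : (s + (i + 1 : ℕ) - 1 : ℤ) ≤ ((s + (i + 1 : ℕ) : ℤ) : WithTop ℤ) :=
    WithTop.coe_le_coe.2 (by omega)
  obtain ⟨E, w, hw, hE, k1, k2, k3, k4⟩ := (hW.horn h2 (le_top : ((s - 1 : ℤ) : WithTop ℤ) ≤ ⊤)
    (i + 1) _).lift_triangle L'.spherical_right L.spherical_right
    (isTriangle_point L'.right rfl L.right) (isTriangle_point L'.right' rfl L.right')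
    ((rS_point (W := W) _ _ _).trans (rN_point (W := W) _ _ _).symm)
  obtain ⟨F, c, hc, hF, l1, l2, l3, l4⟩ := (hW.horn
    (le_top : ((s + (i + 1 : ℕ) : ℤ) : WithTop ℤ) ≤ ⊤) h1
    (i + 1) _).lift_triangle L'.spherical_left L.spherical_left
    ((hE.app (lowerS W ((s + (i + 1 : ℕ) : ℤ) : WithTop ℤ)
      (le_top : (s : WithTop ℤ) ≤ ⊤))).congr L'.eq.symm L.eq.symm)
    (isTriangle_point L'.left rfl L.left)
    ((rS_rS (W := W) _ _ _ E).trans (k2.trans (rN_point (W := W) _ _ _).symm))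
  refine ⟨c, w, ⟨hc, hw, l4, k3, k4, l3⟩, ?_, ?_⟩
  · exact Htpy.isMul_iff.2 ⟨_, _, _, _, rfl, rfl, rfl,
      hF.fiber_mk (p := (gridTot W).step s) l2⟩
  · exact Htpy.isMul_iff.2 ⟨_, _, _, _, rfl, rfl, rfl,
      IsTriangle.fiber_mk (A := node W _ ⊤) (B := node W _ ⊤) (p := lowerN W h2 ⊤)
        (x := ⟨v, L'.right⟩) (y := ⟨w, k3⟩) (z := ⟨u, L.right⟩) hE k1⟩

end Grid

/-! ### The correspondence of the two edge towers of a grid -/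

/-- An isomorphism of spectral sequences, with the maps of the pages given by relations. -/
structure SpectralSequence.Correspondence (S S' : SpectralSequence.{u}) where
  /-- the relation on pages -/
  Rel : ∀ k s i, S.E k s i → S'.E k s i → Prop
  /-- the bijection of abutments -/
  ab : ∀ i, S.Ab i ≃ S'.Ab i
  left_total : ∀ k s i x, ∃ y, Rel k s i x y
  right_total : ∀ k s i y, ∃ x, Rel k s i x y
  eq_iff : ∀ {k s i x y x' y'}, Rel k s i x y → Rel k s i x' y' → (x = x' ↔ y = y')
  zero : ∀ k s i, Rel k s i (S.zero k s i) (S'.zero k s i)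
  mul_iff : ∀ {k s i x y z x' y' z'}, Rel k s (i + 1) x x' → Rel k s (i + 1) y y' →
    Rel k s (i + 1) z z' → (S.IsMul k s i x y z ↔ S'.IsMul k s i x' y' z')
  act_iff : ∀ {k s i x y z x' y' z'}, Rel k s (i + 1) x x' → Rel k (s + k + 2) i y y' →
    Rel k (s + k + 2) i z z' → (S.IsAct k s i x y z ↔ S'.IsAct k s i x' y' z')
  next_iff : ∀ {k s i x y x' y'}, Rel k s i x x' → Rel (k + 1) s i y y' →
    (S.IsNext k s i x y ↔ S'.IsNext k s i x' y')
  ab_zero : ∀ i, ab i (S.abZero i) = S'.abZero i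
  ab_mul_iff : ∀ {i x y z}, S.AbIsMul i x y z ↔ S'.AbIsMul i (ab _ x) (ab _ y) (ab _ z)
  fil_iff : ∀ {s i z}, S.Fil s i z ↔ S'.Fil s i (ab i z)
  detects_iff : ∀ {k s i z x x'}, Rel k s i x x' →
    (S.Detects k s i z x ↔ S'.Detects k s i (ab i z) x')

namespace SpectralSequence.Correspondence

variable {S S' : SpectralSequence.{u}} (R : Correspondence S S')

/-- The map of pages determined by a correspondence. -/
noncomputable def page (k s i) (x : S.E k s i) : S'.E k s i := (R.left_total k s i x).choose

theorem rel_page {k s i} (x : S.E k s i) : R.Rel k s i x (R.page k s i x) :=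
  (R.left_total k s i x).choose_spec

theorem page_eq {k s i} {x : S.E k s i} {y} (h : R.Rel k s i x y) : R.page k s i x = y :=
  (R.eq_iff (R.rel_page x) h).1 rfl

/-- The morphism determined by a correspondence. -/
noncomputable def hom : S ⟶ S' := SpectralSequence.Hom.mk R.page (fun i => R.ab i)
  (fun k s i => R.page_eq (R.zero k s i))
  (fun _ _ _ _ _ _ h => (R.mul_iff (R.rel_page _) (R.rel_page _) (R.rel_page _)).1 h)
  (fun _ _ _ _ _ _ h => (R.act_iff (R.rel_page _) (R.rel_page _) (R.rel_page _)).1 h)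
  (fun _ _ _ _ _ h => (R.next_iff (R.rel_page _) (R.rel_page _)).1 h)
  R.ab_zero (fun _ _ _ _ h => R.ab_mul_iff.1 h) (fun _ _ _ h => R.fil_iff.1 h)
  (fun _ _ _ _ _ h => (R.detects_iff (R.rel_page _)).1 h)

theorem isIso_hom : IsIso R.hom :=
  SpectralSequence.isIso_of_bijective R.hom
    (fun k s i => ⟨fun x x' h => (R.eq_iff (R.rel_page x) (R.rel_page x')).2 h, fun y =>
      let ⟨x, hx⟩ := R.right_total k s i y
      ⟨x, R.page_eq hx⟩⟩)
    (fun i => (R.ab i).bijective)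
    (fun _ _ _ _ _ _ h => (R.mul_iff (R.rel_page _) (R.rel_page _) (R.rel_page _)).2 h)
    (fun _ _ _ _ _ _ h => (R.act_iff (R.rel_page _) (R.rel_page _) (R.rel_page _)).2 h)
    (fun _ _ _ _ _ h => (R.next_iff (R.rel_page _) (R.rel_page _)).2 h)
    (fun _ _ _ _ h => R.ab_mul_iff.2 h) (fun _ _ _ h => R.fil_iff.2 h)
    (fun _ _ _ _ _ h => (R.detects_iff (R.rel_page _)).2 h)

theorem hom_naturality {P P' : SpectralSequence.{u}} {Q : Correspondence P P'} {f : S ⟶ P}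
    {f' : S' ⟶ P'} (h : ∀ k s i x y, R.Rel k s i x y →
      Q.Rel k s i (f.page _ _ _ x) (f'.page _ _ _ y))
    (h' : ∀ i z, f'.ab i (R.ab i z) = Q.ab i (f.ab i z)) : f ≫ Q.hom = R.hom ≫ f' :=
  SpectralSequence.hom_ext (fun _ _ _ x => Q.page_eq (h _ _ _ _ _ (R.rel_page x)))
    (fun i z => (h' i z).symm)

end SpectralSequence.Correspondence

section Grid

variable {W : (WithTop ℤ)ᵒᵖ ⥤ Tower.{u}}

theorem isFiberAction_zero {A B : PSSet.{u}} (p : A ⟶ B) {i : ℕ} (a : Htpy (fiber p) i) :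
    IsFiberAction p (Htpy.zero B (i + 1)) a a := by
  obtain ⟨x, rfl⟩ := a.exists_mk
  have hx : IsEdge A x.1.1 x.1.1 _ := (x.2.app (fiberι p)).isEdge_refl
  exact ⟨(A.σ 0).toFun x.1.1, Spherical.base _ _, x, x, rfl, rfl, rfl,
    (app_map p _ _).trans ((congrArg _ x.1.2).trans (B.σ 0).map_point),
    (face_eq 0 _).symm.trans hx.zero, (face_eq' (by omega : 1 < i + 2) _).symm.trans hx.one,
    fun j hj => (face_eq j _).symm.trans (hx.other j hj)⟩

theorem Tower.pageRel_refl (T : Tower.{u}) {j : ℕ} {s : ℤ} {i : ℕ} (a) : T.PageRel j s i a a :=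
  ⟨Htpy.zero _ _, Htpy.map_zero _ _, isFiberAction_zero _ _⟩

theorem Tower.IsCycle.of_succ {T : Tower.{u}} {j : ℕ} {s : ℤ} {i : ℕ} {a}
    (h : T.IsCycle (j + 1) s i a) : T.IsCycle 1 s i a := by
  obtain ⟨b, hb⟩ := h
  refine ⟨Htpy.map (T.down (by omega)) i b, ?_⟩
  rw [← hb, ← Tower.comp_apply]
  refine congrArg (fun f => Htpy.map f i b) ?_
  exact (T.map_comp _ _).symm

variable (W) in
/-- The relation between the terms given by linked pairs. -/
def PageCorr (k : ℕ) (s : ℤ) (i : ℕ) (x : (gridTot W).Page (k + 1) s i)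
    (y : (gridPost W).Page k (s + i) i) : Prop :=
  ∃ a u, ∃ L : IsLinked W s i a u, ∃ h h',
    (gridTot W).pageMk (k + 1) s i (Htpy.mk L.fst) h = x ∧
      (gridPost W).pageMk k (s + i) i (Htpy.mk L.snd) h' = y

theorem PageCorr.zero (k : ℕ) (s : ℤ) (i : ℕ) :
    PageCorr W k s i ((gridTot W).pageZero (k + 1) s i) ((gridPost W).pageZero k (s + i) i) :=
  ⟨_, _, isLinked_point s i, (gridTot W).isCycle_zero _ _ _, (gridPost W).isCycle_zero _ _ _,
    rfl, rfl⟩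

variable (hW : IsGrid W)
include hW

theorem IsGrid.pageRel_iff {s : ℤ} {i : ℕ} {a u a' u'} (L : IsLinked W s i a u)
    (L' : IsLinked W s i a' u') (k : ℕ) (h h' g g') :
    (gridTot W).PageRel (k + 1) s i ⟨Htpy.mk L.fst, h⟩ ⟨Htpy.mk L'.fst, h'⟩ ↔
      (gridPost W).PageRel k (s + i) i ⟨Htpy.mk L.snd, g⟩ ⟨Htpy.mk L'.snd, g'⟩ := by
  constructor
  · rintro ⟨α, h0, hα⟩
    obtain ⟨β, hαβ, hβ⟩ := hW.exists_action_right L L' hα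
    exact ⟨β, (hW.corresponds_inj (t := s - 1 - (k + 1 : ℕ)) (m := s + i - 1 - k)
      (by push_cast; omega)
      (hαβ.restrict (by omega) (by omega)) (corresponds_zero _ _ _)).1 h0, hβ⟩
  · rintro ⟨β, h0, hβ⟩
    obtain ⟨α, hαβ, hα⟩ := hW.exists_action_left L L' hβ
    exact ⟨α, (hW.corresponds_inj (t := s - 1 - (k + 1 : ℕ)) (m := s + i - 1 - k)
      (by push_cast; omega)
      (hαβ.restrict (by omega) (by omega)) (corresponds_zero _ _ _)).2 h0, hα⟩

theorem IsGrid.pageCorr_left {k : ℕ} {s : ℤ} {i : ℕ} {a} (h : (gridTot W).IsCycle (k + 1) s i a) :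
    ∃ a' u, ∃ L : IsLinked W s i a' u, Htpy.mk L.fst = a := hW.exists_isLinked_left a h.of_succ

theorem IsGrid.pageCorr_mk {k : ℕ} {s : ℤ} {i : ℕ} {a u} (L : IsLinked W s i a u) (h) :
    PageCorr W k s i ((gridTot W).pageMk (k + 1) s i (Htpy.mk L.fst) h)
      ((gridPost W).pageMk k (s + i) i (Htpy.mk L.snd) ((hW.isCycle_iff L k).1 h)) :=
  ⟨_, _, L, h, _, rfl, rfl⟩

theorem IsGrid.exists_pageCorr_left {k : ℕ} {s : ℤ} {i : ℕ} (x : (gridTot W).Page (k + 1) s i) :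
    ∃ y, PageCorr W k s i x y := by
  obtain ⟨⟨a, ha⟩, rfl⟩ := Quot.exists_rep x
  obtain ⟨a, u, L, rfl⟩ := hW.pageCorr_left ha
  exact ⟨_, hW.pageCorr_mk L ha⟩

theorem IsGrid.exists_pageCorr_right {k : ℕ} {s : ℤ} {i : ℕ} (y : (gridPost W).Page k (s + i) i) :
    ∃ x, PageCorr W k s i x y := by
  obtain ⟨⟨g, hg⟩, rfl⟩ := Quot.exists_rep y
  obtain ⟨a, u, L, rfl⟩ := hW.exists_isLinked_right g
  exact ⟨_, _, _, L, (hW.isCycle_iff L k).2 hg, hg, rfl, rfl⟩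

theorem IsGrid.pageCorr_inj {k : ℕ} {s : ℤ} {i : ℕ} {x x' y y'} (hxy : PageCorr W k s i x y)
    (hxy' : PageCorr W k s i x' y') : x = x' ↔ y = y' := by
  constructor
  · choose a u L hL using fun c : { a // (gridTot W).IsCycle (k + 1) s i a } => hW.pageCorr_left c.2
    let F : (gridTot W).Page (k + 1) s i → (gridPost W).Page k (s + i) i :=
      Quot.lift (fun c => (gridPost W).pageMk k (s + i) i (Htpy.mk (L c).snd)
        ((hW.isCycle_iff (L c) k).1 ((hL c).symm ▸ c.2))) fun c c' h => Quot.sound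
        ((hW.pageRel_iff (L c) (L c') k ((hL c).symm ▸ c.2) ((hL c').symm ▸ c'.2) _ _).1 (by
          convert h using 2 <;> exact hL _))
    have hF : ∀ {x y}, PageCorr W k s i x y → F x = y := by
      rintro _ _ ⟨a, u, L', h, h', rfl, rfl⟩
      refine Quot.sound ((hW.pageRel_iff (L ⟨_, h⟩) L' k ((hL _).symm ▸ h) h _ _).1 ?_)
      convert (gridTot W).pageRel_refl _ using 2
      exact (hL ⟨_, h⟩).symm
    rintro rfl
    exact (hF hxy).symm.trans (hF hxy')
  · choose a u L hL using
      fun c : { a // (gridPost W).IsCycle k (s + i) i a } => hW.exists_isLinked_right c.1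
    let F : (gridPost W).Page k (s + i) i → (gridTot W).Page (k + 1) s i :=
      Quot.lift (fun c => (gridTot W).pageMk (k + 1) s i (Htpy.mk (L c).fst)
        ((hW.isCycle_iff (L c) k).2 ((hL c).symm ▸ c.2))) fun c c' h => Quot.sound
        ((hW.pageRel_iff (L c) (L c') k _ _ ((hL c).symm ▸ c.2) ((hL c').symm ▸ c'.2)).2 (by
          convert h using 2 <;> exact hL _))
    have hF : ∀ {x y}, PageCorr W k s i x y → F y = x := by
      rintro _ _ ⟨a, u, L', h, h', rfl, rfl⟩
      refine Quot.sound ((hW.pageRel_iff (L ⟨_, h'⟩) L' k _ _ ((hL _).symm ▸ h') h').2 ?_)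
      convert (gridPost W).pageRel_refl _ using 2
      exact (hL ⟨_, h'⟩).symm
    rintro rfl
    exact (hF hxy).symm.trans (hF hxy')

theorem IsGrid.pageMul_iff {k : ℕ} {s : ℤ} {i : ℕ} {x y z x' y' z'}
    (hx : PageCorr W k s (i + 1) x x') (hy : PageCorr W k s (i + 1) y y')
    (hz : PageCorr W k s (i + 1) z z') :
    (gridTot W).PageMul (k + 1) s i x y z ↔
      (gridPost W).PageMul k (s + (i + 1 : ℕ)) i x' y' z' := by
  constructor
  · rintro ⟨a, ha, b, hb, c, hc, rfl, rfl, rfl, h⟩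
    obtain ⟨a, u, L, rfl⟩ := hW.pageCorr_left ha
    obtain ⟨b, v, L', rfl⟩ := hW.pageCorr_left hb
    obtain ⟨c', w, L'', h1, h2⟩ := hW.exists_mul L L'
    obtain rfl := (hW.isFib_lowerS ⊤ _).fiber.isMul_unique h1 h
    exact ⟨_, _, _, _, _, _, (hW.pageCorr_inj (hW.pageCorr_mk L ha) hx).1 rfl,
      (hW.pageCorr_inj (hW.pageCorr_mk L' hb) hy).1 rfl,
      (hW.pageCorr_inj (hW.pageCorr_mk L'' hc) hz).1 rfl, h2⟩
  · rintro ⟨a, ha, b, hb, c, hc, rfl, rfl, rfl, h⟩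
    obtain ⟨a, u, L, rfl⟩ := hW.exists_isLinked_right a
    obtain ⟨b, v, L', rfl⟩ := hW.exists_isLinked_right b
    obtain ⟨c', w, L'', h1, h2⟩ := hW.exists_mul L L'
    obtain rfl := (hW.isFib_lowerN _ ⊤).fiber.isMul_unique h2 h
    exact ⟨_, _, _, _, _, _,
      (hW.pageCorr_inj (hW.pageCorr_mk L ((hW.isCycle_iff L k).2 ha)) hx).2 rfl,
      (hW.pageCorr_inj (hW.pageCorr_mk L' ((hW.isCycle_iff L' k).2 hb)) hy).2 rfl,
      (hW.pageCorr_inj (hW.pageCorr_mk L'' ((hW.isCycle_iff L'' k).2 hc)) hz).2 rfl, h1⟩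

theorem IsGrid.pageAct_iff {k : ℕ} {s : ℤ} {i : ℕ} {x y z x' y' z'}
    (hx : PageCorr W k s (i + 1) x x') (hy : PageCorr W k (s + k + 2) i y y')
    (hz : PageCorr W k (s + k + 2) i z z') :
    (gridTot W).PageAct (k + 1) (Tower.act_degree k s) i x y z ↔
      (gridPost W).PageAct k (Tower.reindexed_act_degree k s i) i x' y' z' := by
  constructor
  · rintro ⟨a, ha, b, hb, c, hc, rfl, rfl, rfl, β, hβ, h⟩
    obtain ⟨a, u, L, rfl⟩ := hW.pageCorr_left ha
    obtain ⟨b, v, L', rfl⟩ := hW.pageCorr_left hb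
    obtain ⟨c, w, L'', rfl⟩ := hW.pageCorr_left hc
    obtain ⟨γ, hβγ, hγ⟩ := hW.exists_action_right L' L'' h
    exact ⟨_, _, _, _, _, _, (hW.pageCorr_inj (hW.pageCorr_mk L ha) hx).1 rfl,
      (hW.pageCorr_inj (hW.pageCorr_mk L' hb) hy).1 rfl,
      (hW.pageCorr_inj (hW.pageCorr_mk L'' hc) hz).1 rfl, γ,
      (hW.corresponds_inj rfl (hβγ.restrict (by omega) (by push_cast; omega)) L.corresponds).1 hβ,
      hγ⟩
  · rintro ⟨a, ha, b, hb, c, hc, rfl, rfl, rfl, γ, hγ, h⟩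
    obtain ⟨a, u, L, rfl⟩ := hW.exists_isLinked_right a
    obtain ⟨b, v, L', rfl⟩ := hW.exists_isLinked_right b
    obtain ⟨c, w, L'', rfl⟩ := hW.exists_isLinked_right c
    obtain ⟨β, hβγ, hβ⟩ := hW.exists_action_left L' L'' h
    exact ⟨_, _, _, _, _, _,
      (hW.pageCorr_inj (hW.pageCorr_mk L ((hW.isCycle_iff L k).2 ha)) hx).2 rfl,
      (hW.pageCorr_inj (hW.pageCorr_mk L' ((hW.isCycle_iff L' k).2 hb)) hy).2 rfl,
      (hW.pageCorr_inj (hW.pageCorr_mk L'' ((hW.isCycle_iff L'' k).2 hc)) hz).2 rfl, β,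
      (hW.corresponds_inj rfl (hβγ.restrict (by omega) (by push_cast; omega)) L.corresponds).2 hγ,
      hβ⟩

theorem IsGrid.pageNext_iff {k : ℕ} {s : ℤ} {i : ℕ} {x y x' y'}
    (hx : PageCorr W k s i x x') (hy : PageCorr W (k + 1) s i y y') :
    (gridTot W).PageNext (k + 1) s i x y ↔ (gridPost W).PageNext k (s + i) i x' y' := by
  constructor
  · rintro ⟨a, ha, hb, rfl, rfl⟩
    obtain ⟨a, u, L, rfl⟩ := hW.pageCorr_left ha
    exact ⟨_, _, _, (hW.pageCorr_inj (hW.pageCorr_mk L ha) hx).1 rfl,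
      (hW.pageCorr_inj (hW.pageCorr_mk L hb) hy).1 rfl⟩
  · rintro ⟨a, ha, hb, rfl, rfl⟩
    obtain ⟨a, u, L, rfl⟩ := hW.exists_isLinked_right a
    exact ⟨_, _, _, (hW.pageCorr_inj (hW.pageCorr_mk L ((hW.isCycle_iff L k).2 ha)) hx).2 rfl,
      (hW.pageCorr_inj (hW.pageCorr_mk L ((hW.isCycle_iff L (k + 1)).2 hb)) hy).2 rfl⟩

theorem IsGrid.pageDetects_iff {k : ℕ} {s : ℤ} {i : ℕ} {z x x'} (hx : PageCorr W k s i x x') :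
    (gridTot W).PageDetects (k + 1) s i z x ↔ (gridPost W).PageDetects k (s + i) i z x' := by
  constructor
  · rintro ⟨a, ha, rfl, h⟩
    obtain ⟨a, u, L, rfl⟩ := hW.pageCorr_left ha
    exact ⟨_, _, (hW.pageCorr_inj (hW.pageCorr_mk L ha) hx).1 rfl,
      (hW.corresponds_inj rfl (corresponds_fromLim _ _ z) L.corresponds).1 h⟩
  · rintro ⟨a, ha, rfl, h⟩
    obtain ⟨a, u, L, rfl⟩ := hW.exists_isLinked_right a
    exact ⟨_, _, (hW.pageCorr_inj (hW.pageCorr_mk L ((hW.isCycle_iff L k).2 ha)) hx).2 rfl,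
      (hW.corresponds_inj rfl (corresponds_fromLim _ _ z) L.corresponds).2 h⟩

theorem IsGrid.filtration_iff {s : ℤ} {i : ℕ} {z} :
    (gridTot W).Filtration s i z ↔ (gridPost W).Filtration (s + i) i z :=
  hW.corresponds_inj rfl (corresponds_fromLim _ _ z) (corresponds_zero _ _ _)

/-- The spectral sequence of the tower `s ↦ W (⊤, s)` corresponds to the re-indexed spectral
sequence of the tower `n ↦ W (n, ⊤)`. The abutment of both is the homotopy of `W (⊤, ⊤)`. -/
def IsGrid.correspondence :
    SpectralSequence.Correspondence (gridTot W).homotopySS (gridPost W).reindexedSS where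
  Rel := PageCorr W
  ab _ := Equiv.refl _
  left_total _ _ _ := hW.exists_pageCorr_left
  right_total _ _ _ := hW.exists_pageCorr_right
  eq_iff := hW.pageCorr_inj
  zero := PageCorr.zero
  mul_iff := hW.pageMul_iff
  act_iff := hW.pageAct_iff
  next_iff := hW.pageNext_iff
  ab_zero _ := rfl
  ab_mul_iff := Iff.rfl
  fil_iff := hW.filtration_iff
  detects_iff := hW.pageDetects_iff

end Grid

section

variable {W W' : (WithTop ℤ)ᵒᵖ ⥤ Tower.{u}} (f : W ⟶ W')

/-- The component of a map of bitowers. -/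
noncomputable abbrev nodeMap (n s : WithTop ℤ) : node W n s ⟶ node W' n s :=
  (f.app (op n)).app (op s)

/-- The map on the edges `s = ⊤` induced by a map of bitowers. -/
noncomputable abbrev gridPostMap : gridPost W ⟶ gridPost W' := Functor.whiskerRight f _

theorem nodeMap_rN {n' n : WithTop ℤ} (h : n' ≤ n) (s : WithTop ℤ) {q : SimplexCategoryᵒᵖ}
    (x : ((node W n s).obj q).X) : ((nodeMap f n' s).app q).toFun (rN h s x) =
      rN h s (((nodeMap f n s).app q).toFun x) :=
  app_congr (congrArg (fun g => NatTrans.app g (op s)) (f.naturality (homOfLE h).op)) q x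

theorem nodeMap_rS (n : WithTop ℤ) {s' s : WithTop ℤ} (h : s' ≤ s) {q : SimplexCategoryᵒᵖ}
    (x : ((node W n s).obj q).X) : ((nodeMap f n s').app q).toFun (rS n h x) =
      rS n h (((nodeMap f n s).app q).toFun x) :=
  app_congr ((f.app (op n)).naturality (homOfLE h).op) q x

theorem nodeMap_point (n s : WithTop ℤ) (q : SimplexCategoryᵒᵖ) :
    ((nodeMap f n s).app q).toFun ((node W n s).obj q).point = ((node W' n s).obj q).point :=
  ((nodeMap f n s).app q).map_point

theorem IsLinked.map {s : ℤ} {i : ℕ} {a u} (L : IsLinked W s i a u) :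
    IsLinked W' s i (((nodeMap f _ _).app _).toFun a) (((nodeMap f _ _).app _).toFun u) :=
  ⟨L.spherical_left.app (nodeMap f _ _), L.spherical_right.app (nodeMap f _ _),
    (nodeMap_rS f _ _ a).symm.trans ((congrArg _ L.left).trans (nodeMap_point f _ _ _)),
    (nodeMap_rN f _ _ u).symm.trans ((congrArg _ L.right).trans (nodeMap_point f _ _ _)),
    (nodeMap_rS f _ _ u).symm.trans ((congrArg _ L.right').trans (nodeMap_point f _ _ _)),
    (nodeMap_rN f _ _ a).symm.trans ((congrArg _ L.eq).trans (nodeMap_rS f _ _ u))⟩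

theorem PageCorr.map {k : ℕ} {s : ℤ} {i : ℕ} {x y} (h : PageCorr W k s i x y) :
    PageCorr W' k s i (Tower.pageMap (f.app (op ⊤)) (k + 1) s i x)
      (Tower.pageMap (gridPostMap f) k (s + i) i y) := by
  obtain ⟨a, u, L, h, h', rfl, rfl⟩ := h
  exact ⟨_, _, L.map f, h.map _, h'.map (gridPostMap f), rfl, rfl⟩

theorem IsGrid.correspondence_naturality (hW : IsGrid W) (hW' : IsGrid W') :
    Tower.spectralSequence.map (f.app (op ⊤)) ≫ hW'.correspondence.hom =
      hW.correspondence.hom ≫ Tower.reindexedSpectralSequence.map (gridPostMap f) :=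
  SpectralSequence.Correspondence.hom_naturality _ (fun _ _ _ _ _ h => h.map f) (fun _ _ => rfl)

end

/-! ### Simplices of `Ex` -/

section Ex

variable {n q q' : SimplexCategory}

/-- A chain of subsets of the vertices of `Δⁿ`. -/
abbrev SubsetChain (q n : SimplexCategory) := Fin (q.len + 1) →o Finset (Fin (n.len + 1))

/-- The image of a chain of subsets. -/
def SubsetChain.image (c : SubsetChain q n) {m : SimplexCategory} (f : n ⟶ m) :
    SubsetChain q m where
  toFun t := (c t).image f.toOrderHom
  monotone' _ _ h := Finset.image_subset_image (c.monotone h)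

theorem SubsetChain.image_nonempty {c : SubsetChain q n} (h : ∀ t, (c t).Nonempty)
    {m : SimplexCategory} (f : n ⟶ m) (t) : (c.image f t).Nonempty := (h t).image _

/-- The last vertices of a chain of subsets. -/
noncomputable def SubsetChain.lastVertex (c : SubsetChain q n) : q ⟶ n :=
  SimplexCategory.Hom.mk ⟨fun t => (c t).sup id, fun _ _ h => Finset.sup_mono (c.monotone h)⟩

/-- The simplex of the subdivision of `Δⁿ` given by a chain of nonempty subsets. -/
noncomputable def sdSimplex (c : SubsetChain q n) (h : ∀ t, (c t).Nonempty) :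
    (SimplexCategory.sd.{u}.obj n).obj (op q) :=
  Monotone.functor (f := fun t : Fin (q.len + 1) =>
    (⟨(c t).map Equiv.ulift.symm.toEmbedding, (h t).map, fun _ _ => le_total _ _⟩ :
      PartialOrder.NonemptyFiniteChains (ULift.{u} (Fin (n.len + 1)))))
    fun _ _ h => Finset.map_subset_map.2 (c.monotone h)

theorem map_ulift_map {m : ℕ} (s : Finset (ULift.{u} (Fin m))) :
    (s.map Equiv.ulift.toEmbedding).map Equiv.ulift.symm.toEmbedding = s := by
  rw [Finset.map_map]
  exact Finset.map_refl

theorem map_ulift_image {m k : ℕ} (s : Finset (Fin m)) (f : Fin m → Fin k) (x : ULift.{u} (Fin k)) :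
    (∃ y, y ∈ s.map Equiv.ulift.{u}.symm.toEmbedding ∧ ULift.up (f y.down) = x) ↔
      x ∈ (s.image f).map Equiv.ulift.symm.toEmbedding := by
  simp only [Finset.mem_map, Finset.mem_image]
  constructor
  · rintro ⟨_, ⟨y, hy, rfl⟩, rfl⟩
    exact ⟨_, ⟨y, hy, rfl⟩, rfl⟩
  · rintro ⟨_, ⟨y, hy, rfl⟩, rfl⟩
    exact ⟨_, ⟨y, hy, rfl⟩, rfl⟩

/-- The chain of subsets underlying a simplex of the subdivision of `Δⁿ`. -/
noncomputable def sdChain (z : (SimplexCategory.sd.{u}.obj n).obj (op q)) : SubsetChain q n where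
  toFun t := (z.obj t : PartialOrder.NonemptyFiniteChains (ULift.{u} (Fin (n.len + 1)))).finset.map
    Equiv.ulift.toEmbedding
  monotone' _ _ h := Finset.map_subset_map.2 (leOfHom (z.map (homOfLE h)))

theorem sdChain_nonempty (z : (SimplexCategory.sd.{u}.obj n).obj (op q)) (t) :
    (sdChain z t).Nonempty :=
  (z.obj t : PartialOrder.NonemptyFiniteChains (ULift.{u} (Fin (n.len + 1)))).nonempty.map

theorem sdChain_sdSimplex (c : SubsetChain q n) (h : ∀ t, (c t).Nonempty) :
    sdChain (sdSimplex c h) = c := by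
  ext t : 2
  change ((c t).map _).map _ = _
  rw [Finset.map_map]
  exact Finset.map_refl

theorem sdSimplex_sdChain (z : (SimplexCategory.sd.{u}.obj n).obj (op q)) :
    sdSimplex (sdChain z) (sdChain_nonempty z) = z := by
  refine CategoryTheory.Functor.ext (fun t => ?_) fun _ _ _ => Subsingleton.elim _ _
  exact PartialOrder.NonemptyFiniteChains.ext (map_ulift_map _)

theorem sdSimplex_image (c : SubsetChain q n) (h : ∀ t, (c t).Nonempty) {m : SimplexCategory}
    (f : n ⟶ m) : (SimplexCategory.sd.{u}.map f).app (op q) (sdSimplex c h) =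
      sdSimplex (c.image f) (SubsetChain.image_nonempty h f) := by
  refine CategoryTheory.Functor.ext (fun t => ?_) fun _ _ _ => Subsingleton.elim _ _
  refine PartialOrder.NonemptyFiniteChains.ext ?_
  ext x
  refine (PartialOrder.NonemptyFiniteChains.mem_map_iff _ _ _).trans ?_
  exact map_ulift_image (c t) f.toOrderHom x

variable {K : SSet.{u}}

/-- The value of an `n`-simplex of `Ex K`, that is, of a map from the subdivision of `Δⁿ` to `K`,
on a chain of subsets. -/
noncomputable def exEval (y : (SSet.ex.obj K).obj (op n)) (c : SubsetChain q n)
    (h : ∀ t, (c t).Nonempty) : K.obj (op q) :=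
  (ULift.down y : SimplexCategory.sd.obj n ⟶ K).app (op q) (sdSimplex c h)

theorem exEval_comp (y : (SSet.ex.obj K).obj (op n)) (c : SubsetChain q n)
    (h : ∀ t, (c t).Nonempty) (θ : q' ⟶ q) :
    K.map θ.op (exEval y c h) = exEval y (c.comp θ.toOrderHom) (fun _ => h _) :=
  ((ULift.down y : SimplexCategory.sd.obj n ⟶ K).naturality_apply θ.op (sdSimplex c h)).symm

theorem exEval_map {m : SimplexCategory} (f : m ⟶ n) (y : (SSet.ex.obj K).obj (op n))
    (c : SubsetChain q m) (h : ∀ t, (c t).Nonempty) :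
    exEval ((SSet.ex.obj K).map f.op y) c h =
      exEval y (c.image f) (SubsetChain.image_nonempty h f) :=
  congrArg ((ULift.down y : SimplexCategory.sd.obj n ⟶ K).app (op q)) (sdSimplex_image c h f)

theorem exEval_ext {y y' : (SSet.ex.obj K).obj (op n)}
    (h : ∀ q (c : SubsetChain q n) hc, exEval y c hc = exEval y' c hc) : y = y' := by
  refine ULift.ext _ _ (NatTrans.ext ?_)
  funext q
  ext z
  have h' := h q.unop (sdChain z) (sdChain_nonempty z)
  have hz : sdSimplex (q := q.unop) (sdChain z) (sdChain_nonempty z) = z := sdSimplex_sdChain z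
  rw [exEval, exEval, hz] at h'
  exact h'

theorem exists_exEval_eq (f : ∀ q (c : SubsetChain q n), (∀ t, (c t).Nonempty) → K.obj (op q))
    (hf : ∀ q q' (θ : q' ⟶ q) c h, K.map θ.op (f q c h) = f q' (c.comp θ.toOrderHom) fun _ => h _) :
    ∃ y : (SSet.ex.obj K).obj (op n), ∀ q c h, exEval y c h = f q c h := by
  refine ⟨ULift.up
    { app := fun q => TypeCat.ofHom fun z =>
        f q.unop (sdChain (q := q.unop) z) (sdChain_nonempty (q := q.unop) z)
      naturality := fun q q' θ => by
        ext z
        exact (hf q.unop q'.unop θ.unop (sdChain (q := q.unop) z)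
          (sdChain_nonempty (q := q.unop) z)).symm }, fun q c h => ?_⟩
  change f q (sdChain (sdSimplex c h)) _ = _
  congr 1
  exact sdChain_sdSimplex c h

theorem exEval_toEx (x : K.obj (op n)) (c : SubsetChain q n) (h : ∀ t, (c t).Nonempty) :
    exEval ((toEx.app K).app (op n) x) c h = K.map c.lastVertex.op x := by
  change (SSet.yonedaEquiv.symm x).app (op q) ((lastVertex.app n).app (op q) (sdSimplex c h)) = _
  have : (lastVertex.app n).app (op q) (sdSimplex.{u} c h) =
      SSet.stdSimplex.objEquiv.symm c.lastVertex := by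
    apply SSet.stdSimplex.objEquiv.injective
    rw [Equiv.apply_symm_apply]
    ext t : 3
    change Finset.sup' (Finset.map _ (c t)) ((h t).map) ULift.down = (c t).sup id
    rw [Finset.sup'_eq_sup, Finset.sup_map]
    rfl
  rw [this]
  rfl

theorem SubsetChain.image_lastVertex (c : SubsetChain q n) (h : ∀ t, (c t).Nonempty)
    {m : SimplexCategory} (f : n ⟶ m) : (c.image f).lastVertex = c.lastVertex ≫ f := by
  ext t : 3
  change ((c t).image f.toOrderHom).sup id = f.toOrderHom ((c t).sup id)
  rw [Finset.sup_image, ← Finset.sup'_eq_sup (h t), ← Finset.sup'_eq_sup (h t)]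
  exact (Finset.apply_sup'_eq_sup'_comp (h t) f.toOrderHom f.toOrderHom.monotone.map_sup).symm

theorem SubsetChain.image_injective {m : SimplexCategory} {f : n ⟶ m}
    (hf : Function.Injective f.toOrderHom) {c c' : SubsetChain q n} (h : c.image f = c'.image f) :
    c = c' := by
  ext t : 2
  exact Finset.image_injective hf (congrArg (fun e => e t) h)

theorem SubsetChain.image_comp (c : SubsetChain q n) {m k : SimplexCategory} (f : n ⟶ m)
    (g : m ⟶ k) : (c.image f).image g = c.image (f ≫ g) := by
  ext t : 2
  exact Finset.image_image

/-- A chain of nonempty subsets is the image of a chain in the face of `Δⁿ` spanned by the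
vertices that occur in it. -/
theorem SubsetChain.exists_support (c : SubsetChain q n) (h : ∀ t, (c t).Nonempty) :
    ∃ (m : SimplexCategory) (ι : m ⟶ n) (e : SubsetChain q m), (∀ t, (e t).Nonempty) ∧
      e.image ι = c ∧ ∀ v, (∀ t, v ∉ c t) → ∀ k, ι.toOrderHom k ≠ v := by
  obtain ⟨d, hd⟩ : ∃ d, (c (Fin.last q.len)).card = d + 1 :=
    Nat.exists_eq_succ_of_ne_zero (h _).card_pos.ne'
  let ι : ⦋d⦌ ⟶ n := SimplexCategory.Hom.mk ((c (Fin.last q.len)).orderEmbOfFin hd).toOrderHom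
  have hι : ∀ v, v ∈ c (Fin.last q.len) ↔ ∃ k, ι.toOrderHom k = v := fun v => by
    rw [← Finset.mem_coe, ← Finset.range_orderEmbOfFin _ hd]
    rfl
  let e : SubsetChain q ⦋d⦌ := ⟨fun t => Finset.univ.filter fun k => ι.toOrderHom k ∈ c t,
    fun s t hst k hk => Finset.mem_filter.2 ⟨Finset.mem_univ _, c.monotone hst
      (Finset.mem_filter.1 hk).2⟩⟩
  have he : e.image ι = c := by
    ext t v
    constructor
    · intro hv
      obtain ⟨k, hk, rfl⟩ := Finset.mem_image.1 hv
      exact (Finset.mem_filter.1 hk).2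
    · intro hv
      obtain ⟨k, rfl⟩ := (hι v).1 (c.monotone (Fin.le_last t) hv)
      exact Finset.mem_image.2 ⟨k, Finset.mem_filter.2 ⟨Finset.mem_univ _, hv⟩, rfl⟩
  refine ⟨⦋d⦌, ι, e, fun t => ?_, he, fun v hv k hk => hv _ ((hι v).2 ⟨k, hk⟩)⟩
  have := h t
  rw [← he] at this
  exact Finset.image_nonempty.1 this

end Ex

/-! ### Deformation of `Ex K` into a Kan complex `K` -/

theorem SubsetChain.exists_preimage {q : SimplexCategory} {n : ℕ} (c : SubsetChain q ⦋n + 1⦌)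
    (h : ∀ t, (c t).Nonempty) {v : Fin (n + 2)} (hv : ∀ t, v ∉ c t) :
    ∃ c' : SubsetChain q ⦋n⦌, (∀ t, (c' t).Nonempty) ∧ c'.image (SimplexCategory.δ v) = c := by
  obtain ⟨m, ι, e, he, rfl, hι⟩ := c.exists_support h
  obtain ⟨g, rfl⟩ := (factors_δ_iff ι v).2 (hι v hv)
  exact ⟨e.image g, SubsetChain.image_nonempty he g, e.image_comp _ _⟩

theorem δ_injective {n : ℕ} (v : Fin (n + 2)) :
    Function.Injective (SimplexCategory.δ v).toOrderHom :=
  Fin.succAbove_right_injective (p := v)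

/-- A horn in `Ex K` is a map to `K` from the chains of subsets which miss a vertex `v ≠ k`. This
part of the subdivision is contractible by `A ⊆ A ∪ {k} ⊇ {k}`. -/
instance kanComplex_ex {K : SSet.{u}} [SSet.KanComplex K] : SSet.KanComplex (SSet.ex.obj K) := by
  rw [kanComplex_iff_exists_fill]
  intro n k y hy
  obtain ⟨φ, hφ⟩ := (isUnionOfFaces_horn n k).exists_hom hy
  let Good : ∀ q : SimplexCategory, (Fin (q.len + 1) →o Finset (Fin (n + 2))) → Prop :=
    fun q c => (∀ t, (c t).Nonempty) ∧ ∃ v, v ≠ k ∧ ∀ t, v ∉ c t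
  -- the value on a chain does not depend on the missing vertex
  have key : ∀ q (c : SubsetChain q ⦋n + 1⦌), Good q c → ∃ w : K.obj (op q),
      ∀ v, v ≠ k → ∀ (c' : SubsetChain q ⦋n⦌) h, c'.image (SimplexCategory.δ v) = c →
        exEval (y v) c' h = w := by
    rintro q c ⟨h, v₀, hv₀, hv₀'⟩
    obtain ⟨m, ι, e, he, rfl, hι⟩ := c.exists_support h
    have hmem : SSet.stdSimplex.objEquiv.symm ι ∈ (SSet.horn.{u} (n + 1) k).obj (op m) :=
      ((isUnionOfFaces_horn n k) _ _).2 ⟨v₀, hv₀, (factors_δ_iff ι v₀).2 (hι v₀ hv₀')⟩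
    refine ⟨exEval (φ.app (op m) ⟨_, hmem⟩) e he, fun v hv c' h' hc' => ?_⟩
    have hvc : ∀ t, v ∉ (e.image ι) t := fun t ht => by
      rw [← hc'] at ht
      obtain ⟨k, -, hk⟩ := Finset.mem_image.1 ht
      exact Fin.succAbove_ne _ _ hk
    obtain ⟨g, rfl⟩ := (factors_δ_iff ι v).2 (hι v hvc)
    obtain rfl : c' = e.image g := by
      rw [← e.image_comp] at hc'
      exact SubsetChain.image_injective (δ_injective v) hc'
    rw [hφ m _ hmem v hv g rfl, exEval_map]
  choose f hf using key
  obtain ⟨F, hF⟩ := exists_extension_of_contractible (K := K)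
    (Z := SimplexCategory.sd.{u}.obj ⦋n + 1⦌)
    { obj := fun q => {z | Good q.unop (sdChain (q := q.unop) z)}
      map := by
        rintro q q' θ z ⟨h, v, hv, hv'⟩
        exact ⟨fun t => h _, v, hv, fun t => hv' _⟩ }
    Good ⟨fun A => insert k A, fun _ _ h => Finset.insert_subset_insert k h⟩ {k}
    (fun A => Finset.subset_insert k A)
    (fun A => Finset.singleton_subset_iff.2 (Finset.mem_insert_self k A))
    (by
      rintro q c c' ⟨h, v, hv, hv'⟩ hc
      refine ⟨fun t => ?_, v, hv, fun t => ?_⟩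
      · rcases hc t with h' | h' | h' <;> rw [h']
        exacts [h t, Finset.insert_nonempty _ _, Finset.singleton_nonempty _]
      · rcases hc t with h' | h' | h' <;> rw [h']
        · exact hv' t
        · exact fun h'' => (Finset.mem_insert.1 h'').elim hv (hv' t)
        · exact fun h'' => hv (Finset.mem_singleton.1 h''))
    (by
      obtain ⟨v, hv⟩ := exists_ne k
      exact ⟨fun _ => Finset.singleton_nonempty k, v, hv, fun t h => hv (Finset.mem_singleton.1 h)⟩)
    f (by
      intro q q' θ c h h'
      obtain ⟨hc, v, hv, hv'⟩ := id h
      obtain ⟨c', hc', rfl⟩ := SubsetChain.exists_preimage c hc hv'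
      rw [← hf q _ h v hv c' hc' rfl, exEval_comp]
      exact hf q' _ h' v hv _ _ rfl)
    (fun q z _ => sdChain z) (fun _ _ _ _ _ _ => rfl) (fun q z hz => hz)
  refine ⟨ULift.up F, fun v hv => exEval_ext fun q c hc => ?_⟩
  refine (exEval_map (SimplexCategory.δ v)
    (ULift.up F : (SSet.ex.obj K).obj (op ⦋n + 1⦌)) c hc).trans ?_
  have hz := sdChain_sdSimplex.{u} (c.image (SimplexCategory.δ v)) (SubsetChain.image_nonempty hc _)
  have hg : Good q (c.image (SimplexCategory.δ v)) := ⟨SubsetChain.image_nonempty hc _, v, hv,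
    fun t ht => by
      obtain ⟨k, -, hk⟩ := Finset.mem_image.1 ht
      exact Fin.succAbove_ne _ _ hk⟩
  refine (hF q _ (by rw [← hz] at hg; exact hg)).trans ?_
  rw [hf q _ hg v hv c hc rfl]
  congr 1

/-- Every simplex `y` of `L` whose boundary is the image of a map `x` from `∂Δ[n]` to `K` is
homotopic, relative to the boundary, to the image of a simplex `v` of `K` that extends `x`. -/
def IsDeformable {K L : SSet.{u}} (f : K ⟶ L) : Prop :=
  ∀ (n : ℕ) (y : L.obj (op ⦋n⦌)) (x : ∀ (q : SimplexCategory) (z : q ⟶ ⦋n⦌),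
      (∃ j, Misses z j) → K.obj (op q)),
    (∀ q q' (θ : q' ⟶ q) z h h', K.map θ.op (x q z h) = x q' (θ ≫ z) h') →
    (∀ q z h, f.app _ (x q z h) = L.map z.op y) →
    ∃ (v : K.obj (op ⦋n⦌)) (H : ∀ q : SimplexCategory, (q ⟶ ⦋n⦌) → (q ⟶ ⦋1⦌) → L.obj (op q)),
      (∀ q z h, K.map z.op v = x q z h) ∧
      (∀ q q' (θ : q' ⟶ q) z α, L.map θ.op (H q z α) = H q' (θ ≫ z) (θ ≫ α)) ∧
      (∀ q z α, (∀ t, α.toOrderHom t = 0) → H q z α = L.map z.op y) ∧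
      (∀ q z α, (∀ t, α.toOrderHom t = 1) → H q z α = f.app _ (K.map z.op v)) ∧
      ∀ q z α, (∃ j, Misses z j) → H q z α = L.map z.op y

section Cylinder

/-- The simplicial set of chains in a preordered set. -/
def chainSSet (P : Type) [Preorder P] : SSet.{u} where
  obj q := ULift.{u} (Fin (q.unop.len + 1) →o P)
  map θ := TypeCat.ofHom fun c => ⟨c.down.comp θ.unop.toOrderHom⟩

variable {n : ℕ}

/-- The ambient poset of the cylinder of the last vertex map `sd Δⁿ ⟶ Δⁿ`: `(A, ⊥)` is the vertex
`A` of `sd Δⁿ`, and `(Iic i, i)` is the vertex `i` of `Δⁿ`. Then `A ≤ i` holds if and only if the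
last vertex of `A` is at most `i`. -/
abbrev CylPair (n : ℕ) := Finset (Fin (n + 1)) × WithBot (Fin (n + 1))

/-- The pairs which are elements of the cylinder poset. -/
def InCyl (p : CylPair n) : Prop :=
  (p.2 = ⊥ ∧ p.1.Nonempty) ∨ ∃ i : Fin (n + 1), p = (Finset.Iic i, (i : WithBot (Fin (n + 1))))

/-- The element `p` of the cylinder poset lies over the face of `Δⁿ` opposite to `v`. -/
def CylMisses (p : CylPair n) (v : Fin (n + 1)) : Prop := (p.2 = ⊥ → v ∉ p.1) ∧ p.2 ≠ v

/-- The projection of the cylinder to `Δⁿ`. -/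
noncomputable def cylVertex {q : SimplexCategory} (c : Fin (q.len + 1) →o CylPair n) : q ⟶ ⦋n⦌ :=
  SimplexCategory.Hom.mk ⟨fun t => (c t).1.sup id, fun _ _ h => Finset.sup_mono (c.monotone h).1⟩

theorem sup_Iic (i : Fin (n + 1)) : (Finset.Iic i).sup id = i :=
  le_antisymm (Finset.sup_le fun _ h => Finset.mem_Iic.1 h)
    (Finset.le_sup (f := id) (Finset.mem_Iic.2 le_rfl))

theorem misses_cylVertex {q : SimplexCategory} {c : Fin (q.len + 1) →o CylPair n}
    (hc : ∀ t, InCyl (c t)) {v} (hv : ∀ t, CylMisses (c t) v) : Misses (cylVertex c) v := by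
  intro t ht
  have ht : (c t).1.sup id = v := ht
  rcases hc t with ⟨h1, h2⟩ | ⟨i, hi⟩
  · refine (hv t).1 h1 ?_
    rw [← ht, ← Finset.sup'_eq_sup h2]
    exact Finset.sup'_mem _ (fun a ha b hb => by
      rcases le_total a b with h | h
      · rwa [sup_eq_right.2 h]
      · rwa [sup_eq_left.2 h]) _ _ _ fun a ha => ha
  · refine (hv t).2 ?_
    rw [hi] at ht ⊢
    rw [← ht]
    exact congrArg _ (sup_Iic i).symm

/-- The chains in the cylinder poset whose elements in `Δⁿ` are vertices `i ≥ m`, and the chains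
which lie over the boundary of `Δⁿ`. For `m = n + 1` these form `sd Δⁿ` and the cylinder of the
boundary, for `m = 0` the whole cylinder. -/
def CylGood (m : ℕ) (q : SimplexCategory) (c : Fin (q.len + 1) →o CylPair n) : Prop :=
  (∀ t, InCyl (c t)) ∧ ((∀ t (i : Fin (n + 1)), (c t).2 = i → m ≤ i) ∨
    ∃ v, ∀ t, CylMisses (c t) v)

/-- The elements comparable with the vertex `m` of `Δⁿ`, apart from the vertices `i < m`. A chain
which has to be added to `CylGood (m + 1)` to get `CylGood m` consists of such elements. -/
def CylCone (m : Fin (n + 1)) (p : CylPair n) : Prop :=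
  (p.2 = ⊥ → p.1 ⊆ Finset.Iic m) ∧ ∀ i : Fin (n + 1), p.2 = i → m ≤ i

theorem CylGood.exists_misses {q : SimplexCategory} {c : Fin (q.len + 1) →o CylPair n}
    (h : CylGood (n + 1) q c) (hc : ¬ ∀ t, (c t).2 = ⊥) : ∃ v, ∀ t, CylMisses (c t) v := by
  refine h.2.resolve_left fun h2 => ?_
  push Not at hc
  obtain ⟨t, ht⟩ := hc
  obtain ⟨i, hi⟩ := WithBot.ne_bot_iff_exists.1 ht
  have := h2 t i hi.symm
  omega

theorem CylGood.of_not_cone {m : Fin (n + 1)} {q : SimplexCategory}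
    {c : Fin (q.len + 1) →o CylPair n} (h : CylGood m q c) (hc : ¬ ∀ t, CylCone m (c t)) :
    CylGood (m + 1) q c := by
  refine ⟨h.1, h.2.imp_left fun h2 s i hi => ?_⟩
  push Not at hc
  obtain ⟨t, ht⟩ := hc
  have h3 : ∀ i : Fin (n + 1), (c t).2 = i → m ≤ i := fun i hi => Fin.le_def.2 (h2 t i hi)
  have h4 : (c t).2 = ⊥ ∧ ¬ (c t).1 ⊆ Finset.Iic m := by
    by_contra h5
    exact ht ⟨fun h6 => by_contra fun h7 => h5 ⟨h6, h7⟩, h3⟩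
  obtain ⟨a, ha, ham⟩ := Finset.not_subset.1 h4.2
  have hts : t ≤ s := by
    by_contra hst
    have := (c.monotone (not_le.1 hst).le).2
    rw [hi, h4.1] at this
    simp at this
  have hs : c s = (Finset.Iic i, (i : WithBot (Fin (n + 1)))) := by
    rcases h.1 s with ⟨h5, -⟩ | ⟨j, hj⟩
    · rw [hi] at h5
      simp at h5
    · rw [hj] at hi ⊢
      obtain rfl := WithBot.coe_injective hi
      rfl
  have h6 := (c.monotone hts).1 ha
  rw [hs] at h6
  have h7 := Finset.mem_Iic.1 h6
  have h8 : ¬ a ≤ m := fun h => ham (Finset.mem_Iic.2 h)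
  simp only [Fin.le_def] at h7 h8
  omega

/-- A map to a Kan complex extends from `CylGood (m + 1)` to `CylGood m`: the chains in
`CylGood (m + 1)` with elements in `CylCone m` are contractible by
`p ≤ (p.1 ∪ {m}, p.2) ≥ ({m}, ⊥)`, where the first map fixes the vertices `i ≥ m` of `Δⁿ`. -/
theorem exists_cyl_extension {K : SSet.{u}} [SSet.KanComplex K] (m : Fin (n + 1))
    (f : ∀ q c, CylGood (n := n) (m + 1) q c → K.obj (op q))
    (hf : ∀ q q' (θ : q' ⟶ q) c h h', K.map θ.op (f q c h) = f q' (c.comp θ.toOrderHom) h') :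
    ∃ f' : ∀ q c, CylGood (n := n) m q c → K.obj (op q),
      (∀ q q' (θ : q' ⟶ q) c h h', K.map θ.op (f' q c h) = f' q' (c.comp θ.toOrderHom) h') ∧
      ∀ q c h h', f' q c h = f q c h' := by
  classical
  let Good : ∀ q : SimplexCategory, (Fin (q.len + 1) →o CylPair n) → Prop :=
    fun q c => CylGood (m + 1) q c ∧ ∀ t, CylCone m (c t)
  obtain ⟨F, hF⟩ := exists_extension_of_contractible (K := K) (Z := chainSSet.{u} (CylPair n))
    { obj := fun q => {z | Good q.unop z.down}
      map := by
        rintro q q' θ z ⟨⟨h, h'⟩, h''⟩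
        exact ⟨⟨fun t => h _, h'.imp (fun h t => h _) fun ⟨v, hv⟩ => ⟨v, fun t => hv _⟩⟩,
          fun t => h'' _⟩ }
    Good ⟨fun p => (insert m p.1, p.2), fun _ _ h => ⟨Finset.insert_subset_insert m h.1, h.2⟩⟩
    ({m}, ⊥) (fun p => ⟨Finset.subset_insert m p.1, le_rfl⟩)
    (fun p => ⟨Finset.singleton_subset_iff.2 (Finset.mem_insert_self m p.1), bot_le⟩)
    (by
      rintro q c c' ⟨⟨h1, h2⟩, h3⟩ hc
      have hins : ∀ t (i : Fin (n + 1)), c t = (Finset.Iic i, (i : WithBot (Fin (n + 1)))) →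
          insert m (Finset.Iic i) = Finset.Iic i := fun t i hi =>
        Finset.insert_eq_of_mem (Finset.mem_Iic.2 ((h3 t).2 i (by rw [hi])))
      have hsnd : ∀ t, (c' t).2 = ⊥ ∨ (c' t).2 = (c t).2 := fun t => by
        rcases hc t with h' | h' | h' <;> rw [h']
        exacts [Or.inr rfl, Or.inr rfl, Or.inl rfl]
      have hsnd' : ∀ t (i : Fin (n + 1)), (c' t).2 = i → (c t).2 = i := fun t i hi => by
        rcases hsnd t with h' | h'
        · rw [hi] at h'
          simp at h'
        · rw [← h', hi]
      refine ⟨⟨fun t => ?_, ?_⟩, fun t => ⟨fun h0 => ?_, fun i hi => (h3 t).2 i (hsnd' t i hi)⟩⟩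
      · rcases hc t with h' | h' | h' <;> rw [h']
        · exact h1 t
        · rcases h1 t with ⟨h4, h5⟩ | ⟨i, hi⟩
          · exact Or.inl ⟨h4, Finset.insert_nonempty _ _⟩
          · refine Or.inr ⟨i, ?_⟩
            rw [hi]
            exact congrArg (Prod.mk · _) (hins t i hi)
        · exact Or.inl ⟨rfl, Finset.singleton_nonempty m⟩
      · by_cases h4 : ∀ t (i : Fin (n + 1)), (c t).2 = i → (m : ℕ) + 1 ≤ i
        · exact Or.inl fun t i hi => h4 t i (hsnd' t i hi)
        · obtain ⟨v, hv⟩ := h2.resolve_left h4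
          push Not at h4
          obtain ⟨t₀, i, hi, him⟩ := h4
          have hmi := Fin.le_def.1 ((h3 t₀).2 i hi)
          have hvm : v ≠ m := by
            rintro rfl
            refine (hv t₀).2 ?_
            rw [hi]
            exact congrArg _ (Fin.ext (by omega))
          refine Or.inr ⟨v, fun t => ⟨fun h0 => ?_, fun h5 => (hv t).2 (hsnd' t v h5)⟩⟩
          rcases hc t with h' | h' | h' <;> rw [h'] at h0 ⊢
          · exact (hv t).1 h0
          · exact fun h6 => (Finset.mem_insert.1 h6).elim hvm ((hv t).1 h0)
          · exact fun h6 => hvm (Finset.mem_singleton.1 h6)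
      · rcases hc t with h' | h' | h' <;> rw [h'] at h0 ⊢
        · exact (h3 t).1 h0
        · exact Finset.insert_subset (Finset.mem_Iic.2 le_rfl) ((h3 t).1 h0)
        · exact Finset.singleton_subset_iff.2 (Finset.mem_Iic.2 le_rfl))
    ⟨⟨fun _ => Or.inl ⟨rfl, Finset.singleton_nonempty m⟩, Or.inl fun t i hi => by
        exact absurd hi (WithBot.bot_ne_coe)⟩,
      fun t => ⟨fun _ => Finset.singleton_subset_iff.2 (Finset.mem_Iic.2 le_rfl), fun i hi => by
        exact absurd hi (WithBot.bot_ne_coe)⟩⟩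
    (fun q c h => f q c h.1) (fun q q' θ c h h' => hf _ _ _ _ _ _)
    (fun q z _ => z.down) (fun _ _ _ _ _ _ => rfl) (fun q z hz => hz)
  obtain ⟨F, hFn, hF⟩ : ∃ F : ∀ q, (Fin (SimplexCategory.len q + 1) →o CylPair n) → K.obj (op q),
      (∀ q q' (θ : q' ⟶ q) c, K.map θ.op (F q c) = F q' (c.comp θ.toOrderHom)) ∧
        ∀ q c (h : Good q c), F q c = f q c h.1 :=
    ⟨fun q c => F.app (op q) (⟨c⟩ : ULift _), fun q q' θ c =>
      (F.naturality_apply θ.op (⟨c⟩ : (chainSSet.{u} (CylPair n)).obj (op q))).symm,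
      fun q c h => hF q ⟨c⟩ h⟩
  refine ⟨fun q c h => if hc : ∀ t, CylCone m (c t) then F q c else
    f q c (h.of_not_cone hc), fun q q' θ c h h' => ?_, fun q c h h' => ?_⟩
  · dsimp only
    by_cases hc : ∀ t, CylCone m (c t)
    · have hc' : ∀ t, CylCone m (c.comp θ.toOrderHom t) := fun t => hc _
      rw [dif_pos hc, dif_pos hc']
      exact hFn _ _ _ _
    · rw [dif_neg hc]
      have hg := h.of_not_cone hc
      have hg' : CylGood (m + 1) q' (c.comp θ.toOrderHom) := ⟨fun t => hg.1 _, hg.2.imp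
        (fun h t => h _) fun ⟨v, hv⟩ => ⟨v, fun t => hv _⟩⟩
      rw [hf _ _ _ _ _ hg']
      by_cases hc' : ∀ t, CylCone m (c.comp θ.toOrderHom t)
      · rw [dif_pos hc']
        exact (hF q' _ ⟨hg', hc'⟩).symm
      · rw [dif_neg hc']
  · dsimp only
    by_cases hc : ∀ t, CylCone m (c t)
    · rw [dif_pos hc]
      exact hF q _ ⟨h', hc⟩
    · rw [dif_neg hc]

theorem exists_cyl_extension_all {K : SSet.{u}} [SSet.KanComplex K]
    (f : ∀ q c, CylGood (n := n) (n + 1) q c → K.obj (op q))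
    (hf : ∀ q q' (θ : q' ⟶ q) c h h', K.map θ.op (f q c h) = f q' (c.comp θ.toOrderHom) h') :
    ∃ f' : ∀ q (c : Fin (q.len + 1) →o CylPair n), (∀ t, InCyl (c t)) → K.obj (op q),
      (∀ q q' (θ : q' ⟶ q) c h h', K.map θ.op (f' q c h) = f' q' (c.comp θ.toOrderHom) h') ∧
      ∀ q c h h', f' q c h = f q c h' := by
  have key : ∀ m ≤ n + 1, ∃ f' : ∀ q c, CylGood (n := n) m q c → K.obj (op q),
      (∀ q q' (θ : q' ⟶ q) c h h', K.map θ.op (f' q c h) = f' q' (c.comp θ.toOrderHom) h') ∧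
      ∀ q c h h', f' q c h = f q c h' := by
    intro m hm
    induction hm using Nat.decreasingInduction with
    | self => exact ⟨f, hf, fun _ _ _ _ => rfl⟩
    | of_succ m hm ih =>
      obtain ⟨f₁, h₁, h₁'⟩ := ih
      obtain ⟨f₂, h₂, h₂'⟩ := exists_cyl_extension ⟨m, hm⟩ f₁ h₁
      refine ⟨f₂, h₂, fun q c h h' => ?_⟩
      have h3 : CylGood (m + 1) q c := ⟨h'.1, h'.2.imp_left fun h4 t i hi => (by
        have := h4 t i hi
        omega)⟩
      exact (h₂' q c h h3).trans (h₁' q c h3 h')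
  obtain ⟨f', h1, h2⟩ := key 0 (by omega)
  exact ⟨fun q c h => f' q c ⟨h, Or.inl fun _ _ _ => Nat.zero_le _⟩,
    fun _ _ _ _ _ _ => h1 _ _ _ _ _ _,
    fun _ _ _ _ => h2 _ _ _ _⟩

/-- The inclusion of `sd Δⁿ` in the cylinder. -/
def cylBot {q : SimplexCategory} (c : SubsetChain q ⦋n⦌) : Fin (q.len + 1) →o CylPair n where
  toFun t := (c t, ⊥)
  monotone' _ _ h := ⟨c.monotone h, le_rfl⟩

/-- The first components of a chain of pairs. -/
def cylFst {q : SimplexCategory} (c : Fin (q.len + 1) →o CylPair n) : SubsetChain q ⦋n⦌ where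
  toFun t := (c t).1
  monotone' _ _ h := (c.monotone h).1

/-- The inclusion of `Δⁿ` in the cylinder. -/
def cylTop (i : Fin (n + 1)) : CylPair n := (Finset.Iic i, (i : WithBot (Fin (n + 1))))

theorem cylTop_mono {i j : Fin (n + 1)} (h : i ≤ j) : cylTop i ≤ cylTop j :=
  ⟨Finset.Iic_subset_Iic.2 h, WithBot.coe_le_coe.2 h⟩

theorem le_cylTop {A B : Finset (Fin (n + 1))} (h : A ⊆ B) : (A, ⊥) ≤ cylTop (B.sup id) :=
  ⟨fun _ ha => Finset.mem_Iic.2 (Finset.le_sup (f := id) (h ha)), bot_le⟩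

open Classical in
/-- The image of a chain of subsets of `[m]` in the cylinder, with the subsets whose last vertex
is at the end `1` pushed to `Δⁿ`. As `(z, α)` varies, this is a homotopy between the simplices of
`Ex` of the cylinder given by the inclusions of `sd Δⁿ` and of `Δⁿ`. -/
noncomputable def cylMix {m q : SimplexCategory} (z : m ⟶ ⦋n⦌) (α : m ⟶ ⦋1⦌)
    (c : SubsetChain q m) : Fin (q.len + 1) →o CylPair n where
  toFun t := if α.toOrderHom (c.lastVertex.toOrderHom t) = (1 : Fin 2) then
    cylTop ((c.image z t).sup id) else (c.image z t, ⊥)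
  monotone' s t hst := by
    have h1 : (α.toOrderHom (c.lastVertex.toOrderHom s) : Fin 2) ≤
      α.toOrderHom (c.lastVertex.toOrderHom t) :=
      α.toOrderHom.monotone (c.lastVertex.toOrderHom.monotone hst)
    have h2 := (c.image z).monotone hst
    dsimp only
    split_ifs with hs ht ht
    · exact cylTop_mono (Finset.sup_mono h2)
    · rw [hs] at h1
      exact absurd (le_antisymm (Fin.le_last _) h1) ht
    · exact le_cylTop h2
    · exact ⟨h2, le_rfl⟩

/-- A simplex `y` of `Ex K` with boundary `x` in `K` gives a map to `K` from `sd Δⁿ` and from the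
cylinder of the boundary, which extends to the cylinder. The simplex `v` is the value at the end
`Δⁿ`, and `cylMix` gives the homotopy. -/
theorem isDeformable_toEx (K : SSet.{u}) [SSet.KanComplex K] :
    IsDeformable (K := K) (toEx.app K) := by
  classical
  intro n y x hx hxy
  -- the two definitions agree on the subdivision of the boundary
  have B : ∀ q (c : SubsetChain q ⦋n⦌) (h : ∀ t, (c t).Nonempty) (h' : ∃ j, Misses c.lastVertex j),
      (∃ v, ∀ t, v ∉ c t) → exEval y c h = x q c.lastVertex h' := by
    rintro q c h h' ⟨v, hv⟩
    obtain ⟨m, ι, e, he, rfl, hι⟩ := c.exists_support h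
    refine (exEval_map ι y e he).symm.trans ?_
    rw [← hxy m ι ⟨v, hι v hv⟩]
    refine (exEval_toEx _ _ _).trans ?_
    have hl := e.image_lastVertex he ι
    refine (hx _ _ _ _ _ ⟨v, fun t => hι v hv _⟩).trans ?_
    congr 1
    exact hl.symm
  have key : ∀ q (c : Fin (q.len + 1) →o CylPair n), CylGood (n + 1) q c → ∃ w : K.obj (op q),
      (∀ (e : SubsetChain q ⦋n⦌) h, cylBot e = c → w = exEval y e h) ∧
        ∀ v h, (∀ t, CylMisses (c t) v) → w = x q (cylVertex c) h := by
    rintro q c ⟨h1, h2⟩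
    by_cases hc : ∀ t, (c t).2 = ⊥
    · refine ⟨exEval y (cylFst c) (fun t => (h1 t).elim And.right fun ⟨i, hi⟩ => ?_), ?_,
        fun v h hv => B _ (cylFst c) _ h ⟨v, fun t => (hv t).1 (hc t)⟩⟩
      · have := hc t
        rw [hi] at this
        exact absurd this WithBot.coe_ne_bot
      · rintro e h rfl
        rfl
    · obtain ⟨v, hv⟩ := CylGood.exists_misses ⟨h1, h2⟩ hc
      refine ⟨x q (cylVertex c) ⟨v, misses_cylVertex h1 hv⟩, ?_, fun _ _ _ => rfl⟩
      rintro e h rfl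
      exact absurd (fun _ => rfl) hc
  choose f₀ hf₀ hf₀' using key
  obtain ⟨f, hf, hf'⟩ := exists_cyl_extension_all (n := n) (K := K) f₀ (by
    intro q q' θ c h h'
    by_cases hc : ∀ t, (c t).2 = ⊥
    · obtain ⟨e, rfl⟩ : ∃ e, cylBot e = c := ⟨cylFst c, by
        ext t : 2
        exact Prod.ext rfl (hc t).symm⟩
      have he : ∀ t, (e t).Nonempty := fun t => (h.1 t).elim And.right fun ⟨i, hi⟩ =>
        absurd (congrArg Prod.snd hi).symm WithBot.coe_ne_bot
      rw [hf₀ _ _ h e he rfl, hf₀ _ _ h' (e.comp θ.toOrderHom) (fun _ => he _) rfl, exEval_comp]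
    · obtain ⟨v, hv⟩ := h.exists_misses hc
      rw [hf₀' _ _ h v ⟨v, misses_cylVertex h.1 hv⟩ hv,
        hf₀' _ _ h' v ⟨v, (misses_cylVertex h.1 hv).precomp θ⟩ fun _ => hv _]
      exact hx _ _ _ _ _ _)
  have f_bot : ∀ q (c : SubsetChain q ⦋n⦌) (h : ∀ t, (c t).Nonempty) h',
      f q (cylBot c) h' = exEval y c h := fun q c h h' =>
    (hf' _ _ _ ⟨h', Or.inl fun t i hi => absurd hi WithBot.bot_ne_coe⟩).trans
      (hf₀ _ _ _ c h rfl)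
  have f_miss : ∀ q (c : Fin (q.len + 1) →o CylPair n) h v (hv : ∀ t, CylMisses (c t) v) h',
      f q c h = x q (cylVertex c) h' := fun q c h v hv h' =>
    (hf' _ _ _ ⟨h, Or.inr ⟨v, hv⟩⟩).trans (hf₀' _ _ _ v h' hv)
  have inMix : ∀ {m q : SimplexCategory} (z : m ⟶ ⦋n⦌) (α : m ⟶ ⦋1⦌) (c : SubsetChain q m)
      (_ : ∀ t, (c t).Nonempty) t, InCyl (cylMix z α c t) := by
    intro m q z α c h t
    change InCyl (ite _ _ _)
    split_ifs
    · exact Or.inr ⟨_, rfl⟩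
    · exact Or.inl ⟨rfl, SubsetChain.image_nonempty h z t⟩
  let top : Fin (n + 1) →o CylPair n := ⟨cylTop, fun _ _ h => cylTop_mono h⟩
  have htop : ∀ q (z : q ⟶ ⦋n⦌), ∀ t, InCyl (top.comp z.toOrderHom t) :=
    fun q z t => Or.inr ⟨_, rfl⟩
  have key : ∀ (m : SimplexCategory) (z : m ⟶ ⦋n⦌) (α : m ⟶ ⦋1⦌),
      ∃ w : (SSet.ex.obj K).obj (op m), ∀ q c h,
        exEval w c h = f q (cylMix z α c) (inMix z α c h) :=
    fun m z α => exists_exEval_eq _ fun q q' θ c h => hf _ _ _ _ _ _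
  choose H hH using key
  let v : K.obj (op ⦋n⦌) := f ⦋n⦌ top (htop _ (𝟙 _))
  have hv : ∀ q (z : q ⟶ ⦋n⦌), K.map z.op v = f q (top.comp z.toOrderHom) (htop q z) :=
    fun q z => hf _ _ z _ _ _
  have hvz : ∀ q (z : q ⟶ ⦋n⦌), cylVertex (top.comp z.toOrderHom) = z := fun q z => by
    ext t : 3
    exact sup_Iic (z.toOrderHom t)
  have congr_f : ∀ q c c' h h', c = c' → f q c h = f q c' h' := by
    rintro q c _ h h' rfl
    rfl
  have congr_x : ∀ q c c' h h', c = c' → x q c h = x q c' h' := by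
    rintro q c _ h h' rfl
    rfl
  have mixVertex : ∀ {m q : SimplexCategory} (z : m ⟶ ⦋n⦌) (α : m ⟶ ⦋1⦌) (c : SubsetChain q m),
      (∀ t, (c t).Nonempty) → cylVertex (cylMix z α c) = c.lastVertex ≫ z := fun z α c h => by
    rw [← c.image_lastVertex h]
    ext t : 3
    change (ite _ _ _ : CylPair n).1.sup id = (c.image z t).sup id
    split_ifs
    · exact sup_Iic _
    · rfl
  refine ⟨v, H, fun q z h => ?_, fun q q' θ z α => exEval_ext fun p c hc => ?_,
    fun q z α hα => exEval_ext fun p c hc => ?_, fun q z α hα => exEval_ext fun p c hc => ?_,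
    fun q z α ⟨j, hj⟩ => exEval_ext fun p c hc => ?_⟩
  · rw [hv]
    obtain ⟨j, hj⟩ := h
    refine (f_miss _ _ _ j (fun t => ⟨fun h0 => absurd h0 WithBot.coe_ne_bot,
      fun h0 => hj t (WithBot.coe_injective h0)⟩) ⟨j, (hvz q z).symm ▸ hj⟩).trans ?_
    exact congr_x _ _ _ _ _ (hvz q z)
  · rw [exEval_map, hH, hH]
    refine congr_f _ _ _ _ _ ?_
    ext t : 2
    change ite _ _ _ = ite _ _ _
    rw [c.image_lastVertex hc, c.image_comp]
    rfl
  · rw [hH, exEval_map, ← f_bot _ _ _ fun t => Or.inl ⟨rfl, SubsetChain.image_nonempty hc z t⟩]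
    refine congr_f _ _ _ _ _ ?_
    ext t : 2
    exact if_neg (by rw [hα]; exact Fin.zero_ne_one)
  · rw [hH, exEval_toEx, hv]
    refine Eq.trans ?_ (hf _ _ c.lastVertex _ _ fun t => htop q z _).symm
    refine congr_f _ _ _ _ _ ?_
    ext t : 2
    refine (if_pos (hα _)).trans (congrArg cylTop ?_)
    exact congrArg (fun g => g.toOrderHom t) (c.image_lastVertex hc z)
  · rw [hH, ← hxy q z ⟨j, hj⟩]
    refine Eq.trans ?_ (exEval_toEx _ _ _).symm
    rw [hx _ _ _ _ _ ⟨j, hj.precomp _⟩]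
    have hj' : ∀ t, j ∉ c.image z t := fun t ht => by
      obtain ⟨k, -, hk⟩ := Finset.mem_image.1 ht
      exact hj k hk
    refine (f_miss _ _ _ j (fun t => ?_) ⟨j, ?_⟩).trans (congr_x _ _ _ _ _ (mixVertex z α c hc))
    · change CylMisses (ite _ _ _) j
      split_ifs
      · refine ⟨fun h0 => absurd h0 WithBot.coe_ne_bot, fun h0 => ?_⟩
        have h1 : (c.image z t).sup id = j := WithBot.coe_injective h0
        have h2 : (c.image z t).sup id = z.toOrderHom (c.lastVertex.toOrderHom t) :=
          congrArg (fun g => g.toOrderHom t) (c.image_lastVertex hc z)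
        exact hj _ (h2.symm.trans h1)
      · exact ⟨fun _ => hj' t, fun h0 => absurd h0 WithBot.bot_ne_coe⟩
    · rw [mixVertex z α c hc]
      exact hj.precomp _

end Cylinder

/-! ### The passage to `Ex^∞` -/

/-- The data of a homotopy `Δ[n] × Δ[1] ⟶ L`. -/
abbrev CylFamily (L : SSet.{u}) (n : ℕ) :=
  ∀ q : SimplexCategory, (q ⟶ ⦋n⦌) → (q ⟶ ⦋1⦌) → L.obj (op q)

/-- The family is a map of simplicial sets. -/
def CylFamily.Natural {L : SSet.{u}} {n : ℕ} (H : CylFamily L n) : Prop :=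
  ∀ q q' (θ : q' ⟶ q) z α, L.map θ.op (H q z α) = H q' (θ ≫ z) (θ ≫ α)

/-- The concatenation of a homotopy `F` with a homotopy `H` which is constant on the boundary. -/
theorem exists_concat {L : SSet.{u}} [SSet.KanComplex L] {n : ℕ} {F H : CylFamily L n}
    (hF : F.Natural) (hH : H.Natural)
    (h0 : ∀ q z α β, (∀ t, α.toOrderHom t = 0) → (∀ t, β.toOrderHom t = 1) → H q z α = F q z β)
    (hm : ∀ q z α β, (∃ j, Misses z j) → (∀ t, β.toOrderHom t = 1) → H q z α = F q z β) :
    ∃ G : CylFamily L n, G.Natural ∧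
      (∀ q z α, ((∃ j, Misses z j) ∨ ∀ t, α.toOrderHom t = 0) → G q z α = F q z α) ∧
      ∀ q z α, (∀ t, α.toOrderHom t = 1) → G q z α = H q z α := by
  classical
  let A : (Δ[n] ⊗ Δ[1] : SSet.{u}).Subcomplex :=
    { obj := fun q => {z | (∃ j, Misses (SSet.stdSimplex.objEquiv z.1) j) ∨
        (∀ t, (SSet.stdSimplex.objEquiv z.2).toOrderHom t = 0) ∨
        ∀ t, (SSet.stdSimplex.objEquiv z.2).toOrderHom t = 1}
      map := by
        rintro q q' θ z h
        exact h.imp (fun ⟨j, h⟩ => ⟨j, h.precomp θ.unop⟩) (Or.imp (fun h t => h _) fun h t => h _) }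
  let h : ∀ q, (q ⟶ ⦋n⦌) → (q ⟶ ⦋1⦌) → (q ⟶ ⦋1⦌) → L.obj (op q) := fun q z α β =>
    if ∀ t, α.toOrderHom t = 1 then H q z β else F q z α
  have h1 : ∀ q z α β, (∀ t, α.toOrderHom t = 1) → h q z α β = H q z β :=
    fun q z α β hα => if_pos hα
  have h2 : ∀ q z α β, ((∃ j, Misses z j) ∨ ∀ t, α.toOrderHom t = 0) → h q z α β = F q z α := by
    intro q z α β hα
    by_cases hα' : ∀ t, α.toOrderHom t = 1
    · rw [h1 _ _ _ _ hα']
      refine hm _ _ _ _ (hα.resolve_right fun h => ?_) hα'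
      exact Fin.zero_ne_one ((h 0).symm.trans (hα' 0))
    · exact if_neg hα'
  obtain ⟨G, hG⟩ := exists_extension_of_homotopic A 0 1
    (fun q z _ β => h q (SSet.stdSimplex.objEquiv z.1) (SSet.stdSimplex.objEquiv z.2) β)
    (fun q q' θ z hz hz' β => by
      change L.map θ.op (h q _ _ β) = h q' (θ ≫ SSet.stdSimplex.objEquiv z.1)
        (θ ≫ SSet.stdSimplex.objEquiv z.2) (θ ≫ β)
      rcases hz with ⟨j, hj⟩ | hz | hz
      · rw [h2 _ _ _ _ (Or.inl ⟨j, hj⟩), h2 _ _ _ _ (Or.inl ⟨j, hj.precomp θ⟩), hF]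
      · exact (congrArg _ (h2 _ _ _ _ (Or.inr hz))).trans ((hF _ _ _ _ _).trans
          (h2 q' (θ ≫ _) (θ ≫ _) (θ ≫ β) (Or.inr fun t => hz _)).symm)
      · exact (congrArg _ (h1 _ _ _ _ hz)).trans ((hH _ _ _ _ _).trans
          (h1 q' (θ ≫ _) (θ ≫ _) (θ ≫ β) fun t => hz _).symm))
    (prodHom (fun q z α => F q (SSet.stdSimplex.objEquiv z) α) fun q q' θ z α => hF _ _ _ _ _)
    (fun q z hz β hβ => by
      change h q _ _ β = F q _ _
      by_cases hα : ∀ t, (SSet.stdSimplex.objEquiv z.2).toOrderHom t = 1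
      · rw [h1 _ _ _ _ hα]
        exact h0 _ _ _ _ hβ hα
      · exact if_neg hα)
  let pair : ∀ q, (q ⟶ ⦋n⦌) → (q ⟶ ⦋1⦌) → (Δ[n] ⊗ Δ[1] : SSet.{u}).obj (op q) := fun q z α =>
    (SSet.stdSimplex.objEquiv.symm z, SSet.stdSimplex.objEquiv.symm α)
  have hG' : ∀ q z α, ((∃ j, Misses z j) ∨ (∀ t, α.toOrderHom t = 0) ∨ ∀ t, α.toOrderHom t = 1) →
      G.app (op q) (pair q z α) = h q z α (SimplexCategory.const q ⦋1⦌ 1) :=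
    fun q z α hz => hG q (pair q z α) hz (SimplexCategory.const q ⦋1⦌ 1) fun _ => rfl
  refine ⟨fun q z α => G.app (op q) (pair q z α), fun q q' θ z α => ?_, fun q z α hz => ?_,
    fun q z α hα => ?_⟩
  · exact (G.naturality_apply θ.op (pair q z α)).symm
  · exact (hG' _ _ _ (hz.imp_right Or.inl)).trans (h2 _ _ _ _ hz)
  · refine (hG' _ _ _ (Or.inr (Or.inr hα))).trans ((h1 _ _ _ _ hα).trans ?_)
    congr 1
    ext t : 3
    exact (hα t).symm

theorem IsDeformable.id (K : SSet.{u}) : IsDeformable (𝟙 K) := fun _ y _ _ hx' =>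
  ⟨y, fun _ z _ => K.map z.op y, fun q z h => (hx' q z h).symm,
    fun _ _ θ z _ => (Functor.map_comp_apply K z.op θ.op y).symm, fun _ _ _ _ => rfl,
    fun _ _ _ _ => rfl, fun _ _ _ _ => rfl⟩

theorem IsDeformable.comp {K L M : SSet.{u}} {f : K ⟶ L} {g : L ⟶ M} [SSet.KanComplex M]
    (hf : IsDeformable f) (hg : IsDeformable g) : IsDeformable (f ≫ g) := by
  intro n y x hx hxy
  obtain ⟨w, F, hw, hF, F0, F1, Fm⟩ := hg n y (fun q z h => f.app _ (x q z h))
    (fun q q' θ z h h' => by rw [← NatTrans.naturality_apply, hx _ _ _ _ _ h'])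
    fun q z h => hxy q z h
  obtain ⟨v, H, hv, hH, H0, H1, Hm⟩ := hf n w x hx fun q z h => (hw q z h).symm
  obtain ⟨G, hG, G0, G1⟩ := exists_concat (F := F) (H := fun q z α => g.app _ (H q z α)) hF
    (fun q q' θ z α => by rw [← NatTrans.naturality_apply, hH])
    (fun q z α β hα hβ => by rw [H0 q z α hα, F1 q z β hβ])
    (fun q z α β hz hβ => by rw [Hm q z α hz, F1 q z β hβ])
  exact ⟨v, G, hv, hG, fun q z α hα => (G0 q z α (Or.inr hα)).trans (F0 q z α hα),
    fun q z α hα => (G1 q z α hα).trans (congrArg _ (H1 q z α hα)),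
    fun q z α hz => (G0 q z α (Or.inl hz)).trans (Fm q z α hz)⟩

section Colimit

variable {F : ℕ ⥤ SSet.{u}} {c : Limits.Cocone F} (hc : Limits.IsColimit c)
include hc

theorem exists_rep_of_isColimit {q : SimplexCategoryᵒᵖ} (x : c.pt.obj q) :
    ∃ k y, (c.ι.app k).app q y = x :=
  Limits.Types.jointly_surjective_of_isColimit
    (Limits.isColimitOfPreserves ((evaluation _ _).obj q) hc) x

theorem exists_map_eq_of_isColimit {q : SimplexCategoryᵒᵖ} {k : ℕ} {y y' : (F.obj k).obj q}
    (h : (c.ι.app k).app q y = (c.ι.app k).app q y') :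
    ∃ (l : ℕ) (hl : k ≤ l), (F.map (homOfLE hl)).app q y = (F.map (homOfLE hl)).app q y' := by
  obtain ⟨l, f, g, h⟩ := (Limits.Types.FilteredColimit.isColimit_eq_iff _
    (Limits.isColimitOfPreserves ((evaluation _ _).obj q) hc)).1 h
  exact ⟨l, leOfHom f, h⟩

omit hc in
theorem map_map_sequence {q : SimplexCategoryᵒᵖ} {k l m : ℕ} (h : k ≤ l) (h' : l ≤ m)
    (y : (F.obj k).obj q) : (F.map (homOfLE h')).app q ((F.map (homOfLE h)).app q y) =
      (F.map (homOfLE (h.trans h'))).app q y :=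
  (congrArg (fun f : F.obj k ⟶ F.obj m => f.app q y) (F.map_comp (homOfLE h) (homOfLE h'))).symm

omit hc in
theorem ι_map_sequence {q : SimplexCategoryᵒᵖ} {k l : ℕ} (h : k ≤ l)
    (y : (F.obj k).obj q) : (c.ι.app l).app q ((F.map (homOfLE h)).app q y) =
      (c.ι.app k).app q y :=
  congrArg (fun f : F.obj k ⟶ c.pt => f.app q y) (c.w (homOfLE h))

theorem exists_forall_map_eq_of_isColimit {ι : Type*} [Finite ι] {q : ι → SimplexCategoryᵒᵖ} {k : ℕ}
    {y y' : ∀ a, (F.obj k).obj (q a)}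
    (h : ∀ a, (c.ι.app k).app (q a) (y a) = (c.ι.app k).app (q a) (y' a)) :
    ∃ (l : ℕ) (hl : k ≤ l), ∀ a,
      (F.map (homOfLE hl)).app (q a) (y a) = (F.map (homOfLE hl)).app (q a) (y' a) := by
  choose l hl h' using fun a => exists_map_eq_of_isColimit hc (h a)
  obtain ⟨m, hm⟩ := Set.Finite.bddAbove (Set.finite_range l)
  refine ⟨max k m, le_max_left _ _, fun a => ?_⟩
  have ha : l a ≤ max k m := (hm ⟨a, rfl⟩).trans (le_max_right _ _)
  rw [← map_map_sequence (hl a) ha, ← map_map_sequence (hl a) ha, h' a]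

theorem exists_forall_rep_of_isColimit {ι : Type*} [Finite ι] {q : ι → SimplexCategoryᵒᵖ}
    (x : ∀ a, c.pt.obj (q a)) :
    ∃ (k : ℕ) (y : ∀ a, (F.obj k).obj (q a)), ∀ a, (c.ι.app k).app (q a) (y a) = x a := by
  choose k y h using fun a => exists_rep_of_isColimit hc (x a)
  obtain ⟨m, hm⟩ := Set.Finite.bddAbove (Set.finite_range k)
  exact ⟨m, fun a => (F.map (homOfLE (hm ⟨a, rfl⟩))).app _ (y a), fun a =>
    (ι_map_sequence (hm ⟨a, rfl⟩) _).trans (h a)⟩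

/-- A horn has finitely many faces, so it lifts to a stage of the sequence. -/
theorem kanComplex_of_isColimit (hF : ∀ k, SSet.KanComplex (F.obj k)) : SSet.KanComplex c.pt := by
  rw [kanComplex_iff_exists_fill]
  intro n k y hy
  obtain ⟨a, w, hw⟩ := exists_forall_rep_of_isColimit hc (q := fun _ => op ⦋n⦌) y
  obtain ⟨b, hab, hb⟩ : ∃ (b : ℕ) (hab : a ≤ b),
      FaceCompat {k}ᶜ fun j => (F.map (homOfLE hab)).app _ (w j) := by
    cases n with
    | zero => exact ⟨a, le_rfl, faceCompat_zero⟩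
    | succ n =>
      obtain ⟨b, hab, h⟩ := exists_forall_map_eq_of_isColimit hc (k := a)
        (ι := {p : Fin (n + 2) × Fin (n + 2) // p.1 ≤ p.2 ∧ p.1.castSucc ∈ ({k}ᶜ : Set _) ∧
          p.2.succ ∈ ({k}ᶜ : Set _)}) (q := fun _ => op ⦋n⦌)
        (y := fun p => (F.obj a).δ p.1.1 (w p.1.2.succ))
        (y' := fun p => (F.obj a).δ p.1.2 (w p.1.1.castSucc)) (fun p => by
          refine (NatTrans.naturality_apply (c.ι.app a) _ _).trans ?_
          refine Eq.trans ?_ (NatTrans.naturality_apply (c.ι.app a) _ _).symm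
          refine (congrArg _ (hw _)).trans (Eq.trans ?_ (congrArg _ (hw _)).symm)
          exact hy.δ_eq p.1.1 p.1.2 p.2.1 p.2.2.1 p.2.2.2)
      refine ⟨b, hab, FaceCompat.of_le fun i j hij hi hj => ?_⟩
      refine (NatTrans.naturality_apply (F.map (homOfLE hab)) _ _).symm.trans ?_
      exact (h ⟨(i, j), hij, hi, hj⟩).trans (NatTrans.naturality_apply (F.map (homOfLE hab)) _ _)
  have := hF b
  obtain ⟨z, hz⟩ := exists_fill k hb
  refine ⟨(c.ι.app b).app _ z, fun j hj => ?_⟩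
  refine (NatTrans.naturality_apply (c.ι.app b) _ _).symm.trans ?_
  refine (congrArg _ (hz j hj)).trans ((ι_map_sequence hab _).trans (hw j))

theorem isDeformable_of_isColimit (hF : ∀ k, IsDeformable (F.map (homOfLE (Nat.zero_le k)))) :
    IsDeformable (c.ι.app 0) := by
  intro n y x hx hxy
  obtain ⟨k, w, rfl⟩ := exists_rep_of_isColimit hc y
  obtain ⟨l, hl, h⟩ : ∃ (l : ℕ) (hl : k ≤ l), ∀ q (z : q ⟶ ⦋n⦌) h,
      (F.map (homOfLE (Nat.zero_le l))).app _ (x q z h) =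
        (F.obj l).map z.op ((F.map (homOfLE hl)).app _ w) := by
    cases n with
    | zero => exact ⟨k, le_rfl, fun q z ⟨j, h⟩ => absurd h (not_misses_zero z j)⟩
    | succ n =>
      have hδ : ∀ j : Fin (n + 2), ∃ i, Misses (SimplexCategory.δ j) i := fun j =>
        ⟨j, fun t => Fin.succAbove_ne _ _⟩
      obtain ⟨l, hl, h⟩ := exists_forall_map_eq_of_isColimit hc (k := k) (ι := Fin (n + 2))
        (q := fun _ => op ⦋n⦌)
        (y := fun j => (F.map (homOfLE (Nat.zero_le k))).app _ (x _ (SimplexCategory.δ j) (hδ j)))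
        (y' := fun j => (F.obj k).map (SimplexCategory.δ j).op w) (fun j => by
          rw [ι_map_sequence, NatTrans.naturality_apply]
          exact hxy _ _ _)
      refine ⟨l, hl, fun q z hz => ?_⟩
      obtain ⟨j, hj⟩ := hz
      obtain ⟨g, rfl⟩ := hj.exists_eq
      have hj := h j
      rw [map_map_sequence, NatTrans.naturality_apply] at hj
      rw [← hx _ _ g _ (hδ j), NatTrans.naturality_apply, hj, op_comp, Functor.map_comp_apply]
  obtain ⟨v, H, hv, hH, H0, H1, Hm⟩ := hF l n _ x hx h
  have hι : ∀ q (z : q ⟶ ⦋n⦌), (c.ι.app l).app _ ((F.obj l).map z.op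
      ((F.map (homOfLE hl)).app _ w)) = c.pt.map z.op ((c.ι.app k).app _ w) := fun q z => by
    rw [NatTrans.naturality_apply, ι_map_sequence]
    rfl
  refine ⟨v, fun q z α => (c.ι.app l).app _ (H q z α), hv, fun q q' θ z α => ?_,
    fun q z α hα => ?_, fun q z α hα => ?_, fun q z α hz => ?_⟩
  · exact (NatTrans.naturality_apply (c.ι.app l) _ _).symm.trans (congrArg _ (hH q q' θ z α))
  · exact (congrArg _ (H0 q z α hα)).trans (hι _ _)
  · exact (congrArg _ (H1 q z α hα)).trans (ι_map_sequence _ _)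
  · exact (congrArg _ (Hm q z α hz)).trans (hι _ _)

end Colimit

/-- The sequence `K → Ex K → Ex² K → ⋯`. -/
noncomputable abbrev exSeq (K : SSet.{u}) : ℕ ⥤ SSet.{u} :=
  exSequence ⋙ (evaluation _ _).obj K

theorem kanComplex_exSeq (K : SSet.{u}) [hK : SSet.KanComplex K] (k : ℕ) :
    SSet.KanComplex ((exSeq K).obj k) := by
  induction k with
  | zero => exact hK
  | succ k ih => exact kanComplex_ex (K := (exSeq K).obj k)

theorem isDeformable_exSeq (K : SSet.{u}) [hK : SSet.KanComplex K] (k : ℕ) :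
    IsDeformable ((exSeq K).map (homOfLE (Nat.zero_le k))) := by
  induction k with
  | zero =>
    have : (exSeq K).map (homOfLE (Nat.zero_le 0)) = 𝟙 _ := (exSeq K).map_id 0
    rw [this]
    exact IsDeformable.id _
  | succ k ih =>
    have := kanComplex_exSeq K k
    have h1 : (exSeq K).map (homOfLE (Nat.zero_le (k + 1))) =
        (exSeq K).map (homOfLE (Nat.zero_le k)) ≫ (exSeq K).map (homOfLE (Nat.le_succ k)) :=
      (exSeq K).map_comp _ _
    have h2 : (exSeq K).map (homOfLE (Nat.le_succ k)) = toEx.app ((exSeq K).obj k) :=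
      congrArg (fun f => NatTrans.app f K) (Functor.ofSequence_map_homOfLE_succ
        (X := exIterate.{u}) (fun k => Functor.whiskerLeft (exIterate.{u} k) toEx) k)
    rw [h1, h2]
    have : SSet.KanComplex ((exSeq K).obj (k + 1)) := kanComplex_exSeq K (k + 1)
    exact ih.comp (isDeformable_toEx _)

/-- `Ex^∞ K` is the colimit of the sequence `exSeq K`. -/
noncomputable def isColimitExSeq (K : SSet.{u}) : Limits.IsColimit
    (((evaluation _ _).obj K).mapCocone (Limits.colimit.cocone exSequence.{u})) :=
  Limits.isColimitOfPreserves _ (Limits.colimit.isColimit _)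

instance kanComplex_exInfty (K : SSet.{u}) [SSet.KanComplex K] :
    SSet.KanComplex (exInfty.obj K) :=
  kanComplex_of_isColimit (isColimitExSeq K) (kanComplex_exSeq K)

theorem isDeformable_toExInfty (K : SSet.{u}) [SSet.KanComplex K] :
    IsDeformable (toExInfty.app K) :=
  isDeformable_of_isColimit (isColimitExSeq K) (isDeformable_exSeq K)

/-- The lifting property against `∂Δ[n] ⊆ Δ[n]`, with maps from the boundary described by natural
families. -/
theorem hasLiftingProperty_boundary {K L : SSet.{u}} {p : K ⟶ L} {n : ℕ}
    (h : ∀ (b : L.obj (op ⦋n⦌)) (x : ∀ (q : SimplexCategory) (z : q ⟶ ⦋n⦌),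
      (∃ j, Misses z j) → K.obj (op q)),
      (∀ q q' (θ : q' ⟶ q) z h h', K.map θ.op (x q z h) = x q' (θ ≫ z) h') →
      (∀ q z h, p.app _ (x q z h) = L.map z.op b) →
      ∃ v : K.obj (op ⦋n⦌), (∀ q z h, K.map z.op v = x q z h) ∧ p.app _ v = b) :
    HasLiftingProperty (SSet.boundary.{u} n).ι p := by
  refine ⟨fun {φ b} sq => ?_⟩
  have hm : ∀ {q : SimplexCategory} {z : q ⟶ ⦋n⦌}, (∃ j, Misses z j) →
      SSet.stdSimplex.objEquiv.symm z ∈ (SSet.boundary.{u} n).obj (op q) := fun ⟨j, hj⟩ =>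
    (mem_boundary_iff _).2 ⟨j, trivial, hj⟩
  have hb : ∀ q (z : q ⟶ ⦋n⦌), b.app (op q) (SSet.stdSimplex.objEquiv.symm z) =
      L.map z.op (SSet.yonedaEquiv b) := fun q z => by
    refine Eq.trans (congrArg _ ?_) (b.naturality_apply z.op
      (SSet.stdSimplex.objEquiv.symm (𝟙 (⦋n⦌ : SimplexCategory))))
    exact SSet.stdSimplex.objEquiv.injective (Category.comp_id z).symm
  obtain ⟨v, hv, hv'⟩ := h (SSet.yonedaEquiv b)
    (fun q z h => φ.app (op q) ⟨SSet.stdSimplex.objEquiv.symm z, hm h⟩)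
    (fun q q' θ z h h' => (NatTrans.naturality_apply φ θ.op _).symm)
    (fun q z h => (congrArg (fun f => f.app (op q) ⟨SSet.stdSimplex.objEquiv.symm z, hm h⟩)
      sq.w).trans (hb q z))
  refine ⟨⟨⟨SSet.yonedaEquiv.symm v, ?_, ?_⟩⟩⟩
  · ext q ⟨z, hz⟩
    obtain ⟨z, rfl⟩ := SSet.stdSimplex.objEquiv.symm.surjective z
    obtain ⟨j, -, hj⟩ := (mem_boundary_iff z).1 hz
    exact hv _ z ⟨j, hj⟩
  · rw [SSet.yonedaEquiv_symm_comp, hv', Equiv.symm_apply_apply]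

/-! ### Mapping path spaces -/

/-- The `q`-simplices of the mapping path space of `f : K ⟶ L`: a simplex `x` of `K` together with
a homotopy `Δ^q × Δ^1 ⟶ L` which ends at `f x`. -/
@[ext]
structure PathSimplex {K L : PSSet.{u}} (f : K ⟶ L) (q : SimplexCategory) : Type u where
  /-- the simplex of `K` -/
  base : (K.obj (op q)).X
  /-- the homotopy -/
  path : ∀ p : SimplexCategory, (p ⟶ q) → (p ⟶ ⦋1⦌) → (L.obj (op p)).X
  map_path : ∀ (p p' : SimplexCategory) (θ : p' ⟶ p) (z : p ⟶ q) (α : p ⟶ ⦋1⦌),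
    (L.map θ.op).toFun (path p z α) = path p' (θ ≫ z) (θ ≫ α)
  path_one : ∀ (p : SimplexCategory) (z : p ⟶ q) (α : p ⟶ ⦋1⦌), (∀ t, α.toOrderHom t = 1) →
    path p z α = (f.app _).toFun ((K.map z.op).toFun base)

theorem PSSet.map_map (K : PSSet.{u}) {q q' q'' : SimplexCategory} (θ : q' ⟶ q) (θ' : q'' ⟶ q')
    (x : (K.obj (op q)).X) : (K.map θ'.op).toFun ((K.map θ.op).toFun x) =
      (K.map (θ' ≫ θ).op).toFun x := by
  rw [op_comp, K.map_comp]
  rfl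

/-- The mapping path space of `f : K ⟶ L`, with the constant path at the base point as base point.
-/
def mappingPath {K L : PSSet.{u}} (f : K ⟶ L) : PSSet.{u} where
  obj q := Pointed.of (X := PathSimplex f q.unop)
    { base := (K.obj q).point
      path := fun p _ _ => (L.obj (op p)).point
      map_path := fun _ _ θ _ _ => (L.map θ.op).map_point
      path_one := fun _ z _ _ => ((congrArg _ (K.map z.op).map_point).trans
        (f.app _).map_point).symm }
  map θ := ⟨fun x =>
    { base := (K.map θ).toFun x.base
      path := fun p z α => x.path p (z ≫ θ.unop) α
      map_path := fun p p' θ' z α => by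
        rw [x.map_path]
        simp
      path_one := fun p z α hα => by
        rw [x.path_one p _ α hα]
        exact congrArg _ (PSSet.map_map K θ.unop z x.base).symm },
    PathSimplex.ext (K.map θ).map_point rfl⟩
  map_id q := by
    apply Pointed.Hom.ext
    funext x
    apply PathSimplex.ext
    · exact congrArg (fun g => g.toFun x.base) (K.map_id q)
    · funext p z α
      exact congrArg (x.path p · α) (Category.comp_id z)
  map_comp θ θ' := by
    apply Pointed.Hom.ext
    funext x
    apply PathSimplex.ext
    · exact congrArg (fun g => g.toFun x.base) (K.map_comp θ θ')
    · funext p z α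
      exact congrArg (x.path p · α) (Category.assoc z _ _).symm

section

variable {K L : PSSet.{u}} (f : K ⟶ L)

/-- The projection of the mapping path space. -/
def pathBase : mappingPath f ⟶ K where
  app _ := ⟨PathSimplex.base, rfl⟩
  naturality _ _ _ := rfl

/-- The map which sends a path to its start. -/
def pathStart : mappingPath f ⟶ L where
  app q := ⟨fun x => x.path q.unop (𝟙 _) (SimplexCategory.const _ _ 0), rfl⟩
  naturality q q' θ := by
    apply Pointed.Hom.ext
    funext x
    exact (congrArg (x.path q'.unop · (SimplexCategory.const _ _ 0))
      ((Category.id_comp θ.unop).trans (Category.comp_id θ.unop).symm)).trans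
        (x.map_path _ _ θ.unop (𝟙 _) (SimplexCategory.const _ _ 0)).symm

/-- The constant paths. -/
def constPath : K ⟶ mappingPath f where
  app q := ⟨fun x =>
    { base := x
      path := fun p z _ => (f.app _).toFun ((K.map z.op).toFun x)
      map_path := fun p p' θ z α => by
        rw [← app_map, PSSet.map_map]
      path_one := fun _ _ _ _ => rfl },
    PathSimplex.ext rfl (by
      funext p z α
      exact (congrArg _ (K.map z.op).map_point).trans (f.app _).map_point)⟩
  naturality q q' θ := by
    apply Pointed.Hom.ext
    funext x
    apply PathSimplex.ext
    · rfl
    · funext p z α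
      exact congrArg _ (PSSet.map_map K θ.unop z x)

theorem constPath_start : constPath f ≫ pathStart f = f := by
  apply NatTrans.ext
  funext q
  apply Pointed.Hom.ext
  funext x
  exact congrArg (fun g => (f.app q).toFun (g.toFun x)) (K.map_id q)

/-- Mapping path spaces are functorial. -/
def mappingPathMap {f : K ⟶ L} {K' L' : PSSet.{u}} {f' : K' ⟶ L'} (a : K ⟶ K') (b : L ⟶ L')
    (h : f ≫ b = a ≫ f') : mappingPath f ⟶ mappingPath f' where
  app q := ⟨fun x =>
    { base := (a.app _).toFun x.base
      path := fun p z α => (b.app _).toFun (x.path p z α)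
      map_path := fun p p' θ z α => by
        rw [← app_map, x.map_path]
      path_one := fun p z α hα => by
        rw [x.path_one p z α hα, ← app_map]
        exact app_congr h (op p) _ },
    PathSimplex.ext (a.app _).map_point (by
      funext p z α
      exact (b.app _).map_point)⟩
  naturality q q' θ := by
    apply Pointed.Hom.ext
    funext x
    apply PathSimplex.ext
    · exact app_map a θ x.base
    · rfl

variable {f}

theorem PathSimplex.path_eq {n : ℕ} {x : ∀ (q : SimplexCategory) (z : q ⟶ ⦋n⦌),
      (∃ j, Misses z j) → PathSimplex f q}
    (hx : ∀ q q' (θ : q' ⟶ q) z h h', ((mappingPath f).map θ.op).toFun (x q z h) = x q' (θ ≫ z) h')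
    {q p : SimplexCategory} (z : q ⟶ ⦋n⦌) (h) (θ : p ⟶ q) (h') (α : p ⟶ ⦋1⦌) :
    (x p (θ ≫ z) h').path p (𝟙 _) α = (x q z h).path p θ α := by
  rw [← hx q p θ z h]
  exact congrArg ((x q z h).path p · α) (Category.id_comp θ)

/-- The values on the boundary of `Δ^n` of a homotopy `Δ^n × Δ^1 ⟶ L` that extends paths given on
the boundary and is given at one end. -/
theorem exists_path_extension [SSet.KanComplex (toSSet.obj L)] {n : ℕ}
    {x : ∀ (q : SimplexCategory) (z : q ⟶ ⦋n⦌), (∃ j, Misses z j) → PathSimplex f q}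
    (hx : ∀ q q' (θ : q' ⟶ q) z h h', ((mappingPath f).map θ.op).toFun (x q z h) = x q' (θ ≫ z) h')
    (ε : Fin 2) (b : (L.obj (op ⦋n⦌)).X)
    (hb : ∀ q z h α, (∀ t, α.toOrderHom t = ε) → (x q z h).path q (𝟙 _) α = (L.map z.op).toFun b) :
    ∃ F : CylFamily (toSSet.obj L) n, F.Natural ∧
      (∀ q z h α, F q z α = (x q z h).path q (𝟙 _) α) ∧
      ∀ q z α, (∀ t, α.toOrderHom t = ε) → F q z α = (L.map z.op).toFun b := by
  classical
  let g : CylFamily (toSSet.obj L) n := fun q z α =>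
    if h : ∃ j, Misses z j then (x q z h).path q (𝟙 _) α else (L.map z.op).toFun b
  have g1 : ∀ q z h α, g q z α = (x q z h).path q (𝟙 _) α := fun q z h α => dif_pos h
  have g2 : ∀ q z α, (∀ t, α.toOrderHom t = ε) → g q z α = (L.map z.op).toFun b :=
    fun q z α hα => by
      by_cases h : ∃ j, Misses z j
      · exact (g1 q z h α).trans (hb q z h α hα)
      · exact dif_neg h
  have hm : ∀ {q : SimplexCategory} (z : (Δ[n] : SSet.{u}).obj (op q)),
      z ∈ (SSet.boundary.{u} n).obj (op q) → ∃ j, Misses (SSet.stdSimplex.objEquiv z) j :=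
    fun z hz => by
      obtain ⟨j, -, h⟩ := (mem_boundary_iff (SSet.stdSimplex.objEquiv z)).1 hz
      exact ⟨j, h⟩
  obtain ⟨F, hF, -⟩ := exists_homotopy_lift (Limits.terminal.from (toSSet.obj L))
    (SSet.boundary.{u} n) ε (fun q z α _ => g q (SSet.stdSimplex.objEquiv z) α)
    (fun q q' θ z α h h' => by
      rcases h with h | h
      · obtain ⟨j, hj⟩ := hm z h
        refine (congrArg _ (g1 _ _ ⟨j, hj⟩ _)).trans (((x _ _ _).map_path _ _ θ _ _).trans
          (Eq.trans ?_ (g1 q' (θ ≫ _) ⟨j, hj.precomp θ⟩ _).symm))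
        refine Eq.trans ?_ (PathSimplex.path_eq hx _ ⟨j, hj⟩ θ _ _).symm
        exact congrArg (fun t => (x _ _ _).path _ t _) (Category.comp_id θ)
      · exact (congrArg _ (g2 _ _ _ h)).trans ((PSSet.map_map L _ θ b).trans
          (g2 q' (θ ≫ _) _ fun t => h _).symm))
    (Limits.terminal.from _) (fun _ _ _ _ => Subsingleton.elim _ _)
  have hF' : ∀ q z α, ((∃ j, Misses z j) ∨ ∀ t, α.toOrderHom t = ε) →
      F.app (op q) (SSet.stdSimplex.objEquiv.symm z, SSet.stdSimplex.objEquiv.symm α) = g q z α :=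
    fun q z α h => hF q (SSet.stdSimplex.objEquiv.symm z) α
      (h.imp_left fun ⟨j, hj⟩ => (mem_boundary_iff _).2 ⟨j, trivial, hj⟩)
  exact ⟨fun q z α => F.app (op q)
      (SSet.stdSimplex.objEquiv.symm z, SSet.stdSimplex.objEquiv.symm α),
    fun q q' θ z α => (F.naturality_apply θ.op _).symm,
    fun q z h α => (hF' q z α (Or.inl h)).trans (g1 q z h α),
    fun q z α hα => (hF' q z α (Or.inr hα)).trans (g2 q z α hα)⟩

/-- The projection of the mapping path space to `K` is a trivial fibration. -/
theorem hasLiftingProperty_pathBase [SSet.KanComplex (toSSet.obj L)] (n : ℕ) :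
    HasLiftingProperty (SSet.boundary.{u} n).ι (toSSet.map (pathBase f)) := by
  refine hasLiftingProperty_boundary fun (b : (K.obj _).X) x hx hxb => ?_
  change ∀ q (z : q ⟶ ⦋n⦌), (∃ j, Misses z j) → PathSimplex f q at x
  obtain ⟨F, hF, F1, F2⟩ := exists_path_extension hx 1 ((f.app _).toFun b) fun q z h α hα => by
    rw [(x q z h).path_one _ _ _ hα, ← app_map f z.op b]
    exact congrArg _ ((congrArg (fun g => g.toFun (x q z h).base) (K.map_id (op q))).trans
      (hxb q z h))
  refine ⟨(⟨b, F, hF, fun p z α hα => (F2 p z α hα).trans (app_map f z.op b).symm⟩ :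
    PathSimplex f ⦋n⦌), fun q z h => ?_, rfl⟩
  refine PathSimplex.ext (hxb q z h).symm ?_
  funext p z' α
  exact (F1 p (z' ≫ z) (h.imp fun j hj => hj.precomp z') α).trans
    (PathSimplex.path_eq hx z h z' _ α)

/-- Taking the start of a path is a trivial fibration, if every simplex of `L` with boundary in
`K` can be deformed into `K`. -/
theorem hasLiftingProperty_pathStart [SSet.KanComplex (toSSet.obj L)]
    (hf : IsDeformable (toSSet.map f)) (n : ℕ) :
    HasLiftingProperty (SSet.boundary.{u} n).ι (toSSet.map (pathStart f)) := by
  refine hasLiftingProperty_boundary fun (b : (L.obj _).X) x hx hxb => ?_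
  change ∀ q (z : q ⟶ ⦋n⦌), (∃ j, Misses z j) → PathSimplex f q at x
  have const_eq : ∀ {q : SimplexCategory} {α : q ⟶ ⦋1⦌} {ε : Fin 2}, (∀ t, α.toOrderHom t = ε) →
      α = SimplexCategory.const q ⦋1⦌ ε := fun h => by
    ext t : 3
    exact h t
  -- extend the given paths on the boundary to a homotopy starting at `b`, and deform its end into
  -- `K`
  obtain ⟨F, hF, F1, F2⟩ := exists_path_extension hx 0 b fun q z h α hα => by
    rw [const_eq hα]
    exact hxb q z h
  have F3 : ∀ q z α, (∀ t, α.toOrderHom t = 1) → F q z α =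
      (L.map z.op).toFun (F _ (𝟙 _) (SimplexCategory.const _ _ 1)) := fun q z α hα => by
    refine Eq.trans ?_ (hF _ _ z (𝟙 _) (SimplexCategory.const _ _ 1)).symm
    rw [Category.comp_id]
    exact congrArg _ (const_eq hα)
  obtain ⟨v, H, hv, hH, H0, H1, Hm⟩ := hf n (F _ (𝟙 _) (SimplexCategory.const _ _ 1))
    (fun q z h => (x q z h).base)
    (fun q q' θ z h h' => congrArg PathSimplex.base (hx q q' θ z h h'))
    (fun q z h => by
      refine Eq.trans ?_ (F3 q z (SimplexCategory.const _ _ 1) fun _ => rfl)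
      rw [F1 q z h, (x q z h).path_one _ _ _ fun _ => rfl]
      exact congrArg (fun g => (f.app _).toFun (g.toFun (x q z h).base)) (K.map_id (op q)).symm)
  obtain ⟨G, hG, G0, G1⟩ := exists_concat hF hH
    (fun q z α β hα hβ => (H0 q z α hα).trans (F3 q z β hβ).symm)
    (fun q z α β hz hβ => (Hm q z α hz).trans (F3 q z β hβ).symm)
  refine ⟨(⟨v, G, hG, fun p z α hα => (G1 p z α hα).trans (H1 p z α hα)⟩ : PathSimplex f ⦋n⦌),
    fun q z h => ?_, ?_⟩
  · refine PathSimplex.ext (hv q z h) ?_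
    funext p z' α
    have h' := h.imp fun j hj => hj.precomp z'
    exact (G0 p (z' ≫ z) α (Or.inl h')).trans ((F1 p (z' ≫ z) h' α).trans
      (PathSimplex.path_eq hx z h z' _ α))
  · refine (G0 _ (𝟙 _) (SimplexCategory.const _ _ 0) (Or.inr fun _ => rfl)).trans
      ((F2 _ (𝟙 _) _ fun _ => rfl).trans ?_)
    exact congrArg (fun g => g.toFun b) (L.map_id (op ⦋n⦌))

end

/-! ### Trivial fibrations of towers -/

section

variable {A B A' B' : PSSet.{u}} {p : A ⟶ B} {p' : A' ⟶ B'} {f : A ⟶ A'} {g : B ⟶ B'} {n : ℕ}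

/-- The lifting properties of a trivial fibration, in terms of simplices. -/
structure IsTrivFib (f : A ⟶ A') : Prop where
  fill : ∀ n, HasFill (toSSet.map f) n Set.univ
  surj : ∀ x : (A' _⦋0⦌).X, ∃ y, (f.app _).toFun y = x

theorem IsTrivFib.liftsSpherical (hf : IsTrivFib f) (n : ℕ) : LiftsSpherical f n := by
  cases n with
  | zero =>
    intro v _
    obtain ⟨y, hy⟩ := hf.surj v
    exact ⟨y, isSpherical_zero y, hy⟩
  | succ n => exact .of_fill (hf.fill n)

theorem IsTrivFib.map_bijective (hf : IsTrivFib f) (hA : IsKan A) (hA' : IsKan A') (n : ℕ) :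
    Function.Bijective (Htpy.map f n) :=
  ⟨Htpy.map_injective (hf.fill n) hA hA', Htpy.map_surjective (hf.liftsSpherical n)⟩

theorem IsTrivFib.exists_lift (hf : IsTrivFib f) (hA : IsKan A) (hA' : IsKan A') {a : Htpy A n}
    {x' : Spherical A' n} (h : Htpy.mk x' = Htpy.map f n a) :
    ∃ x : Spherical A n, Htpy.mk x = a ∧ (f.app _).toFun x.1 = x'.1 := by
  obtain ⟨x, hx, h'⟩ := hf.liftsSpherical n x'.1 x'.2
  exact ⟨⟨x, hx⟩, (hf.map_bijective hA hA' n).1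
    ((congrArg Htpy.mk (Subtype.ext h' : Spherical.map f ⟨x, hx⟩ = x')).trans h), h'⟩

theorem IsTrivFib.isMul_of_map (hf : IsTrivFib f) (hA : IsKan A) (hA' : IsKan A')
    {a b c : Htpy A (n + 1)}
    (h : Htpy.IsMul (Htpy.map f _ a) (Htpy.map f _ b) (Htpy.map f _ c)) : Htpy.IsMul a b c := by
  obtain ⟨e', x', y', z', hx, hy, hz, he⟩ := Htpy.isMul_iff.1 h
  obtain ⟨x, rfl, hx'⟩ := hf.exists_lift hA hA' hx
  obtain ⟨y, rfl, hy'⟩ := hf.exists_lift hA hA' hy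
  obtain ⟨z, rfl, hz'⟩ := hf.exists_lift hA hA' hz
  obtain ⟨e, h, -⟩ := (hf.fill (n + 1)).exists_fill
    (fun j => if j = n then y.1 else if j = n + 1 then z.1 else if j = n + 2 then x.1 else
      (A _⦋n + 1⦌).point)
    (fun j => by split_ifs; exacts [y.2, z.2, x.2, isSpherical_point]) e' (fun j _ _ => by
      split_ifs with h0 h1 h2
      · rw [h0, he.first, hy']
      · rw [h1, he.second, hz']
      · rw [h2, he.third, hx']
      · exact (he.other j h0 h1 h2).trans (f.app _).map_point.symm)
  refine Htpy.isMul_iff.2 ⟨e, x, y, z, rfl, rfl, rfl, (h n (by omega) trivial).trans (if_pos rfl),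
    (h (n + 1) (by omega) trivial).trans (by simp), (h (n + 2) (by omega) trivial).trans (by simp),
    fun t h0 h1 h2 => ?_⟩
  by_cases ht : t < n + 3
  · exact (h t ht trivial).trans (by rw [if_neg h0, if_neg h1, if_neg h2])
  · exact face_of_le (by omega) e

theorem isTrivFib_fiberMap (h : p ≫ g = f ≫ p') (H : ∀ n, SquareFill f p p' g n Set.univ)
    (H' : SquareSurj f p p' g) : IsTrivFib (fiberMap f g h) where
  fill n y hy x hx := by
    obtain ⟨z, h1, h2, h3⟩ := H n (fun j => (y j).1)
      (fun i hi j hj m a b h => congrArg Subtype.val (hy i hi j hj m a b h)) x.1 (B.obj _).point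
      (x.2.trans (g.app _).map_point.symm) (fun j hj => congrArg Subtype.val (hx j hj))
      (fun j _ => (B.δ j).map_point.trans (y j).2.symm)
    exact ⟨⟨z, h3⟩, fun j hj => Subtype.ext (h1 j hj), Subtype.ext h2⟩
  surj x := by
    obtain ⟨z, h1, h2⟩ := H' x.1 (B.obj _).point (x.2.trans (g.app _).map_point.symm)
    exact ⟨⟨z, h2⟩, Subtype.ext h1⟩

theorem isFiberAction_of_map (h : p ≫ g = f ≫ p') (H : ∀ n, SquareFill f p p' g n Set.univ)
    (H' : SquareSurj f p p' g) (hp : IsFib p) (hp' : IsFib p') (hg : IsTrivFib g) (hB : IsKan B)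
    (hB' : IsKan B') {α : Htpy B (n + 1)} {a b : Htpy (fiber p) n}
    (hab : IsFiberAction p' (Htpy.map g _ α) (Htpy.map (fiberMap f g h) _ a)
      (Htpy.map (fiberMap f g h) _ b)) : IsFiberAction p α a b := by
  have hF := isTrivFib_fiberMap h H H'
  obtain ⟨e', z', x', y', hz, hx, hy, hez, he0, he1, he⟩ := hab
  obtain ⟨x, rfl, hx'⟩ := hF.exists_lift hp.fiber hp'.fiber hx
  obtain ⟨y, rfl, hy'⟩ := hF.exists_lift hp.fiber hp'.fiber hy
  obtain ⟨z, rfl, hz'⟩ := hg.exists_lift hB hB' hz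
  have hx'' : (f.app _).toFun x.1.1 = x'.1.1 := congrArg Subtype.val hx'
  have hy'' : (f.app _).toFun y.1.1 = y'.1.1 := congrArg Subtype.val hy'
  obtain ⟨e, h1, h2, h3⟩ := (H n).exists_fill (fun j => if j = 0 then x.1.1 else if j = 1 then y.1.1
      else (A _⦋n⦌).point)
    (fun j => by
      split_ifs
      exacts [x.2.app (fiberι p), y.2.app (fiberι p), isSpherical_point]) e' z.1
    (hez.trans hz'.symm) (fun j hj _ => by
      split_ifs with h0 h1
      · rw [hx'', ← he0, h0]
        exact face_eq 0 e'
      · rw [hy'', ← he1, h1]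
        exact face_eq 1 e'
      · exact (face_eq' hj e').trans ((he ⟨j, hj⟩ (by
          change 1 < j
          omega)).trans (f.app _).map_point.symm))
    (fun j _ _ => by
      refine (z.2.face j).trans ?_
      split_ifs
      exacts [x.1.2.symm, y.1.2.symm, (p.app _).map_point.symm])
  exact ⟨e, z, x, y, rfl, rfl, rfl, h3, (face_eq 0 e).symm.trans (h1 0 (by omega) trivial),
    (face_eq 1 e).symm.trans (h1 1 (by omega) trivial), fun j hj =>
      (face_eq j e).symm.trans ((h1 j j.2 trivial).trans (by
        have : 1 < (j : ℕ) := hj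
        rw [if_neg (by omega), if_neg (by omega)]))⟩

end

namespace Tower

/-- A map of towers of fibrations for which the maps to the pullbacks of the squares are trivial
fibrations. -/
structure IsTrivialFibration {T T' : Tower.{u}} (φ : T ⟶ T') : Prop where
  fill : ∀ {s t : WithTop ℤ} (h : s ≤ t) (n : ℕ), SquareFill (φ.app (op t)) (T.map (homOfLE h).op)
    (T'.map (homOfLE h).op) (φ.app (op s)) n Set.univ
  squareSurj : ∀ {s t : WithTop ℤ} (h : s ≤ t), SquareSurj (φ.app (op t)) (T.map (homOfLE h).op)
    (T'.map (homOfLE h).op) (φ.app (op s))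
  isFib : ∀ {s t : WithTop ℤ} (h : s ≤ t), IsFib (T.map (homOfLE h).op)
  isFib' : ∀ {s t : WithTop ℤ} (h : s ≤ t), IsFib (T'.map (homOfLE h).op)
  subsingleton : ∀ (s : WithTop ℤ), s < 0 → ∀ q, Subsingleton ((T.obj (op s)).obj q).X
  subsingleton' : ∀ (s : WithTop ℤ), s < 0 → ∀ q, Subsingleton ((T'.obj (op s)).obj q).X

namespace IsTrivialFibration

variable {T T' : Tower.{u}} {φ : T ⟶ T'} (hφ : IsTrivialFibration φ)
include hφ

omit hφ in
theorem exists_lt (s : WithTop ℤ) : ∃ t ≤ s, t < 0 :=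
  ⟨min s ((-1 : ℤ) : WithTop ℤ), min_le_left _ _, lt_of_le_of_lt (min_le_right _ _) coe_neg_one_lt⟩

theorem isKan (s : WithTop ℤ) : IsKan (T.obj (op s)) := by
  obtain ⟨t, hts, ht⟩ := exists_lt s
  exact (hφ.isFib hts).of_subsingleton (hφ.subsingleton t ht)

theorem isKan' (s : WithTop ℤ) : IsKan (T'.obj (op s)) := by
  obtain ⟨t, hts, ht⟩ := exists_lt s
  exact (hφ.isFib' hts).of_subsingleton (hφ.subsingleton' t ht)

theorem isTrivFib (s : WithTop ℤ) : IsTrivFib (φ.app (op s)) := by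
  obtain ⟨t, hts, ht⟩ := exists_lt s
  refine ⟨fun n => (hφ.fill hts n).hasFill' (hφ.subsingleton t ht) (hφ.subsingleton' t ht),
    fun x => ?_⟩
  obtain ⟨y, hy, -⟩ := hφ.squareSurj hts x ((T.obj _).obj _).point
    ((hφ.subsingleton' t ht _).elim _ _)
  exact ⟨y, hy⟩

theorem map_bijective (s : WithTop ℤ) (i : ℕ) : Function.Bijective (Htpy.map (φ.app (op s)) i) :=
  (hφ.isTrivFib s).map_bijective (hφ.isKan s) (hφ.isKan' s) i

theorem isTrivFib_fibMap (s : ℤ) : IsTrivFib (fibMap φ s) :=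
  isTrivFib_fiberMap _ (hφ.fill _) (hφ.squareSurj _)

theorem isKan_fib (s : ℤ) : IsKan (T.fib s) := (hφ.isFib _).fiber

theorem isKan_fib' (s : ℤ) : IsKan (T'.fib s) := (hφ.isFib' _).fiber

theorem fibMap_bijective (s : ℤ) (i : ℕ) : Function.Bijective (Htpy.map (fibMap φ s) i) :=
  (hφ.isTrivFib_fibMap s).map_bijective (hφ.isKan_fib s) (hφ.isKan_fib' s) i

theorem isFiberAction_iff {s : ℤ} {i : ℕ} {α : Htpy (T.stage (s - 1)) (i + 1)}
    {a b : Htpy (T.fib s) i} :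
    IsFiberAction (T'.step s) (Htpy.map (φ.app _) _ α) (Htpy.map (fibMap φ s) i a)
      (Htpy.map (fibMap φ s) i b) ↔ IsFiberAction (T.step s) α a b :=
  ⟨isFiberAction_of_map _ (hφ.fill _) (hφ.squareSurj _) (hφ.isFib _) (hφ.isFib' _)
    (hφ.isTrivFib _) (hφ.isKan _) (hφ.isKan' _), isFiberAction_map φ⟩

theorem isCycle_iff {j : ℕ} {s : ℤ} {i : ℕ} {a : Htpy (T.fib s) i} :
    T'.IsCycle j s i (Htpy.map (fibMap φ s) i a) ↔ T.IsCycle j s i a := by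
  refine ⟨fun ⟨b, hb⟩ => ?_, fun h => h.map φ⟩
  obtain ⟨b, rfl⟩ := (hφ.map_bijective _ i).2 b
  refine ⟨b, (hφ.map_bijective s i).1 ?_⟩
  exact (square_apply (down_naturality φ _) i b).trans
    (hb.trans (square_apply (fibι_naturality φ s) i a).symm)

/-- The bijection between the cycles. -/
noncomputable def cycleEquiv (j : ℕ) (s : ℤ) (i : ℕ) :
    { a // T.IsCycle j s i a } ≃ { a // T'.IsCycle j s i a } :=
  (Equiv.ofBijective _ (hφ.fibMap_bijective s i)).subtypeEquiv fun _ => hφ.isCycle_iff.symm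

theorem pageMap_bijective (j : ℕ) (s : ℤ) (i : ℕ) : Function.Bijective (pageMap φ j s i) := by
  have h : ∀ a b, T.PageRel j s i a b ↔
      T'.PageRel j s i (hφ.cycleEquiv j s i a) (hφ.cycleEquiv j s i b) := by
    intro a b
    constructor
    · rintro ⟨α, hα, h⟩
      refine ⟨Htpy.map (φ.app _) (i + 1) α, ?_, isFiberAction_map φ h⟩
      exact (square_apply (down_naturality φ _) _ α).symm.trans
        ((congrArg _ hα).trans (Htpy.map_zero _ _))
    · rintro ⟨α, hα, h⟩
      obtain ⟨α, rfl⟩ := (hφ.map_bijective _ _).2 α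
      refine ⟨α, (hφ.map_bijective _ _).1 ?_, hφ.isFiberAction_iff.1 h⟩
      exact (square_apply (down_naturality φ _) _ α).trans (hα.trans (Htpy.map_zero _ _).symm)
  refine Eq.subst (motive := Function.Bijective) ?_ (Quot.congr (hφ.cycleEquiv j s i) h).bijective
  funext x
  induction x using Quot.inductionOn
  rfl

theorem exists_pageMk {j : ℕ} {s : ℤ} {i : ℕ} {x : T.Page j s i} {a' h'}
    (h : T'.pageMk j s i a' h' = pageMap φ j s i x) :
    ∃ a ha, T.pageMk j s i a ha = x ∧ Htpy.map (fibMap φ s) i a = a' := by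
  obtain ⟨a, rfl⟩ := (hφ.fibMap_bijective s i).2 a'
  exact ⟨a, hφ.isCycle_iff.1 h', (hφ.pageMap_bijective j s i).1 h, rfl⟩

theorem isIso : IsIso (spectralSequence.map φ) := by
  refine SpectralSequence.isIso_of_bijective _ (fun k s i => hφ.pageMap_bijective (k + 1) s i)
    (fun i => hφ.map_bijective ⊤ i) ?_ ?_ ?_
    (fun i x y z h => (hφ.isTrivFib ⊤).isMul_of_map (hφ.isKan ⊤) (hφ.isKan' ⊤) h) ?_ ?_
  · rintro k s i x y z ⟨a, ha', b, hb', c, hc', hx, hy, hz, h⟩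
    obtain ⟨a, ha, rfl, rfl⟩ := hφ.exists_pageMk hx
    obtain ⟨b, hb, rfl, rfl⟩ := hφ.exists_pageMk hy
    obtain ⟨c, hc, rfl, rfl⟩ := hφ.exists_pageMk hz
    exact ⟨a, ha, b, hb, c, hc, rfl, rfl, rfl,
      (hφ.isTrivFib_fibMap s).isMul_of_map (hφ.isKan_fib s) (hφ.isKan_fib' s) h⟩
  · rintro k s i x y z ⟨a, ha', b, hb', c, hc', hx, hy, hz, β, hβ, h⟩
    obtain ⟨a, ha, rfl, rfl⟩ := hφ.exists_pageMk hx
    obtain ⟨b, hb, rfl, rfl⟩ := hφ.exists_pageMk hy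
    obtain ⟨c, hc, rfl, rfl⟩ := hφ.exists_pageMk hz
    obtain ⟨β, rfl⟩ := (hφ.map_bijective _ _).2 β
    refine ⟨a, ha, b, hb, c, hc, rfl, rfl, rfl, β, (hφ.map_bijective _ _).1 ?_,
      hφ.isFiberAction_iff.1 h⟩
    exact (square_apply (down_naturality φ _) _ β).trans
      (hβ.trans (square_apply (fibι_naturality φ s) _ a).symm)
  · rintro k s i x y ⟨a, h, h', hx, hy⟩
    obtain ⟨a, ha, rfl, rfl⟩ := hφ.exists_pageMk hx
    exact ⟨a, ha, hφ.isCycle_iff.1 h', rfl, (hφ.pageMap_bijective _ _ _).1 hy⟩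
  · intro s i z h
    refine (hφ.map_bijective s i).1 ?_
    exact (square_apply (fromLim_naturality φ s) i z).trans (Eq.trans h (Htpy.map_zero _ _).symm)
  · rintro k s i z x ⟨a, h, hx, hz⟩
    obtain ⟨a, ha, rfl, rfl⟩ := hφ.exists_pageMk hx
    refine ⟨a, ha, rfl, (hφ.map_bijective s i).1 ?_⟩
    exact (square_apply (fromLim_naturality φ s) i z).trans
      (hz.trans (square_apply (fibι_naturality φ s) i a).symm)

end IsTrivialFibration

end Tower

theorem IsLevelKan.of_trivialFibration {X Y : CosimplicialPSSet.{u}} (f : X ⟶ Y)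
    (hf : ∀ i n, HasLiftingProperty (SSet.boundary.{u} n).ι (toSSet.map (f.app i)))
    (hY : IsLevelKan Y) : IsLevelKan X := by
  intro i
  have := hY i
  have hp : Fibration (toSSet.map (f.app i)) := by
    rw [fibration_iff]
    refine MorphismProperty.antitone_rlp J_le_monomorphisms _ ?_
    rw [SSet.rlp_monomorphisms]
    rintro _ _ _ ⟨n⟩
    exact hf i n
  rw [SSet.KanComplex, isFibrant_iff,
    ← Limits.terminal.comp_from (toSSet.map (f.app i))]
  infer_instance

theorem isTrivialFibration_tot {X Y : CosimplicialPSSet.{u}} (f : X ⟶ Y)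
    (hf : ∀ i n, HasLiftingProperty (SSet.boundary.{u} n).ι (toSSet.map (f.app i)))
    (hY : IsLevelKan Y) :
    Tower.IsTrivialFibration (tot.map (cosimplicialReplacement.map f)) where
  fill h _ := tot_squareFill f h fun r _ _ i => lifts_boundary_boundary _ r _ fun q _ => hf i q
  squareSurj h := tot_squareSurj f h fun r _ _ i => lifts_boundary_boundary _ r _ fun q _ => hf i q
  isFib h _ k := tot_hasFill (hY.of_trivialFibration f hf) h k
  isFib' h _ k := tot_hasFill hY h k
  subsingleton _ hs q := totStage_subsingleton _ hs q
  subsingleton' _ hs q := totStage_subsingleton _ hs q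

/-! ### The comparison of the two spectral sequences -/

theorem exInftyPt_isLevelKan {X : CosimplicialPSSet.{u}} (hX : IsLevelKan X) :
    IsLevelKan (((CosimplicialObject.whiskering PSSet.{u} PSSet.{u}).obj exInftyPt).obj X) :=
  fun n => by
    have := hX n
    exact kanComplex_exInfty (toSSet.obj (X.obj n))

theorem holimTower_isFibrationTower {X : CosimplicialPSSet.{u}} (hX : IsLevelKan X) :
    (holimTower.obj X).IsFibrationTower :=
  tot_isFibrationTower (exInftyPt_isLevelKan hX)

/-- The mapping path space of `K ⟶ Ex^∞ K`. -/
noncomputable def exPath : PSSet.{u} ⥤ PSSet.{u} where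
  obj K := mappingPath (K := K) (toExInftyPt.app K)
  map f := mappingPathMap f (exInftyPt.map f) (toExInftyPt.naturality f).symm
  map_id K := by
    apply NatTrans.ext
    funext q
    apply Pointed.Hom.ext
    funext x
    apply PathSimplex.ext
    · rfl
    · funext p z α
      exact congrArg (fun g : exInftyPt.obj K ⟶ exInftyPt.obj K =>
        (g.app (op p)).toFun (x.path p z α)) (exInftyPt.map_id K)
  map_comp {K K' K''} f g := by
    apply NatTrans.ext
    funext q
    apply Pointed.Hom.ext
    funext x
    apply PathSimplex.ext
    · rfl
    · funext p z α
      exact congrArg (fun g : exInftyPt.obj K ⟶ exInftyPt.obj K'' =>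
        (g.app (op p)).toFun (x.path p z α)) (exInftyPt.map_comp f g)

/-- The start of a path. -/
noncomputable def exPathStart : exPath.{u} ⟶ exInftyPt where
  app K := pathStart (K := K) (toExInftyPt.app K)
  naturality _ _ _ := rfl

/-- The projection to `K`, followed by the isomorphism from `K` to its Postnikov stage `K(⊤)`. -/
noncomputable def exPathBase : exPath.{u} ⟶
    postnikov ⋙ (evaluation (WithTop ℤ)ᵒᵖ PSSet.{u}).obj (op ⊤) where
  app K := pathBase (K := K) (toExInftyPt.app K) ≫ toPostnikovTop.app K
  naturality _ _ _ := rfl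

/-- The constant paths. -/
noncomputable def constExPath : 𝟭 PSSet.{u} ⟶ exPath where
  app K := constPath (K := K) (toExInftyPt.app K)
  naturality K L f := by
    apply NatTrans.ext
    funext q
    apply Pointed.Hom.ext
    funext x
    apply PathSimplex.ext
    · rfl
    · funext p z α
      refine (congrArg _ (app_map f z.op x).symm).trans ?_
      exact app_congr (toExInftyPt.naturality f) (op p) ((K.map z.op).toFun x)

theorem hasLiftingProperty_exPathStart (K : PSSet.{u}) [SSet.KanComplex (toSSet.obj K)] (n : ℕ) :
    HasLiftingProperty (SSet.boundary.{u} n).ι (toSSet.map (exPathStart.app K)) :=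
  have : SSet.KanComplex (toSSet.obj (exInftyPt.obj K)) := kanComplex_exInfty (toSSet.obj K)
  hasLiftingProperty_pathStart (f := toExInftyPt.app K) (isDeformable_toExInfty (toSSet.obj K)) n

instance isIso_toPostnikovTop (K : PSSet.{u}) : IsIso (toSSet.map (toPostnikovTop.app K)) := by
  have : ∀ q, IsIso ((toSSet.map (toPostnikovTop.app K)).app q) := fun q => by
    rw [isIso_iff_bijective]
    refine ⟨fun x y h => ?_, Quotient.mk_surjective⟩
    have h' := Quotient.exact h q.unop le_top (𝟙 _)
    have hid : ∀ z : (K.obj q).X, (K.map (𝟙 q.unop).op).toFun z = z := fun z =>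
      congrArg (fun g : K.obj q ⟶ K.obj q => g.toFun z) (K.map_id q)
    exact (hid x).symm.trans (h'.trans (hid y))
  exact NatIso.isIso_of_isIso_app _

theorem hasLiftingProperty_exPathBase (K : PSSet.{u}) [SSet.KanComplex (toSSet.obj K)] (n : ℕ) :
    HasLiftingProperty (SSet.boundary.{u} n).ι (toSSet.map (exPathBase.app K)) := by
  have : SSet.KanComplex (toSSet.obj (exInftyPt.obj K)) := kanComplex_exInfty (toSSet.obj K)
  have := hasLiftingProperty_pathBase (K := K) (f := toExInftyPt.app K) n
  have h : toSSet.map (exPathBase.app K) =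
    toSSet.map (pathBase (K := K) (toExInftyPt.app K)) ≫ toSSet.map (toPostnikovTop.app K) :=
    toSSet.map_comp _ _
  rw [h]
  have := isIso_toPostnikovTop K
  exact @HasLiftingProperty.of_comp_right _ _ _ _ _ _ _ (toSSet.map (toPostnikovTop.app K))
    (toSSet.map (pathBase _)) _ (HasLiftingProperty.of_right_iso _ _) ‹_›

/-- The tower `s ↦ Tot_s (Π P)` for the levelwise mapping path space `P` of `X ⟶ Ex^∞ X`. -/
noncomputable def pathTower : CosimplicialPSSet.{u} ⥤ Tower.{u} :=
  (CosimplicialObject.whiskering PSSet.{u} PSSet.{u}).obj exPath ⋙ cosimplicialReplacement ⋙ tot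

/-- The map of towers induced by `exPathStart`. -/
noncomputable def pathTowerStart : pathTower.{u} ⟶ holimTower :=
  Functor.whiskerRight ((CosimplicialObject.whiskering PSSet.{u} PSSet.{u}).map exPathStart) _

/-- The map of towers induced by `exPathBase`. -/
noncomputable def pathTowerBase : pathTower.{u} ⟶
    grid ⋙ (evaluation (WithTop ℤ)ᵒᵖ Tower.{u}).obj (op ⊤) :=
  Functor.whiskerRight ((CosimplicialObject.whiskering PSSet.{u} PSSet.{u}).map exPathBase)
    (cosimplicialReplacement ⋙ tot)

theorem isTrivialFibration_pathTowerStart {X : CosimplicialPSSet.{u}} (hX : IsLevelKan X) :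
    Tower.IsTrivialFibration (pathTowerStart.app X) :=
  isTrivialFibration_tot _ (fun i n => have := hX i; hasLiftingProperty_exPathStart (X.obj i) n)
    (exInftyPt_isLevelKan hX)

theorem isTrivialFibration_pathTowerBase {X : CosimplicialPSSet.{u}} (hX : IsLevelKan X) :
    Tower.IsTrivialFibration (pathTowerBase.app X) :=
  isTrivialFibration_tot _ (fun i n => have := hX i; hasLiftingProperty_exPathBase (X.obj i) n)
    fun i => have := hX i; postnikovStage_kan ⊤

/-- The spectral sequence of the tower `pathTower`. -/
noncomputable def pathSpectralSequence : CosimplicialPSSet.{u} ⥤ SpectralSequence.{u} :=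
  pathTower ⋙ Tower.spectralSequence

/-- The comparison of `pathSpectralSequence` with the homotopy limit spectral sequence. -/
noncomputable def pathToHolim : pathSpectralSequence.{u} ⟶ holimSpectralSequence :=
  Functor.whiskerRight pathTowerStart _

/-- The comparison of `pathSpectralSequence` with the Postnikov spectral sequence. -/
noncomputable def pathToPostnikov {X : CosimplicialPSSet.{u}} (hX : IsLevelKan X) :
    pathSpectralSequence.obj X ⟶ postnikovSpectralSequence.obj X :=
  Tower.spectralSequence.map (pathTowerBase.app X) ≫ (isGrid hX).correspondence.hom

theorem isIso_pathToHolim {X : CosimplicialPSSet.{u}} (hX : IsLevelKan X) :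
    IsIso (pathToHolim.app X) :=
  (isTrivialFibration_pathTowerStart hX).isIso

theorem isIso_pathToPostnikov {X : CosimplicialPSSet.{u}} (hX : IsLevelKan X) :
    IsIso (pathToPostnikov hX) :=
  IsIso.comp_isIso' (isTrivialFibration_pathTowerBase hX).isIso
    (isGrid hX).correspondence.isIso_hom

theorem pathToPostnikov_naturality {X Y : CosimplicialPSSet.{u}} (f : X ⟶ Y) (hX : IsLevelKan X)
    (hY : IsLevelKan Y) : pathSpectralSequence.map f ≫ pathToPostnikov hY =
      pathToPostnikov hX ≫ postnikovSpectralSequence.map f := by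
  have h : Tower.spectralSequence.map (pathTower.map f) ≫
      Tower.spectralSequence.map (pathTowerBase.app Y) =
        Tower.spectralSequence.map (pathTowerBase.app X) ≫
          Tower.spectralSequence.map ((grid.map f).app (op ⊤)) :=
    (Tower.spectralSequence.map_comp _ _).symm.trans
      ((congrArg _ (pathTowerBase.naturality f)).trans (Tower.spectralSequence.map_comp _ _))
  exact (Category.assoc _ _ _).symm.trans ((congrArg (· ≫ (isGrid hY).correspondence.hom) h).trans
    ((Category.assoc _ _ _).trans ((congrArg (Tower.spectralSequence.map (pathTowerBase.app X) ≫ ·)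
      (IsGrid.correspondence_naturality (grid.map f) (isGrid hX) (isGrid hY))).trans
        (Category.assoc _ _ _).symm)))

/-- The isomorphism from the homotopy limit spectral sequence to the Postnikov spectral sequence.
-/
noncomputable def comparison {X : CosimplicialPSSet.{u}} (hX : IsLevelKan X) :
    holimSpectralSequence.obj X ≅ postnikovSpectralSequence.obj X :=
  have := isIso_pathToHolim hX
  have := isIso_pathToPostnikov hX
  (asIso (pathToHolim.app X)).symm ≪≫ asIso (pathToPostnikov hX)

theorem pathToHolim_comparison {X : CosimplicialPSSet.{u}} (hX : IsLevelKan X) :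
    pathToHolim.app X ≫ (comparison hX).hom = pathToPostnikov hX :=
  have := isIso_pathToHolim hX
  IsIso.hom_inv_id_assoc (pathToHolim.app X) _

theorem comparison_naturality {X Y : CosimplicialPSSet.{u}} (f : X ⟶ Y) (hX : IsLevelKan X)
    (hY : IsLevelKan Y) : holimSpectralSequence.map f ≫ (comparison hY).hom =
      (comparison hX).hom ≫ postnikovSpectralSequence.map f := by
  have := isIso_pathToHolim hX
  rw [← cancel_epi (pathToHolim.app X), ← NatTrans.naturality_assoc, pathToHolim_comparison,
    pathToPostnikov_naturality f hX hY, ← pathToHolim_comparison, Category.assoc]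

/-- Constant paths map `Tot_∞ (Π X)` to the limit of `pathTower.obj X`, compatibly with the maps
to the limits of the two other towers. -/
theorem comparison_ab {X : CosimplicialPSSet.{u}} (hX : IsLevelKan X) (i : ℕ)
    (z : Htpy (totInfty.obj (cosimplicialReplacement.obj X)) i) :
    (comparison hX).hom.ab i (Htpy.map (toHolim X) i z) = Htpy.map (toPostnikovLim X) i z := by
  let c : totInfty.obj (cosimplicialReplacement.obj X) ⟶ (pathTower.obj X).lim :=
    totInfty.map (cosimplicialReplacement.map (Functor.whiskerLeft X constExPath))
  have h1 : toHolim X = c ≫ (pathTowerStart.app X).app (op ⊤) := by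
    have h : Functor.whiskerLeft X toExInftyPt =
        Functor.whiskerLeft X constExPath ≫ Functor.whiskerLeft X exPathStart := by
      apply NatTrans.ext
      funext n
      exact (constPath_start (toExInftyPt.app (X.obj n))).symm
    exact (congrArg (fun g => totInfty.map (cosimplicialReplacement.map g)) h).trans
      (((congrArg totInfty.map (cosimplicialReplacement.map_comp _ _)).trans
        (totInfty.map_comp _ _)))
  have h2 : toPostnikovLim X = c ≫ (pathTowerBase.app X).app (op ⊤) := rfl
  refine (congrArg ((comparison hX).hom.ab i) ((congrArg (fun f => Htpy.map f i z) h1).trans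
    (Tower.comp_apply _ _ i z))).trans (Eq.trans ?_ ((congrArg (fun f => Htpy.map f i z) h2).trans
    (Tower.comp_apply _ _ i z)).symm)
  exact congrArg (fun g : pathSpectralSequence.obj X ⟶ postnikovSpectralSequence.obj X =>
    g.ab i (Htpy.map c i z)) (pathToHolim_comparison hX)

end CosimplicialSpace

theorem mainTheorem3 :
    (∀ X : CosimplicialPSSet.{u}, IsLevelKan X →
      (holimTower.obj X).IsFibrationTower ∧ (postnikovTower.obj X).IsFibrationTower) ∧
    ∃ φ : IsLevelKan.{u}.ι ⋙ holimSpectralSequence ≅ IsLevelKan.{u}.ι ⋙ postnikovSpectralSequence,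
      ∀ (X : IsLevelKan.{u}.FullSubcategory) (i : ℕ)
        (z : Htpy (totInfty.obj (cosimplicialReplacement.obj X.obj)) i),
        (φ.hom.app X).ab i (Htpy.map (toHolim X.obj) i z) =
          Htpy.map (toPostnikovLim X.obj) i z := by
  refine ⟨fun X hX => ⟨holimTower_isFibrationTower hX, postnikovTower_isFibrationTower hX⟩,
    NatIso.ofComponents (fun X => comparison X.property)
      fun {X Y} f => comparison_naturality (IsLevelKan.ι.map f) X.property Y.property,
    fun X i z => comparison_ab X.property i z⟩
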